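/- Let $n\ge 2$, $0<\alpha<n$, $1<p<\infty$, $1/p+1/p'=1$. Let $S^n\subset\mathbb R^{n+1}$ be the unit sphere with surface measure $dx$, let $\langle a,b\rangle_S=\{x\in S^n: a<x_{n+1}<b\}$, and for $\Omega\subset S^n$ put $$(I^\alpha_\Omega\varphi)(x)=\frac{\Gamma((n-\alpha)/2)}{2^\alpha\pi^{n/2}\Gamma(\alpha/2)}\int_\Omega |x-y|^{\alpha-n}\varphi(y)\,dy .$$ Write $\varphi\in L^p(\Omega;w)$ if $w\varphi\in L^p(\Omega)$. *Hypersingular integrals.* Write $x=(\sin\theta\,\xi',-\cos\theta)=(\theta,\xi')$ with $0<\theta<\pi$, $\xi'\in S^{n-1}$, and $s=\tan^2(\theta/2)=\frac{1+x_{n+1}}{1-x_{n+1}}$. Let $(\Pi h)(\xi',r)=\frac{1}{\sigma_{n-1}}\int_{S^{n-1}}\frac{1-r^2}{|r\xi'-\eta'|^n}h(\eta')\,d\eta'$, $0\le r<1$, with $\sigma_{n-1}=2\pi^{n/2}/\Gamma(n/2)$. For $\beta>0$ and $f$ on $S^n$ set $(A^\pm_xf)(0)=(1+s)^{\beta-n/2}f(x)$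 and, for $u<0$, $$(A^+_xf)(u)=\Big(1+\frac us\Big)^{n/2-1}(1+s+u)^{\beta-n/2}\,\Pi\big[f(2\arctan\sqrt{s+u},\cdot)\big]\Big(\xi',\Big(1+\frac us\Big)^{1/2}\Big)\quad\text{if } s+u>0,$$ $(A_x^+f)(u)=0$ if $s+u\le 0$, and $$(A^-_xf)(u)=(1+s-u)^{\beta-n/2}\,\Pi\big[f(2\arctan\sqrt{s-u},\cdot)\big]\Big(\xi',\Big(1-\frac us\Big)^{-1/2}\Big).$$ For an integer $\ell>\beta$ and $\varepsilon>0$ let $$(T^\beta_{\pm,\varepsilon}f)(x)=\frac{2^{-\beta}(1+s)^{\beta+n/2}}{\varkappa(\beta,\ell)}\int_\varepsilon^\infty\frac{1}{\tau^{1+\beta}}\sum_{j=0}^{\ell}(-1)^j\binom{\ell}{j}(A^\pm_xf)(-j\tau)\,d\tau,\qquad \varkappa(\beta,\ell)=\int_0^\infty\frac{(1-e^{-\tau})^\ell}{\tau^{1+\beta}}\,d\tau,$$ and $T^\beta_\pm f=\lim_{\varepsilon\to0^+}T^\beta_{\pm,\varepsilon}f$ (pointwise a.e.). For $f$ on $\langle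 -1,b\rangle_S$ (resp. $\langle a,1\rangle_S$) let $T^\beta_{b-}f$ (resp. $T^\beta_{a+}f$) be the restriction to that cap of $T^\beta_-\tilde f$ (resp. $T^\beta_+\tilde f$), where $\tilde f$ is the extension of $f$ by zero. Let $q_\alpha$ be multiplication by $(1-x_{n+1}^2)^{\alpha/2}$. *Theorem.* Let $f=I^\alpha_\Omega\varphi$ a.e. on $\Omega$. (i) If $\Omega=\langle-1,b\rangle_S$, $b\in(-1,1)$, and $\varphi\in L^p(\Omega;(1+x_{n+1})^\mu)$ with $\mu<\frac{n}{2p'}$, then $\varphi=T^{\alpha/2}_{b-}\,q_\alpha\,T^{\alpha/2}_+f$ a.e. on $\Omega$. (ii) If $\Omega=\langle a,1\rangle_S$, $a\in(-1,1)$, and $\varphi\in L^p(\Omega;(1-x_{n+1})^\nu)$ with $\nu<\frac{n}{2p'}$, then $\varphi=T^{\alpha/2}_{a+}\,q_\alpha\,T^{\alpha/2}_-f$ a.e. on $\Omega$. Here the integral defining $I^\alpha_\Omega\varphi$ converges absolutely a.e. on $\Omega$. For a.e. $x\in\Omega$ the Poisson integrals entering the formulas converge absolutely for a.e. $u<0$,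 the truncated integrals $T^{\alpha/2}_{\pm,\varepsilon}$ in both steps converge absolutely for all $\varepsilon>0$, and their limits as $\varepsilon\to0^+$ exist. The integers $\ell>\alpha/2$ used in the two steps are arbitrary and may be different. -/

import Mathlib

open MeasureTheory Set Filter Topology

/-- The unit sphere of `ℝ^d`; thus `S^n` is `Sph (n + 1)` and `S^{n-1}` is `Sph n`. -/
abbrev Sph (d : ℕ) : Type := Metric.sphere (0 : EuclideanSpace ℝ (Fin d)) 1

/-- The standard (unnormalized) surface area measure on the unit sphere of `ℝ^d`. -/
noncomputable abbrev surf (d : ℕ) : Measure (Sph d) :=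
  (volume : Measure (EuclideanSpace ℝ (Fin d))).toSphere

/-- The last coordinate `x_{n+1}` of a point `x ∈ S^n`. -/
def height {n : ℕ} (x : Sph (n + 1)) : ℝ := (x : EuclideanSpace ℝ (Fin (n + 1))) (Fin.last n)

/-- The spherical segment `⟨a, b⟩_S = {x ∈ S^n : a < x_{n+1} < b}`. -/
def seg (n : ℕ) (a b : ℝ) : Set (Sph (n + 1)) := {x | a < height x ∧ height x < b}

/-- The projection `(x_1, …, x_n)` of `x ∈ S^n`. -/
noncomputable def horiz {n : ℕ} (x : Sph (n + 1)) : EuclideanSpace ℝ (Fin n) :=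
  WithLp.toLp 2 (fun i : Fin n => (x : EuclideanSpace ℝ (Fin (n + 1))) (Fin.castSucc i))

/-- The direction `ξ' = (x_1, …, x_n) / |(x_1, …, x_n)| ∈ S^{n-1}` of a point `x ≠ ± e_{n+1}`. -/
noncomputable def dir {n : ℕ} (x : Sph (n + 1)) : EuclideanSpace ℝ (Fin n) :=
  ‖horiz x‖⁻¹ • horiz x

/-- `tan² (θ / 2) = (1 + x_{n+1}) / (1 - x_{n+1})`, where `θ ∈ (0, π)` is the angle between `x` and
the South Pole, `x_{n+1} = - cos θ`; it is `|ξ|²` for the stereographic image `ξ` of `x`. -/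
noncomputable def tanSq {n : ℕ} (x : Sph (n + 1)) : ℝ := (1 + height x) / (1 - height x)

/-- The point `(sin θ · ω, - cos θ)` of `S^n` with `tan (θ / 2) = ρ`, that is `θ = 2 arctan ρ`;
it is the inverse stereographic image of `ρ ω ∈ ℝ^n`. -/
noncomputable def spherePt {n : ℕ} (ρ : ℝ) (ω : Sph n) : Sph (n + 1) :=
  ⟨WithLp.toLp 2 (Fin.snoc (α := fun _ => ℝ)
      (fun i : Fin n => 2 * ρ / (1 + ρ ^ 2) * (ω : EuclideanSpace ℝ (Fin n)) i)
      ((ρ ^ 2 - 1) / (1 + ρ ^ 2))), by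
    have hω : ∑ i, (ω : EuclideanSpace ℝ (Fin n)) i ^ 2 = 1 := by
      have h := EuclideanSpace.real_norm_sq_eq (ω : EuclideanSpace ℝ (Fin n))
      rw [norm_eq_of_mem_sphere] at h
      linarith
    have h0 : (1 + ρ ^ 2) ≠ 0 := by positivity
    rw [mem_sphere_zero_iff_norm, ← sq_eq_sq₀ (norm_nonneg _) zero_le_one,
      EuclideanSpace.real_norm_sq_eq, Fin.sum_univ_castSucc]
    simp only [Fin.snoc_castSucc, Fin.snoc_last, mul_pow]
    rw [← Finset.mul_sum, hω]
    field_simp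
    ring⟩

/-- The area `σ_{n-1} = 2 π^{n/2} / Γ(n/2)` of `S^{n-1}`. -/
noncomputable def sphereArea (n : ℕ) : ℝ :=
  2 * Real.pi ^ ((n : ℝ) / 2) / Real.Gamma ((n : ℝ) / 2)

/-- The Riesz potential over `Ω ⊆ S^n`: its integrand and the potential itself. -/
noncomputable def rieszIntegrand {n : ℕ} (α : ℝ) (φ : Sph (n + 1) → ℂ) (x y : Sph (n + 1)) : ℂ :=
  (‖(x : EuclideanSpace ℝ (Fin (n + 1))) - y‖ ^ (α - n)) • φ y

noncomputable def rieszPotential {n : ℕ} (α : ℝ) (Ω : Set (Sph (n + 1))) (φ : Sph (n + 1) → ℂ)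
    (x : Sph (n + 1)) : ℂ :=
  (Real.Gamma ((n - α) / 2) / (2 ^ α * Real.pi ^ ((n : ℝ) / 2) * Real.Gamma (α / 2))) •
    ∫ y in Ω, rieszIntegrand α φ x y ∂(surf (n + 1))

/-- The Poisson integral on `S^{n-1}`: its integrand and the integral itself. -/
noncomputable def poissonIntegrand {n : ℕ} (h : Sph n → ℂ) (ξ : EuclideanSpace ℝ (Fin n)) (r : ℝ)
    (η : Sph n) : ℂ :=
  ((1 - r ^ 2) / ‖r • ξ - (η : EuclideanSpace ℝ (Fin n))‖ ^ n) • h η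

noncomputable def poisson {n : ℕ} (h : Sph n → ℂ) (ξ : EuclideanSpace ℝ (Fin n)) (r : ℝ) : ℂ :=
  (sphereArea n)⁻¹ • ∫ η, poissonIntegrand h ξ r η ∂(surf n)

/-- The finite difference `(Δ^ℓ_τ F)(u) = ∑_j (-1)^j C(ℓ, j) F(u - j τ)`. -/
noncomputable def finDiff (ℓ : ℕ) (τ : ℝ) (F : ℝ → ℂ) (u : ℝ) : ℂ :=
  ∑ j ∈ Finset.range (ℓ + 1), ((-1 : ℂ) ^ j * (ℓ.choose j : ℂ)) * F (u - j * τ)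

/-- The constant `ϰ(β, ℓ) = ∫_0^∞ (1 - e^{-τ})^ℓ τ^{-1-β} dτ`. -/
noncomputable def kap (β : ℝ) (ℓ : ℕ) : ℝ :=
  ∫ τ in Ioi (0 : ℝ), (1 - Real.exp (-τ)) ^ ℓ / τ ^ (1 + β)

/-- The integrand of the Poisson integral in `A_x^+`. -/
noncomputable def aPlusIntegrand {n : ℕ} (f : Sph (n + 1) → ℂ) (x : Sph (n + 1)) (u : ℝ) :
    Sph n → ℂ :=
  poissonIntegrand (fun ω => f (spherePt (√(tanSq x + u)) ω)) (dir x) (√(1 + u / tanSq x))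

/-- The function `u ↦ (A_x^+ f)(u)`, `u ≤ 0`, for the order `β`. It vanishes for
`u ≤ -tan² (θ / 2)`; the value for `u > 0` is immaterial. -/
noncomputable def aPlus {n : ℕ} (β : ℝ) (f : Sph (n + 1) → ℂ) (x : Sph (n + 1)) (u : ℝ) : ℂ :=
  open Classical in
  if u = 0 then ((1 + tanSq x) ^ (β - (n : ℝ) / 2)) • f x
  else if u < 0 ∧ 0 < tanSq x + u then
    ((1 + u / tanSq x) ^ ((n : ℝ) / 2 - 1) * (1 + tanSq x + u) ^ (β - (n : ℝ) / 2)) •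
      poisson (fun ω => f (spherePt (√(tanSq x + u)) ω)) (dir x) (√(1 + u / tanSq x))
  else 0

/-- The integrand of the Poisson integral in `A_x^-`. -/
noncomputable def aMinusIntegrand {n : ℕ} (f : Sph (n + 1) → ℂ) (x : Sph (n + 1)) (u : ℝ) :
    Sph n → ℂ :=
  poissonIntegrand (fun ω => f (spherePt (√(tanSq x - u)) ω)) (dir x) ((√(1 - u / tanSq x))⁻¹)

/-- The function `u ↦ (A_x^- f)(u)`, `u ≤ 0`, for the order `β`. The value for `u > 0` is
immaterial. -/
noncomputable def aMinus {n : ℕ} (β : ℝ) (f : Sph (n + 1) → ℂ) (x : Sph (n + 1)) (u : ℝ) : ℂ :=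
  open Classical in
  if u = 0 then ((1 + tanSq x) ^ (β - (n : ℝ) / 2)) • f x
  else if u < 0 then
    ((1 + tanSq x - u) ^ (β - (n : ℝ) / 2)) •
      poisson (fun ω => f (spherePt (√(tanSq x - u)) ω)) (dir x) ((√(1 - u / tanSq x))⁻¹)
  else 0

/-- `(Δ^ℓ_τ F)(0) / τ^{1+β}`. -/
noncomputable def marchaudIntegrand (β : ℝ) (ℓ : ℕ) (F : ℝ → ℂ) (τ : ℝ) : ℂ :=
  (τ ^ (1 + β))⁻¹ • finDiff ℓ τ F 0

/-- The truncated hypersingular integrals `T^β_{+,ε} f` and `T^β_{-,ε} f`. -/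
noncomputable def tPlusTrunc {n : ℕ} (β : ℝ) (ℓ : ℕ) (ε : ℝ) (f : Sph (n + 1) → ℂ)
    (x : Sph (n + 1)) : ℂ :=
  ((2 : ℝ) ^ (-β) / kap β ℓ * (1 + tanSq x) ^ (β + (n : ℝ) / 2)) •
    ∫ τ in Ioi ε, marchaudIntegrand β ℓ (aPlus β f x) τ

noncomputable def tMinusTrunc {n : ℕ} (β : ℝ) (ℓ : ℕ) (ε : ℝ) (f : Sph (n + 1) → ℂ)
    (x : Sph (n + 1)) : ℂ :=
  ((2 : ℝ) ^ (-β) / kap β ℓ * (1 + tanSq x) ^ (β + (n : ℝ) / 2)) •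
    ∫ τ in Ioi ε, marchaudIntegrand β ℓ (aMinus β f x) τ

/-- `(T^β_+ f)(x) = lim_{ε → 0+} (T^β_{+,ε} f)(x)`, meaningful where `TPlusConverges` holds. -/
noncomputable def tPlus {n : ℕ} (β : ℝ) (ℓ : ℕ) (f : Sph (n + 1) → ℂ) (x : Sph (n + 1)) : ℂ :=
  limUnder (𝓝[>] (0 : ℝ)) (fun ε => tPlusTrunc β ℓ ε f x)

/-- `(T^β_- f)(x) = lim_{ε → 0+} (T^β_{-,ε} f)(x)`, meaningful where `TMinusConverges` holds. -/
noncomputable def tMinus {n : ℕ} (β : ℝ) (ℓ : ℕ) (f : Sph (n + 1) → ℂ) (x : Sph (n + 1)) : ℂ :=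
  limUnder (𝓝[>] (0 : ℝ)) (fun ε => tMinusTrunc β ℓ ε f x)

/-- The hypersingular integral `(T^β_+ f)(x)` converges: the Poisson integrals exist in the
Lebesgue sense for almost every `u`, so do all truncated integrals, and the limit exists. -/
structure TPlusConverges {n : ℕ} (β : ℝ) (ℓ : ℕ) (f : Sph (n + 1) → ℂ) (x : Sph (n + 1)) :
    Prop where
  poisson_integrable : ∀ᵐ u ∂(volume : Measure ℝ), u < 0 → 0 < tanSq x + u →
    Integrable (aPlusIntegrand f x u) (surf n)
  trunc_integrable : ∀ ε : ℝ, 0 < ε →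
    IntegrableOn (marchaudIntegrand β ℓ (aPlus β f x)) (Ioi ε)
  limit_exists : ∃ c : ℂ, Tendsto (fun ε => tPlusTrunc β ℓ ε f x) (𝓝[>] (0 : ℝ)) (𝓝 c)

/-- The hypersingular integral `(T^β_- f)(x)` converges. -/
structure TMinusConverges {n : ℕ} (β : ℝ) (ℓ : ℕ) (f : Sph (n + 1) → ℂ) (x : Sph (n + 1)) :
    Prop where
  poisson_integrable : ∀ᵐ u ∂(volume : Measure ℝ), u < 0 →
    Integrable (aMinusIntegrand f x u) (surf n)
  trunc_integrable : ∀ ε : ℝ, 0 < ε →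
    IntegrableOn (marchaudIntegrand β ℓ (aMinus β f x)) (Ioi ε)
  limit_exists : ∃ c : ℂ, Tendsto (fun ε => tMinusTrunc β ℓ ε f x) (𝓝[>] (0 : ℝ)) (𝓝 c)

/-- Multiplication by `(1 - x_{n+1}²)^{λ/2}`. -/
noncomputable def qMul {n : ℕ} (lam : ℝ) (f : Sph (n + 1) → ℂ) (x : Sph (n + 1)) : ℂ :=
  ((1 - height x ^ 2) ^ (lam / 2)) • f x

/-- Extension by zero of the restriction of `f` to `Ω`. -/
noncomputable def extZero {n : ℕ} (Ω : Set (Sph (n + 1))) (f : Sph (n + 1) → ℂ) :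
    Sph (n + 1) → ℂ :=
  Ω.indicator f

/-- `T^β_{b-} f`, for `f` on `⟨-1, b⟩_S`: apply `T^β_-` to the extension of `f` by zero. It is
meant to be evaluated on `⟨-1, b⟩_S` only. -/
noncomputable def tRight {n : ℕ} (β : ℝ) (ℓ : ℕ) (b : ℝ) (f : Sph (n + 1) → ℂ) :
    Sph (n + 1) → ℂ :=
  tMinus β ℓ (extZero (seg n (-1) b) f)

/-- `T^β_{a+} f`, for `f` on `⟨a, 1⟩_S`: apply `T^β_+` to the extension of `f` by zero. It is
meant to be evaluated on `⟨a, 1⟩_S` only. -/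
noncomputable def tLeft {n : ℕ} (β : ℝ) (ℓ : ℕ) (a : ℝ) (f : Sph (n + 1) → ℂ) :
    Sph (n + 1) → ℂ :=
  tPlus β ℓ (extZero (seg n a 1) f)

/-- `φ ∈ L^p(Ω; w)`, that is `w φ ∈ L^p(Ω)`. -/
def MemWeightedLp {n : ℕ} (p : ℝ) (Ω : Set (Sph (n + 1))) (w : Sph (n + 1) → ℝ)
    (φ : Sph (n + 1) → ℂ) : Prop :=
  MemLp (fun x => w x • φ x) (ENNReal.ofReal p) ((surf (n + 1)).restrict Ω)

open scoped ENNReal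

/-! Write α = 2β and use the stereographic coordinates s = tan²(θ/2), ξ. The surface measure has an
explicit density in (s, ξ) (`lintegral_surf_succ`), and |x - y|² = 4 |√s ξ - √t η|² / ((1 + s)(1 +
t)) (`norm_cylPt_sub_sq`). Up to powers of s, t, 1 + s and 1 + t, the potential is therefore the
operator on (0, ∞) × S^{n-1} with kernel |√s ξ - √t η|^{2β-n}.

This kernel factors. The substitution z = (s - v)(t - v)/v turns a Beta integral into a
representation of it as an integral over v < min(s, t), or over v > max(s, t), of |s - v|^{β-1} |t -
v|^{β-1} times a power of v and a Poisson kernel of radius v/√(st), respectively √(st)/v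
(`lintegral_riesz_below`, `lintegral_riesz_above`). By the semigroup property that Poisson kernel is
the composition of the kernels between the spheres of radii √s, √v and √v, √t. So the operator is ψ
↦ M_{-e}[v^γ M_e ψ], where M_e is the one-sided fractional integral of order β in the direction e =
±1, composed with Poisson integrals (`fracKer`).

The semigroup property `lintegral_poissonKer_mul` is proved by real integration: a Beta integral
merges the two denominators into one power of an affine function of the integration point, the
sphere integral of that power is the volume of an ellipsoid with a focus at the origin, and a
one-dimensional integral of a quadratic remains. Its constant is read off from the case of radii
zero.

To invert M_e, fix (s, ξ) and let h(r) be the Poisson integral at ξ of W(s + er, ·). By the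
semigroup property the Poisson integral at ξ of (M_e W)(s + ea, ·) is the fractional integral of h
evaluated at a, so the problem lives on a half-line. The truncated Marchaud derivative of a
fractional integral is an average of h against dilates of `marchaudKer`, a kernel dominated by an
integrable one because ℓ > β. It tends to ϰ(β, ℓ) W(s, ξ) as soon as h(r) → W(s, ξ) in the mean as r
→ 0+ (`tendsto_integral_marchaudIntegrand`). This mean convergence holds almost everywhere for W
locally in L^p with p > 1 (`ae_lebesgue_poisson`): near (s, ξ) the kernel is dominated by a
half-space Poisson kernel, and Hölder's inequality at an L^p Lebesgue point controls its integral
over thin slabs. The two facts combine in `ae_tendsto_marchaud_poisson`.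

For the lower cap the outer factor M_{-1} looks towards smaller s, so it is inverted from values on
the cap alone. The inner factor M_1 looks beyond the cap, but ψ and M_1 ψ vanish there, and this is
why the intermediate function is extended by zero. The multiplier q_α removes the powers left
between the two steps. For the upper cap the directions are exchanged. The bound on the weight
exponent enters through Hölder's inequality, which places φ in L¹ and makes the potential absolutely
convergent almost everywhere; the inversion itself uses only local L^p bounds away from the poles.
-/

/-! ### Gamma and Beta integrals, polar coordinates -/

theorem lintegral_rpow_mul_exp_neg_mul_Ioi {a r : ℝ} (ha : 0 < a) (hr : 0 < r) :
    ∫⁻ t in Ioi (0 : ℝ), ENNReal.ofReal (t ^ (a - 1) * Real.exp (-(r * t))) =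
      ENNReal.ofReal (r ^ (-a) * Real.Gamma a) := by
  have h := Real.integral_rpow_mul_exp_neg_mul_Ioi ha hr
  rw [one_div, Real.inv_rpow hr.le, ← Real.rpow_neg hr.le] at h
  rw [← h, ofReal_integral_eq_lintegral_ofReal]
  · by_contra hni
    rw [integral_undef hni] at h
    have := mul_pos (Real.rpow_pos_of_pos hr (-a)) (Real.Gamma_pos_of_pos ha)
    exact this.ne h
  · refine (ae_restrict_iff' measurableSet_Ioi).2 (.of_forall fun t ht => ?_)
    exact mul_nonneg (Real.rpow_nonneg (le_of_lt ht) _) (Real.exp_pos _).le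

/-- The Beta integral `∫_0^∞ z^{b-1} (z + D)^{-a} dz`. -/
theorem lintegral_rpow_mul_add_rpow_neg {a b D : ℝ} (hb : 0 < b) (hab : b < a) (hD : 0 < D) :
    ∫⁻ z in Ioi (0 : ℝ), ENNReal.ofReal (z ^ (b - 1) * (z + D) ^ (-a)) =
      ENNReal.ofReal (D ^ (b - a) * (Real.Gamma b * Real.Gamma (a - b) / Real.Gamma a)) := by
  have ha : 0 < a := hb.trans hab
  have hΓ := Real.Gamma_pos_of_pos ha
  have key : ENNReal.ofReal (Real.Gamma a) *
      ∫⁻ z in Ioi (0 : ℝ), ENNReal.ofReal (z ^ (b - 1) * (z + D) ^ (-a)) =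
      ENNReal.ofReal (D ^ (b - a) * (Real.Gamma b * Real.Gamma (a - b))) := by
    -- Γ(a) (z + D)^{-a} is written as a Gamma integral in t; after exchanging the order both
    -- integrations are Gamma integrals.
    calc _ = ∫⁻ z in Ioi (0 : ℝ), ∫⁻ t in Ioi (0 : ℝ),
          ENNReal.ofReal (t ^ (a - 1) * Real.exp (-(D * t))) *
            ENNReal.ofReal (z ^ (b - 1) * Real.exp (-(t * z))) := by
          rw [← lintegral_const_mul _ (by fun_prop)]
          refine setLIntegral_congr_fun measurableSet_Ioi fun z hz => ?_
          have hz : 0 < z := hz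
          rw [ENNReal.ofReal_mul (by positivity), mul_left_comm, ← ENNReal.ofReal_mul hΓ.le,
            mul_comm (Real.Gamma a), ← lintegral_rpow_mul_exp_neg_mul_Ioi ha (by positivity),
            ← lintegral_const_mul _ (by fun_prop)]
          refine setLIntegral_congr_fun measurableSet_Ioi fun t ht => ?_
          have ht : 0 < t := ht
          rw [← ENNReal.ofReal_mul (by positivity), ← ENNReal.ofReal_mul (by positivity),
            show -((z + D) * t) = -(D * t) + -(t * z) by ring, Real.exp_add]
          ring_nf
      _ = ∫⁻ t in Ioi (0 : ℝ), ∫⁻ z in Ioi (0 : ℝ),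
          ENNReal.ofReal (t ^ (a - 1) * Real.exp (-(D * t))) *
            ENNReal.ofReal (z ^ (b - 1) * Real.exp (-(t * z))) :=
          lintegral_lintegral_swap (by fun_prop)
      _ = ∫⁻ t in Ioi (0 : ℝ), ENNReal.ofReal (Real.Gamma b) *
            ENNReal.ofReal (t ^ (a - b - 1) * Real.exp (-(D * t))) := by
          refine setLIntegral_congr_fun measurableSet_Ioi fun t ht => ?_
          have ht : 0 < t := ht
          rw [lintegral_const_mul _ (by fun_prop), lintegral_rpow_mul_exp_neg_mul_Ioi hb ht,
            ← ENNReal.ofReal_mul (by positivity),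
            ← ENNReal.ofReal_mul (Real.Gamma_pos_of_pos hb).le,
            show a - b - 1 = (a - 1) + -b by ring, Real.rpow_add ht]
          ring_nf
      _ = _ := by
          rw [lintegral_const_mul _ (by fun_prop),
            lintegral_rpow_mul_exp_neg_mul_Ioi (sub_pos.2 hab) hD,
            ← ENNReal.ofReal_mul (Real.Gamma_pos_of_pos hb).le, neg_sub]
          ring_nf
  have h0 : ENNReal.ofReal (Real.Gamma a) ≠ 0 := by simpa using hΓ
  rw [← ENNReal.mul_right_inj h0 ENNReal.ofReal_ne_top, key, ← ENNReal.ofReal_mul hΓ.le]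
  congr 1
  field_simp

/-- Integration in polar coordinates. -/
theorem lintegral_polar {d : ℕ} (hd : 1 ≤ d) {F : EuclideanSpace ℝ (Fin d) → ℝ≥0∞}
    (hF : Measurable F) :
    ∫⁻ x, F x = ∫⁻ ω : Sph d, (∫⁻ ρ in Ioi (0 : ℝ),
      ENNReal.ofReal (ρ ^ (d - 1)) * F (ρ • (ω : EuclideanSpace ℝ (Fin d)))) ∂(surf d) := by
  have : Nonempty (Fin d) := ⟨⟨0, hd⟩⟩
  have hmp := (volume : Measure (EuclideanSpace ℝ (Fin d))).measurePreserving_homeomorphUnitSphereProd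
  have hemb := (homeomorphUnitSphereProd (EuclideanSpace ℝ (Fin d))).measurableEmbedding
  rw [← setLIntegral_univ, ← setLIntegral_congr (s := {0}ᶜ)
      (by rw [← Set.sdiff_empty (s := univ), Set.compl_eq_univ_sdiff]
          exact (ae_eq_refl _).diff (by simp [ae_eq_empty])),
    ← lintegral_subtype_comap (measurableSet_singleton _).compl]
  have h2 := hmp.lintegral_comp_emb hemb
    (fun p => F (p.2.1 • (p.1 : EuclideanSpace ℝ (Fin d))))
  have h3 : ∀ x : ({0}ᶜ : Set (EuclideanSpace ℝ (Fin d))),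
      (homeomorphUnitSphereProd (EuclideanSpace ℝ (Fin d)) x).2.1 •
        ((homeomorphUnitSphereProd (EuclideanSpace ℝ (Fin d)) x).1 : EuclideanSpace ℝ (Fin d))
        = x := by
    intro x
    have hx : (x : EuclideanSpace ℝ (Fin d)) ≠ 0 := x.2
    simp [smul_smul, mul_inv_cancel₀ (norm_ne_zero_iff.2 hx)]
  simp only [h3] at h2
  rw [h2, lintegral_prod _ (by fun_prop)]
  refine lintegral_congr fun ω => ?_
  rw [Measure.volumeIoiPow, lintegral_withDensity_eq_lintegral_mul _ (by fun_prop) (by fun_prop)]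
  have := lintegral_subtype_comap (μ := volume) (measurableSet_Ioi (a := (0 : ℝ)))
    (fun ρ => ENNReal.ofReal (ρ ^ (d - 1)) * F (ρ • (ω : EuclideanSpace ℝ (Fin d))))
  simp only [finrank_euclideanSpace, Fintype.card_fin, Pi.mul_apply]
  rw [← this]

theorem surf_univ {d : ℕ} (hd : 1 ≤ d) : surf d univ = ENNReal.ofReal (sphereArea d) := by
  have : Nonempty (Fin d) := ⟨⟨0, hd⟩⟩
  have hd' : (0 : ℝ) < d := by exact_mod_cast hd
  rw [surf, Measure.toSphere_apply_univ, EuclideanSpace.volume_ball]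
  simp only [finrank_euclideanSpace, Fintype.card_fin, ENNReal.ofReal_one, one_pow, one_mul]
  rw [← ENNReal.ofReal_natCast, ← ENNReal.ofReal_mul (by positivity), sphereArea]
  congr 1
  have h : √Real.pi ^ d = Real.pi ^ ((d : ℝ) / 2) := by
    rw [Real.sqrt_eq_rpow, ← Real.rpow_natCast, ← Real.rpow_mul Real.pi_pos.le]
    ring_nf
  have := Real.Gamma_pos_of_pos (half_pos hd')
  rw [h, Real.Gamma_add_one (by positivity)]
  field_simp

theorem sphereArea_pos {d : ℕ} (hd : 1 ≤ d) : 0 < sphereArea d := by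
  have hd' : (0 : ℝ) < d := by exact_mod_cast hd
  have := Real.Gamma_pos_of_pos (half_pos hd')
  have := Real.pi_pos
  unfold sphereArea
  positivity

/-! ### An integral over the sphere from the volume of an ellipsoid -/

/-- The volume of the ellipsoid `|x| < 1 + ⟪x, u⟫`. -/
theorem volume_norm_lt_one_add_inner {d : ℕ} (u : EuclideanSpace ℝ (Fin d)) (hu : ‖u‖ < 1) :
    volume {x : EuclideanSpace ℝ (Fin d) | ‖x‖ < 1 + inner ℝ x u} =
      ENNReal.ofReal ((√(1 - ‖u‖ ^ 2))⁻¹ ^ (d + 1)) *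
        volume (Metric.ball (0 : EuclideanSpace ℝ (Fin d)) 1) := by
  have hpos : 0 < 1 - ‖u‖ ^ 2 := by nlinarith [norm_nonneg u]
  set γ := (√(1 - ‖u‖ ^ 2))⁻¹ with hγ
  have hγ0 : 0 < γ := by positivity
  have hγ2 : γ ^ 2 * (1 - ‖u‖ ^ 2) = 1 := by
    rw [hγ, inv_pow, Real.sq_sqrt hpos.le]; field_simp
  -- γ and κ are those of the Lorentz boost with velocity u, whose spatial part is z ↦ z + κ⟪z, u⟫u,
  -- of determinant γ. The ellipsoid has centre γ²u and is the translate of the image of the unit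
  -- ball under γ times this map; hence the factor γ^{d+1}.
  set κ := γ ^ 2 / (γ + 1) with hκ
  have hκ1 : 1 + κ * ‖u‖ ^ 2 = γ := by
    rw [hκ]; field_simp; nlinarith
  have hκ2 : κ * (γ + 1) = γ ^ 2 := by rw [hκ]; field_simp
  let T : EuclideanSpace ℝ (Fin d) →ₗ[ℝ] EuclideanSpace ℝ (Fin d) :=
    LinearMap.transvection (innerₛₗ ℝ u) (κ • u)
  let L : EuclideanSpace ℝ (Fin d) →ₗ[ℝ] EuclideanSpace ℝ (Fin d) := γ • T
  have hT : T.det = γ := by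
    simp only [T, LinearMap.transvection.det, map_smul, innerₛₗ_apply_apply, smul_eq_mul,
      real_inner_self_eq_norm_sq]
    exact hκ1
  have hL : L.det = γ ^ (d + 1) := by
    simp only [L, LinearMap.det_smul, finrank_euclideanSpace, Fintype.card_fin, hT]
    ring
  have hLz : ∀ z, L z = γ • (z + (inner ℝ z u * κ) • u) := fun z => by
    simp [L, T, LinearMap.transvection, smul_smul, real_inner_comm]
  have hset : {x : EuclideanSpace ℝ (Fin d) | ‖x‖ < 1 + inner ℝ x u} =
      (fun x => γ ^ 2 • u + x) '' (L '' Metric.ball 0 1) := by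
    have hLinv : Function.Surjective L := by
      have : IsUnit L := (LinearMap.isUnit_iff_isUnit_det L).2 (by
        rw [hL]; exact (pow_pos hγ0 _).ne'.isUnit)
      exact ((Module.End.isUnit_iff L).1 this).2
    have key : ∀ z, (‖γ ^ 2 • u + L z‖ < 1 + inner ℝ (γ ^ 2 • u + L z) u) ↔ ‖z‖ < 1 := by
      intro z
      have e1 : 1 + inner ℝ (γ ^ 2 • u + L z) u = γ ^ 2 * (1 + inner ℝ z u) := by
        rw [hLz]
        simp only [inner_add_left, inner_smul_left, real_inner_self_eq_norm_sq, RCLike.conj_to_real]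
        linear_combination (γ * inner ℝ z u) * hκ1 - hγ2
      have e2 : ‖γ ^ 2 • u + L z‖ ^ 2 = γ ^ 2 * ‖z‖ ^ 2 + γ ^ 4 * (inner ℝ z u) ^ 2 +
          2 * γ ^ 4 * inner ℝ z u + γ ^ 4 * ‖u‖ ^ 2 := by
        rw [hLz, ← real_inner_self_eq_norm_sq]
        simp only [inner_add_left, inner_add_right, inner_smul_left, inner_smul_right,
          real_inner_self_eq_norm_sq, RCLike.conj_to_real, real_inner_comm z u]
        have : κ ^ 2 * ‖u‖ ^ 2 + 2 * κ = γ ^ 2 := by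
          linear_combination κ * hκ1 + hκ2
        linear_combination (2 * γ ^ 3 * inner ℝ z u) * hκ1 + γ ^ 2 * (inner ℝ z u) ^ 2 * this
      -- In these coordinates the squared form of the inequality becomes |z|² < 1.
      have e3 : ‖γ ^ 2 • u + L z‖ ^ 2 - (1 + inner ℝ (γ ^ 2 • u + L z) u) ^ 2 =
          γ ^ 2 * (‖z‖ ^ 2 - 1) := by
        rw [e1, e2]; linear_combination (-γ ^ 2) * hγ2
      -- Cauchy–Schwarz with |u| < 1 fixes the sign of 1 + ⟪x, u⟫, so that the inequality and its
      -- square are equivalent.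
      have hcs := abs_real_inner_le_norm (γ ^ 2 • u + L z) u
      have h1 := abs_le.1 hcs
      set X := ‖γ ^ 2 • u + L z‖
      set Y := inner ℝ (γ ^ 2 • u + L z) u
      have hX : 0 ≤ X := norm_nonneg _
      have hz : 0 ≤ ‖z‖ := norm_nonneg _
      have hg2 : 0 < γ ^ 2 := by positivity
      constructor
      · intro h
        have : γ ^ 2 * (‖z‖ ^ 2 - 1) < 0 := by rw [← e3]; nlinarith
        have : ‖z‖ ^ 2 < 1 := by nlinarith
        nlinarith
      · intro h
        have h4 : X ^ 2 < (1 + Y) ^ 2 := by nlinarith [mul_pos hg2 (sub_pos.2 (show ‖z‖ ^ 2 < 1 by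
            nlinarith))]
        by_contra hc
        push Not at hc
        have hu1 : X * ‖u‖ ≤ X := by nlinarith
        have h6 : 0 < 1 + Y + X := by linarith
        nlinarith [mul_nonneg (sub_nonneg.2 hc) h6.le]
    ext x
    simp only [mem_ofPred_eq, mem_image, exists_exists_and_eq_and, Metric.mem_ball, dist_zero_right]
    constructor
    · intro hx
      obtain ⟨z, hz⟩ := hLinv (x - γ ^ 2 • u)
      have hz' : γ ^ 2 • u + L z = x := by rw [hz]; abel
      exact ⟨z, (key z).1 (by rwa [hz']), hz'⟩
    · rintro ⟨z, hz, rfl⟩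
      exact (key z).2 hz
  rw [hset, image_add_left, measure_preimage_add, Measure.addHaar_image_linearMap, hL,
    abs_of_pos (by positivity)]

theorem lintegral_Ioo_pow {d : ℕ} (hd : 1 ≤ d) {c : ℝ} (hc : 0 < c) :
    ∫⁻ ρ in Ioo 0 c, ENNReal.ofReal (ρ ^ (d - 1)) = ENNReal.ofReal (c ^ d / d) := by
  rw [Measure.restrict_congr_set Ioo_ae_eq_Ioc, ← ofReal_integral_eq_lintegral_ofReal]
  · rw [← intervalIntegral.integral_of_le hc.le, integral_pow]
    obtain ⟨k, rfl⟩ : ∃ k, d = k + 1 := ⟨d - 1, by omega⟩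
    simp
  · exact (intervalIntegral.intervalIntegrable_pow _).1
  · filter_upwards [ae_restrict_mem measurableSet_Ioc] with y hy
    exact pow_nonneg hy.1.le _

theorem inner_sphere_lt_one {d : ℕ} {u : EuclideanSpace ℝ (Fin d)} (hu : ‖u‖ < 1) (ζ : Sph d) :
    inner ℝ (ζ : EuclideanSpace ℝ (Fin d)) u < 1 := by
  have h := abs_real_inner_le_norm (ζ : EuclideanSpace ℝ (Fin d)) u
  rw [norm_eq_of_mem_sphere, one_mul] at h
  exact (le_abs_self _).trans_lt (h.trans_lt hu)

/-- The ray in direction ζ leaves the ellipsoid |x| < 1 + ⟪x, u⟫ at distance 1/(1 - ⟪ζ, u⟫). Its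
volume in polar coordinates is thus this integral divided by d. -/
theorem lintegral_sphere_one_sub_inner_pow {d : ℕ} (hd : 1 ≤ d) (u : EuclideanSpace ℝ (Fin d))
    (hu : ‖u‖ < 1) :
    ∫⁻ ζ : Sph d, ENNReal.ofReal
        (((1 - inner ℝ (ζ : EuclideanSpace ℝ (Fin d)) u) ^ d)⁻¹) ∂(surf d) =
      surf d univ * ENNReal.ofReal ((√(1 - ‖u‖ ^ 2))⁻¹ ^ (d + 1)) := by
  have : Nonempty (Fin d) := ⟨⟨0, hd⟩⟩
  have hd' : (0 : ℝ) < d := by exact_mod_cast hd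
  have hm : MeasurableSet {x : EuclideanSpace ℝ (Fin d) | ‖x‖ < 1 + inner ℝ x u} :=
    measurableSet_lt (by fun_prop) (by fun_prop)
  have h1 := volume_norm_lt_one_add_inner u hu
  rw [← lintegral_indicator_one hm, lintegral_polar hd (measurable_one.indicator hm)] at h1
  have h2 : ∀ ω : Sph d, (∫⁻ ρ in Ioi (0 : ℝ), ENNReal.ofReal (ρ ^ (d - 1)) *
      {x : EuclideanSpace ℝ (Fin d) | ‖x‖ < 1 + inner ℝ x u}.indicator 1
        (ρ • (ω : EuclideanSpace ℝ (Fin d)))) = (ENNReal.ofReal d)⁻¹ * ENNReal.ofReal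
        (((1 - inner ℝ (ω : EuclideanSpace ℝ (Fin d)) u) ^ d)⁻¹) := by
    intro ω
    have hω := sub_pos.2 (inner_sphere_lt_one hu ω)
    set c := 1 - inner ℝ (ω : EuclideanSpace ℝ (Fin d)) u with hc
    rw [← ENNReal.ofReal_inv_of_pos hd', ← ENNReal.ofReal_mul (by positivity)]
    have h3 : (d : ℝ)⁻¹ * (c ^ d)⁻¹ = (c⁻¹) ^ d / d := by rw [inv_pow]; ring
    rw [h3, ← lintegral_Ioo_pow hd (by positivity), ← lintegral_indicator measurableSet_Ioi,
      ← lintegral_indicator measurableSet_Ioo]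
    refine lintegral_congr fun ρ => ?_
    by_cases hρ : 0 < ρ
    · have h4 : ‖ρ • (ω : EuclideanSpace ℝ (Fin d))‖ <
          1 + inner ℝ (ρ • (ω : EuclideanSpace ℝ (Fin d))) u ↔ ρ < c⁻¹ := by
        rw [norm_smul, norm_eq_of_mem_sphere, inner_smul_left, Real.norm_of_nonneg hρ.le,
          lt_inv_comm₀ hρ hω, inv_eq_one_div, lt_div_iff₀ hρ, hc]
        simp only [RCLike.conj_to_real]
        constructor <;> intro h <;> linarith
      by_cases h5 : ρ < c⁻¹
      · simp [indicator, hρ, h4, h5]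
      · simp [indicator, hρ, h4, h5]
    · simp [indicator, hρ]
  simp_rw [h2] at h1
  rw [lintegral_const_mul _ (by fun_prop)] at h1
  have h0 : (ENNReal.ofReal d) ≠ 0 := by simpa using hd'.ne'
  rw [surf, Measure.toSphere_apply_univ]
  simp only [finrank_euclideanSpace, Fintype.card_fin]
  have h6 := congrArg (fun z => ENNReal.ofReal d * z) h1
  beta_reduce at h6
  rw [← mul_assoc, ENNReal.mul_inv_cancel h0 ENNReal.ofReal_ne_top, one_mul] at h6
  rw [h6, ENNReal.ofReal_natCast]
  ring

theorem lintegral_sphere_sub_inner_pow {d : ℕ} (hd : 1 ≤ d) (w : EuclideanSpace ℝ (Fin d))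
    {C : ℝ} (hC : ‖w‖ < C) :
    ∫⁻ ζ : Sph d, ENNReal.ofReal
        (((C - inner ℝ (ζ : EuclideanSpace ℝ (Fin d)) w) ^ d)⁻¹) ∂(surf d) =
      surf d univ * ENNReal.ofReal (C * (C ^ 2 - ‖w‖ ^ 2) ^ (-((d : ℝ) + 1) / 2)) := by
  have hC0 : 0 < C := (norm_nonneg _).trans_lt hC
  have hu : ‖C⁻¹ • w‖ < 1 := by
    rw [norm_smul, norm_inv, Real.norm_of_nonneg hC0.le, inv_mul_lt_iff₀ hC0]; linarith
  have h := lintegral_sphere_one_sub_inner_pow hd (C⁻¹ • w) hu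
  have hpos : 0 < C ^ 2 - ‖w‖ ^ 2 := by nlinarith [norm_nonneg w]
  have h2 : ∀ ζ : Sph d, ENNReal.ofReal
        (((C - inner ℝ (ζ : EuclideanSpace ℝ (Fin d)) w) ^ d)⁻¹) = ENNReal.ofReal ((C ^ d)⁻¹) *
        ENNReal.ofReal
        (((1 - inner ℝ (ζ : EuclideanSpace ℝ (Fin d)) (C⁻¹ • w)) ^ d)⁻¹) := by
    intro ζ
    rw [← ENNReal.ofReal_mul (by positivity), ← mul_inv, ← mul_pow, inner_smul_right]
    congr 3
    field_simp
  simp_rw [h2]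
  rw [lintegral_const_mul _ (by fun_prop), h, mul_left_comm, ← ENNReal.ofReal_mul (by positivity)]
  congr 2
  have h3 : 1 - ‖C⁻¹ • w‖ ^ 2 = (C ^ 2 - ‖w‖ ^ 2) / C ^ 2 := by
    rw [norm_smul, norm_inv, Real.norm_of_nonneg hC0.le]; field_simp
  have h4 : √(1 - ‖C⁻¹ • w‖ ^ 2) = √(C ^ 2 - ‖w‖ ^ 2) / C := by
    rw [h3, Real.sqrt_div hpos.le, Real.sqrt_sq hC0.le]
  have h5 : (C ^ 2 - ‖w‖ ^ 2) ^ (-((d : ℝ) + 1) / 2) = (√(C ^ 2 - ‖w‖ ^ 2) ^ (d + 1))⁻¹ := by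
    rw [Real.sqrt_eq_rpow, ← Real.rpow_mul_natCast hpos.le, ← Real.rpow_neg hpos.le]
    push_cast
    ring_nf
  rw [h4, h5, inv_div, div_pow]
  have := Real.sqrt_pos.2 hpos
  field_simp
  ring

/-- A one-dimensional integral with a quadratic polynomial. -/
theorem lintegral_rpow_mul_quadratic_rpow {P Q K a b : ℝ} (N : ℝ) (hP : 0 < P) (hQ : 0 < Q)
    (hK : 0 < K) (ha : 0 ≤ a) (hb : 0 ≤ b) :
    ∫⁻ y in Ioi (0 : ℝ), ENNReal.ofReal (y ^ (N / 2 - 1) * ((a * y + b) *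
        (P ^ 2 * y ^ 2 + (K - 2 * P * Q) * y + Q ^ 2) ^ (-(N + 1) / 2))) =
      ENNReal.ofReal ((a / P + b / Q) * K ^ (-N / 2)) *
        ∫⁻ m : ℝ, ENNReal.ofReal ((1 + m ^ 2) ^ (-(N + 1) / 2)) := by
  set R : ℝ → ℝ := fun y => P ^ 2 * y ^ 2 + (K - 2 * P * Q) * y + Q ^ 2 with hR
  have hRpos : ∀ y, 0 < y → 0 < R y := by
    intro y hy
    have : R y = (P * y - Q) ^ 2 + K * y := by simp only [hR]; ring
    rw [this]; positivity
  set c := ∫⁻ m : ℝ, ENNReal.ofReal ((1 + m ^ 2) ^ (-(N + 1) / 2)) with hc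
  set A := ∫⁻ y in Ioi (0 : ℝ), ENNReal.ofReal (y ^ (N / 2) * R y ^ (-(N + 1) / 2)) with hA
  set B := ∫⁻ y in Ioi (0 : ℝ), ENNReal.ofReal (y ^ (N / 2 - 1) * R y ^ (-(N + 1) / 2)) with hB
  have hsplit : ∀ {a b : ℝ}, 0 ≤ a → 0 ≤ b → ∫⁻ y in Ioi (0 : ℝ),
      ENNReal.ofReal (y ^ (N / 2 - 1) * ((a * y + b) * R y ^ (-(N + 1) / 2))) =
      ENNReal.ofReal a * A + ENNReal.ofReal b * B := by
    intro a b ha hb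
    rw [hA, hB, ← lintegral_const_mul _ (by fun_prop), ← lintegral_const_mul _ (by fun_prop),
      ← lintegral_add_left (by fun_prop)]
    refine setLIntegral_congr_fun measurableSet_Ioi fun y hy => ?_
    have hy : 0 < y := hy
    have := (hRpos y hy).le
    rw [← ENNReal.ofReal_mul ha, ← ENNReal.ofReal_mul hb,
      ← ENNReal.ofReal_add (by positivity) (by positivity)]
    congr 1
    rw [show N / 2 = N / 2 - 1 + 1 by ring, Real.rpow_add_one hy.ne']
    ring_nf
  -- Dilation by √K; the exponent -(N + 1)/2 loses one half to the Jacobian.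
  have hscale : ∫⁻ m : ℝ, ENNReal.ofReal ((m ^ 2 + K) ^ (-(N + 1) / 2)) =
      ENNReal.ofReal (K ^ (-N / 2)) * c := by
    have h := lintegral_image_eq_lintegral_abs_deriv_mul (s := univ) (f := fun m => √K * m)
      (f' := fun _ => √K) MeasurableSet.univ
      (fun x _ => by simpa using! (hasDerivAt_id x).const_mul (√K))
      (fun x _ y _ h => by
        have := Real.sqrt_pos.2 hK
        exact mul_left_cancel₀ this.ne' h)
      (fun m => ENNReal.ofReal ((m ^ 2 + K) ^ (-(N + 1) / 2)))
    have hsurj : (fun m => √K * m) '' univ = univ := by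
      rw [image_univ, range_eq_univ]
      intro y
      exact ⟨y / √K, by have := Real.sqrt_pos.2 hK; field_simp⟩
    rw [hsurj, setLIntegral_univ, setLIntegral_univ] at h
    rw [h, hc, ← lintegral_const_mul _ (by fun_prop)]
    refine lintegral_congr fun m => ?_
    rw [abs_of_nonneg (Real.sqrt_nonneg _), ← ENNReal.ofReal_mul (by positivity),
      ← ENNReal.ofReal_mul (by positivity), mul_pow, Real.sq_sqrt hK.le,
      show K * m ^ 2 + K = K * (1 + m ^ 2) by ring, Real.mul_rpow hK.le (by positivity),
      ← mul_assoc, Real.sqrt_eq_rpow, ← Real.rpow_add hK]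
    congr 3
    ring
  -- The substitution m = (P y - Q)/√y maps (0, ∞) onto ℝ, with m² + K = R(y)/y and dm = (P y +
  -- Q)/(2 y √y) dy. The weights P and Q of the two moments are exactly those of the Jacobian.
  have hsum : ENNReal.ofReal P * A + ENNReal.ofReal Q * B =
      2 * (ENNReal.ofReal (K ^ (-N / 2)) * c) := by
    rw [← hsplit hP.le hQ.le, ← hscale]
    have hder : ∀ x ∈ Ioi (0 : ℝ), HasDerivWithinAt (fun y : ℝ => (P * y - Q) / √y)
        ((P * x + Q) / (2 * x * √x)) (Ioi 0) x := by
      intro x hx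
      have hx : 0 < x := hx
      have h0 := Real.sqrt_pos.2 hx
      have h1 := (((hasDerivAt_id x).const_mul P).sub_const Q).div
        (Real.hasDerivAt_sqrt hx.ne') h0.ne'
      refine (h1.congr_deriv ?_).hasDerivWithinAt
      have h2 := Real.sq_sqrt hx.le
      simp only [id]
      field_simp
      rw [h2]; ring
    have hmono : StrictMonoOn (fun y : ℝ => (P * y - Q) / √y) (Ioi 0) := by
      intro x hx y hy hxy
      have hx : 0 < x := hx
      have hy : 0 < y := hy
      have h0 := Real.sqrt_pos.2 hx
      have h0' := Real.sqrt_pos.2 hy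
      have hs : √x < √y := Real.sqrt_lt_sqrt hx.le hxy
      have e : ∀ z, 0 < z → (P * z - Q) / √z = P * √z - Q / √z := by
        intro z hz
        have := Real.sqrt_pos.2 hz
        have h2 := Real.sq_sqrt hz.le
        field_simp
        rw [h2]
      beta_reduce
      rw [e x hx, e y hy]
      have : Q / √y < Q / √x := by gcongr
      nlinarith
    have himg : (fun y : ℝ => (P * y - Q) / √y) '' Ioi 0 = univ := by
      refine eq_univ_of_forall fun m => ?_
      set z := (m + √(m ^ 2 + 4 * P * Q)) / (2 * P) with hz
      have hlt : |m| < √(m ^ 2 + 4 * P * Q) := by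
        rw [← Real.sqrt_sq_eq_abs]
        exact Real.sqrt_lt_sqrt (sq_nonneg _) (by nlinarith [mul_pos hP hQ])
      have hz0 : 0 < z := by
        have := neg_abs_le m
        exact div_pos (by linarith) (by positivity)
      refine ⟨z ^ 2, sq_pos_of_pos hz0, ?_⟩
      beta_reduce
      rw [Real.sqrt_sq hz0.le, div_eq_iff hz0.ne']
      have h4 : (2 * P * z - m) ^ 2 = m ^ 2 + 4 * P * Q := by
        rw [hz, mul_div_cancel₀ _ (by positivity), add_sub_cancel_left,
            Real.sq_sqrt (by positivity)]
      have : 4 * P * (P * z ^ 2 - Q - m * z) = 0 := by linarith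
      have := (mul_eq_zero.1 this).resolve_left (by positivity)
      linarith
    have h := lintegral_image_eq_lintegral_abs_deriv_mul measurableSet_Ioi hder hmono.injOn
      (fun m => ENNReal.ofReal ((m ^ 2 + K) ^ (-(N + 1) / 2)))
    rw [himg, setLIntegral_univ] at h
    rw [h, ← lintegral_const_mul _ (by fun_prop)]
    refine setLIntegral_congr_fun measurableSet_Ioi fun y hy => ?_
    have hy : 0 < y := hy
    have h0 := Real.sqrt_pos.2 hy
    rw [abs_of_pos (by positivity), ← ENNReal.ofReal_mul (by positivity),
      show (2 : ℝ≥0∞) = ENNReal.ofReal 2 by simp, ← ENNReal.ofReal_mul (by positivity)]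
    congr 1
    have h5 : R y = y * (((P * y - Q) / √y) ^ 2 + K) := by
      rw [div_pow, Real.sq_sqrt hy.le]; field_simp; simp only [hR]; ring
    rw [h5, Real.mul_rpow hy.le (by positivity), Real.sqrt_eq_rpow]
    have h6 : y ^ (N / 2 - 1) * y ^ (-(N + 1) / 2) = (y * y ^ (1 / 2 : ℝ))⁻¹ := by
      rw [← Real.rpow_one_add' hy.le (by norm_num), ← Real.rpow_add hy, ← Real.rpow_neg hy.le]
      congr 1; ring
    calc _ = (y ^ (N / 2 - 1) * y ^ (-(N + 1) / 2)) * ((P * y + Q) *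
          (((P * y - Q) / y ^ (1 / 2 : ℝ)) ^ 2 + K) ^ (-(N + 1) / 2)) := by ring
      _ = _ := by
        rw [h6]
        field_simp
  -- The inversion y ↦ (Q/P)²/y reproduces R up to a factor and exchanges the two moments, so each
  -- of them is half of the sum.
  have hsymm : ENNReal.ofReal P * A = ENNReal.ofReal Q * B := by
    have hder : ∀ x ∈ Ioi (0 : ℝ), HasDerivWithinAt (fun y : ℝ => (Q / P) ^ 2 * y⁻¹)
        ((Q / P) ^ 2 * (-(x ^ 2)⁻¹)) (Ioi 0) x := by
      intro x hx
      have hx : 0 < x := hx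
      exact ((hasDerivAt_inv hx.ne').const_mul _).hasDerivWithinAt
    have hinj : InjOn (fun y : ℝ => (Q / P) ^ 2 * y⁻¹) (Ioi 0) := by
      intro x _ y _ h
      have : (Q / P) ^ 2 ≠ 0 := by positivity
      exact inv_injective (mul_left_cancel₀ this h)
    have himg : (fun y : ℝ => (Q / P) ^ 2 * y⁻¹) '' Ioi 0 = Ioi 0 := by
      ext z
      constructor
      · rintro ⟨y, hy, rfl⟩
        have hy : 0 < y := hy
        exact mem_Ioi.2 (by positivity)
      · intro hz
        have hz : 0 < z := hz
        exact ⟨(Q / P) ^ 2 * z⁻¹, mem_Ioi.2 (by positivity), by field_simp⟩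
    have h := lintegral_image_eq_lintegral_abs_deriv_mul measurableSet_Ioi hder hinj
      (fun y => ENNReal.ofReal (y ^ (N / 2) * R y ^ (-(N + 1) / 2)))
    rw [himg] at h
    rw [hA, hB, h, ← lintegral_const_mul' _ _ ENNReal.ofReal_ne_top,
      ← lintegral_const_mul' _ _ ENNReal.ofReal_ne_top]
    refine setLIntegral_congr_fun measurableSet_Ioi fun y hy => ?_
    have hy : 0 < y := hy
    have hRy := hRpos y hy
    rw [mul_neg, abs_neg, abs_of_pos (by positivity), ← ENNReal.ofReal_mul (by positivity),
      ← ENNReal.ofReal_mul hP.le, ← ENNReal.ofReal_mul hQ.le]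
    congr 1
    have h5 : R ((Q / P) ^ 2 * y⁻¹) = (Q / P) ^ 2 * (y ^ 2)⁻¹ * R y := by
      simp only [hR]; field_simp; ring
    rw [h5, Real.mul_rpow (by positivity) (by positivity), Real.mul_rpow (by positivity)
        (by positivity),
      Real.mul_rpow (by positivity) (by positivity), Real.inv_rpow (by positivity),
      Real.inv_rpow (by positivity), ← Real.rpow_natCast_mul (by positivity),
      ← Real.rpow_natCast_mul (by positivity), ← Real.rpow_natCast_mul (by positivity),
      Nat.cast_ofNat, show 2 * (N / 2) = N by ring, show 2 * (-(N + 1) / 2) = -(N + 1) by ring,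
      Real.rpow_neg (by positivity), Real.rpow_neg hy.le, Real.rpow_add_one (by positivity),
      Real.rpow_add_one hy.ne', Real.rpow_sub_one hy.ne']
    have : y ^ N = y ^ (N / 2) * y ^ (N / 2) := by rw [← Real.rpow_add hy]; ring_nf
    rw [this]
    have h7 : 0 < (Q / P) ^ N := by positivity
    have h8 : 0 < y ^ (N / 2) := by positivity
    field_simp
  have hPA : ENNReal.ofReal P * A = ENNReal.ofReal (K ^ (-N / 2)) * c := by
    rw [← hsymm, ← two_mul] at hsum
    exact (ENNReal.mul_right_inj (by simp) (by simp)).1 hsum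
  have hQB : ENNReal.ofReal Q * B = ENNReal.ofReal (K ^ (-N / 2)) * c := hsymm ▸ hPA
  rw [hsplit ha hb]
  have e1 : ENNReal.ofReal a * A = ENNReal.ofReal (a / P) * (ENNReal.ofReal P * A) := by
    rw [← mul_assoc, ← ENNReal.ofReal_mul (by positivity)]; congr 2; field_simp
  have e2 : ENNReal.ofReal b * B = ENNReal.ofReal (b / Q) * (ENNReal.ofReal Q * B) := by
    rw [← mul_assoc, ← ENNReal.ofReal_mul (by positivity)]; congr 2; field_simp
  rw [e1, e2, hPA, hQB, ← add_mul, ← ENNReal.ofReal_add (by positivity) (by positivity),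
    ← mul_assoc, ← ENNReal.ofReal_mul (by positivity)]

/-! ### The Poisson kernel and its semigroup property -/

/-- The Poisson kernel of the unit ball, without normalization. -/
noncomputable def poissonKer {n : ℕ} (r : ℝ) (ξ η : EuclideanSpace ℝ (Fin n)) : ℝ :=
  (1 - r ^ 2) / ‖r • ξ - η‖ ^ n

theorem norm_smul_sub_sq {n : ℕ} (r : ℝ) (ξ η : Sph n) :
    ‖r • (ξ : EuclideanSpace ℝ (Fin n)) - η‖ ^ 2 =
      1 + r ^ 2 - 2 * r * inner ℝ (ξ : EuclideanSpace ℝ (Fin n)) η := by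
  rw [norm_sub_sq_real, norm_smul, inner_smul_left, norm_eq_of_mem_sphere, norm_eq_of_mem_sphere,
    mul_one, Real.norm_eq_abs, sq_abs]
  simp
  ring

theorem norm_smul_sub_pos {n : ℕ} {r : ℝ} (hr0 : 0 ≤ r) (hr : r < 1) (ξ η : Sph n) :
    0 < ‖r • (ξ : EuclideanSpace ℝ (Fin n)) - η‖ := by
  have h := norm_sub_norm_le (η : EuclideanSpace ℝ (Fin n)) (r • (ξ : EuclideanSpace ℝ (Fin n)))
  rw [norm_smul, norm_eq_of_mem_sphere, norm_eq_of_mem_sphere, Real.norm_of_nonneg hr0,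
    norm_sub_rev] at h
  linarith

theorem norm_smul_sub_pow {n : ℕ} (r : ℝ) (ξ η : Sph n) :
    ‖r • (ξ : EuclideanSpace ℝ (Fin n)) - η‖ ^ n =
      (1 + r ^ 2 - 2 * r * inner ℝ (ξ : EuclideanSpace ℝ (Fin n)) η) ^ ((n : ℝ) / 2) := by
  rw [← norm_smul_sub_sq, ← Real.rpow_natCast_mul (norm_nonneg _), ← Real.rpow_natCast]
  congr 1
  push_cast
  ring

theorem poissonKer_symm {n : ℕ} (r : ℝ) (ξ η : Sph n) :
    poissonKer r (ξ : EuclideanSpace ℝ (Fin n)) η = poissonKer r (η : EuclideanSpace ℝ (Fin n))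
      ξ := by
  rw [poissonKer, poissonKer, norm_smul_sub_pow, norm_smul_sub_pow, real_inner_comm]

theorem poissonKer_pos {n : ℕ} {r : ℝ} (hr0 : 0 ≤ r) (hr : r < 1) (ξ η : Sph n) :
    0 < poissonKer r (ξ : EuclideanSpace ℝ (Fin n)) η :=
  div_pos (by nlinarith) (pow_pos (norm_smul_sub_pos hr0 hr ξ η) _)

/-- A Beta integral in an auxiliary variable y replaces A^{-n} B^{-n} by (A² y + B²)^{-n}. Both
squares are affine in ζ on the sphere, so the ζ-integral is that of
`lintegral_sphere_sub_inner_pow`, and the remaining y-integral is that of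
`lintegral_rpow_mul_quadratic_rpow`. The Gamma constant and the integral in m are left unevaluated,
since only their ratio will matter. -/
theorem lintegral_norm_smul_sub_rpow_mul {n : ℕ} (hn : 1 ≤ n) {r₁ r₂ : ℝ} (h₁ : 0 ≤ r₁)
    (h₁' : r₁ < 1) (h₂ : 0 ≤ r₂) (h₂' : r₂ < 1) (ξ η : Sph n) :
    ENNReal.ofReal (Real.Gamma (n / 2) * Real.Gamma (n - n / 2) / Real.Gamma n) *
      ∫⁻ ζ : Sph n, ENNReal.ofReal
        (((‖r₁ • (ξ : EuclideanSpace ℝ (Fin n)) - ζ‖ ^ n)⁻¹) *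
          (‖r₂ • (ζ : EuclideanSpace ℝ (Fin n)) - η‖ ^ n)⁻¹) ∂(surf n) =
    surf n univ * (ENNReal.ofReal
      (2 * (1 - (r₁ * r₂) ^ 2) / ((1 - r₁ ^ 2) * (1 - r₂ ^ 2)) *
        (4 * ‖(r₁ * r₂) • (ξ : EuclideanSpace ℝ (Fin n)) - η‖ ^ 2) ^ (-(n : ℝ) / 2)) *
      ∫⁻ m : ℝ, ENNReal.ofReal ((1 + m ^ 2) ^ (-((n : ℝ) + 1) / 2))) := by
  have hn' : (0 : ℝ) < n := by exact_mod_cast hn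
  have hrr : r₁ * r₂ < 1 := by nlinarith
  set w : ℝ → EuclideanSpace ℝ (Fin n) := fun y =>
    (2 * (y * r₁)) • (ξ : EuclideanSpace ℝ (Fin n)) + (2 * r₂) • (η : EuclideanSpace ℝ (Fin n))
      with hw
  set C : ℝ → ℝ := fun y => (1 + r₁ ^ 2) * y + (1 + r₂ ^ 2) with hC
  have hP : 0 < 1 - r₁ ^ 2 := by nlinarith
  have hQ : 0 < 1 - r₂ ^ 2 := by nlinarith
  have hKpos : 0 < 4 * ‖(r₁ * r₂) • (ξ : EuclideanSpace ℝ (Fin n)) - η‖ ^ 2 := by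
    have := norm_smul_sub_pos (mul_nonneg h₁ h₂) hrr ξ η
    positivity
  -- The discriminant takes the form expected by `lintegral_rpow_mul_quadratic_rpow`, with P = 1 -
  -- r₁², Q = 1 - r₂² and K = 4 |r₁r₂ξ - η|². This is where the radius r₁r₂ appears.
  have hquad : ∀ y, C y ^ 2 - ‖w y‖ ^ 2 = (1 - r₁ ^ 2) ^ 2 * y ^ 2 +
      (4 * ‖(r₁ * r₂) • (ξ : EuclideanSpace ℝ (Fin n)) - η‖ ^ 2 -
        2 * (1 - r₁ ^ 2) * (1 - r₂ ^ 2)) * y + (1 - r₂ ^ 2) ^ 2 := by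
    intro y
    have : ‖w y‖ ^ 2 = (2 * (y * r₁)) ^ 2 + 2 * ((2 * (y * r₁)) * (2 * r₂) *
        inner ℝ (ξ : EuclideanSpace ℝ (Fin n)) η) + (2 * r₂) ^ 2 := by
      rw [hw, norm_add_sq_real, norm_smul, norm_smul, norm_eq_of_mem_sphere, norm_eq_of_mem_sphere,
        mul_one, mul_one, Real.norm_eq_abs, sq_abs, Real.norm_eq_abs, sq_abs, inner_smul_left,
        inner_smul_right]
      simp
      ring
    rw [this, norm_smul_sub_sq]
    simp only [hC]
    ring
  have hwC : ∀ y, 0 < y → ‖w y‖ < C y := by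
    intro y hy
    have h0 : 0 < C y ^ 2 - ‖w y‖ ^ 2 := by
      rw [hquad]
      have : (1 - r₁ ^ 2) ^ 2 * y ^ 2 +
        (4 * ‖(r₁ * r₂) • (ξ : EuclideanSpace ℝ (Fin n)) - η‖ ^ 2 -
          2 * (1 - r₁ ^ 2) * (1 - r₂ ^ 2)) * y + (1 - r₂ ^ 2) ^ 2 =
          ((1 - r₁ ^ 2) * y - (1 - r₂ ^ 2)) ^ 2 +
          (4 * ‖(r₁ * r₂) • (ξ : EuclideanSpace ℝ (Fin n)) - η‖ ^ 2) * y := by ring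
      rw [this]
      positivity
    have hC0 : 0 < C y := by simp only [hC]; positivity
    exact lt_of_pow_lt_pow_left₀ 2 hC0.le (by linarith)
  have hInt : ∀ ζ : Sph n, ENNReal.ofReal (Real.Gamma (n / 2) * Real.Gamma (n - n / 2)
      / Real.Gamma n) *
      ENNReal.ofReal (((‖r₁ • (ξ : EuclideanSpace ℝ (Fin n)) - ζ‖ ^ n)⁻¹) *
          (‖r₂ • (ζ : EuclideanSpace ℝ (Fin n)) - η‖ ^ n)⁻¹) =
      ∫⁻ y in Ioi (0 : ℝ), ENNReal.ofReal (y ^ ((n : ℝ) / 2 - 1)) *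
        ENNReal.ofReal (((C y - inner ℝ (ζ : EuclideanSpace ℝ (Fin n)) (w y)) ^ n)⁻¹) := by
    intro ζ
    set A := ‖r₁ • (ξ : EuclideanSpace ℝ (Fin n)) - ζ‖ with hA
    set B := ‖r₂ • (ζ : EuclideanSpace ℝ (Fin n)) - η‖ with hB
    have hA0 : 0 < A := norm_smul_sub_pos h₁ h₁' ξ ζ
    have hB0 : 0 < B := norm_smul_sub_pos h₂ h₂' ζ η
    have hCw : ∀ y, C y - inner ℝ (ζ : EuclideanSpace ℝ (Fin n)) (w y) = A ^ 2 * (y +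
        B ^ 2 / A ^ 2) := by
      intro y
      have : A ^ 2 * (y + B ^ 2 / A ^ 2) = A ^ 2 * y + B ^ 2 := by field_simp
      rw [this, hA, hB, norm_smul_sub_sq, norm_smul_sub_sq]
      simp only [hC, hw, inner_add_right, inner_smul_right]
      rw [real_inner_comm (ζ : EuclideanSpace ℝ (Fin n)) ξ]
      ring
    have hbeta := lintegral_rpow_mul_add_rpow_neg (a := n) (b := n / 2) (D := B ^ 2 / A ^ 2)
      (by positivity) (by linarith) (by positivity)
    have e : ∀ y ∈ Ioi (0 : ℝ), ENNReal.ofReal (y ^ ((n : ℝ) / 2 - 1)) *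
        ENNReal.ofReal (((C y - inner ℝ (ζ : EuclideanSpace ℝ (Fin n)) (w y)) ^ n)⁻¹) =
        ENNReal.ofReal (((A ^ 2) ^ n)⁻¹) *
          ENNReal.ofReal (y ^ ((n : ℝ) / 2 - 1) * (y + B ^ 2 / A ^ 2) ^ (-(n : ℝ))) := by
      intro y hy
      have hy : 0 < y := hy
      rw [hCw, ← ENNReal.ofReal_mul (by positivity), ← ENNReal.ofReal_mul (by positivity),
        Real.rpow_neg (by positivity), Real.rpow_natCast, mul_pow, mul_inv]
      congr 1
      ring
    have h1 := Real.Gamma_pos_of_pos (half_pos hn')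
    have h2 := Real.Gamma_pos_of_pos (show (0 : ℝ) < n - n / 2 by linarith)
    have h3 := Real.Gamma_pos_of_pos hn'
    rw [setLIntegral_congr_fun measurableSet_Ioi e, lintegral_const_mul _ (by fun_prop), hbeta,
      ← ENNReal.ofReal_mul (by positivity), ← ENNReal.ofReal_mul (by positivity)]
    · congr 1
      have h5 : (B ^ 2 / A ^ 2) ^ ((n : ℝ) / 2 - n) = A ^ n * (B ^ n)⁻¹ := by
        rw [show (n : ℝ) / 2 - n = -(n / 2) by ring, Real.rpow_neg (by positivity), ← div_pow,
          ← Real.rpow_natCast_mul (by positivity), Nat.cast_ofNat,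
          mul_div_cancel₀ _ (by norm_num : (2 : ℝ) ≠ 0), Real.rpow_natCast, div_pow, inv_div]
        ring
      rw [h5]
      field_simp
      ring
  have hmeas : Measurable fun p : Sph n × ℝ => ENNReal.ofReal (p.2 ^ ((n : ℝ) / 2 - 1)) *
        ENNReal.ofReal (((C p.2 - inner ℝ (p.1 : EuclideanSpace ℝ (Fin n)) (w p.2)) ^ n)⁻¹) := by
    simp only [hC, hw]
    fun_prop
  rw [← lintegral_const_mul' _ _ ENNReal.ofReal_ne_top]
  simp_rw [hInt]
  rw [lintegral_lintegral_swap (by exact hmeas.aemeasurable)]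
  have e2 : ∀ y ∈ Ioi (0 : ℝ), (∫⁻ ζ : Sph n, ENNReal.ofReal (y ^ ((n : ℝ) / 2 - 1)) *
        ENNReal.ofReal (((C y - inner ℝ (ζ : EuclideanSpace ℝ (Fin n)) (w y)) ^ n)⁻¹) ∂(surf n)) =
      surf n univ * ENNReal.ofReal (y ^ ((n : ℝ) / 2 - 1) * (((1 + r₁ ^ 2) * y + (1 + r₂ ^ 2)) *
        ((1 - r₁ ^ 2) ^ 2 * y ^ 2 +
      (4 * ‖(r₁ * r₂) • (ξ : EuclideanSpace ℝ (Fin n)) - η‖ ^ 2 -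
        2 * (1 - r₁ ^ 2) * (1 - r₂ ^ 2)) * y + (1 - r₂ ^ 2) ^ 2) ^ (-((n : ℝ) + 1) / 2))) := by
    intro y hy
    have hy : 0 < y := hy
    rw [lintegral_const_mul _ (by fun_prop), lintegral_sphere_sub_inner_pow hn _ (hwC y hy), hquad,
      mul_left_comm, ← ENNReal.ofReal_mul (by positivity)]
  rw [setLIntegral_congr_fun measurableSet_Ioi e2, lintegral_const_mul _ (by fun_prop),
    lintegral_rpow_mul_quadratic_rpow n hP hQ hKpos (by positivity) (by positivity)]
  congr 4
  field_simp
  ring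

/-- The semigroup property of the Poisson kernel. -/
theorem lintegral_poissonKer_mul {n : ℕ} (hn : 1 ≤ n) {r₁ r₂ : ℝ} (h₁ : 0 ≤ r₁)
    (h₁' : r₁ < 1) (h₂ : 0 ≤ r₂) (h₂' : r₂ < 1) (ξ η : Sph n) :
    ∫⁻ ζ : Sph n, ENNReal.ofReal (poissonKer r₁ (ξ : EuclideanSpace ℝ (Fin n)) ζ) *
        ENNReal.ofReal (poissonKer r₂ (ζ : EuclideanSpace ℝ (Fin n)) η) ∂(surf n) =
      ENNReal.ofReal (sphereArea n * poissonKer (r₁ * r₂) (ξ : EuclideanSpace ℝ (Fin n)) η) := by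
  have hn' : (0 : ℝ) < n := by exact_mod_cast hn
  set κ := ENNReal.ofReal (Real.Gamma (n / 2) * Real.Gamma (n - n / 2) / Real.Gamma n) with hκ
  set c := ∫⁻ m : ℝ, ENNReal.ofReal ((1 + m ^ 2) ^ (-((n : ℝ) + 1) / 2)) with hc
  have hs0 : surf n univ ≠ 0 := by
    rw [surf_univ hn]; simpa using sphereArea_pos hn
  have hs1 : surf n univ ≠ ⊤ := measure_ne_top _ _
  have hκ0 : κ ≠ 0 := by
    have h1 := Real.Gamma_pos_of_pos (half_pos hn')
    have h2 := Real.Gamma_pos_of_pos (show (0 : ℝ) < n - n / 2 by linarith)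
    have h3 := Real.Gamma_pos_of_pos hn'
    rw [hκ, ne_eq, ENNReal.ofReal_eq_zero, not_le]
    positivity
  have hκ1 : κ ≠ ⊤ := ENNReal.ofReal_ne_top
  -- For r₁ = r₂ = 0 all kernels are constant, which determines the ratio of the two unevaluated
  -- constants.
  have hbase : κ = ENNReal.ofReal (2 * 4 ^ (-(n : ℝ) / 2)) * c := by
    have h := lintegral_norm_smul_sub_rpow_mul hn (le_refl 0) zero_lt_one (le_refl 0)
        zero_lt_one ξ η
    simp only [zero_smul, zero_sub, norm_neg, norm_eq_of_mem_sphere, one_pow, inv_one, mul_one,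
      ENNReal.ofReal_one, lintegral_one, mul_zero, ne_eq, OfNat.ofNat_ne_zero, not_false_eq_true,
      zero_pow, sub_zero, div_one] at h
    rw [mul_comm, ENNReal.mul_right_inj hs0 hs1] at h
    exact h
  have h := lintegral_norm_smul_sub_rpow_mul hn h₁ h₁' h₂ h₂' ξ η
  have hP : 0 < 1 - r₁ ^ 2 := by nlinarith
  have hQ : 0 < 1 - r₂ ^ 2 := by nlinarith
  have e : ∀ ζ : Sph n, ENNReal.ofReal (poissonKer r₁ (ξ : EuclideanSpace ℝ (Fin n)) ζ) *
        ENNReal.ofReal (poissonKer r₂ (ζ : EuclideanSpace ℝ (Fin n)) η) =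
      ENNReal.ofReal ((1 - r₁ ^ 2) * (1 - r₂ ^ 2)) * ENNReal.ofReal
        (((‖r₁ • (ξ : EuclideanSpace ℝ (Fin n)) - ζ‖ ^ n)⁻¹) *
          (‖r₂ • (ζ : EuclideanSpace ℝ (Fin n)) - η‖ ^ n)⁻¹) := by
    intro ζ
    rw [← ENNReal.ofReal_mul (poissonKer_pos h₁ h₁' ξ ζ).le, ← ENNReal.ofReal_mul (by positivity)]
    congr 1
    simp only [poissonKer]
    ring
  have hrr : r₁ * r₂ < 1 := by nlinarith
  have hN := norm_smul_sub_pos (mul_nonneg h₁ h₂) hrr ξ η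
  have hrr' : 0 < 1 - (r₁ * r₂) ^ 2 := by nlinarith [mul_nonneg h₁ h₂]
  simp_rw [e]
  rw [lintegral_const_mul' _ _ ENNReal.ofReal_ne_top, ← ENNReal.mul_right_inj hκ0 hκ1,
    mul_left_comm, h, surf_univ hn, ← hc, hbase]
  simp only [← mul_assoc]
  rw [← ENNReal.ofReal_mul (by positivity),
    ← ENNReal.ofReal_mul (by have := sphereArea_pos hn; positivity),
      mul_right_comm (ENNReal.ofReal (2 * _)) c,
    ← ENNReal.ofReal_mul (by positivity)]
  congr 2
  rw [Real.mul_rpow (by norm_num) (by positivity), ← Real.rpow_natCast_mul hN.le, Nat.cast_ofNat,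
    show (2 : ℝ) * (-(n : ℝ) / 2) = -n by ring, Real.rpow_neg hN.le, Real.rpow_natCast, poissonKer]
  field_simp

/-- The semigroup property with second radius 0, where the kernel is identically 1. -/
theorem lintegral_poissonKer {n : ℕ} (hn : 1 ≤ n) {r : ℝ} (h : 0 ≤ r) (h' : r < 1) (ξ : Sph n) :
    ∫⁻ ζ : Sph n, ENNReal.ofReal (poissonKer r (ξ : EuclideanSpace ℝ (Fin n)) ζ) ∂(surf n) =
      ENNReal.ofReal (sphereArea n) := by
  have := lintegral_poissonKer_mul hn h h' (le_refl 0) zero_lt_one ξ ξ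
  simpa [poissonKer] using this

/-! ### Composition of kernels -/

section Composition

variable {Y Z : Type*} [MeasurableSpace Y] [MeasurableSpace Z] {μ : Measure Y} [SFinite μ]
  {ν : Measure Z} [SFinite ν] {k₁ : Y → ℝ} {K₂ : Y → Z → ℝ} {k₃ : Z → ℝ}

theorem lintegral_kernel_comp (hk₁ : Measurable k₁) (hK₂ : Measurable (Function.uncurry K₂))
    (h : ∀ᵐ z ∂ν, ∫⁻ y, ENNReal.ofReal (k₁ y) * ENNReal.ofReal (K₂ y z) ∂μ = ENNReal.ofReal (k₃ z))
    {f : Z → ℝ≥0∞} (hf : Measurable f) :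
    ∫⁻ y, ENNReal.ofReal (k₁ y) * ∫⁻ z, ENNReal.ofReal (K₂ y z) * f z ∂ν ∂μ =
      ∫⁻ z, ENNReal.ofReal (k₃ z) * f z ∂ν := by
  have hK₂' : ∀ y, Measurable (K₂ y) := fun y => hK₂.comp measurable_prodMk_left
  calc _ = ∫⁻ y, ∫⁻ z, ENNReal.ofReal (k₁ y) * (ENNReal.ofReal (K₂ y z) * f z) ∂ν ∂μ := by
        refine lintegral_congr fun y => ?_
        exact (lintegral_const_mul _ ((hK₂' y).ennreal_ofReal.mul hf)).symm
    _ = ∫⁻ z, ∫⁻ y, ENNReal.ofReal (k₁ y) * (ENNReal.ofReal (K₂ y z) * f z) ∂μ ∂ν := by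
        refine lintegral_lintegral_swap (Measurable.aemeasurable ?_)
        exact (hk₁.comp measurable_fst).ennreal_ofReal.mul
          (hK₂.ennreal_ofReal.mul (hf.comp measurable_snd))
    _ = _ := by
        refine lintegral_congr_ae (h.mono fun z hz => ?_)
        beta_reduce
        rw [← hz, ← lintegral_mul_const]
        · exact lintegral_congr fun y => (mul_assoc _ _ _).symm
        · exact hk₁.ennreal_ofReal.mul (hK₂.comp measurable_prodMk_right).ennreal_ofReal

/-- The exchange of integrals behind every composition below. The composition identity is needed
only for almost every z, which allows kernels that are singular on a null set of z. -/
theorem integral_kernel_comp (hk₁ : Measurable k₁) (hk₁0 : ∀ y, 0 ≤ k₁ y)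
    (hK₂ : Measurable (Function.uncurry K₂)) (hK₂0 : ∀ y z, 0 ≤ K₂ y z) (hk₃0 : ∀ z, 0 ≤ k₃ z)
    (h : ∀ᵐ z ∂ν, ∫⁻ y, ENNReal.ofReal (k₁ y) * ENNReal.ofReal (K₂ y z) ∂μ = ENNReal.ofReal (k₃ z))
    {f : Z → ℂ} (hf : Measurable f) (hfin : ∫⁻ z, ENNReal.ofReal (k₃ z) * ‖f z‖ₑ ∂ν < ⊤) :
    (∀ᵐ y ∂μ, k₁ y ≠ 0 → Integrable (fun z => K₂ y z • f z) ν) ∧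
    Integrable (fun y => k₁ y • ∫ z, K₂ y z • f z ∂ν) μ ∧
    ∫ y, k₁ y • ∫ z, K₂ y z • f z ∂ν ∂μ = ∫ z, k₃ z • f z ∂ν := by
  have hK₂' : ∀ y, Measurable (K₂ y) := fun y => hK₂.comp measurable_prodMk_left
  have hG : Measurable fun p : Y × Z => k₁ p.1 • K₂ p.1 p.2 • f p.2 :=
    (hk₁.comp measurable_fst).smul (hK₂.smul (hf.comp measurable_snd))
  have hGi : Integrable (fun p : Y × Z => k₁ p.1 • K₂ p.1 p.2 • f p.2) (μ.prod ν) := by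
    refine ⟨hG.aestronglyMeasurable, ?_⟩
    rw [hasFiniteIntegral_iff_enorm, lintegral_prod _ hG.enorm.aemeasurable]
    refine lt_of_eq_of_lt ?_ hfin
    rw [← lintegral_kernel_comp hk₁ hK₂ h hf.enorm]
    refine lintegral_congr fun y => ?_
    refine Eq.trans ?_ (lintegral_const_mul _ ((hK₂' y).ennreal_ofReal.mul hf.enorm))
    refine lintegral_congr fun z => ?_
    simp only
    rw [enorm_smul, enorm_smul, Real.enorm_of_nonneg (hk₁0 y), Real.enorm_of_nonneg (hK₂0 y z)]
  refine ⟨?_, ?_, ?_⟩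
  · refine hGi.prod_right_ae.mono fun y hy hy0 => ?_
    exact (integrable_smul_iff hy0 _).1 hy
  · refine hGi.integral_prod_left.congr (.of_forall fun y => ?_)
    exact integral_smul (k₁ y) fun z => K₂ y z • f z
  · calc _ = ∫ y, ∫ z, k₁ y • K₂ y z • f z ∂ν ∂μ :=
          integral_congr_ae (.of_forall fun y => (integral_smul _ _).symm)
      _ = ∫ z, ∫ y, k₁ y • K₂ y z • f z ∂μ ∂ν := integral_integral_swap hGi
      _ = _ := by
        refine integral_congr_ae (h.mono fun z hz => ?_)
        beta_reduce
        simp_rw [← smul_assoc]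
        rw [integral_smul_const]
        congr 1
        have hm : Measurable fun y => k₁ y * K₂ y z :=
          hk₁.mul (hK₂.comp measurable_prodMk_right)
        simp only [smul_eq_mul]
        rw [integral_eq_lintegral_of_nonneg_ae (.of_forall fun y => mul_nonneg (hk₁0 y) (hK₂0 y z))
          hm.aestronglyMeasurable]
        simp_rw [fun y => ENNReal.ofReal_mul (q := K₂ y z) (hk₁0 y)]
        rw [hz, ENNReal.toReal_ofReal (hk₃0 z)]

end Composition

/-! ### The Poisson kernel between two spheres -/

/-- The Poisson kernel between the spheres of radii `√a` and `√b`. -/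
noncomputable def pairKer {n : ℕ} (a b : ℝ) (ξ η : Sph n) : ℝ :=
  poissonKer (√(min a b / max a b)) (ξ : EuclideanSpace ℝ (Fin n)) η

theorem pairKer_comm {n : ℕ} (a b : ℝ) (ξ η : Sph n) : pairKer a b ξ η = pairKer b a ξ η := by
  rw [pairKer, pairKer, min_comm, max_comm]

theorem pairKer_symm {n : ℕ} (a b : ℝ) (ξ η : Sph n) : pairKer a b ξ η = pairKer a b η ξ :=
  poissonKer_symm _ _ _

theorem pairKer_of_le {n : ℕ} {a b : ℝ} (h : a ≤ b) (ξ η : Sph n) :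
    pairKer a b ξ η = poissonKer (√(a / b)) (ξ : EuclideanSpace ℝ (Fin n)) η := by
  rw [pairKer, min_eq_left h, max_eq_right h]

theorem sqrt_div_lt_one {a b : ℝ} (ha : 0 < a) (h : a < b) : √(a / b) < 1 := by
  rw [Real.sqrt_lt' one_pos, one_pow, div_lt_one (ha.trans h)]
  exact h

theorem pairKer_pos {n : ℕ} {a b : ℝ} (ha : 0 < a) (hb : 0 < b) (hab : a ≠ b) (ξ η : Sph n) :
    0 < pairKer a b ξ η := by
  rcases lt_or_gt_of_ne hab with h | h
  · rw [pairKer_of_le h.le]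
    exact poissonKer_pos (Real.sqrt_nonneg _) (sqrt_div_lt_one ha h) _ _
  · rw [pairKer_comm, pairKer_of_le h.le]
    exact poissonKer_pos (Real.sqrt_nonneg _) (sqrt_div_lt_one hb h) _ _

theorem measurable_pairKer {n : ℕ} :
    Measurable fun p : (ℝ × Sph n) × ℝ × Sph n => pairKer p.1.1 p.2.1 p.1.2 p.2.2 := by
  unfold pairKer poissonKer
  fun_prop

theorem norm_sqrt_smul_sub_sq {n : ℕ} {a b : ℝ} (ha : 0 ≤ a) (hb : 0 ≤ b) (ξ η : Sph n) :
    ‖√a • (ξ : EuclideanSpace ℝ (Fin n)) - √b • (η : EuclideanSpace ℝ (Fin n))‖ ^ 2 =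
      a + b - 2 * √(a * b) * inner ℝ (ξ : EuclideanSpace ℝ (Fin n)) η := by
  rw [norm_sub_sq_real, norm_smul, norm_smul, inner_smul_left, inner_smul_right,
    norm_eq_of_mem_sphere, norm_eq_of_mem_sphere, mul_one, mul_one, Real.norm_eq_abs, sq_abs,
    Real.norm_eq_abs, sq_abs, Real.sq_sqrt ha, Real.sq_sqrt hb, Real.sqrt_mul ha]
  simp
  ring

theorem pairKer_eq {n : ℕ} {a b : ℝ} (ha : 0 < a) (hab : a < b) (ξ η : Sph n) :
    pairKer a b ξ η = b ^ ((n : ℝ) / 2 - 1) * (b - a) /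
      ‖√a • (ξ : EuclideanSpace ℝ (Fin n)) - √b • (η : EuclideanSpace ℝ (Fin n))‖ ^ n := by
  have hb := ha.trans hab
  have hsb := Real.sqrt_pos.2 hb
  rw [pairKer_of_le hab.le, poissonKer, Real.sq_sqrt (by positivity)]
  have h1 : ‖√a • (ξ : EuclideanSpace ℝ (Fin n)) - √b • (η : EuclideanSpace ℝ (Fin n))‖ =
      √b * ‖√(a / b) • (ξ : EuclideanSpace ℝ (Fin n)) - η‖ := by
    rw [← Real.norm_of_nonneg hsb.le, ← norm_smul, smul_sub, smul_smul, Real.norm_of_nonneg hsb.le,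
      Real.sqrt_div ha.le, mul_div_cancel₀ _ hsb.ne']
  have h2 : √b ^ n = b ^ ((n : ℝ) / 2) := by
    rw [Real.sqrt_eq_rpow, ← Real.rpow_mul_natCast hb.le]; ring_nf
  have h3 := norm_smul_sub_pos (Real.sqrt_nonneg _) (sqrt_div_lt_one ha hab) ξ η
  rw [h1, mul_pow, h2, Real.rpow_sub_one hb.ne']
  have : 0 < b ^ ((n : ℝ) / 2) := by positivity
  field_simp

theorem lintegral_pairKer {n : ℕ} (hn : 1 ≤ n) {a b : ℝ} (ha : 0 < a) (hb : 0 < b) (hab : a ≠ b)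
    (ξ : Sph n) :
    ∫⁻ ζ, ENNReal.ofReal (pairKer a b ξ ζ) ∂(surf n) = ENNReal.ofReal (sphereArea n) := by
  wlog h : a < b generalizing a b
  · simp_rw [pairKer_comm a b]
    exact this hb ha hab.symm (lt_of_le_of_ne (not_lt.1 h) hab.symm)
  simp_rw [pairKer_of_le h.le]
  exact lintegral_poissonKer hn (Real.sqrt_nonneg _) (sqrt_div_lt_one ha h) ξ

theorem lintegral_pairKer_mul_of_lt {n : ℕ} (hn : 1 ≤ n) {a b c : ℝ} (ha : 0 < a) (hab : a < b)
    (hbc : b < c) (ξ η : Sph n) :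
    ∫⁻ ζ, ENNReal.ofReal (pairKer a b ξ ζ) * ENNReal.ofReal (pairKer b c ζ η) ∂(surf n) =
      ENNReal.ofReal (sphereArea n * pairKer a c ξ η) := by
  have hb := ha.trans hab
  simp_rw [pairKer_of_le hab.le, pairKer_of_le hbc.le, pairKer_of_le (hab.trans hbc).le]
  rw [lintegral_poissonKer_mul hn (Real.sqrt_nonneg _) (sqrt_div_lt_one ha hab)
    (Real.sqrt_nonneg _) (sqrt_div_lt_one hb hbc), ← Real.sqrt_mul (by positivity),
    div_mul_div_cancel₀ hb.ne']

theorem lintegral_pairKer_mul {n : ℕ} (hn : 1 ≤ n) {a b c : ℝ} (ha : 0 < a) (hc : 0 < c)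
    (h : (a < b ∧ b < c) ∨ (c < b ∧ b < a)) (ξ η : Sph n) :
    ∫⁻ ζ, ENNReal.ofReal (pairKer a b ξ ζ) * ENNReal.ofReal (pairKer b c ζ η) ∂(surf n) =
      ENNReal.ofReal (sphereArea n * pairKer a c ξ η) := by
  rcases h with ⟨h1, h2⟩ | ⟨h1, h2⟩
  · exact lintegral_pairKer_mul_of_lt hn ha h1 h2 ξ η
  · rw [pairKer_comm, pairKer_symm, ← lintegral_pairKer_mul_of_lt hn hc h1 h2]
    refine lintegral_congr fun ζ => ?_
    rw [mul_comm, pairKer_comm a b, pairKer_symm b a, pairKer_comm b c, pairKer_symm c b]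

/-- Passing from radius √s to √v and then to √t through a sphere inside both is not a passage
between the outer spheres: the two radii multiply to √(v/s) √(v/t) = v/√(st). This is the Poisson
kernel in the factorization of the Riesz kernel; a sphere outside both gives √(st)/v. -/
theorem lintegral_pairKer_mul_below {n : ℕ} (hn : 1 ≤ n) {s t v : ℝ} (hv : 0 < v) (hs : v < s)
    (ht : v < t) (ξ η : Sph n) :
    ∫⁻ ζ, ENNReal.ofReal (pairKer s v ξ ζ) * ENNReal.ofReal (pairKer v t ζ η) ∂(surf n) =
      ENNReal.ofReal (sphereArea n *
        poissonKer (v / √(s * t)) (ξ : EuclideanSpace ℝ (Fin n)) η) := by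
  simp_rw [pairKer_comm s v, pairKer_of_le hs.le, pairKer_of_le ht.le]
  rw [lintegral_poissonKer_mul hn (Real.sqrt_nonneg _) (sqrt_div_lt_one hv hs)
    (Real.sqrt_nonneg _) (sqrt_div_lt_one hv ht)]
  congr 3
  rw [Real.sqrt_div hv.le, Real.sqrt_div hv.le, Real.sqrt_mul (hv.trans hs).le, div_mul_div_comm,
    Real.mul_self_sqrt hv.le]

theorem lintegral_pairKer_mul_above {n : ℕ} (hn : 1 ≤ n) {s t v : ℝ} (hs0 : 0 < s) (ht0 : 0 < t)
    (hs : s < v) (ht : t < v) (ξ η : Sph n) :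
    ∫⁻ ζ, ENNReal.ofReal (pairKer s v ξ ζ) * ENNReal.ofReal (pairKer v t ζ η) ∂(surf n) =
      ENNReal.ofReal (sphereArea n *
        poissonKer (√(s * t) / v) (ξ : EuclideanSpace ℝ (Fin n)) η) := by
  have hv := hs0.trans hs
  simp_rw [pairKer_comm v t, pairKer_of_le hs.le, pairKer_of_le ht.le]
  rw [lintegral_poissonKer_mul hn (Real.sqrt_nonneg _) (sqrt_div_lt_one hs0 hs)
    (Real.sqrt_nonneg _) (sqrt_div_lt_one ht0 ht)]
  congr 3
  rw [Real.sqrt_div hs0.le, Real.sqrt_div ht0.le, Real.sqrt_mul hs0.le, div_mul_div_comm,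
    Real.mul_self_sqrt hv.le]

/-! ### Factorization of the Riesz kernel -/

theorem hasDerivAt_sub_mul_sub_div {s t v : ℝ} (hv : v ≠ 0) :
    HasDerivAt (fun v : ℝ => (s - v) * (t - v) / v) (1 - s * t / v ^ 2) v := by
  have h := (((hasDerivAt_id v).const_sub s).mul ((hasDerivAt_id v).const_sub t)).div
    (hasDerivAt_id v) hv
  refine h.congr_deriv ?_
  simp only [id, Pi.mul_apply]
  field_simp
  ring

/-- The substitution is invariant under v ↦ st/v, which exchanges (0, min(s, t)) and (max(s, t), ∞).
It is therefore injective on either interval. -/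
theorem eq_or_mul_eq_of_sub_mul_sub_div_eq {s t v w : ℝ} (hv : v ≠ 0) (hw : w ≠ 0)
    (h : (s - v) * (t - v) / v = (s - w) * (t - w) / w) : v = w ∨ v * w = s * t := by
  rw [div_eq_div_iff hv hw] at h
  have : (v - w) * (v * w - s * t) = 0 := by linarith
  rcases mul_eq_zero.1 this with h | h
  · exact Or.inl (by linarith)
  · exact Or.inr (by linarith)

/-- The preimages of z are the two roots of v² - (s + t + z)v + st; the smaller serves the interval
below s and t, the larger the interval above. -/
theorem exists_sub_mul_sub_div_eq {s t z : ℝ} (hs : 0 < s) (ht : 0 < t) (hz : 0 < z) :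
    ∃ v w, 0 < v ∧ v < s ∧ v < t ∧ s < w ∧ t < w ∧
      (s - v) * (t - v) / v = z ∧ (s - w) * (t - w) / w = z := by
  set b := s + t + z with hb
  have hD : 0 < b ^ 2 - 4 * (s * t) := by
    nlinarith [sq_nonneg (s - t), mul_pos hs hz, mul_pos ht hz]
  set q := √(b ^ 2 - 4 * (s * t)) with hq
  have hq0 : 0 < q := Real.sqrt_pos.2 hD
  have hq2 : q ^ 2 = b ^ 2 - 4 * (s * t) := Real.sq_sqrt hD.le
  have hst := mul_pos hs ht
  have hqb : q < b := by nlinarith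
  set v := (b - q) / 2 with hv
  set w := (b + q) / 2 with hw
  have hv0 : 0 < v := by rw [hv]; linarith
  have hvw : v < w := by rw [hv, hw]; linarith
  have hprod : v * w = s * t := by rw [hv, hw]; nlinarith
  have hsum : v + w = b := by rw [hv, hw]; ring
  have ev : (s - v) * (t - v) = z * v := by
    have : v * v = b * v - s * t := by rw [← hsum, ← hprod]; ring
    linear_combination this + v * hb
  have ew : (s - w) * (t - w) = z * w := by
    have : w * w = b * w - s * t := by rw [← hsum, ← hprod]; ring
    linear_combination this + w * hb
  have hw0 := hv0.trans hvw
  refine ⟨v, w, hv0, ?_, ?_, ?_, ?_, ?_, ?_⟩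
  -- As (s - v)(t - v) > 0, a small root above one of s, t would lie above both, against v² < vw =
  -- st. The large root is treated in the same way.
  · by_contra hc
    push Not at hc
    have h1 : 0 < z * v := by positivity
    have h2 : t < v := by by_contra h; nlinarith
    nlinarith
  · by_contra hc
    push Not at hc
    have h1 : 0 < z * v := by positivity
    have h2 : s < v := by by_contra h; nlinarith
    nlinarith
  · by_contra hc
    push Not at hc
    have h1 : 0 < z * w := by positivity
    have h2 : w < t := by by_contra h; nlinarith
    nlinarith
  · by_contra hc
    push Not at hc
    have h1 : 0 < z * w := by positivity
    have h2 : w < s := by by_contra h; nlinarith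
    nlinarith
  · rw [ev]; field_simp
  · rw [ew]; field_simp

/-- Put z = (s - v)(t - v)/v and N = |√s ξ - √t η|. The denominator of the Poisson kernel of radius
v/√(st) is a power of (v/(st))(z + N²), and its numerator 1 - v²/(st) is |dz/dv| up to a power of v.
The integral becomes the Beta integral of z^{β-1} (z + N²)^{-n/2}, which converges because 0 < β <
n/2. -/
theorem lintegral_riesz_below {n : ℕ} {β s t : ℝ} (hβ : 0 < β) (hβn : β < n / 2) (hs : 0 < s)
    (ht : 0 < t) (ξ η : Sph n)
    (hD : √s • (ξ : EuclideanSpace ℝ (Fin n)) - √t • (η : EuclideanSpace ℝ (Fin n)) ≠ 0) :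
    ∫⁻ v in Ioo 0 (min s t), ENNReal.ofReal ((s - v) ^ (β - 1) * (t - v) ^ (β - 1) *
        v ^ ((n : ℝ) / 2 - 1 - β) * poissonKer (v / √(s * t)) (ξ : EuclideanSpace ℝ (Fin n)) η) =
      ENNReal.ofReal ((s * t) ^ ((n : ℝ) / 2 - 1) *
        ‖√s • (ξ : EuclideanSpace ℝ (Fin n)) - √t • (η : EuclideanSpace ℝ (Fin n))‖ ^ (2 * β - n) *
        (Real.Gamma β * Real.Gamma (n / 2 - β) / Real.Gamma (n / 2))) := by
  set N := ‖√s • (ξ : EuclideanSpace ℝ (Fin n)) - √t • (η : EuclideanSpace ℝ (Fin n))‖ with hN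
  have hN0 : 0 < N := norm_pos_iff.2 hD
  have hst := mul_pos hs ht
  have hr : √(s * t) ^ 2 = s * t := Real.sq_sqrt hst.le
  have hr0 := Real.sqrt_pos.2 hst
  have hN2 : N ^ 2 = s + t - 2 * √(s * t) * inner ℝ (ξ : EuclideanSpace ℝ (Fin n)) η :=
    norm_sqrt_smul_sub_sq hs.le ht.le ξ η
  have hbeta := lintegral_rpow_mul_add_rpow_neg hβ hβn (D := N ^ 2) (by positivity)
  have himg : (fun v : ℝ => (s - v) * (t - v) / v) '' Ioo 0 (min s t) = Ioi 0 := by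
    ext z
    constructor
    · rintro ⟨v, ⟨hv0, hv⟩, rfl⟩
      have := lt_min_iff.1 hv
      exact div_pos (mul_pos (by linarith) (by linarith)) hv0
    · intro hz
      obtain ⟨v, w, hv0, hvs, hvt, -, -, h, -⟩ := exists_sub_mul_sub_div_eq hs ht hz
      exact ⟨v, ⟨hv0, lt_min hvs hvt⟩, h⟩
  have hinj : InjOn (fun v : ℝ => (s - v) * (t - v) / v) (Ioo 0 (min s t)) := by
    rintro v ⟨hv0, hv⟩ w ⟨hw0, hw⟩ h
    have h1 := lt_min_iff.1 hv
    have h2 := lt_min_iff.1 hw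
    rcases eq_or_mul_eq_of_sub_mul_sub_div_eq hv0.ne' hw0.ne' h with h | h
    · exact h
    · nlinarith
  have h := lintegral_image_eq_lintegral_abs_deriv_mul (measurableSet_Ioo (a := 0) (b := min s t))
    (fun v hv => (hasDerivAt_sub_mul_sub_div hv.1.ne').hasDerivWithinAt) hinj
    (fun z => ENNReal.ofReal (z ^ (β - 1) * (z + N ^ 2) ^ (-((n : ℝ) / 2))))
  rw [himg, hbeta] at h
  have h' : ∫⁻ v in Ioo 0 (min s t), ENNReal.ofReal ((s - v) ^ (β - 1) * (t - v) ^ (β - 1) *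
        v ^ ((n : ℝ) / 2 - 1 - β) * poissonKer (v / √(s * t)) (ξ : EuclideanSpace ℝ (Fin n)) η) =
      ENNReal.ofReal ((s * t) ^ ((n : ℝ) / 2 - 1)) * ∫⁻ v in Ioo 0 (min s t),
        ENNReal.ofReal |1 - s * t / v ^ 2| * ENNReal.ofReal (((s - v) * (t - v) / v) ^ (β - 1) *
          ((s - v) * (t - v) / v + N ^ 2) ^ (-((n : ℝ) / 2))) := by
    rw [← lintegral_const_mul' _ _ ENNReal.ofReal_ne_top]
    refine setLIntegral_congr_fun measurableSet_Ioo fun v hv => ?_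
    obtain ⟨hv0, hv⟩ := hv
    have hvs := (lt_min_iff.1 hv).1
    have hvt := (lt_min_iff.1 hv).2
    have hvv : v ^ 2 < s * t := by nlinarith
    have hs' := sub_pos.2 hvs
    have ht' := sub_pos.2 hvt
    beta_reduce
    rw [abs_sub_comm, abs_of_pos (by rw [sub_pos, one_lt_div (by positivity)]; exact hvv),
      ← ENNReal.ofReal_mul (by rw [sub_nonneg, one_le_div (by positivity)]; exact hvv.le),
      ← ENNReal.ofReal_mul (by positivity)]
    congr 1
    have hZ : 0 < (s - v) * (t - v) / v + N ^ 2 := by positivity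
    -- The identity that makes the substitution work: N² supplies the angular term and z the radial
    -- one.
    have hden : 1 + (v / √(s * t)) ^ 2 -
        2 * (v / √(s * t)) * inner ℝ (ξ : EuclideanSpace ℝ (Fin n)) η =
        v / (s * t) * ((s - v) * (t - v) / v + N ^ 2) := by
      rw [hN2, div_pow, hr]
      have : v / √(s * t) = v * √(s * t) / (s * t) := by
        rw [div_eq_div_iff hr0.ne' hst.ne']; linear_combination -v * hr
      rw [this]
      field_simp
      ring
    rw [poissonKer, norm_smul_sub_pow, hden, div_pow, hr, Real.mul_rpow (by positivity) hZ.le,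
      Real.div_rpow (by positivity) hst.le, Real.div_rpow (by positivity) hv0.le,
      Real.mul_rpow hs'.le ht'.le, Real.rpow_neg hZ.le,
      show (n : ℝ) / 2 - 1 - β = (n : ℝ) / 2 - 1 - 1 - (β - 1) by ring, Real.rpow_sub hv0,
      Real.rpow_sub_one hv0.ne', Real.rpow_sub_one hv0.ne', Real.rpow_sub_one hst.ne']
    have h1 : 0 < v ^ ((n : ℝ) / 2) := by positivity
    have h2 : 0 < (s * t) ^ ((n : ℝ) / 2) := by positivity
    have h3 : 0 < v ^ (β - 1) := by positivity
    have h4 := Real.rpow_pos_of_pos hZ ((n : ℝ) / 2)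
    generalize ((s - v) * (t - v) / v + N ^ 2) ^ ((n : ℝ) / 2) = X at *
    generalize (s * t) ^ ((n : ℝ) / 2) = X2 at *
    field_simp
  rw [h', ← h, ← ENNReal.ofReal_mul (by positivity)]
  congr 1
  rw [← Real.rpow_natCast_mul hN0.le, Nat.cast_ofNat, show (2 : ℝ) * (β - n / 2) = 2 * β - n by
      ring]
  ring

/-- The same substitution on its other monotone branch, with the Poisson radius √(st)/v. -/
theorem lintegral_riesz_above {n : ℕ} {β s t : ℝ} (hβ : 0 < β) (hβn : β < n / 2) (hs : 0 < s)
    (ht : 0 < t) (ξ η : Sph n)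
    (hD : √s • (ξ : EuclideanSpace ℝ (Fin n)) - √t • (η : EuclideanSpace ℝ (Fin n)) ≠ 0) :
    ∫⁻ v in Ioi (max s t), ENNReal.ofReal ((v - s) ^ (β - 1) * (v - t) ^ (β - 1) *
        v ^ (1 - β - (n : ℝ) / 2) * poissonKer (√(s * t) / v) (ξ : EuclideanSpace ℝ (Fin n)) η) =
      ENNReal.ofReal (
        ‖√s • (ξ : EuclideanSpace ℝ (Fin n)) - √t • (η : EuclideanSpace ℝ (Fin n))‖ ^ (2 * β - n) *
        (Real.Gamma β * Real.Gamma (n / 2 - β) / Real.Gamma (n / 2))) := by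
  set N := ‖√s • (ξ : EuclideanSpace ℝ (Fin n)) - √t • (η : EuclideanSpace ℝ (Fin n))‖ with hN
  have hN0 : 0 < N := norm_pos_iff.2 hD
  have hst := mul_pos hs ht
  have hr : √(s * t) ^ 2 = s * t := Real.sq_sqrt hst.le
  have hr0 := Real.sqrt_pos.2 hst
  have hN2 : N ^ 2 = s + t - 2 * √(s * t) * inner ℝ (ξ : EuclideanSpace ℝ (Fin n)) η :=
    norm_sqrt_smul_sub_sq hs.le ht.le ξ η
  have hbeta := lintegral_rpow_mul_add_rpow_neg hβ hβn (D := N ^ 2) (by positivity)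
  have hpos : ∀ v ∈ Ioi (max s t), 0 < v := fun v hv => hs.trans (max_lt_iff.1 (mem_Ioi.1 hv)).1
  have himg : (fun v : ℝ => (s - v) * (t - v) / v) '' Ioi (max s t) = Ioi 0 := by
    ext z
    constructor
    · rintro ⟨v, hv, rfl⟩
      have := max_lt_iff.1 (mem_Ioi.1 hv)
      exact div_pos (mul_pos_of_neg_of_neg (by linarith) (by linarith)) (hpos v hv)
    · intro hz
      obtain ⟨v, w, -, -, -, hws, hwt, -, h⟩ := exists_sub_mul_sub_div_eq hs ht hz
      exact ⟨w, max_lt hws hwt, h⟩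
  have hinj : InjOn (fun v : ℝ => (s - v) * (t - v) / v) (Ioi (max s t)) := by
    intro v hv w hw h
    have h1 := max_lt_iff.1 (mem_Ioi.1 hv)
    have h2 := max_lt_iff.1 (mem_Ioi.1 hw)
    rcases eq_or_mul_eq_of_sub_mul_sub_div_eq (hpos v hv).ne' (hpos w hw).ne' h with h | h
    · exact h
    · nlinarith
  have h := lintegral_image_eq_lintegral_abs_deriv_mul (measurableSet_Ioi (a := max s t))
    (fun v hv => (hasDerivAt_sub_mul_sub_div (hpos v hv).ne').hasDerivWithinAt) hinj
    (fun z => ENNReal.ofReal (z ^ (β - 1) * (z + N ^ 2) ^ (-((n : ℝ) / 2))))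
  rw [himg, hbeta] at h
  have h' : ∫⁻ v in Ioi (max s t), ENNReal.ofReal ((v - s) ^ (β - 1) * (v - t) ^ (β - 1) *
        v ^ (1 - β - (n : ℝ) / 2) * poissonKer (√(s * t) / v) (ξ : EuclideanSpace ℝ (Fin n)) η) =
      ∫⁻ v in Ioi (max s t),
        ENNReal.ofReal |1 - s * t / v ^ 2| * ENNReal.ofReal (((s - v) * (t - v) / v) ^ (β - 1) *
          ((s - v) * (t - v) / v + N ^ 2) ^ (-((n : ℝ) / 2))) := by
    refine setLIntegral_congr_fun measurableSet_Ioi fun v hv => ?_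
    have hv0 := hpos v hv
    obtain ⟨hvs, hvt⟩ := max_lt_iff.1 (mem_Ioi.1 hv)
    have hvv : s * t < v ^ 2 := by nlinarith
    have hs' := sub_pos.2 hvs
    have ht' := sub_pos.2 hvt
    have hvv' : 0 < 1 - s * t / v ^ 2 := by rw [sub_pos, div_lt_one (by positivity)]; exact hvv
    beta_reduce
    rw [abs_of_pos hvv', ← ENNReal.ofReal_mul hvv'.le]
    congr 1
    rw [show (s - v) * (t - v) = (v - s) * (v - t) by ring]
    have hZ : 0 < (v - s) * (v - t) / v + N ^ 2 := by positivity
    have hden : 1 + (√(s * t) / v) ^ 2 -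
        2 * (√(s * t) / v) * inner ℝ (ξ : EuclideanSpace ℝ (Fin n)) η =
        v⁻¹ * ((v - s) * (v - t) / v + N ^ 2) := by
      rw [hN2, div_pow, hr]
      field_simp
      ring
    rw [poissonKer, norm_smul_sub_pow, hden, div_pow, hr, Real.mul_rpow (by positivity) hZ.le,
      Real.inv_rpow (by positivity), Real.div_rpow (by positivity) hv0.le,
      Real.mul_rpow hs'.le ht'.le, Real.rpow_neg hZ.le,
      show 1 - β - (n : ℝ) / 2 = -(β - 1) - (n : ℝ) / 2 by ring, Real.rpow_sub hv0,
      Real.rpow_neg hv0.le]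
    have h1 : 0 < v ^ ((n : ℝ) / 2) := by positivity
    have h3 : 0 < v ^ (β - 1) := by positivity
    have h4 := Real.rpow_pos_of_pos hZ ((n : ℝ) / 2)
    generalize ((v - s) * (v - t) / v + N ^ 2) ^ ((n : ℝ) / 2) = X at *
    field_simp
  rw [h', ← h]
  congr 1
  rw [← Real.rpow_natCast_mul hN0.le, Nat.cast_ofNat, show (2 : ℝ) * (β - n / 2) = 2 * β - n by
      ring]

/-! ### One-sided fractional integrals composed with Poisson integrals -/

/-- The product of Lebesgue measure and surface measure on `ℝ × S^{n-1}`. -/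
noncomputable abbrev cylMeasure (n : ℕ) : Measure (ℝ × Sph n) :=
  (volume : Measure ℝ).prod (surf n)

/-- The kernel of the one-sided fractional integral of order `β` composed with Poisson integrals:
to the right for `e = 1`, to the left for `e = -1`. -/
noncomputable def fracKer {n : ℕ} (β e : ℝ) (x y : ℝ × Sph n) : ℝ :=
  open Classical in
  if 0 < x.1 ∧ 0 < y.1 ∧ 0 < e * (y.1 - x.1) then
    (Real.Gamma β * sphereArea n)⁻¹ * (|y.1 - x.1| ^ (β - 1) * pairKer x.1 y.1 x.2 y.2)
  else 0

theorem fracKer_nonneg {n : ℕ} (hn : 1 ≤ n) {β : ℝ} (hβ : 0 < β) (e : ℝ) (x y : ℝ × Sph n) :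
    0 ≤ fracKer β e x y := by
  unfold fracKer
  split_ifs with h
  · have h1 := Real.Gamma_pos_of_pos hβ
    have h2 := sphereArea_pos hn
    have hne : x.1 ≠ y.1 := by
      intro h'
      simp [h'] at h
    have := pairKer_pos h.1 h.2.1 hne x.2 y.2
    positivity
  · exact le_rfl

theorem measurable_fracKer {n : ℕ} (β e : ℝ) :
    Measurable fun p : (ℝ × Sph n) × ℝ × Sph n => fracKer β e p.1 p.2 := by
  unfold fracKer
  refine Measurable.ite ?_ ?_ measurable_const
  · have h1 : MeasurableSet {p : (ℝ × Sph n) × ℝ × Sph n | 0 < p.1.1} :=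
      measurableSet_lt measurable_const (by fun_prop)
    have h2 : MeasurableSet {p : (ℝ × Sph n) × ℝ × Sph n | 0 < p.2.1} :=
      measurableSet_lt measurable_const (by fun_prop)
    have h3 : MeasurableSet {p : (ℝ × Sph n) × ℝ × Sph n | 0 < e * (p.2.1 - p.1.1)} :=
      measurableSet_lt measurable_const (by fun_prop)
    exact h1.inter (h2.inter h3)
  · have := measurable_pairKer (n := n)
    fun_prop

theorem measurable_fracKer_right {n : ℕ} (β e : ℝ) (x : ℝ × Sph n) : Measurable (fracKer β e x) :=
  (measurable_fracKer β e).comp measurable_prodMk_left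

/-- The constant of the Riesz kernel in the factorization. -/
noncomputable def rieszConst (n : ℕ) (β : ℝ) : ℝ :=
  Real.Gamma (n / 2 - β) / (2 * Real.pi ^ ((n : ℝ) / 2) * Real.Gamma β)

theorem rieszConst_eq {n : ℕ} (hn : 1 ≤ n) {β : ℝ} (hβ : 0 < β) :
    (Real.Gamma β * sphereArea n)⁻¹ * ((Real.Gamma β * sphereArea n)⁻¹ * (sphereArea n *
      (Real.Gamma β * Real.Gamma (n / 2 - β) / Real.Gamma (n / 2)))) = rieszConst n β := by
  have hn' : (0 : ℝ) < n := by exact_mod_cast hn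
  have h1 := Real.Gamma_pos_of_pos hβ
  have h2 := Real.Gamma_pos_of_pos (half_pos hn')
  have h3 : 0 < Real.pi ^ ((n : ℝ) / 2) := by positivity
  unfold rieszConst sphereArea
  field_simp

theorem sqrt_smul_sub_ne_zero {n : ℕ} {s t : ℝ} (hs : 0 < s) (ht : 0 < t) (hst : s ≠ t)
    (ξ η : Sph n) :
    √s • (ξ : EuclideanSpace ℝ (Fin n)) - √t • (η : EuclideanSpace ℝ (Fin n)) ≠ 0 := by
  intro h
  have h1 := congrArg norm (sub_eq_zero.1 h)
  rw [norm_smul, norm_smul, norm_eq_of_mem_sphere, norm_eq_of_mem_sphere, mul_one, mul_one,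
    Real.norm_of_nonneg (Real.sqrt_nonneg _), Real.norm_of_nonneg (Real.sqrt_nonneg _),
    Real.sqrt_inj hs.le ht.le] at h1
  exact hst h1

/-- The common form of the factorizations below and above s and t: J is the set of admissible
intermediate levels v, V the weight inserted between the factors, and R(v) the Poisson radius
obtained by composing over the sphere at level v. -/
theorem lintegral_fracKer_mul_fracKer {n : ℕ} {β e : ℝ}
    (V : ℝ → ℝ) (J : Set ℝ) (hJ : MeasurableSet J) (R : ℝ → ℝ)
    {x z : ℝ × Sph n} (hx : 0 < x.1) (hz : 0 < z.1)
    (hJe : ∀ v, v ∈ J ↔ 0 < v ∧ 0 < e * (v - x.1) ∧ 0 < -e * (z.1 - v))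
    (hβ : 0 < β) (hn : 1 ≤ n) (hV : ∀ v, 0 < v → 0 ≤ V v)
    (hR : ∀ v ∈ J, ∫⁻ ζ, ENNReal.ofReal (pairKer x.1 v x.2 ζ) *
      ENNReal.ofReal (pairKer v z.1 ζ z.2) ∂(surf n) =
        ENNReal.ofReal (sphereArea n * poissonKer (R v) (x.2 : EuclideanSpace ℝ (Fin n)) z.2))
    (hVm : Measurable V) {c : ℝ}
    (hInt : ∫⁻ v in J, ENNReal.ofReal (|v - x.1| ^ (β - 1) * |z.1 - v| ^ (β - 1) * V v *
      poissonKer (R v) (x.2 : EuclideanSpace ℝ (Fin n)) z.2) = ENNReal.ofReal (c *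
        (Real.Gamma β * Real.Gamma (n / 2 - β) / Real.Gamma (n / 2)))) :
    ∫⁻ y, ENNReal.ofReal (fracKer β e x y * V y.1) * ENNReal.ofReal (fracKer β (-e) y z)
      ∂(cylMeasure n) = ENNReal.ofReal (rieszConst n β * c) := by
  have h1 := Real.Gamma_pos_of_pos hβ
  have h2 := sphereArea_pos hn
  have hm : Measurable fun y : ℝ × Sph n =>
      ENNReal.ofReal (fracKer β e x y * V y.1) * ENNReal.ofReal (fracKer β (-e) y z) :=
    (((measurable_fracKer β e).comp measurable_prodMk_left).mul
      (hVm.comp measurable_fst)).ennreal_ofReal.mul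
      ((measurable_fracKer β (-e)).comp measurable_prodMk_right).ennreal_ofReal
  rw [lintegral_prod _ hm.aemeasurable]
  set G := (Real.Gamma β * sphereArea n)⁻¹ with hG
  have hG0 : 0 < G := by positivity
  -- For fixed v the sphere variable is integrated first, by the semigroup property. Outside J one
  -- of the two one-sided kernels vanishes.
  have key : ∀ v : ℝ, (∫⁻ ζ, ENNReal.ofReal (fracKer β e x (v, ζ) * V v) *
      ENNReal.ofReal (fracKer β (-e) (v, ζ) z) ∂(surf n)) =
      J.indicator (fun v => ENNReal.ofReal (G * (G * sphereArea n)) * ENNReal.ofReal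
        (|v - x.1| ^ (β - 1) * |z.1 - v| ^ (β - 1) * V v *
      poissonKer (R v) (x.2 : EuclideanSpace ℝ (Fin n)) z.2)) v := by
    intro v
    by_cases hv : v ∈ J
    · obtain ⟨hv0, hv1, hv2⟩ := (hJe v).1 hv
      have hVv := hV v hv0
      rw [indicator_of_mem hv]
      have hne1 : x.1 ≠ v := by rintro h; simp [h] at hv1
      have hne2 : v ≠ z.1 := by rintro h; simp [h] at hv2
      have e1 : ∀ ζ : Sph n, ENNReal.ofReal (fracKer β e x (v, ζ) * V v) *
        ENNReal.ofReal (fracKer β (-e) (v, ζ) z) =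
          ENNReal.ofReal (G * (|v - x.1| ^ (β - 1) * V v) * (G * |z.1 - v| ^ (β - 1))) *
          (ENNReal.ofReal (pairKer x.1 v x.2 ζ) * ENNReal.ofReal (pairKer v z.1 ζ z.2)) := by
        intro ζ
        have p1 := pairKer_pos hx hv0 hne1 x.2 ζ
        have p2 := pairKer_pos hv0 hz hne2 ζ z.2
        rw [fracKer, fracKer, if_pos ⟨hx, hv0, hv1⟩, if_pos ⟨hv0, hz, hv2⟩,
          ← ENNReal.ofReal_mul p1.le, ← ENNReal.ofReal_mul (by positivity),
          ← ENNReal.ofReal_mul (by positivity)]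
        congr 1
        simp only [hG]
        ring
      simp_rw [e1]
      rw [lintegral_const_mul' _ _ ENNReal.ofReal_ne_top, hR v hv,
        ← ENNReal.ofReal_mul (by positivity), ← ENNReal.ofReal_mul (by positivity)]
      congr 1
      ring
    · rw [indicator_of_notMem hv]
      refine lintegral_eq_zero_of_ae_eq_zero (.of_forall fun ζ => ?_)
      rw [hJe] at hv
      simp only [fracKer, Pi.zero_apply]
      by_cases ha : 0 < v ∧ 0 < e * (v - x.1)
      · have : ¬ (0 < v ∧ 0 < z.1 ∧ 0 < -e * (z.1 - v)) := fun h => hv ⟨ha.1, ha.2, h.2.2⟩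
        rw [if_neg this, ENNReal.ofReal_zero, mul_zero]
      · have : ¬ (0 < x.1 ∧ 0 < v ∧ 0 < e * (v - x.1)) := fun h => ha h.2
        simp [this]
  simp_rw [key]
  rw [lintegral_indicator hJ, lintegral_const_mul' _ _ ENNReal.ofReal_ne_top, hInt,
    ← ENNReal.ofReal_mul (by positivity)]
  congr 1
  rw [← rieszConst_eq hn hβ]
  ring

theorem lintegral_fracKer_comp_below {n : ℕ} (hn : 1 ≤ n) {β : ℝ} (hβ : 0 < β) (hβn : β < n / 2)
    {x z : ℝ × Sph n} (hx : 0 < x.1) (hz : 0 < z.1) (hxz : x.1 ≠ z.1) :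
    ∫⁻ y, ENNReal.ofReal (fracKer β (-1) x y * y.1 ^ ((n : ℝ) / 2 - 1 - β)) *
      ENNReal.ofReal (fracKer β 1 y z) ∂(cylMeasure n) =
    ENNReal.ofReal (rieszConst n β * ((x.1 * z.1) ^ ((n : ℝ) / 2 - 1) *
        ‖√x.1 • (x.2 : EuclideanSpace ℝ (Fin n)) - √z.1 • (z.2 : EuclideanSpace ℝ (Fin n))‖ ^
          (2 * β - n))) := by
  have h := lintegral_fracKer_mul_fracKer (e := -1) (fun v => v ^ ((n : ℝ) / 2 - 1 - β))
    (Ioo 0 (min x.1 z.1)) measurableSet_Ioo (fun v => v / √(x.1 * z.1)) hx hz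
    (fun v => by
      simp only [mem_Ioo, lt_min_iff]
      constructor
      · rintro ⟨h1, h2, h3⟩
        exact ⟨h1, by linarith, by linarith⟩
      · rintro ⟨h1, h2, h3⟩
        exact ⟨h1, by linarith, by linarith⟩) hβ hn (fun v hv => by positivity)
    (fun v hv => lintegral_pairKer_mul_below hn hv.1 (lt_min_iff.1 hv.2).1 (lt_min_iff.1 hv.2).2 _ _)
    (by fun_prop) (c := ((x.1 * z.1) ^ ((n : ℝ) / 2 - 1) *
        ‖√x.1 • (x.2 : EuclideanSpace ℝ (Fin n)) - √z.1 • (z.2 : EuclideanSpace ℝ (Fin n))‖ ^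
          (2 * β - n)))
    (by
      rw [← lintegral_riesz_below hβ hβn hx hz x.2 z.2 (sqrt_smul_sub_ne_zero hx hz hxz _ _)]
      refine setLIntegral_congr_fun measurableSet_Ioo fun v hv => ?_
      have h1 := lt_min_iff.1 hv.2
      rw [abs_sub_comm, abs_of_pos (sub_pos.2 h1.1), abs_of_pos (sub_pos.2 h1.2)])
  rwa [neg_neg] at h

theorem lintegral_fracKer_comp_above {n : ℕ} (hn : 1 ≤ n) {β : ℝ} (hβ : 0 < β) (hβn : β < n / 2)
    {x z : ℝ × Sph n} (hx : 0 < x.1) (hz : 0 < z.1) (hxz : x.1 ≠ z.1) :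
    ∫⁻ y, ENNReal.ofReal (fracKer β 1 x y * y.1 ^ (1 - β - (n : ℝ) / 2)) *
      ENNReal.ofReal (fracKer β (-1) y z) ∂(cylMeasure n) =
    ENNReal.ofReal (rieszConst n β *
        ‖√x.1 • (x.2 : EuclideanSpace ℝ (Fin n)) - √z.1 • (z.2 : EuclideanSpace ℝ (Fin n))‖ ^
          (2 * β - n)) := by
  exact lintegral_fracKer_mul_fracKer (e := 1) (fun v => v ^ (1 - β - (n : ℝ) / 2))
    (Ioi (max x.1 z.1)) measurableSet_Ioi (fun v => √(x.1 * z.1) / v) hx hz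
    (fun v => by
      simp only [mem_Ioi, max_lt_iff]
      constructor
      · rintro ⟨h2, h3⟩
        exact ⟨by linarith, by linarith, by linarith⟩
      · rintro ⟨h1, h2, h3⟩
        exact ⟨by linarith, by linarith⟩) hβ hn (fun v hv => by positivity)
    (fun v hv => lintegral_pairKer_mul_above hn hx hz (max_lt_iff.1 (mem_Ioi.1 hv)).1
      (max_lt_iff.1 (mem_Ioi.1 hv)).2 _ _)
    (by fun_prop)
    (by
      rw [← lintegral_riesz_above hβ hβn hx hz x.2 z.2 (sqrt_smul_sub_ne_zero hx hz hxz _ _)]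
      refine setLIntegral_congr_fun measurableSet_Ioi fun v hv => ?_
      have h1 := max_lt_iff.1 (mem_Ioi.1 hv)
      rw [abs_of_pos (sub_pos.2 h1.1), abs_sub_comm, abs_of_pos (sub_pos.2 h1.2)])

/-- A Poisson integral of a fractional integral is a fractional integral of Poisson integrals. -/
theorem lintegral_pairKer_mul_fracKer {n : ℕ} (hn : 1 ≤ n) {β e : ℝ} (hβ : 0 < β)
    (he : e = 1 ∨ e = -1) {s v : ℝ} (hs : 0 < s) (hv : 0 < v) (hsv : 0 < e * (v - s)) (ξ : Sph n)
    (z : ℝ × Sph n) :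
    ∫⁻ ζ, ENNReal.ofReal (pairKer s v ξ ζ) * ENNReal.ofReal (fracKer β e (v, ζ) z) ∂(surf n) =
      ENNReal.ofReal ((Ioi (0 : ℝ) ∩ {t | 0 < e * (t - v)}).indicator
        (fun t => (Real.Gamma β)⁻¹ * (|t - v| ^ (β - 1) * pairKer s t ξ z.2)) z.1) := by
  have h1 := Real.Gamma_pos_of_pos hβ
  have h2 := sphereArea_pos hn
  by_cases hz : z.1 ∈ Ioi (0 : ℝ) ∩ {t | 0 < e * (t - v)}
  · rw [indicator_of_mem hz]
    have hz0 : 0 < z.1 := hz.1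
    have hz1 : 0 < e * (z.1 - v) := hz.2
    have hord : (s < v ∧ v < z.1) ∨ (z.1 < v ∧ v < s) := by
      rcases he with rfl | rfl
      · left; constructor <;> linarith
      · right; constructor <;> linarith
    simp only [fracKer, hv, hz0, hz1, and_self, if_true]
    have e1 : ∀ ζ : Sph n, ENNReal.ofReal (pairKer s v ξ ζ) * ENNReal.ofReal
        ((Real.Gamma β * sphereArea n)⁻¹ * (|z.1 - v| ^ (β - 1) * pairKer v z.1 ζ z.2)) =
        ENNReal.ofReal ((Real.Gamma β * sphereArea n)⁻¹ * |z.1 - v| ^ (β - 1)) *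
        (ENNReal.ofReal (pairKer s v ξ ζ) * ENNReal.ofReal (pairKer v z.1 ζ z.2)) := by
      intro ζ
      rw [← mul_assoc (_⁻¹), ENNReal.ofReal_mul (by positivity)]
      ring
    simp_rw [e1]
    rw [lintegral_const_mul' _ _ ENNReal.ofReal_ne_top, lintegral_pairKer_mul hn hs hz0 hord,
      ← ENNReal.ofReal_mul (by positivity)]
    congr 1
    field_simp
  · rw [indicator_of_notMem hz, ENNReal.ofReal_zero]
    refine lintegral_eq_zero_of_ae_eq_zero (.of_forall fun ζ => ?_)
    have : ¬ (0 < v ∧ 0 < z.1 ∧ 0 < e * (z.1 - v)) := fun h => hz ⟨h.2.1, h.2.2⟩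
    simp [fracKer, this]

/-! ### Finite differences of powers -/

/-- The backward difference of order `ℓ` of the power `x ^ γ`. -/
noncomputable def rpowDiff : ℕ → ℝ → ℝ → ℝ
  | 0, γ, x => x ^ γ
  | ℓ + 1, γ, x => rpowDiff ℓ γ x - rpowDiff ℓ γ (x - 1)

theorem rpowDiff_eq_sum (ℓ : ℕ) (γ x : ℝ) :
    rpowDiff ℓ γ x = ∑ j ∈ Finset.range (ℓ + 1), (-1) ^ j * (ℓ.choose j : ℝ) * (x - j) ^ γ := by
  have h : ∀ ℓ : ℕ, ∀ x, rpowDiff ℓ γ x = (-1) ^ ℓ * (fwdDiff (-1 : ℝ))^[ℓ] (fun x => x ^ γ) x := by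
    intro ℓ
    induction ℓ with
    | zero => intro x; simp [rpowDiff]
    | succ k ih =>
      intro x
      rw [rpowDiff, ih, ih, Function.iterate_succ_apply', fwdDiff]
      ring_nf
  rw [h, fwdDiff_iter_eq_sum_shift, Finset.mul_sum]
  refine Finset.sum_congr rfl fun j hj => ?_
  have hj : j ≤ ℓ := Nat.lt_succ_iff.1 (Finset.mem_range.1 hj)
  simp only [zsmul_eq_mul, Int.cast_mul, Int.cast_pow, Int.cast_neg, Int.cast_one, Int.cast_natCast,
    nsmul_eq_mul, mul_neg, mul_one]
  rw [← mul_assoc, ← mul_assoc, ← pow_add, ← sub_eq_add_neg]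
  congr 2
  have : ℓ + (ℓ - j) = j + 2 * (ℓ - j) := by omega
  rw [this, pow_add, pow_mul]
  simp

theorem hasDerivAt_rpowDiff (ℓ : ℕ) (γ : ℝ) {x : ℝ} (hx : (ℓ : ℝ) < x) :
    HasDerivAt (rpowDiff ℓ γ) (γ * rpowDiff ℓ (γ - 1) x) x := by
  induction ℓ generalizing x with
  | zero =>
    have : (0 : ℝ) < x := by simpa using hx
    exact Real.hasDerivAt_rpow_const (Or.inl this.ne')
  | succ k ih =>
    push_cast at hx
    have h1 := ih (show (k : ℝ) < x by linarith)
    have h2 := (ih (show (k : ℝ) < x - 1 by linarith)).comp_sub_const x 1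
    refine (h1.sub h2).congr_deriv ?_
    rw [rpowDiff]
    ring

/-- By the mean value theorem one more difference acts as one derivative, lowering the exponent by
one. The bound 2ℓ + 1 ≤ x keeps all arguments positive and comparable with x. -/
theorem abs_rpowDiff_le (ℓ : ℕ) (γ : ℝ) :
    ∃ C, 0 ≤ C ∧ ∀ x : ℝ, 2 * ℓ + 1 ≤ x → |rpowDiff ℓ γ x| ≤ C * x ^ (γ - ℓ) := by
  induction ℓ generalizing γ with
  | zero =>
    refine ⟨1, zero_le_one, fun x hx => ?_⟩
    have hx : (0 : ℝ) < x := by push_cast at hx; linarith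
    simp [rpowDiff, abs_of_pos (Real.rpow_pos_of_pos hx γ)]
  | succ k ih =>
    obtain ⟨C, hC, h⟩ := ih (γ - 1)
    -- The mean value point y lies in (x - 1, x), so y/x ∈ [1/2, 1]; the last factor absorbs the
    -- change from y to x for an exponent of either sign.
    refine ⟨|γ| * C * (1 / 2) ^ (-|γ - 1 - k|), by positivity, fun x hx => ?_⟩
    push_cast at hx
    have hk : (0 : ℝ) ≤ k := k.cast_nonneg
    obtain ⟨y, hy, hy'⟩ := exists_hasDerivAt_eq_slope (rpowDiff k γ)
      (fun y => γ * rpowDiff k (γ - 1) y) (show x - 1 < x by linarith)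
      (fun z hz => (hasDerivAt_rpowDiff k γ (by linarith [hz.1])).continuousAt.continuousWithinAt)
      (fun z hz => hasDerivAt_rpowDiff k γ (by linarith [hz.1]))
    rw [sub_sub_cancel, div_one] at hy'
    have hx0 : 0 < x := by linarith
    have hy0 : 0 < y := by linarith [hy.1]
    rw [rpowDiff, ← hy', abs_mul, mul_assoc, mul_assoc]
    gcongr
    refine (h y (by linarith [hy.1])).trans ?_
    gcongr
    have e : γ - ((k + 1 : ℕ) : ℝ) = γ - 1 - k := by push_cast; ring
    rw [e]
    set a := γ - 1 - (k : ℝ)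
    have h1 : y ^ a = (y / x) ^ a * x ^ a := by
      rw [Real.div_rpow hy0.le hx0.le]; field_simp
    rw [h1]
    gcongr
    have hyx : 1 / 2 ≤ y / x := by
      rw [le_div_iff₀ hx0]; linarith [hy.1]
    have hyx1 : y / x ≤ 1 := by rw [div_le_one hx0]; exact hy.2.le
    calc (y / x) ^ a ≤ (y / x) ^ (-|a|) :=
          Real.rpow_le_rpow_of_exponent_ge (by positivity) hyx1 (neg_abs_le a)
      _ ≤ (1 / 2) ^ (-|a|) :=
          Real.rpow_le_rpow_of_nonpos (by norm_num) hyx (by simp)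

/-! ### The kernel of the truncated Marchaud derivative -/

/-- The kernel of the truncated Marchaud derivative of a fractional integral, at unit scale. -/
noncomputable def marchaudKer (β : ℝ) (ℓ : ℕ) (x : ℝ) : ℝ :=
  ∑ j ∈ Finset.range (ℓ + 1), (-1) ^ j * (ℓ.choose j : ℝ) *
    ((Real.Gamma (β + 1))⁻¹ * (x⁻¹ * (max (x - j) 0) ^ β))

/-- Near 0 the kernel has the singularity x^{β-1} of the fractional integral. At infinity the
cancellation in the ℓ-th difference leaves x^{β-1-ℓ}. The majorant is integrable precisely for ℓ >
β. -/
theorem abs_marchaudKer_le {β : ℝ} (hβ : 0 < β) (ℓ : ℕ) :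
    ∃ C, 0 ≤ C ∧ ∀ x : ℝ, 0 < x → |marchaudKer β ℓ x| ≤ C * (x ^ (β - 1) * (1 + x) ^ (-(ℓ : ℝ))) :=
      by
  obtain ⟨C, hC, h⟩ := abs_rpowDiff_le ℓ β
  have hΓ := Real.Gamma_pos_of_pos (show 0 < β + 1 by linarith)
  set B := ∑ j ∈ Finset.range (ℓ + 1), (ℓ.choose j : ℝ) with hB
  have hB0 : 0 ≤ B := Finset.sum_nonneg fun _ _ => Nat.cast_nonneg _
  have hℓ : (0 : ℝ) ≤ ℓ := ℓ.cast_nonneg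
  refine ⟨(Real.Gamma (β + 1))⁻¹ * (C * 2 ^ (ℓ : ℝ) + B * (2 * ℓ + 2) ^ (ℓ : ℝ)), by positivity,
    fun x hx => ?_⟩
  have hx1 : 0 < 1 + x := by linarith
  have hP := Real.rpow_pos_of_pos hx1 (-(ℓ : ℝ))
  rcases le_or_gt (2 * ℓ + 1 : ℝ) x with hxl | hxl
  -- Once x ≥ ℓ no term is truncated, and the kernel is the full finite difference of x^β divided by
  -- x.
  · have e : marchaudKer β ℓ x = (Real.Gamma (β + 1))⁻¹ * (x⁻¹ * rpowDiff ℓ β x) := by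
      rw [marchaudKer, rpowDiff_eq_sum, Finset.mul_sum, Finset.mul_sum]
      refine Finset.sum_congr rfl fun j hj => ?_
      have hj : (j : ℝ) ≤ ℓ := by exact_mod_cast Nat.lt_succ_iff.1 (Finset.mem_range.1 hj)
      rw [max_eq_left (by linarith)]
      ring
    rw [e, abs_mul, abs_mul, abs_of_pos (inv_pos.2 hΓ), abs_of_pos (inv_pos.2 hx), mul_assoc]
    refine mul_le_mul_of_nonneg_left ?_ (inv_pos.2 hΓ).le
    calc x⁻¹ * |rpowDiff ℓ β x| ≤ x⁻¹ * (C * x ^ (β - ℓ)) := by gcongr; exact h x hxl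
      _ = C * (x ^ (β - 1) * x ^ (-(ℓ : ℝ))) := by
          rw [Real.rpow_sub_one hx.ne', Real.rpow_sub hx, Real.rpow_neg hx.le]; field_simp
      _ ≤ C * (x ^ (β - 1) * (2 ^ (ℓ : ℝ) * (1 + x) ^ (-(ℓ : ℝ)))) := by
          gcongr
          have h2 : x ^ (-(ℓ : ℝ)) = 2 ^ (ℓ : ℝ) * (2 * x) ^ (-(ℓ : ℝ)) := by
            rw [Real.mul_rpow (by norm_num) hx.le, ← mul_assoc, ← Real.rpow_add (by norm_num)]
            simp
          rw [h2]
          gcongr 2 ^ (ℓ : ℝ) * ?_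
          exact Real.rpow_le_rpow_of_nonpos hx1 (by linarith) (by linarith)
      _ = C * 2 ^ (ℓ : ℝ) * (x ^ (β - 1) * (1 + x) ^ (-(ℓ : ℝ))) := by ring
      _ ≤ _ := by
          gcongr
          have : 0 ≤ B * (2 * ℓ + 2 : ℝ) ^ (ℓ : ℝ) := by positivity
          linarith
  · have h1 : |marchaudKer β ℓ x| ≤ (Real.Gamma (β + 1))⁻¹ * (B * x ^ (β - 1)) := by
      rw [marchaudKer, hB, Finset.sum_mul, Finset.mul_sum]
      refine (Finset.abs_sum_le_sum_abs _ _).trans (Finset.sum_le_sum fun j _ => ?_)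
      have hm : 0 ≤ max (x - j) 0 := le_max_right _ _
      rw [abs_mul, abs_mul, abs_pow, abs_neg, abs_one, one_pow, one_mul,
        abs_of_nonneg (Nat.cast_nonneg _), abs_of_nonneg (by positivity), mul_left_comm]
      gcongr
      rw [Real.rpow_sub_one hx.ne', div_eq_inv_mul]
      gcongr
      exact max_le (by linarith [(Nat.cast_nonneg j : (0 : ℝ) ≤ j)]) hx.le
    refine h1.trans ?_
    rw [mul_assoc]
    refine mul_le_mul_of_nonneg_left ?_ (inv_pos.2 hΓ).le
    have h2 : 1 ≤ (2 * ℓ + 2 : ℝ) ^ (ℓ : ℝ) * (1 + x) ^ (-(ℓ : ℝ)) := by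
      rw [Real.rpow_neg hx1.le, ← div_eq_mul_inv, one_le_div (by positivity)]
      exact Real.rpow_le_rpow hx1.le (by linarith) hℓ
    calc B * x ^ (β - 1) ≤ B * x ^ (β - 1) * ((2 * ℓ + 2 : ℝ) ^ (ℓ : ℝ) * (1 + x) ^ (-(ℓ : ℝ))) :=
          le_mul_of_one_le_right (by positivity) h2
      _ = B * (2 * ℓ + 2 : ℝ) ^ (ℓ : ℝ) * (x ^ (β - 1) * (1 + x) ^ (-(ℓ : ℝ))) := by ring
      _ ≤ _ := by
          gcongr
          have : 0 ≤ C * 2 ^ (ℓ : ℝ) := by positivity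
          linarith

theorem lintegral_Ioo_rpow {β c : ℝ} (hβ : 0 < β) (hc : 0 ≤ c) :
    ∫⁻ y in Ioo 0 c, ENNReal.ofReal (y ^ (β - 1)) = ENNReal.ofReal (c ^ β / β) := by
  rw [Measure.restrict_congr_set Ioo_ae_eq_Ioc, ← ofReal_integral_eq_lintegral_ofReal]
  · rw [← intervalIntegral.integral_of_le hc, integral_rpow (Or.inl (by linarith))]
    simp [hβ.ne']
  · exact (intervalIntegral.intervalIntegrable_rpow' (by linarith)).1
  · filter_upwards [ae_restrict_mem measurableSet_Ioc] with y hy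
    exact Real.rpow_nonneg hy.1.le _

/-- The kernel of the fractional integral evaluated at the shift `a`. -/
noncomputable def shiftKer (β : ℝ) (a r : ℝ) : ℝ :=
  (Real.Gamma β)⁻¹ * (Ioi a).indicator (fun r => (r - a) ^ (β - 1)) r

theorem shiftKer_nonneg {β : ℝ} (hβ : 0 < β) (a r : ℝ) : 0 ≤ shiftKer β a r := by
  have := Real.Gamma_pos_of_pos hβ
  refine mul_nonneg (by positivity) (indicator_nonneg (fun r hr => ?_) _)
  exact Real.rpow_nonneg (sub_nonneg.2 (le_of_lt hr)) _

theorem measurable_shiftKer (β : ℝ) : Measurable fun p : ℝ × ℝ => shiftKer β p.1 p.2 := by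
  unfold shiftKer
  refine Measurable.const_mul ?_ _
  have : (fun p : ℝ × ℝ => (Ioi p.1).indicator (fun r => (r - p.1) ^ (β - 1)) p.2) =
      {p : ℝ × ℝ | p.1 < p.2}.indicator (fun p => (p.2 - p.1) ^ (β - 1)) := by
    ext p
    simp [indicator]
  rw [this]
  exact ((measurable_snd.sub measurable_fst).pow_const _).indicator
    (measurableSet_lt measurable_fst measurable_snd)

/-- The substitution y = r/τ - j turns τ^{-1-β} (r - jτ)^{β-1} dτ into y^{β-1} dy/r. The
contribution of each shift j is thus an elementary function of r/ε, and their signed sum is the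
dilated `marchaudKer`. -/
theorem lintegral_rpow_mul_shiftKer {β ε r : ℝ} (hβ : 0 < β) (hε : 0 < ε) (hr : 0 < r) (j : ℕ) :
    ∫⁻ τ in Ioi ε, ENNReal.ofReal ((|τ| ^ (1 + β))⁻¹) * ENNReal.ofReal (shiftKer β (j * τ) r) =
      ENNReal.ofReal (ε⁻¹ * ((Real.Gamma (β + 1))⁻¹ * ((r / ε)⁻¹ * (max (r / ε - j) 0) ^ β))) := by
  have hΓ := Real.Gamma_pos_of_pos hβ
  set T := {τ : ℝ | ε < τ ∧ j * τ < r} with hT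
  have hTm : MeasurableSet T :=
    (measurableSet_lt measurable_const measurable_id).inter
      (measurableSet_lt (measurable_id.const_mul (j : ℝ)) measurable_const)
  have hj : (0 : ℝ) ≤ j := j.cast_nonneg
  have himg : (fun τ : ℝ => r * τ⁻¹ - j) '' T = Ioo 0 (r / ε - j) := by
    ext y
    constructor
    · rintro ⟨τ, ⟨h1, h2⟩, rfl⟩
      have hτ := hε.trans h1
      refine ⟨?_, ?_⟩
      · rw [sub_pos, ← div_eq_mul_inv, lt_div_iff₀ hτ]; exact h2
      · beta_reduce
        rw [← div_eq_mul_inv]; gcongr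
    · rintro ⟨h1, h2⟩
      have hy : 0 < y + j := by linarith
      refine ⟨r / (y + j), ⟨?_, ?_⟩, ?_⟩
      · rw [lt_div_iff₀ hy, mul_comm, ← lt_div_iff₀ hε]; linarith
      · rw [mul_div_assoc', div_lt_iff₀ hy]; nlinarith
      · beta_reduce
        rw [inv_div, mul_div_cancel₀ _ hr.ne', add_sub_cancel_right]
  have hinj : InjOn (fun τ : ℝ => r * τ⁻¹ - j) T := by
    intro a _ b _ h
    have : r * a⁻¹ = r * b⁻¹ := by linarith
    exact inv_injective (mul_left_cancel₀ hr.ne' this)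
  have hder : ∀ τ ∈ T, HasDerivWithinAt (fun τ : ℝ => r * τ⁻¹ - j) (r * (-(τ ^ 2)⁻¹)) T τ :=
    fun τ hτ => (((hasDerivAt_inv (hε.trans hτ.1).ne').const_mul r).sub_const _).hasDerivWithinAt
  have h := lintegral_image_eq_lintegral_abs_deriv_mul hTm hder hinj
    (fun y => ENNReal.ofReal (y ^ (β - 1)))
  have e1 : ∫⁻ τ in Ioi ε, ENNReal.ofReal ((|τ| ^ (1 + β))⁻¹) * ENNReal.ofReal (shiftKer β (j * τ)
      r) =
      ENNReal.ofReal ((Real.Gamma β)⁻¹ * r⁻¹) * ∫⁻ τ in T, ENNReal.ofReal |r * (-(τ ^ 2)⁻¹)| *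
        ENNReal.ofReal ((r * τ⁻¹ - j) ^ (β - 1)) := by
    rw [← lintegral_const_mul' _ _ ENNReal.ofReal_ne_top, ← lintegral_indicator measurableSet_Ioi,
      ← lintegral_indicator hTm]
    refine lintegral_congr fun τ => ?_
    by_cases h1 : ε < τ
    · have hτ := hε.trans h1
      by_cases h2 : j * τ < r
      · rw [indicator_of_mem (show τ ∈ Ioi ε from h1), indicator_of_mem (show τ ∈ T from ⟨h1, h2⟩),
          shiftKer, indicator_of_mem (show r ∈ Ioi (j * τ) from h2), mul_neg, abs_neg,
          abs_of_pos hτ, abs_of_pos (show 0 < r * (τ ^ 2)⁻¹ by positivity),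
            ← ENNReal.ofReal_mul (by positivity),
          ← ENNReal.ofReal_mul (by positivity), ← ENNReal.ofReal_mul (by positivity)]
        congr 1
        have h3 : r * τ⁻¹ - j = (r - j * τ) / τ := by field_simp
        rw [h3, Real.div_rpow (sub_pos.2 h2).le hτ.le, Real.rpow_one_add' hτ.le (by linarith),
          Real.rpow_sub_one hτ.ne']
        have : 0 < τ ^ β := by positivity
        field_simp
      · rw [indicator_of_mem (show τ ∈ Ioi ε from h1),
          indicator_of_notMem (show τ ∉ T from fun h => h2 h.2), shiftKer,
          indicator_of_notMem (show r ∉ Ioi (j * τ) from h2)]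
        simp
    · rw [indicator_of_notMem (show τ ∉ Ioi ε from h1),
        indicator_of_notMem (show τ ∉ T from fun h => h1 h.1)]
  have e2 : ∫⁻ y in Ioo 0 (r / ε - j), ENNReal.ofReal (y ^ (β - 1)) =
      ENNReal.ofReal ((max (r / ε - j) 0) ^ β / β) := by
    rw [← lintegral_Ioo_rpow hβ (le_max_right _ _)]
    congr 2
    rcases le_total (r / ε - j) 0 with h | h
    · rw [max_eq_right h, Ioo_eq_empty (not_lt.2 h), Ioo_self]
    · rw [max_eq_left h]
  rw [e1, ← h, himg, e2, ← ENNReal.ofReal_mul (by positivity), Real.Gamma_add_one hβ.ne']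
  congr 1
  field_simp

/-- The truncated Marchaud derivative of a fractional integral. -/
theorem integral_marchaudIntegrand {β : ℝ} (hβ : 0 < β) (ℓ : ℕ) {h : ℝ → ℂ} (hm : Measurable h)
    (hfin : ∫⁻ r in Ioi (0 : ℝ), ENNReal.ofReal (r ^ (β - 1)) * ‖h r‖ₑ < ⊤) {F : ℝ → ℂ}
    (hF0 : F 0 = ∫ r in Ioi (0 : ℝ), shiftKer β 0 r • h r)
    (hF : ∀ᵐ a : ℝ, 0 < a → F (-a) = ∫ r in Ioi (0 : ℝ), shiftKer β a r • h r) {ε : ℝ}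
    (hε : 0 < ε) :
    IntegrableOn (marchaudIntegrand β ℓ F) (Ioi ε) ∧
    ∫ τ in Ioi ε, marchaudIntegrand β ℓ F τ =
      ∫ r in Ioi (0 : ℝ), (ε⁻¹ * marchaudKer β ℓ (r / ε)) • h r := by
  have hΓ := Real.Gamma_pos_of_pos (show 0 < β + 1 by linarith)
  -- The representation of F holds off a null set, which is pulled back by the dilation τ ↦ jτ. For
  -- j = 0 the dilation is constant, so the value at 0 is a separate hypothesis.
  have hFj : ∀ j : ℕ, ∀ᵐ τ ∂(volume.restrict (Ioi ε)),
      F (0 - j * τ) = ∫ r in Ioi (0 : ℝ), shiftKer β (j * τ) r • h r := by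
    intro j
    rcases Nat.eq_zero_or_pos j with rfl | hj
    · exact .of_forall fun τ => by simpa using hF0
    · have hj' : (0 : ℝ) < j := by exact_mod_cast hj
      have hq : Measure.QuasiMeasurePreserving (fun τ : ℝ => (j : ℝ) * τ) := by
        refine ⟨by fun_prop, ?_⟩
        rw [Real.map_volume_mul_left hj'.ne']
        exact Measure.smul_absolutelyContinuous
      rw [ae_restrict_iff' measurableSet_Ioi]
      filter_upwards [hq.ae hF] with τ hτ hτε
      rw [zero_sub]
      exact hτ (mul_pos hj' (hε.trans hτε))
  have hfinj : ∀ j : ℕ, ∫⁻ r in Ioi (0 : ℝ), ENNReal.ofReal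
      (ε⁻¹ * ((Real.Gamma (β + 1))⁻¹ * ((|r| / ε)⁻¹ * (max (r / ε - j) 0) ^ β))) * ‖h r‖ₑ < ⊤ := by
    intro j
    refine lt_of_le_of_lt ?_ (ENNReal.mul_lt_top (ENNReal.ofReal_lt_top
      (r := ε⁻¹ * ((Real.Gamma (β + 1))⁻¹ * (ε * ε ^ (-β))))) hfin)
    rw [← lintegral_const_mul' _ _ ENNReal.ofReal_ne_top]
    refine setLIntegral_mono' measurableSet_Ioi fun r hr => ?_
    have hr : 0 < r := hr
    rw [← mul_assoc (ENNReal.ofReal _) (ENNReal.ofReal _), ← ENNReal.ofReal_mul (by positivity)]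
    gcongr ENNReal.ofReal ?_ * _
    rw [abs_of_pos hr, mul_assoc, mul_assoc]
    refine mul_le_mul_of_nonneg_left (mul_le_mul_of_nonneg_left ?_ (inv_pos.2 hΓ).le)
      (inv_pos.2 hε).le
    calc (r / ε)⁻¹ * (max (r / ε - j) 0) ^ β ≤ (r / ε)⁻¹ * (r / ε) ^ β := by
          gcongr
          exact max_le (by linarith [(Nat.cast_nonneg j : (0 : ℝ) ≤ j)]) (by positivity)
      _ = ε * ε ^ (-β) * r ^ (β - 1) := by
          rw [Real.div_rpow hr.le hε.le, Real.rpow_neg hε.le, Real.rpow_sub_one hr.ne']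
          field_simp
  -- The absolute values of τ and r only make the kernels nonnegative on all of ℝ, as
  -- `integral_kernel_comp` asks; on the half-lines of integration they change nothing.
  have hcomp : ∀ j : ℕ, _ := fun j => integral_kernel_comp (μ := volume.restrict (Ioi ε))
    (ν := volume.restrict (Ioi (0 : ℝ))) (k₁ := fun τ => (|τ| ^ (1 + β))⁻¹)
    (K₂ := fun τ r => shiftKer β (j * τ) r)
    (k₃ := fun r => ε⁻¹ * ((Real.Gamma (β + 1))⁻¹ * ((|r| / ε)⁻¹ * (max (r / ε - j) 0) ^ β)))
    (by fun_prop) (fun τ => by positivity)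
    ((measurable_shiftKer β).comp ((measurable_fst.const_mul (j : ℝ)).prodMk measurable_snd))
    (fun τ r => shiftKer_nonneg hβ _ _)
    (fun r => by have : 0 ≤ max (r / ε - j) 0 := le_max_right _ _
                 positivity)
    ((ae_restrict_iff' measurableSet_Ioi).2 (.of_forall fun r hr => by
      rw [abs_of_pos (mem_Ioi.1 hr)]; exact lintegral_rpow_mul_shiftKer hβ hε hr j)) hm (hfinj j)
  have hterm : ∀ j : ℕ, (fun τ => (|τ| ^ (1 + β))⁻¹ • ∫ r in Ioi (0 : ℝ), shiftKer β (j * τ)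
      r • h r)
      =ᵐ[volume.restrict (Ioi ε)] fun τ => (τ ^ (1 + β))⁻¹ • F (0 - j * τ) := by
    intro j
    filter_upwards [hFj j, ae_restrict_mem measurableSet_Ioi] with τ h1 h2
    rw [h1, abs_of_pos (hε.trans h2)]
  have hmar : marchaudIntegrand β ℓ F = fun τ => ∑ j ∈ Finset.range (ℓ + 1),
      ((-1 : ℂ) ^ j * (ℓ.choose j : ℂ)) * ((τ ^ (1 + β))⁻¹ • F (0 - j * τ)) := by
    ext τ
    rw [marchaudIntegrand, finDiff, Finset.smul_sum]
    exact Finset.sum_congr rfl fun j _ => (mul_smul_comm _ _ _).symm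
  have hInt : ∀ j ∈ Finset.range (ℓ + 1), IntegrableOn
      (fun τ => ((-1 : ℂ) ^ j * (ℓ.choose j : ℂ)) * ((τ ^ (1 + β))⁻¹ • F (0 - j * τ))) (Ioi ε) :=
    fun j _ => ((hcomp j).2.1.congr (hterm j)).const_mul _
  have hk3int : ∀ j ∈ Finset.range (ℓ + 1), IntegrableOn (fun r : ℝ =>
      ((-1 : ℂ) ^ j * (ℓ.choose j : ℂ)) * ((ε⁻¹ * ((Real.Gamma (β + 1))⁻¹ *
        ((|r| / ε)⁻¹ * (max (r / ε - j) 0) ^ β))) • h r)) (Ioi 0) := by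
    intro j _
    have hk : Measurable fun r : ℝ => ε⁻¹ * ((Real.Gamma (β + 1))⁻¹ *
        ((|r| / ε)⁻¹ * (max (r / ε - j) 0) ^ β)) := by fun_prop
    refine Integrable.const_mul ⟨(hk.smul hm).aestronglyMeasurable, ?_⟩ _
    rw [hasFiniteIntegral_iff_enorm]
    refine lt_of_le_of_lt (le_of_eq ?_) (hfinj j)
    refine lintegral_congr fun r => ?_
    have : 0 ≤ max (r / ε - j) 0 := le_max_right _ _
    rw [Pi.smul_apply', enorm_smul, Real.enorm_of_nonneg (by positivity)]
  constructor
  · rw [hmar]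
    exact integrable_finsetSum _ hInt
  · rw [hmar, integral_finsetSum _ hInt]
    have e1 : ∀ j ∈ Finset.range (ℓ + 1), ∫ τ in Ioi ε,
        ((-1 : ℂ) ^ j * (ℓ.choose j : ℂ)) * ((τ ^ (1 + β))⁻¹ • F (0 - j * τ)) =
        ∫ r in Ioi (0 : ℝ), ((-1 : ℂ) ^ j * (ℓ.choose j : ℂ)) * ((ε⁻¹ * ((Real.Gamma (β + 1))⁻¹ *
        ((|r| / ε)⁻¹ * (max (r / ε - j) 0) ^ β))) • h r) := by
      intro j _
      rw [integral_const_mul, integral_const_mul, ← (hcomp j).2.2]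
      exact congrArg _ (integral_congr_ae (hterm j).symm)
    rw [Finset.sum_congr rfl e1, ← integral_finsetSum _ hk3int]
    refine setIntegral_congr_fun measurableSet_Ioi fun r hr => ?_
    have hr : 0 < r := hr
    rw [marchaudKer, Finset.mul_sum, Finset.sum_smul]
    refine Finset.sum_congr rfl fun j _ => ?_
    rw [abs_of_pos hr]
    simp only [Complex.real_smul]
    push_cast
    ring

/-! ### Marchaud inversion on the half-line -/

theorem rpow_le_two_rpow_abs_mul {x R : ℝ} (hx : 0 < x) (hxR : x ≤ R) (hR : R ≤ 2 * x) (a : ℝ) :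
    x ^ a ≤ 2 ^ |a| * R ^ a := by
  have hR0 : 0 < R := hx.trans_le hxR
  have h1 : x ^ a = (x / R) ^ a * R ^ a := by
    rw [Real.div_rpow hx.le hR0.le]; field_simp
  rw [h1]
  gcongr
  calc (x / R) ^ a ≤ (x / R) ^ (-|a|) :=
        Real.rpow_le_rpow_of_exponent_ge (by positivity) ((div_le_one hR0).2 hxR) (neg_abs_le a)
    _ ≤ (1 / 2) ^ (-|a|) :=
        Real.rpow_le_rpow_of_nonpos (by norm_num) (by rw [le_div_iff₀ hR0]; linarith) (by simp)
    _ = 2 ^ |a| := by rw [one_div, Real.inv_rpow (by norm_num), Real.rpow_neg (by norm_num),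
        inv_inv]

/-- Integration of a function of `κ y` by means of the distribution of `κ`. -/
theorem lintegral_comp_le_of_distribution {Y : Type*} [MeasurableSpace Y] (ν : Measure Y)
    [SFinite ν]
    {κ : Y → ℝ} (hκ : Measurable κ) (hκ0 : ∀ᵐ y ∂ν, 0 < κ y) {Θ φ H : ℝ → ℝ≥0∞}
    (hφ : Measurable φ) (hΘ : ∀ x, 0 < x → Θ x ≤ ∫⁻ R in Ioi x, φ R)
    (hH : ∀ R, 0 < R → ν {y | κ y < R} ≤ H R) :
    ∫⁻ y, Θ (κ y) ∂ν ≤ ∫⁻ R in Ioi (0 : ℝ), φ R * H R := by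
  calc ∫⁻ y, Θ (κ y) ∂ν ≤ ∫⁻ y, (∫⁻ R in Ioi (0 : ℝ), {p : Y × ℝ | κ p.1 < p.2}.indicator
        (fun p => φ p.2) (y, R)) ∂ν := by
        refine lintegral_mono_ae (hκ0.mono fun y hy => (hΘ _ hy).trans ?_)
        rw [← lintegral_indicator measurableSet_Ioi, ← lintegral_indicator measurableSet_Ioi]
        refine lintegral_mono fun R => ?_
        by_cases hR : κ y < R
        · simp [indicator, hR, hy.trans hR]
        · simp [indicator, hR]
    _ = ∫⁻ R in Ioi (0 : ℝ), ∫⁻ y, {p : Y × ℝ | κ p.1 < p.2}.indicator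
        (fun p => φ p.2) (y, R) ∂ν := by
        refine lintegral_lintegral_swap (Measurable.aemeasurable ?_)
        exact (hφ.comp measurable_snd).indicator
          (measurableSet_lt (hκ.comp measurable_fst) measurable_snd)
    _ ≤ _ := by
        refine setLIntegral_mono' measurableSet_Ioi fun R hR => ?_
        have hm : MeasurableSet {y | κ y < R} := measurableSet_lt hκ measurable_const
        calc _ = ∫⁻ y, {y | κ y < R}.indicator (fun _ => φ R) y ∂ν := rfl
          _ = φ R * ν {y | κ y < R} := by rw [lintegral_indicator hm, setLIntegral_const]
          _ ≤ _ := by gcongr; exact hH R hR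

/-- The only information on g is that its integral over (0, ρ] is at most ηρ, so the integral is
taken through the distribution of r/ε, for which the mass of {r/ε < R} is at most ηεR. The factor ε
cancels the normalization, leaving η times a Beta integral. -/
theorem lintegral_marchaud_majorant_le {β : ℝ} (hβ : 0 < β) {ℓ : ℕ} (hℓ : β < ℓ) :
    ∃ C : ℝ, 0 ≤ C ∧ ∀ (g : ℝ → ℝ≥0∞) (_ : Measurable g) (η r₀ : ℝ) (_ : 0 ≤ η) (_ : 0 < r₀)
      (_ : ∀ ρ, 0 < ρ → ρ ≤ r₀ → ∫⁻ r in Ioc 0 ρ, g r ≤ ENNReal.ofReal (η * ρ)) (ε : ℝ) (_ : 0 < ε),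
      ∫⁻ r in Ioc 0 r₀, ENNReal.ofReal
        (ε⁻¹ * ((r / ε) ^ (β - 1) * (1 + r / ε) ^ (-(ℓ : ℝ)))) * g r ≤ ENNReal.ofReal (C * η) := by
  have hB := lintegral_rpow_mul_add_rpow_neg hβ hℓ one_pos
  have hℓ0 : (0 : ℝ) < ℓ := hβ.trans hℓ
  have hΓ1 := Real.Gamma_pos_of_pos hβ
  have hΓ2 := Real.Gamma_pos_of_pos hℓ0
  have hΓ3 := Real.Gamma_pos_of_pos (sub_pos.2 hℓ)
  set B := Real.Gamma β * Real.Gamma (ℓ - β) / Real.Gamma ℓ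
  set A : ℝ := 2 ^ |β - 2| * 2 ^ (ℓ : ℝ) with hA
  refine ⟨A * B, by positivity, fun g hg η r₀ hη hr₀ hle ε hε => ?_⟩
  -- The majorant at x is recovered from its size on the dyadic interval (x, 2x]; no monotonicity is
  -- available when β > 1.
  have hΘ : ∀ x, 0 < x → ENNReal.ofReal (ε⁻¹ * (x ^ (β - 1) * (1 + x) ^ (-(ℓ : ℝ)))) ≤
      ∫⁻ R in Ioi x, ENNReal.ofReal (ε⁻¹ * A * (R ^ (β - 2) * (R + 1) ^ (-(ℓ : ℝ)))) := by
    intro x hx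
    calc _ = ∫⁻ R in Ioc x (2 * x), ENNReal.ofReal (x⁻¹ *
          (ε⁻¹ * (x ^ (β - 1) * (1 + x) ^ (-(ℓ : ℝ))))) := by
          rw [setLIntegral_const, Real.volume_Ioc, ← ENNReal.ofReal_mul (by positivity)]
          congr 1
          field_simp
          ring
      _ ≤ ∫⁻ R in Ioc x (2 * x), ENNReal.ofReal (ε⁻¹ * A * (R ^ (β - 2) * (R + 1) ^ (-(ℓ : ℝ)))) :=
          by
          refine setLIntegral_mono' measurableSet_Ioc fun R hR => ENNReal.ofReal_le_ofReal ?_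
          have hR0 : 0 < R := hx.trans hR.1
          have h1 := rpow_le_two_rpow_abs_mul hx hR.1.le hR.2 (β - 2)
          have h2 := rpow_le_two_rpow_abs_mul (show 0 < 1 + x by linarith)
            (show 1 + x ≤ R + 1 by linarith [hR.1]) (by linarith [hR.2]) (-(ℓ : ℝ))
          rw [abs_neg, abs_of_pos hℓ0] at h2
          have h3 : x⁻¹ * (ε⁻¹ * (x ^ (β - 1) * (1 + x) ^ (-(ℓ : ℝ)))) =
              ε⁻¹ * (x ^ (β - 2) * (1 + x) ^ (-(ℓ : ℝ))) := by
            rw [show β - 1 = β - 2 + 1 by ring, Real.rpow_add_one hx.ne']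
            field_simp
          have hx1 : 0 < 1 + x := by linarith
          rw [h3, mul_assoc]
          refine mul_le_mul_of_nonneg_left ?_ (inv_pos.2 hε).le
          calc _ ≤ 2 ^ |β - 2| * R ^ (β - 2) * (2 ^ (ℓ : ℝ) * (R + 1) ^ (-(ℓ : ℝ))) := by gcongr
            _ = _ := by rw [hA]; ring
      _ ≤ _ := lintegral_mono_set Ioc_subset_Ioi_self
  have h := lintegral_comp_le_of_distribution ((volume.restrict (Ioc 0 r₀)).withDensity g)
    (κ := fun r => r / ε) (by fun_prop)
    ((withDensity_absolutelyContinuous _ _).ae_le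
      ((ae_restrict_iff' measurableSet_Ioc).2 (.of_forall fun r hr => div_pos hr.1 hε)))
    (Θ := fun x => ENNReal.ofReal (ε⁻¹ * (x ^ (β - 1) * (1 + x) ^ (-(ℓ : ℝ)))))
    (H := fun R => ENNReal.ofReal (η * (ε * R))) (by fun_prop) hΘ (fun R hR => by
      have hm : MeasurableSet {r : ℝ | r / ε < R} := measurableSet_lt (by fun_prop) measurable_const
      rw [withDensity_apply _ hm, Measure.restrict_restrict hm]
      calc _ ≤ ∫⁻ r in Ioc 0 (min (ε * R) r₀), g r := by
            refine lintegral_mono_set fun r hr => ⟨hr.2.1, le_min ?_ hr.2.2⟩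
            have : r / ε < R := hr.1
            rw [div_lt_iff₀ hε] at this
            linarith
        _ ≤ _ := (hle _ (lt_min (by positivity) hr₀) (min_le_right _ _)).trans
            (ENNReal.ofReal_le_ofReal (by gcongr; exact min_le_left _ _)))
  rw [lintegral_withDensity_eq_lintegral_mul _ hg (by fun_prop)] at h
  simp only [Pi.mul_apply] at h
  calc _ = ∫⁻ r in Ioc 0 r₀, g r * ENNReal.ofReal
        (ε⁻¹ * ((r / ε) ^ (β - 1) * (1 + r / ε) ^ (-(ℓ : ℝ)))) :=
        lintegral_congr fun r => mul_comm _ _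
    _ ≤ _ := h
    _ = ∫⁻ R in Ioi (0 : ℝ), ENNReal.ofReal (A * η) *
          ENNReal.ofReal (R ^ (β - 1) * (R + 1) ^ (-(ℓ : ℝ))) := by
        refine setLIntegral_congr_fun measurableSet_Ioi fun R hR => ?_
        have hR : 0 < R := hR
        rw [← ENNReal.ofReal_mul (by positivity), ← ENNReal.ofReal_mul (by positivity)]
        congr 1
        rw [show β - 1 = β - 2 + 1 by ring, Real.rpow_add_one hR.ne']
        field_simp
    _ = _ := by
        rw [lintegral_const_mul' _ _ ENNReal.ofReal_ne_top, hB,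
            ← ENNReal.ofReal_mul (by positivity),
          Real.one_rpow]
        congr 1
        ring

/-- The truncated Marchaud derivatives tend to zero at a point where the averages do. -/
theorem tendsto_integral_marchaudKer_zero {β : ℝ} (hβ : 0 < β) {ℓ : ℕ} (hℓ : β < ℓ) {h : ℝ → ℂ}
    (hm : Measurable h)
    (hfin : ∫⁻ r in Ioi (0 : ℝ), ENNReal.ofReal (r ^ (β - 1)) * ‖h r‖ₑ < ⊤)
    (hLeb : ∀ η : ℝ, 0 < η → ∃ r₀ : ℝ, 0 < r₀ ∧ ∀ ρ, 0 < ρ → ρ ≤ r₀ →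
      ∫⁻ r in Ioc 0 ρ, ‖h r‖ₑ ≤ ENNReal.ofReal (η * ρ)) :
    Tendsto (fun ε : ℝ => ∫ r in Ioi (0 : ℝ), (ε⁻¹ * marchaudKer β ℓ (r / ε)) • h r)
      (𝓝[>] 0) (𝓝 0) := by
  obtain ⟨C, hC, hK⟩ := abs_marchaudKer_le hβ ℓ
  obtain ⟨C', hC', hN⟩ := lintegral_marchaud_majorant_le hβ hℓ
  set M := ∫⁻ r in Ioi (0 : ℝ), ENNReal.ofReal (r ^ (β - 1)) * ‖h r‖ₑ with hM
  rw [Metric.tendsto_nhds]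
  intro δ hδ
  set η := δ / (2 * (C * C' + 1)) with hη
  have hCC : 0 < C * C' + 1 := by positivity
  have hη0 : 0 < η := by positivity
  obtain ⟨r₀, hr₀, hle⟩ := hLeb η hη0
  have hfar : Tendsto (fun ε : ℝ => C * (ε ^ ((ℓ : ℝ) - β) * r₀ ^ (-(ℓ : ℝ))) * M.toReal)
      (𝓝[>] 0) (𝓝 0) := by
    have h0 : Tendsto (fun ε : ℝ => ε ^ ((ℓ : ℝ) - β)) (𝓝[>] 0) (𝓝 0) := by
      have := (Real.continuousAt_rpow_const 0 ((ℓ : ℝ) - β) (Or.inr (by linarith))).tendsto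
      rw [Real.zero_rpow (by linarith)] at this
      exact this.mono_left nhdsWithin_le_nhds
    simpa using ((h0.mul_const (r₀ ^ (-(ℓ : ℝ)))).const_mul C).mul_const M.toReal
  filter_upwards [self_mem_nhdsWithin, hfar.eventually (gt_mem_nhds (half_pos hδ))] with ε hε hεfar
  have hε : 0 < ε := hε
  have hpt : ∀ r ∈ Ioi (0 : ℝ), ‖(ε⁻¹ * marchaudKer β ℓ (r / ε)) • h r‖ₑ ≤
      ENNReal.ofReal C * (ENNReal.ofReal
        (ε⁻¹ * ((r / ε) ^ (β - 1) * (1 + r / ε) ^ (-(ℓ : ℝ)))) * ‖h r‖ₑ) := by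
    intro r hr
    have hr : 0 < r := hr
    rw [enorm_smul, ← mul_assoc, ← ENNReal.ofReal_mul hC, Real.enorm_eq_ofReal_abs, abs_mul,
      abs_of_pos (inv_pos.2 hε)]
    gcongr ENNReal.ofReal ?_ * _
    calc ε⁻¹ * |marchaudKer β ℓ (r / ε)| ≤
          ε⁻¹ * (C * ((r / ε) ^ (β - 1) * (1 + r / ε) ^ (-(ℓ : ℝ)))) := by
          gcongr; exact hK _ (by positivity)
      _ = _ := by ring
  have hnear : ∫⁻ r in Ioc 0 r₀, ‖(ε⁻¹ * marchaudKer β ℓ (r / ε)) • h r‖ₑ ≤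
      ENNReal.ofReal (C * (C' * η)) := by
    refine (setLIntegral_mono' measurableSet_Ioc fun r hr => hpt r hr.1).trans ?_
    rw [lintegral_const_mul' _ _ ENNReal.ofReal_ne_top, ENNReal.ofReal_mul hC]
    gcongr
    exact hN _ hm.enorm η r₀ hη0.le hr₀ hle ε hε
  -- Away from 0 the decay (r/ε)^{-ℓ} gives the factor ε^{ℓ-β} against the finite integral of
  -- r^{β-1} |h|.
  have hfar' : ∫⁻ r in Ioi r₀, ‖(ε⁻¹ * marchaudKer β ℓ (r / ε)) • h r‖ₑ ≤
      ENNReal.ofReal (C * (ε ^ ((ℓ : ℝ) - β) * r₀ ^ (-(ℓ : ℝ))) * M.toReal) := by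
    rw [ENNReal.ofReal_mul (by positivity), ENNReal.ofReal_toReal hfin.ne, hM,
      ← lintegral_const_mul' _ _ ENNReal.ofReal_ne_top]
    refine le_trans ?_ (lintegral_mono_set (Ioi_subset_Ioi hr₀.le))
    refine setLIntegral_mono' measurableSet_Ioi fun r hr => ?_
    have hr₁ : r₀ < r := hr
    have hr : 0 < r := hr₀.trans hr₁
    refine (hpt r hr).trans ?_
    rw [← mul_assoc (ENNReal.ofReal _) (ENNReal.ofReal _),
      ← mul_assoc (ENNReal.ofReal _) (ENNReal.ofReal _), ← ENNReal.ofReal_mul hC,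
      ← ENNReal.ofReal_mul (by positivity)]
    gcongr ENNReal.ofReal ?_ * _
    rw [mul_assoc C]
    refine mul_le_mul_of_nonneg_left ?_ hC
    calc ε⁻¹ * ((r / ε) ^ (β - 1) * (1 + r / ε) ^ (-(ℓ : ℝ)))
        ≤ ε⁻¹ * ((r / ε) ^ (β - 1) * (r₀ / ε) ^ (-(ℓ : ℝ))) := by
          gcongr ε⁻¹ * ((r / ε) ^ (β - 1) * ?_)
          refine Real.rpow_le_rpow_of_nonpos (by positivity) ?_ (by linarith)
          have : r₀ / ε ≤ r / ε := by gcongr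
          linarith
      _ = _ := by
          rw [Real.div_rpow hr.le hε.le, Real.div_rpow hr₀.le hε.le,
            Real.rpow_sub_one hε.ne', Real.rpow_sub hε, Real.rpow_neg hε.le]
          field_simp
  have htot : ∫⁻ r in Ioi (0 : ℝ), ‖(ε⁻¹ * marchaudKer β ℓ (r / ε)) • h r‖ₑ <
      ENNReal.ofReal δ := by
    rw [← Ioc_union_Ioi_eq_Ioi hr₀.le]
    refine (lintegral_union_le _ _ _).trans_lt ?_
    refine (add_le_add hnear hfar').trans_lt ?_
    rw [← ENNReal.ofReal_add (by positivity) (by positivity)]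
    refine (ENNReal.ofReal_lt_ofReal_iff hδ).2 ?_
    have : C * (C' * η) ≤ δ / 2 := by
      rw [hη]
      calc C * (C' * (δ / (2 * (C * C' + 1)))) = δ / 2 * (C * C' / (C * C' + 1)) := by field_simp
        _ ≤ δ / 2 * 1 := by
            gcongr
            rw [div_le_one hCC]; linarith
        _ = δ / 2 := mul_one _
    linarith
  rw [dist_zero_right]
  have h1 := (enorm_integral_le_lintegral_enorm (μ := volume.restrict (Ioi (0 : ℝ)))
    fun r => (ε⁻¹ * marchaudKer β ℓ (r / ε)) • h r).trans_lt htot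
  rwa [← ofReal_norm, ENNReal.ofReal_lt_ofReal_iff hδ] at h1

theorem integrableOn_kap {β : ℝ} (hβ : 0 < β) {ℓ : ℕ} (hℓ : β < ℓ) :
    IntegrableOn (fun τ : ℝ => (1 - Real.exp (-τ)) ^ ℓ / τ ^ (1 + β)) (Ioi 0) := by
  rw [← Ioc_union_Ioi_eq_Ioi zero_le_one, integrableOn_union]
  have hm : ∀ s : Set ℝ, AEStronglyMeasurable (fun τ : ℝ => (1 - Real.exp (-τ)) ^ ℓ / τ ^ (1 + β))
      (volume.restrict s) := fun s => Measurable.aestronglyMeasurable (by fun_prop)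
  have h01 : ∀ τ : ℝ, 0 < τ → 0 ≤ 1 - Real.exp (-τ) ∧ 1 - Real.exp (-τ) ≤ τ ∧
      1 - Real.exp (-τ) ≤ 1 := by
    intro τ hτ
    have h1 := Real.exp_le_one_iff.2 (show -τ ≤ 0 by linarith)
    have h2 := Real.add_one_le_exp (-τ)
    have h3 := Real.exp_pos (-τ)
    refine ⟨by linarith, by linarith, by linarith⟩
  constructor
  · have hi : IntegrableOn (fun τ : ℝ => τ ^ ((ℓ : ℝ) - (1 + β))) (Ioc 0 1) :=
      (intervalIntegral.intervalIntegrable_rpow' (by linarith)).1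
    refine hi.mono' (hm _) ((ae_restrict_iff' measurableSet_Ioc).2 (.of_forall fun τ hτ => ?_))
    obtain ⟨h1, h2, -⟩ := h01 τ hτ.1
    have hp := Real.rpow_pos_of_pos hτ.1 (1 + β)
    rw [Real.norm_of_nonneg (by positivity), Real.rpow_sub hτ.1, Real.rpow_natCast]
    gcongr
  · have hi : IntegrableOn (fun τ : ℝ => τ ^ (-(1 + β))) (Ioi 1) :=
      integrableOn_Ioi_rpow_of_lt (by linarith) one_pos
    refine hi.mono' (hm _) ((ae_restrict_iff' measurableSet_Ioi).2 (.of_forall fun τ hτ => ?_))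
    have hτ : 0 < τ := one_pos.trans hτ
    obtain ⟨h1, -, h2⟩ := h01 τ hτ
    have hp := Real.rpow_pos_of_pos hτ (1 + β)
    rw [Real.norm_of_nonneg (by positivity), Real.rpow_neg hτ.le, div_eq_mul_inv]
    exact mul_le_of_le_one_left (by positivity) (pow_le_one₀ h1 h2)

theorem kap_pos {β : ℝ} (hβ : 0 < β) {ℓ : ℕ} (hℓ : β < ℓ) : 0 < kap β ℓ := by
  have hpos : ∀ τ ∈ Ioi (0 : ℝ), 0 < (1 - Real.exp (-τ)) ^ ℓ / τ ^ (1 + β) := by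
    intro τ hτ
    have hτ : 0 < τ := hτ
    have : 0 < 1 - Real.exp (-τ) := by
      have : Real.exp (-τ) < 1 := by simpa using hτ
      linarith
    positivity
  rw [kap, setIntegral_pos_iff_support_of_nonneg_ae
    ((ae_restrict_iff' measurableSet_Ioi).2 (.of_forall fun τ hτ => (hpos τ hτ).le))
    (integrableOn_kap hβ hℓ)]
  have : Function.support (fun τ : ℝ => (1 - Real.exp (-τ)) ^ ℓ / τ ^ (1 + β)) ∩ Ioi 0 = Ioi 0 :=
    inter_eq_right.2 fun τ hτ => (hpos τ hτ).ne'
  rw [this]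
  simp

/-- The exponential is reproduced by the fractional integral on a half-line, and its finite
differences are (1 - e^{-τ})^ℓ. It serves as the test function that brings in ϰ(β, ℓ). -/
theorem integral_shiftKer_exp {β : ℝ} (hβ : 0 < β) {a : ℝ} (ha : 0 ≤ a) (c : ℂ) :
    ∫ r in Ioi (0 : ℝ), shiftKer β a r • (c * (Real.exp (-r) : ℂ)) = c * (Real.exp (-a) : ℂ) := by
  have hΓ := Real.Gamma_pos_of_pos hβ
  have h1 := Real.integral_rpow_mul_exp_neg_mul_Ioi hβ one_pos
  simp only [one_mul, div_one, Real.one_rpow] at h1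
  have h2 : ∫ r in Ioi (0 : ℝ), shiftKer β a r * Real.exp (-r) = Real.exp (-a) := by
    have e : ∀ r, shiftKer β a r * Real.exp (-r) = (Real.Gamma β)⁻¹ *
        (Ioi a).indicator (fun r => (r - a) ^ (β - 1) * Real.exp (-r)) r := by
      intro r
      rw [shiftKer, mul_assoc]
      congr 1
      by_cases hr : r ∈ Ioi a
      · rw [indicator_of_mem hr, indicator_of_mem hr]
      · rw [indicator_of_notMem hr, indicator_of_notMem hr, zero_mul]
    simp_rw [e]
    rw [integral_const_mul, setIntegral_indicator measurableSet_Ioi,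
      inter_eq_right.2 (Ioi_subset_Ioi ha)]
    have h3 : ∫ r in Ioi a, (r - a) ^ (β - 1) * Real.exp (-r) =
        ∫ r in Ioi (0 : ℝ), r ^ (β - 1) * Real.exp (-(r + a)) := by
      have := (measurePreserving_add_right volume a).setIntegral_preimage_emb
        (measurableEmbedding_addRight a) (fun r => (r - a) ^ (β - 1) * Real.exp (-r)) (Ioi a)
      simp only [preimage_add_const_Ioi, sub_self, add_sub_cancel_right] at this
      exact this.symm
    have h4 : ∀ r : ℝ, r ^ (β - 1) * Real.exp (-(r + a)) =
        Real.exp (-a) * (r ^ (β - 1) * Real.exp (-r)) := by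
      intro r
      rw [neg_add, Real.exp_add]
      ring
    simp_rw [h3, h4]
    rw [integral_const_mul, h1]
    field_simp
  have e2 : ∀ r, shiftKer β a r • (c * (Real.exp (-r) : ℂ)) =
      c * ((shiftKer β a r * Real.exp (-r) : ℝ) : ℂ) := by
    intro r
    rw [Complex.real_smul]
    push_cast
    ring
  simp_rw [e2]
  rw [integral_const_mul, integral_complex_ofReal, h2]

theorem finDiff_exp (ℓ : ℕ) (τ : ℝ) (c : ℂ) :
    finDiff ℓ τ (fun u => c * (Real.exp u : ℂ)) 0 = c * (((1 - Real.exp (-τ)) ^ ℓ : ℝ) : ℂ) := by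
  have h : (1 - Real.exp (-τ)) ^ ℓ = ∑ j ∈ Finset.range (ℓ + 1),
      (-1) ^ j * (ℓ.choose j : ℝ) * Real.exp (0 - j * τ) := by
    rw [sub_eq_add_neg, add_comm, add_pow]
    refine Finset.sum_congr rfl fun j _ => ?_
    rw [neg_pow, ← Real.exp_nat_mul, one_pow]
    ring_nf
  rw [finDiff, h]
  push_cast
  rw [Finset.mul_sum]
  refine Finset.sum_congr rfl fun j _ => ?_
  ring

theorem lintegral_rpow_mul_exp_lt_top {β : ℝ} (hβ : 0 < β) (c : ℂ) :
    ∫⁻ r in Ioi (0 : ℝ), ENNReal.ofReal (r ^ (β - 1)) * ‖c * (Real.exp (-r) : ℂ)‖ₑ < ⊤ := by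
  have e : ∀ r ∈ Ioi (0 : ℝ), ENNReal.ofReal (r ^ (β - 1)) * ‖c * (Real.exp (-r) : ℂ)‖ₑ =
      ‖c‖ₑ * ENNReal.ofReal (r ^ (β - 1) * Real.exp (-(1 * r))) := by
    intro r hr
    have hr : 0 < r := hr
    have h2 : ‖(Real.exp (-r) : ℂ)‖ₑ = ENNReal.ofReal (Real.exp (-r)) := by
      rw [← ofReal_norm, Complex.norm_of_nonneg (Real.exp_pos _).le]
    rw [enorm_mul, h2, one_mul, ENNReal.ofReal_mul (by positivity)]
    ring
  rw [setLIntegral_congr_fun measurableSet_Ioi e, lintegral_const_mul' _ _ enorm_ne_top,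
    lintegral_rpow_mul_exp_neg_mul_Ioi hβ one_pos]
  exact ENNReal.mul_lt_top enorm_lt_top ENNReal.ofReal_lt_top

/-- The Marchaud derivative inverts the fractional integral at every one-sided Lebesgue point. -/
theorem tendsto_integral_marchaudIntegrand {β : ℝ} (hβ : 0 < β) {ℓ : ℕ} (hℓ : β < ℓ) {h : ℝ → ℂ}
    (hm : Measurable h)
    (hfin : ∫⁻ r in Ioi (0 : ℝ), ENNReal.ofReal (r ^ (β - 1)) * ‖h r‖ₑ < ⊤) {F : ℝ → ℂ}
    (hF0 : F 0 = ∫ r in Ioi (0 : ℝ), shiftKer β 0 r • h r)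
    (hF : ∀ᵐ a : ℝ, 0 < a → F (-a) = ∫ r in Ioi (0 : ℝ), shiftKer β a r • h r) {c : ℂ}
    (hLeb : ∀ η : ℝ, 0 < η → ∃ r₀ : ℝ, 0 < r₀ ∧ ∀ ρ, 0 < ρ → ρ ≤ r₀ →
      ∫⁻ r in Ioc 0 ρ, ‖h r - c‖ₑ ≤ ENNReal.ofReal (η * ρ)) :
    Tendsto (fun ε : ℝ => ∫ τ in Ioi ε, marchaudIntegrand β ℓ F τ) (𝓝[>] 0)
      (𝓝 (kap β ℓ • c)) := by
  -- Comparison with c e^{-r}: it has limit c at 0, and its Marchaud derivative converges to ϰ(β, ℓ)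
  -- c straight from the definition of ϰ. The total integral of `marchaudKer` is therefore never
  -- computed.
  set h₁ : ℝ → ℂ := fun r => c * (Real.exp (-r) : ℂ) with hh₁
  set F₁ : ℝ → ℂ := fun u => c * (Real.exp u : ℂ) with hF₁
  have hm₁ : Measurable h₁ := by simp only [hh₁]; fun_prop
  have hfin₁ := lintegral_rpow_mul_exp_lt_top hβ c
  have hrep := fun ε (hε : 0 < ε) => integral_marchaudIntegrand hβ ℓ hm hfin hF0 hF (ε := ε) hε
  have hrep₁ := fun ε (hε : 0 < ε) => integral_marchaudIntegrand hβ ℓ hm₁ hfin₁ (F := F₁)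
    (by rw [integral_shiftKer_exp hβ le_rfl]; simp [hF₁])
    (.of_forall fun a ha => by rw [integral_shiftKer_exp hβ ha.le]) (ε := ε) hε
  have hInt : ∀ {g : ℝ → ℂ}, Measurable g →
      ∫⁻ r in Ioi (0 : ℝ), ENNReal.ofReal (r ^ (β - 1)) * ‖g r‖ₑ < ⊤ → ∀ ε : ℝ, 0 < ε →
      IntegrableOn (fun r => (ε⁻¹ * marchaudKer β ℓ (r / ε)) • g r) (Ioi 0) := by
    intro g hg hgfin ε hε
    obtain ⟨C, hC, hK⟩ := abs_marchaudKer_le hβ ℓ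
    have hkm : Measurable fun r : ℝ => ε⁻¹ * marchaudKer β ℓ (r / ε) := by
      unfold marchaudKer
      fun_prop
    refine ⟨(hkm.smul hg).aestronglyMeasurable, ?_⟩
    rw [hasFiniteIntegral_iff_enorm]
    refine lt_of_le_of_lt ?_ (ENNReal.mul_lt_top (ENNReal.ofReal_lt_top
      (r := ε⁻¹ * (C * ε ^ (-(β - 1))))) hgfin)
    rw [← lintegral_const_mul' _ _ ENNReal.ofReal_ne_top]
    refine setLIntegral_mono' measurableSet_Ioi fun r hr => ?_
    have hr : 0 < r := hr
    rw [enorm_smul, ← mul_assoc (ENNReal.ofReal _) (ENNReal.ofReal _),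
      ← ENNReal.ofReal_mul (by positivity), Real.enorm_eq_ofReal_abs, abs_mul,
      abs_of_pos (inv_pos.2 hε)]
    gcongr ENNReal.ofReal ?_ * _
    rw [mul_assoc]
    refine mul_le_mul_of_nonneg_left ?_ (inv_pos.2 hε).le
    refine (hK _ (by positivity)).trans ?_
    rw [mul_assoc]
    refine mul_le_mul_of_nonneg_left ?_ hC
    rw [Real.div_rpow hr.le hε.le, Real.rpow_neg hε.le, div_eq_inv_mul]
    refine mul_le_of_le_one_right (by positivity) ?_
    exact Real.rpow_le_one_of_one_le_of_nonpos (by have := div_pos hr hε; linarith) (by simp)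
  have hzero := tendsto_integral_marchaudKer_zero hβ hℓ (h := fun r => h r - h₁ r) (hm.sub hm₁)
    (by
      refine lt_of_le_of_lt ?_ (ENNReal.add_lt_top.2 ⟨hfin, hfin₁⟩)
      rw [← lintegral_add_left (by fun_prop)]
      refine lintegral_mono fun r => ?_
      rw [← mul_add]
      gcongr
      exact enorm_sub_le)
    (by
      intro η hη
      obtain ⟨r₀, hr₀, hle⟩ := hLeb (η / 2) (half_pos hη)
      have hc : 0 < ‖c‖ + 1 := by positivity
      -- The second bound makes |c| (1 - e^{-r}) ≤ |c| r at most η/2.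
      refine ⟨min r₀ (η / (2 * (‖c‖ + 1))), lt_min hr₀ (by positivity), fun ρ hρ hρ' => ?_⟩
      have hρ₂ : ρ * (‖c‖ + 1) ≤ η / 2 := by
        have := hρ'.trans (min_le_right _ _)
        rw [le_div_iff₀ (by positivity)] at this
        linarith
      calc ∫⁻ r in Ioc 0 ρ, ‖h r - h₁ r‖ₑ ≤
          ∫⁻ r in Ioc 0 ρ, (‖h r - c‖ₑ + ENNReal.ofReal (η / 2)) := by
            refine setLIntegral_mono' measurableSet_Ioc fun r hr => ?_
            have e : h r - h₁ r = (h r - c) + (c - h₁ r) := by ring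
            rw [e]
            refine (enorm_add_le _ _).trans (add_le_add le_rfl ?_)
            rw [← ofReal_norm]
            refine ENNReal.ofReal_le_ofReal ?_
            have h1 : c - h₁ r = c * ((1 - Real.exp (-r) : ℝ) : ℂ) := by
              simp only [hh₁]; push_cast; ring
            have h2 : 0 ≤ 1 - Real.exp (-r) := by
              have := Real.exp_le_one_iff.2 (show -r ≤ 0 by linarith [hr.1]); linarith
            have h3 : 1 - Real.exp (-r) ≤ r := by linarith [Real.add_one_le_exp (-r)]
            rw [h1, norm_mul, Complex.norm_of_nonneg h2]
            nlinarith [norm_nonneg c, hr.1, hr.2]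
        _ = (∫⁻ r in Ioc 0 ρ, ‖h r - c‖ₑ) + ENNReal.ofReal (η / 2 * ρ) := by
            rw [lintegral_add_right _ measurable_const, setLIntegral_const, Real.volume_Ioc,
                sub_zero,
              ← ENNReal.ofReal_mul (by positivity)]
        _ ≤ ENNReal.ofReal (η / 2 * ρ) + ENNReal.ofReal (η / 2 * ρ) := by
            gcongr
            exact hle ρ hρ (hρ'.trans (min_le_left _ _))
        _ = _ := by
            rw [← ENNReal.ofReal_add (by positivity) (by positivity)]
            congr 1
            ring)
  have hexp : Tendsto (fun ε : ℝ => ∫ τ in Ioi ε, marchaudIntegrand β ℓ F₁ τ) (𝓝[>] 0)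
      (𝓝 (kap β ℓ • c)) := by
    have e : ∀ τ, marchaudIntegrand β ℓ F₁ τ =
        (((1 - Real.exp (-τ)) ^ ℓ / τ ^ (1 + β) : ℝ)) • c := by
      intro τ
      rw [marchaudIntegrand, finDiff_exp]
      simp only [Complex.real_smul]
      push_cast
      ring
    simp_rw [e, integral_smul_const]
    refine Tendsto.smul_const ?_ c
    rw [kap]
    have := (integrableOn_kap hβ hℓ)
    have h0 : Tendsto (fun ε : ℝ => ∫ τ in Ioi ε, (1 - Real.exp (-τ)) ^ ℓ / τ ^ (1 + β)) (𝓝[>] 0)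
        (𝓝 (∫ τ in Ioi (0 : ℝ), (1 - Real.exp (-τ)) ^ ℓ / τ ^ (1 + β))) := by
      have e2 : ∀ ε : ℝ, 0 < ε → ∫ τ in Ioi ε, (1 - Real.exp (-τ)) ^ ℓ / τ ^ (1 + β) =
          ∫ τ in Ioi (0 : ℝ), (Ioi ε).indicator
            (fun τ => (1 - Real.exp (-τ)) ^ ℓ / τ ^ (1 + β)) τ := by
        intro ε hε
        rw [setIntegral_indicator measurableSet_Ioi, inter_eq_right.2 (Ioi_subset_Ioi hε.le)]
      refine Tendsto.congr' (f₁ := fun ε => ∫ τ in Ioi (0 : ℝ), (Ioi ε).indicator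
            (fun τ => (1 - Real.exp (-τ)) ^ ℓ / τ ^ (1 + β)) τ)
        (eventually_nhdsWithin_of_forall fun ε hε => (e2 ε hε).symm) ?_
      refine tendsto_integral_filter_of_dominated_convergence
        (fun τ => ‖(1 - Real.exp (-τ)) ^ ℓ / τ ^ (1 + β)‖) ?_ ?_ this.norm ?_
      · exact .of_forall fun ε => this.aestronglyMeasurable.indicator measurableSet_Ioi
      · exact .of_forall fun ε => .of_forall fun τ => norm_indicator_le_norm_self _ _
      · refine (ae_restrict_iff' measurableSet_Ioi).2 (.of_forall fun τ hτ => ?_)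
        refine tendsto_const_nhds.congr' ?_
        filter_upwards [nhdsWithin_le_nhds (gt_mem_nhds hτ)] with ε hε
        rw [indicator_of_mem (mem_Ioi.2 hε)]
    exact h0
  have hsum := hzero.add hexp
  rw [zero_add] at hsum
  refine hsum.congr' (eventually_nhdsWithin_of_forall fun ε hε => ?_)
  beta_reduce
  rw [(hrep₁ ε hε).2, (hrep ε hε).2, ← integral_add]
  · refine integral_congr_ae (.of_forall fun r => ?_)
    simp only [smul_sub, hh₁, sub_add_cancel]
  · simp_rw [smul_sub]
    exact (hInt hm hfin ε hε).sub (hInt hm₁ hfin₁ ε hε)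
  · exact hInt hm₁ hfin₁ ε hε

/-! ### Measure of spherical caps and Lebesgue points -/

theorem smul_sub_self {E : Type*} [AddCommGroup E] [Module ℝ E] (ρ : ℝ) (x : E) :
    ρ • x - x = (ρ - 1) • x := by
  rw [sub_smul, one_smul]

/-- Spherical caps of radius `R` have measure at most a multiple of `R ^ (d - 1)`. -/
theorem exists_surf_closedBall_le {d : ℕ} (hd : 1 ≤ d) :
    ∃ C : ℝ, 0 < C ∧ ∀ (ξ : Sph d) (R : ℝ), 0 < R → R ≤ 1 / 2 →
      surf d (Metric.closedBall ξ R) ≤ ENNReal.ofReal (C * R ^ (d - 1)) := by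
  have : Nonempty (Fin d) := ⟨⟨0, hd⟩⟩
  have hV : 0 < √Real.pi ^ d / Real.Gamma (d / 2 + 1) := by
    have := Real.Gamma_pos_of_pos (show (0 : ℝ) < d / 2 + 1 by positivity)
    have := Real.pi_pos
    positivity
  set V := √Real.pi ^ d / Real.Gamma (d / 2 + 1) with hVdef
  refine ⟨2 ^ (d - 1) * 2 ^ d * V, by positivity, fun ξ R hR hR2 => ?_⟩
  have hvol : (volume : Measure (EuclideanSpace ℝ (Fin d)))
      (Metric.closedBall (ξ : EuclideanSpace ℝ (Fin d)) (2 * R)) =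
      ENNReal.ofReal ((2 * R) ^ d * V) := by
    rw [EuclideanSpace.volume_closedBall, Fintype.card_fin, ← ENNReal.ofReal_pow (by positivity),
      ← ENNReal.ofReal_mul (by positivity)]
  -- The truncated cone over the cap, with radii in (1 - R, 1), lies in the Euclidean ball of radius
  -- 2R about ξ.
  have key : ENNReal.ofReal (R * (1 / 2) ^ (d - 1)) * surf d (Metric.closedBall ξ R) ≤
      ENNReal.ofReal ((2 * R) ^ d * V) := by
    rw [← hvol, ← lintegral_indicator_one (μ := volume) Metric.isClosed_closedBall.measurableSet,
      lintegral_polar hd (measurable_one.indicator Metric.isClosed_closedBall.measurableSet),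
      ← setLIntegral_const]
    refine (setLIntegral_mono' Metric.isClosed_closedBall.measurableSet fun ω hω => ?_).trans
      (setLIntegral_le_lintegral _ _)
    calc ENNReal.ofReal (R * (1 / 2) ^ (d - 1))
        = ∫⁻ ρ in Ioo (1 - R) 1, ENNReal.ofReal ((1 / 2) ^ (d - 1)) := by
          rw [setLIntegral_const, Real.volume_Ioo, ← ENNReal.ofReal_mul (by positivity)]
          congr 1
          ring
      _ ≤ ∫⁻ ρ in Ioo (1 - R) 1, ENNReal.ofReal (ρ ^ (d - 1)) *
          (Metric.closedBall (ξ : EuclideanSpace ℝ (Fin d)) (2 * R)).indicator 1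
            (ρ • (ω : EuclideanSpace ℝ (Fin d))) := by
          refine setLIntegral_mono' measurableSet_Ioo fun ρ hρ => ?_
          have hρ0 : 1 / 2 ≤ ρ := by linarith [hρ.1]
          rw [indicator_of_mem, Pi.one_apply, mul_one]
          · exact ENNReal.ofReal_le_ofReal (by gcongr)
          · rw [Metric.mem_closedBall, dist_eq_norm]
            have h1 : ‖(ω : EuclideanSpace ℝ (Fin d)) - ξ‖ ≤ R := by
              rw [← dist_eq_norm]; exact hω
            have h2 : ‖ρ • (ω : EuclideanSpace ℝ (Fin d)) - ω‖ ≤ R := by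
              rw [smul_sub_self, norm_smul, norm_eq_of_mem_sphere, mul_one, Real.norm_eq_abs,
                abs_le]
              constructor <;> linarith [hρ.1, hρ.2]
            calc _ = ‖(ρ • (ω : EuclideanSpace ℝ (Fin d)) - ω) +
                ((ω : EuclideanSpace ℝ (Fin d)) - ξ)‖ := by rw [sub_add_sub_cancel]
              _ ≤ _ := (norm_add_le _ _).trans (by linarith)
      _ ≤ _ := lintegral_mono_set fun ρ hρ => by
          have := hρ.1
          exact mem_Ioi.2 (by linarith)
  have hpos : 0 < R * (1 / 2 : ℝ) ^ (d - 1) := by positivity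
  rw [← ENNReal.mul_le_mul_iff_right (ENNReal.ofReal_pos.2 hpos).ne' ENNReal.ofReal_ne_top]
  refine key.trans_eq ?_
  rw [← ENNReal.ofReal_mul hpos.le]
  congr 1
  obtain ⟨k, rfl⟩ : ∃ k, d = k + 1 := ⟨d - 1, by omega⟩
  simp only [Nat.add_sub_cancel, one_div, inv_pow]
  field_simp
  ring

/-- Spherical caps of radius `R` have measure at least a multiple of `R ^ (d - 1)`. -/
theorem exists_le_surf_closedBall {d : ℕ} (hd : 1 ≤ d) :
    ∃ c : ℝ, 0 < c ∧ ∀ (ξ : Sph d) (R : ℝ), 0 < R → R ≤ 1 →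
      ENNReal.ofReal (c * R ^ (d - 1)) ≤ surf d (Metric.closedBall ξ R) := by
  have : Nonempty (Fin d) := ⟨⟨0, hd⟩⟩
  have hV : 0 < √Real.pi ^ d / Real.Gamma (d / 2 + 1) := by
    have := Real.Gamma_pos_of_pos (show (0 : ℝ) < d / 2 + 1 by positivity)
    have := Real.pi_pos
    positivity
  set V := √Real.pi ^ d / Real.Gamma (d / 2 + 1) with hVdef
  refine ⟨V / (2 ^ (d - 1) * 2 ^ d), by positivity, fun ξ R hR hR2 => ?_⟩
  have hvol : (volume : Measure (EuclideanSpace ℝ (Fin d)))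
      (Metric.ball (ξ : EuclideanSpace ℝ (Fin d)) (R / 2)) =
      ENNReal.ofReal ((R / 2) ^ d * V) := by
    rw [EuclideanSpace.volume_ball, Fintype.card_fin, ← ENNReal.ofReal_pow (by positivity),
      ← ENNReal.ofReal_mul (by positivity)]
  -- Conversely, the Euclidean ball of radius R/2 about ξ lies in the truncated cone over the cap
  -- with radii within R/2 of 1.
  have key : ENNReal.ofReal ((R / 2) ^ d * V) ≤
      ENNReal.ofReal (R * 2 ^ (d - 1)) * surf d (Metric.closedBall ξ R) := by
    rw [← hvol, ← lintegral_indicator_one (μ := volume) Metric.isOpen_ball.measurableSet,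
      lintegral_polar hd (measurable_one.indicator Metric.isOpen_ball.measurableSet),
      ← setLIntegral_const, ← lintegral_indicator Metric.isClosed_closedBall.measurableSet]
    refine lintegral_mono fun ω => ?_
    have hmem : ∀ ρ : ℝ, 0 < ρ → ρ • (ω : EuclideanSpace ℝ (Fin d)) ∈
        Metric.ball (ξ : EuclideanSpace ℝ (Fin d)) (R / 2) →
        ω ∈ Metric.closedBall ξ R ∧ ρ ∈ Ioo (1 - R / 2) (1 + R / 2) := by
      intro ρ hρ0 h
      rw [Metric.mem_ball, dist_eq_norm] at h
      have h1 : |ρ - 1| < R / 2 := by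
        have := abs_norm_sub_norm_le (ρ • (ω : EuclideanSpace ℝ (Fin d)))
          (ξ : EuclideanSpace ℝ (Fin d))
        rw [norm_smul, norm_eq_of_mem_sphere, norm_eq_of_mem_sphere, mul_one, Real.norm_eq_abs,
          abs_of_pos hρ0] at this
        linarith
      have h2 : ‖(ω : EuclideanSpace ℝ (Fin d)) - ρ • (ω : EuclideanSpace ℝ (Fin d))‖ < R / 2 := by
        rw [← norm_neg, neg_sub, smul_sub_self, norm_smul, norm_eq_of_mem_sphere, mul_one,
          Real.norm_eq_abs]
        exact h1
      refine ⟨?_, ?_⟩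
      · rw [Metric.mem_closedBall, Subtype.dist_eq, dist_eq_norm]
        calc _ = ‖((ω : EuclideanSpace ℝ (Fin d)) - ρ • (ω : EuclideanSpace ℝ (Fin d))) +
            (ρ • (ω : EuclideanSpace ℝ (Fin d)) - ξ)‖ := by rw [sub_add_sub_cancel]
          _ ≤ _ := (norm_add_le _ _).trans (by linarith)
      · rw [abs_lt] at h1
        constructor <;> linarith [h1.1, h1.2]
    by_cases hω : ω ∈ Metric.closedBall ξ R
    · rw [indicator_of_mem hω]
      calc _ ≤ ∫⁻ ρ in Ioi (0 : ℝ), (Ioo (1 - R / 2) (1 + R / 2)).indicator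
            (fun _ => ENNReal.ofReal (2 ^ (d - 1))) ρ := by
            refine setLIntegral_mono' measurableSet_Ioi fun ρ hρ => ?_
            by_cases hb : ρ • (ω : EuclideanSpace ℝ (Fin d)) ∈
                Metric.ball (ξ : EuclideanSpace ℝ (Fin d)) (R / 2)
            · have hI := (hmem ρ hρ hb).2
              have hρ0 : 0 < ρ := hρ
              rw [indicator_of_mem hb, indicator_of_mem hI, Pi.one_apply, mul_one]
              have : ρ ≤ 2 := by linarith [hI.2]
              exact ENNReal.ofReal_le_ofReal (by gcongr)
            · rw [indicator_of_notMem hb, mul_zero]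
              exact zero_le
        _ ≤ ∫⁻ ρ, (Ioo (1 - R / 2) (1 + R / 2)).indicator
            (fun _ => ENNReal.ofReal (2 ^ (d - 1))) ρ := setLIntegral_le_lintegral _ _
        _ = _ := by
            rw [lintegral_indicator measurableSet_Ioo, setLIntegral_const, Real.volume_Ioo,
              ← ENNReal.ofReal_mul (by positivity)]
            congr 1
            ring
    · rw [indicator_of_notMem hω, nonpos_iff_eq_zero,
        setLIntegral_congr_fun measurableSet_Ioi (g := fun _ => 0), lintegral_zero]
      intro ρ hρ
      beta_reduce
      rw [indicator_of_notMem (fun h => hω (hmem ρ hρ h).1), mul_zero]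
  have hpos : 0 < R * (2 : ℝ) ^ (d - 1) := by positivity
  rw [← ENNReal.mul_le_mul_iff_right (ENNReal.ofReal_pos.2 hpos).ne' ENNReal.ofReal_ne_top]
  refine le_trans (le_of_eq ?_) key
  rw [← ENNReal.ofReal_mul hpos.le]
  congr 1
  obtain ⟨k, rfl⟩ : ∃ k, d = k + 1 := ⟨d - 1, by omega⟩
  simp only [Nat.add_sub_cancel, div_pow]
  field_simp
  ring

/-- Upper and lower bounds of the same order R^{d-1}; doubling gives a Vitali family and so the
differentiation theorem. -/
theorem isUnifLocDoublingMeasure_surf {d : ℕ} (hd : 1 ≤ d) : IsUnifLocDoublingMeasure (surf d) := by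
  obtain ⟨C, hC, hup⟩ := exists_surf_closedBall_le hd
  obtain ⟨c, hc, hlow⟩ := exists_le_surf_closedBall hd
  refine ⟨⟨(C * 2 ^ (d - 1) / c).toNNReal, ?_⟩⟩
  have : Ioo (0 : ℝ) (1 / 4) ∈ 𝓝[>] (0 : ℝ) := Ioo_mem_nhdsGT (by norm_num)
  filter_upwards [this] with R hR ξ
  refine (hup ξ (2 * R) (by linarith [hR.1]) (by linarith [hR.2])).trans ?_
  refine le_trans (le_of_eq ?_) (mul_le_mul_right (hlow ξ R hR.1 (by linarith [hR.2])) _)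
  change _ = ENNReal.ofReal _ * _
  have := hR.1
  rw [← ENNReal.ofReal_mul (by positivity)]
  congr 1
  rw [mul_pow]
  field_simp

/-- Almost every point is an `L^p` Lebesgue point. -/
theorem ae_eventually_lintegral_closedBall_le {X : Type*} [MetricSpace X] [MeasurableSpace X]
    [BorelSpace X] [SecondCountableTopology X] (μ : Measure X) [IsLocallyFiniteMeasure μ]
    [IsUnifLocDoublingMeasure μ] {p : ℝ} (hp : 1 ≤ p) {W : X → ℂ} (hW : Measurable W)
    {U : ℕ → Set X} (hU : ∀ N, MeasurableSet (U N)) (hμU : ∀ N, μ (U N) < ⊤)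
    (hfin : ∀ N, ∫⁻ y in U N, ‖W y‖ₑ ^ p ∂μ < ⊤) :
    ∀ᵐ x ∂μ, (∃ N, U N ∈ 𝓝 x) → ∀ δ : ℝ≥0∞, δ ≠ 0 → δ ≠ ⊤ → ∀ᶠ R in 𝓝[>] (0 : ℝ),
      ∫⁻ y in Metric.closedBall x R, ‖W y - W x‖ₑ ^ p ∂μ ≤ δ * μ (Metric.closedBall x R) := by
  have hp0 : 0 < p := by linarith
  have hbound : ∀ a b : ℂ, ‖a - b‖ₑ ^ p ≤ 2 ^ (p - 1) * (‖a‖ₑ ^ p + ‖b‖ₑ ^ p) := fun a b =>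
    (ENNReal.rpow_le_rpow (enorm_sub_le (a := a) (b := b)) hp0.le).trans
      (ENNReal.rpow_add_le_mul_rpow_add_rpow _ _ hp)
  have h2 : (2 : ℝ≥0∞) ^ (p - 1) ≠ ⊤ :=
    ENNReal.rpow_ne_top_of_nonneg (by linarith) ENNReal.ofNat_ne_top
  have h20 : (2 : ℝ≥0∞) ^ (p - 1) ≠ 0 := by
    rw [Ne, ENNReal.rpow_eq_zero_iff]; simp
  have hmeas : ∀ q : ℂ, Measurable fun y => ‖W y - q‖ₑ ^ p := fun q =>
    ((hW.sub_const q).enorm).pow_const p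
  -- Lebesgue differentiation is applied to countably many functions |W - q|^p, with q in a dense
  -- sequence, so that one null set suffices. The sets U N supply integrability.
  have key : ∀ N k : ℕ, ∀ᵐ x ∂μ, Tendsto
      (fun a => (∫⁻ y in a, (U N).indicator (fun y => ‖W y - TopologicalSpace.denseSeq ℂ k‖ₑ ^ p) y
        ∂μ) / μ a) ((IsUnifLocDoublingMeasure.vitaliFamily μ 1).filterAt x)
      (𝓝 ((U N).indicator (fun y => ‖W y - TopologicalSpace.denseSeq ℂ k‖ₑ ^ p) x)) := by
    intro N k
    refine VitaliFamily.ae_tendsto_lintegral_div' _ ((hmeas _).indicator (hU N)) ?_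
    rw [lintegral_indicator (hU N)]
    refine ne_of_lt ((lintegral_mono fun y => hbound _ _).trans_lt ?_)
    rw [lintegral_const_mul' _ _ h2, lintegral_add_right _ measurable_const, setLIntegral_const]
    refine ENNReal.mul_lt_top h2.lt_top (ENNReal.add_lt_top.2 ⟨hfin N,
      ENNReal.mul_lt_top (ENNReal.rpow_lt_top_of_nonneg hp0.le enorm_ne_top) (hμU N)⟩)
  filter_upwards [ae_all_iff.2 fun N => ae_all_iff.2 (key N)] with x hx ⟨N, hN⟩ δ hδ hδt
  -- Both |W - q|^p and |W(x) - q|^p will be bounded by δ' on average, and 2^{p-1} comes from the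
  -- convexity of the p-th power.
  set δ' : ℝ≥0∞ := δ / (2 ^ (p - 1) * 2) with hδ'
  have hδ'0 : δ' ≠ 0 := (ENNReal.div_pos hδ (ENNReal.mul_ne_top h2 (by simp))).ne'
  obtain ⟨k, hk⟩ : ∃ k, ‖W x - TopologicalSpace.denseSeq ℂ k‖ₑ ^ p < δ' := by
    have hcont : Continuous fun q : ℂ => ‖W x - q‖ₑ ^ p :=
      (ENNReal.continuous_rpow_const (y := p)).comp (continuous_const.sub continuous_id).enorm
    have hopen : IsOpen {q : ℂ | ‖W x - q‖ₑ ^ p < δ'} := isOpen_lt hcont continuous_const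
    exact (TopologicalSpace.denseRange_denseSeq ℂ).exists_mem_open hopen
      ⟨W x, by simpa [hp0] using pos_iff_ne_zero.2 hδ'0⟩
  have hxU : x ∈ U N := mem_of_mem_nhds hN
  have hT := (hx N k).comp (IsUnifLocDoublingMeasure.tendsto_closedBall_filterAt μ (K := 1)
    (x := x) (l := 𝓝[>] (0 : ℝ)) (fun _ => x) (fun R => R) tendsto_id
    (eventually_nhdsWithin_of_forall fun R hR => by
      have hR : 0 < R := hR
      simpa using hR.le))
  rw [indicator_of_mem hxU] at hT
  have hsub : ∀ᶠ R in 𝓝[>] (0 : ℝ), Metric.closedBall x R ⊆ U N := by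
    obtain ⟨R₀, hR₀, hb⟩ := Metric.nhds_basis_closedBall.mem_iff.1 hN
    filter_upwards [Ioc_mem_nhdsGT hR₀] with R hR
    exact (Metric.closedBall_subset_closedBall hR.2).trans hb
  filter_upwards [hT.eventually (gt_mem_nhds hk), hsub] with R hR hRU
  have h1 : ∫⁻ y in Metric.closedBall x R, ‖W y - TopologicalSpace.denseSeq ℂ k‖ₑ ^ p ∂μ ≤
      δ' * μ (Metric.closedBall x R) := by
    refine (ENNReal.div_le_iff_le_mul (Or.inr ?_) (Or.inr hδ'0)).1 (le_trans (le_of_eq ?_) hR.le)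
    · exact ENNReal.div_ne_top hδt (mul_ne_zero h20 (by simp))
    · simp only [Function.comp]
      congr 1
      refine setLIntegral_congr_fun Metric.isClosed_closedBall.measurableSet fun y hy => ?_
      rw [indicator_of_mem (hRU hy)]
  calc ∫⁻ y in Metric.closedBall x R, ‖W y - W x‖ₑ ^ p ∂μ
      ≤ ∫⁻ y in Metric.closedBall x R, 2 ^ (p - 1) *
        (‖W y - TopologicalSpace.denseSeq ℂ k‖ₑ ^ p + δ') ∂μ := by
        refine lintegral_mono fun y => ?_
        have := hbound (W y - TopologicalSpace.denseSeq ℂ k) (W x - TopologicalSpace.denseSeq ℂ k)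
        rw [sub_sub_sub_cancel_right] at this
        exact this.trans (by gcongr)
    _ = 2 ^ (p - 1) * (∫⁻ y in Metric.closedBall x R,
          ‖W y - TopologicalSpace.denseSeq ℂ k‖ₑ ^ p ∂μ + δ' * μ (Metric.closedBall x R)) := by
        rw [lintegral_const_mul' _ _ h2, lintegral_add_right _ measurable_const, setLIntegral_const]
    _ ≤ 2 ^ (p - 1) * (δ' * μ (Metric.closedBall x R) + δ' * μ (Metric.closedBall x R)) := by gcongr
    _ = (2 ^ (p - 1) * 2) * δ' * μ (Metric.closedBall x R) := by ring
    _ = _ := by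
        rw [hδ', ENNReal.mul_div_cancel (mul_ne_zero h20 (by simp))
            (ENNReal.mul_ne_top h2 (by simp))]

/-- Hölder's inequality against the constant function. -/
theorem setLIntegral_le_rpow_mul {X : Type*} [MeasurableSpace X] (μ : Measure X) {p : ℝ}
    (hp : 1 < p) {g : X → ℝ≥0∞} (hg : Measurable g) (A : Set X) :
    ∫⁻ y in A, g y ∂μ ≤ (∫⁻ y in A, g y ^ p ∂μ) ^ (1 / p) * μ A ^ (1 - 1 / p) := by
  have hc := Real.HolderConjugate.conjExponent hp
  have := ENNReal.lintegral_mul_le_Lp_mul_Lq (μ.restrict A) hc hg.aemeasurable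
    (aemeasurable_const (b := (1 : ℝ≥0∞)))
  simp only [Pi.mul_apply, mul_one, ENNReal.one_rpow, lintegral_const, one_mul,
    Measure.restrict_apply_univ] at this
  refine this.trans_eq ?_
  congr 2
  have := hc.inv_add_inv_eq_one
  rw [one_div, one_div]
  linarith

/-! ### Mean convergence of Poisson integrals near a Lebesgue point -/

theorem lintegral_comp_add_mul_sign {e : ℝ} (he : e = 1 ∨ e = -1) (G : ℝ → ℝ≥0∞) (s : ℝ) :
    ∫⁻ r, G (s + e * r) = ∫⁻ v, G v := by
  rcases he with rfl | rfl
  · simpa using lintegral_add_left_eq_self G s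
  · simpa [sub_eq_add_neg] using lintegral_sub_left_eq_self G s

/-- The Poisson kernel in the coordinates `(s, ξ)` is dominated by that of a half-space. -/
theorem exists_pairKer_le {n : ℕ} (hn : 2 ≤ n) {s : ℝ} (hs : 0 < s) :
    ∃ C : ℝ, 0 < C ∧ ∀ (ξ : Sph n) (y : ℝ × Sph n), s / 2 ≤ y.1 → y.1 ≤ 2 * s → y.1 ≠ s →
      pairKer s y.1 ξ y.2 ≤ C * (|y.1 - s| / dist y (s, ξ) ^ n) := by
  -- The first entry compares |√s - √v| with |s - v|, using √s + √v ≤ 3√s. The second compares the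
  -- angular part, using √(sv) ≥ s/2.
  set c := min (1 / (3 * √s)) √(s / 2) with hc
  have hss := Real.sqrt_pos.2 hs
  have hc0 : 0 < c := lt_min (by positivity) (by positivity)
  refine ⟨(2 * s) ^ ((n : ℝ) / 2 - 1) / c ^ n, by positivity, ?_⟩
  rintro ξ ⟨v, ζ⟩ h1 h2 hne
  dsimp only at h1 h2 hne ⊢
  have hv : 0 < v := by linarith
  have hn2 : (0 : ℝ) ≤ (n : ℝ) / 2 - 1 := by
    have : (2 : ℝ) ≤ n := by exact_mod_cast hn
    linarith
  have hform : pairKer s v ξ ζ = (max s v) ^ ((n : ℝ) / 2 - 1) * |v - s| /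
      ‖√s • (ξ : EuclideanSpace ℝ (Fin n)) - √v • (ζ : EuclideanSpace ℝ (Fin n))‖ ^ n := by
    rcases lt_or_gt_of_ne hne with h | h
    · rw [pairKer_comm, pairKer_symm, pairKer_eq hv h, max_eq_left h.le, abs_of_neg (by linarith),
        neg_sub, norm_sub_rev]
    · rw [pairKer_eq hs h, max_eq_right h.le, abs_of_pos (by linarith)]
  have hdist : 0 < dist ((v, ζ) : ℝ × Sph n) (s, ξ) := dist_pos.2 fun h => hne (congrArg Prod.fst h)
  have hlow : c * dist ((v, ζ) : ℝ × Sph n) (s, ξ) ≤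
      ‖√s • (ξ : EuclideanSpace ℝ (Fin n)) - √v • (ζ : EuclideanSpace ℝ (Fin n))‖ := by
    -- The squared distance splits into a radial and an angular part, either of which controls one
    -- coordinate of the maximum distance on the product.
    have hsq : ‖√s • (ξ : EuclideanSpace ℝ (Fin n)) - √v • (ζ : EuclideanSpace ℝ (Fin n))‖ ^ 2 =
        (√s - √v) ^ 2 + √(s * v) * ‖(ζ : EuclideanSpace ℝ (Fin n)) - ξ‖ ^ 2 := by
      rw [norm_sqrt_smul_sub_sq hs.le hv.le, norm_sub_sq_real, norm_eq_of_mem_sphere,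
        norm_eq_of_mem_sphere, real_inner_comm, Real.sqrt_mul hs.le, sub_sq, Real.sq_sqrt hs.le,
        Real.sq_sqrt hv.le]
      ring
    rw [Prod.dist_eq, Subtype.dist_eq, dist_eq_norm, dist_eq_norm, Real.norm_eq_abs]
    refine abs_le_of_sq_le_sq' ?_ (norm_nonneg _) |>.2
    rw [hsq]
    dsimp only
    rcases max_cases |v - s| ‖(ζ : EuclideanSpace ℝ (Fin n)) - ξ‖ with ⟨h, -⟩ | ⟨h, -⟩
    · rw [h]
      have h3 : √v ≤ 2 * √s := by
        rw [Real.sqrt_le_left (by positivity), mul_pow, Real.sq_sqrt hs.le]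
        linarith
      have h4 : v - s = -((√s - √v) * (√s + √v)) := by
        linear_combination Real.sq_sqrt hs.le - Real.sq_sqrt hv.le
      have h5 : c * (√s + √v) ≤ 1 := by
        calc c * (√s + √v) ≤ 1 / (3 * √s) * (3 * √s) := by
              gcongr
              · exact min_le_left _ _
              · linarith
          _ = 1 := by field_simp
      have h6 : (c * (√s + √v)) ^ 2 ≤ 1 := by
        have : 0 ≤ c * (√s + √v) := by positivity
        nlinarith
      calc (c * |v - s|) ^ 2 = (c * (√s + √v)) ^ 2 * (√s - √v) ^ 2 := by
            rw [mul_pow, sq_abs, h4]; ring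
        _ ≤ 1 * (√s - √v) ^ 2 := by gcongr
        _ ≤ _ := by
            have : 0 ≤ √(s * v) * ‖(ζ : EuclideanSpace ℝ (Fin n)) - ξ‖ ^ 2 := by positivity
            linarith
    · rw [h]
      have h3 : c ^ 2 ≤ √(s * v) := by
        calc c ^ 2 ≤ √(s / 2) ^ 2 := by gcongr; exact min_le_right _ _
          _ = s / 2 := Real.sq_sqrt (by positivity)
          _ ≤ √(s * v) := by
              refine Real.le_sqrt_of_sq_le ?_
              nlinarith
      calc (c * ‖(ζ : EuclideanSpace ℝ (Fin n)) - ξ‖) ^ 2 =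
            c ^ 2 * ‖(ζ : EuclideanSpace ℝ (Fin n)) - ξ‖ ^ 2 := mul_pow _ _ _
        _ ≤ √(s * v) * ‖(ζ : EuclideanSpace ℝ (Fin n)) - ξ‖ ^ 2 := by gcongr
        _ ≤ _ := by nlinarith [sq_nonneg (√s - √v)]
  rw [hform]
  calc _ ≤ (2 * s) ^ ((n : ℝ) / 2 - 1) * |v - s| / (c * dist ((v, ζ) : ℝ × Sph n) (s, ξ)) ^ n := by
        gcongr
        exact max_le (by linarith) h2
    _ = _ := by rw [mul_pow]; field_simp

/-- The balls of the product ℝ × S^{n-1} have measure of order R^n, and the sets [1/(N + 1), N + 1]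
× S^{n-1} exhaust the half where W is locally in L^p. -/
theorem ae_lebesgue_point_cyl {n : ℕ} (hn : 1 ≤ n) {p : ℝ} (hp : 1 ≤ p) {W : ℝ × Sph n → ℂ}
    (hW : Measurable W)
    (hfin : ∀ a b : ℝ, 0 < a → ∫⁻ y in Icc a b ×ˢ univ, ‖W y‖ₑ ^ p ∂(cylMeasure n) < ⊤) :
    ∀ᵐ x ∂(cylMeasure n), 0 < x.1 → ∀ η : ℝ, 0 < η → ∃ R₁ : ℝ, 0 < R₁ ∧ R₁ ≤ 1 / 2 ∧
      ∀ R, 0 < R → R ≤ R₁ →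
      ∫⁻ y in Metric.closedBall x R, ‖W y - W x‖ₑ ^ p ∂(cylMeasure n) ≤
        ENNReal.ofReal (η * R ^ n) := by
  have := isUnifLocDoublingMeasure_surf hn
  obtain ⟨C, hC, hcap⟩ := exists_surf_closedBall_le hn
  have hL := ae_eventually_lintegral_closedBall_le (cylMeasure n) hp hW
    (U := fun N => Icc (1 / ((N : ℝ) + 1)) (N + 1) ×ˢ univ)
    (fun N => measurableSet_Icc.prod MeasurableSet.univ)
    (fun N => by
      rw [Measure.prod_prod]
      exact ENNReal.mul_lt_top measure_Icc_lt_top (measure_lt_top _ _))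
    (fun N => hfin _ _ (by positivity))
  filter_upwards [hL] with x hx hx0 η hη
  have hN : ∃ N : ℕ, Icc (1 / ((N : ℝ) + 1)) (N + 1) ×ˢ (univ : Set (Sph n)) ∈ 𝓝 x := by
    obtain ⟨N₁, h₁⟩ := exists_nat_one_div_lt hx0
    obtain ⟨N₂, h₂⟩ := exists_nat_gt x.1
    refine ⟨max N₁ N₂, ?_⟩
    rw [nhds_prod_eq]
    refine prod_mem_prod (Icc_mem_nhds ?_ ?_) univ_mem
    · refine lt_of_le_of_lt ?_ h₁
      gcongr
      exact le_max_left _ _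
    · push_cast
      have := le_max_right (N₁ : ℝ) N₂
      linarith
  have hev := hx hN (ENNReal.ofReal (η / (2 * C))) (ENNReal.ofReal_pos.2 (by positivity)).ne'
    ENNReal.ofReal_ne_top
  obtain ⟨R₀, hR₀, hb⟩ := (mem_nhdsGT_iff_exists_Ioc_subset).1 hev
  refine ⟨min R₀ (1 / 2), lt_min hR₀ (by norm_num), min_le_right _ _, fun R hR hRR => ?_⟩
  refine (hb ⟨hR, hRR.trans (min_le_left _ _)⟩).trans ?_
  have hball : cylMeasure n (Metric.closedBall x R) ≤ ENNReal.ofReal (2 * R * (C * R ^ (n - 1))) :=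
      by
    rw [← Prod.mk.eta (p := x), ← closedBall_prod_same, Measure.prod_prod, Real.volume_closedBall,
      ENNReal.ofReal_mul (p := 2 * R) (by positivity)]
    gcongr
    exact hcap _ _ hR (hRR.trans (min_le_right _ _))
  refine (mul_le_mul_right hball _).trans_eq ?_
  rw [← ENNReal.ofReal_mul (by positivity)]
  congr 1
  obtain ⟨k, rfl⟩ : ∃ k, n = k + 1 := ⟨n - 1, by omega⟩
  simp only [Nat.add_sub_cancel]
  field_simp
  ring

theorem lintegral_Ioi_rpow_neg {lam ρ : ℝ} (hl : 0 < lam) (hρ : 0 < ρ) :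
    ∫⁻ R in Ioi ρ, ENNReal.ofReal (R ^ (-1 - lam)) = ENNReal.ofReal (ρ ^ (-lam) / lam) := by
  rw [← ofReal_integral_eq_lintegral_ofReal
    (integrableOn_Ioi_rpow_of_lt (by linarith) hρ)]
  · rw [integral_Ioi_rpow_of_lt (by linarith) hρ]
    congr 1
    rw [show -1 - lam + 1 = -lam by ring]
    field_simp
  · filter_upwards [ae_restrict_mem measurableSet_Ioi] with R hR
    exact Real.rpow_nonneg (hρ.trans hR).le _

/-- Integration of the half-space Poisson kernel over a thin slab near a Lebesgue point. -/
theorem lintegral_slab_near_le {n : ℕ} (hn : 2 ≤ n) {p : ℝ} (hp : 1 < p) :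
    ∃ D : ℝ, 0 < D ∧ ∀ (g : ℝ × Sph n → ℝ≥0∞), Measurable g → ∀ (x : ℝ × Sph n) (η R₁ : ℝ), 0 < η →
      0 < R₁ → R₁ ≤ 1 / 2 → (∀ R, 0 < R → R ≤ R₁ →
        ∫⁻ y in Metric.closedBall x R, g y ^ p ∂(cylMeasure n) ≤ ENNReal.ofReal (η * R ^ n)) →
      ∀ (e ρ : ℝ), e = 1 ∨ e = -1 → 0 < ρ →
      ∫⁻ y in {y | e * (y.1 - x.1) ∈ Ioc 0 ρ} ∩ Metric.ball x R₁,
        ENNReal.ofReal (|y.1 - x.1| / dist y x ^ n) * g y ∂(cylMeasure n) ≤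
        ENNReal.ofReal (D * η ^ (1 / p) * ρ) := by
  obtain ⟨C, hC, hcap⟩ := exists_surf_closedBall_le (d := n) (by omega)
  have hp0 : 0 < p := by linarith
  set lam := 1 - 1 / p with hlam
  have hl0 : 0 < lam := by
    have : 1 / p < 1 := by rw [div_lt_one hp0]; exact hp
    linarith
  have hl1 : lam ≤ 1 := by
    have : 0 < 1 / p := by positivity
    linarith
  refine ⟨n * C ^ lam * (1 + 1 / lam), by positivity, ?_⟩
  intro g hg x η R₁ hη hR₁ hR₁2 hLeb e ρ he hρ
  set A := {y : ℝ × Sph n | e * (y.1 - x.1) ∈ Ioc 0 ρ} ∩ Metric.ball x R₁ with hA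
  have hee : |e| = 1 := by rcases he with rfl | rfl <;> simp
  have habs : ∀ y ∈ A, |y.1 - x.1| = e * (y.1 - x.1) := by
    intro y hy
    rw [← one_mul |y.1 - x.1|, ← hee, ← abs_mul, abs_of_pos hy.1.1]
  have hAm : MeasurableSet A := by
    refine MeasurableSet.inter ?_ Metric.isOpen_ball.measurableSet
    exact (measurable_const.mul (measurable_fst.sub_const _)) measurableSet_Ioc
  set ν := ((cylMeasure n).restrict A).withDensity g with hν
  have hdm : Measurable fun y : ℝ × Sph n => dist y x := measurable_id.dist measurable_const
  have hpos : ∀ y ∈ A, 0 < dist y x := by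
    intro y hy
    refine dist_pos.2 fun h => ?_
    have := hy.1.1
    rw [h, sub_self, mul_zero] at this
    exact lt_irrefl _ this
  have hle : ∀ y ∈ A, |y.1 - x.1| ≤ dist y x := by
    intro y hy
    rw [Prod.dist_eq, ← Real.dist_eq]
    exact le_max_left _ _
  have hn0 : (0 : ℝ) < n := by positivity
  set φ : ℝ → ℝ≥0∞ := fun R => ENNReal.ofReal (n * (min ρ R * R ^ (-1 - (n : ℝ)))) with hφ
  -- Hölder's bound for the mass of g on the part of the slab within distance R of x: the first
  -- factor is the Lebesgue point hypothesis, the second the measure of a slab of thickness min(ρ,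
  -- R) in a ball of radius R.
  set H : ℝ → ℝ≥0∞ := fun R => ENNReal.ofReal
    ((η * R ^ n) ^ (1 / p) * (min ρ R * (C * R ^ (n - 1))) ^ lam) with hH
  have hdens : ∫⁻ y in A, ENNReal.ofReal (|y.1 - x.1| / dist y x ^ n) * g y ∂(cylMeasure n) ≤
      ∫⁻ y, ENNReal.ofReal (min ρ (dist y x) * (dist y x) ^ (-(n : ℝ))) ∂ν := by
    rw [hν, lintegral_withDensity_eq_lintegral_mul _ hg (by fun_prop)]
    refine setLIntegral_mono' hAm fun y hy => ?_
    rw [Pi.mul_apply, mul_comm]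
    gcongr
    rw [Real.rpow_neg dist_nonneg, Real.rpow_natCast, ← div_eq_mul_inv]
    have := hpos y hy
    gcongr
    exact le_min ((habs y hy).le.trans hy.1.2) (hle y hy)
  have hfs : SFinite ν := by rw [hν]; infer_instance
  have hdist := lintegral_comp_le_of_distribution ν hdm
    (Θ := fun k => ENNReal.ofReal (min ρ k * k ^ (-(n : ℝ)))) (φ := φ) (H := H) ?_ ?_ ?_ ?_
  · refine hdens.trans (hdist.trans ?_)
    have hsplit : Ioi (0 : ℝ) = Ioc 0 ρ ∪ Ioi ρ := (Ioc_union_Ioi_eq_Ioi hρ.le).symm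
    -- All powers of R combine to min(ρ, R)^{1+λ} R^{-1-λ} with λ = 1 - 1/p: constant for R ≤ ρ and
    -- integrable at infinity since p > 1. Both ranges contribute a multiple of ρ.
    have hprod : ∀ R : ℝ, 0 < R → φ R * H R = ENNReal.ofReal (n * (η ^ (1 / p) * C ^ lam) *
        (min ρ R * min ρ R ^ lam * R ^ (-1 - lam))) := by
      intro R hR
      have hm : 0 ≤ min ρ R := le_min hρ.le hR.le
      rw [hφ, hH]
      dsimp only
      rw [← ENNReal.ofReal_mul (by positivity)]
      congr 1
      rw [Real.mul_rpow hη.le (by positivity), Real.mul_rpow hm (by positivity),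
        Real.mul_rpow hC.le (by positivity), ← Real.rpow_natCast, ← Real.rpow_natCast,
        ← Real.rpow_mul hR.le, ← Real.rpow_mul hR.le]
      have : R ^ (-1 - lam) = R ^ (-1 - (n : ℝ)) * R ^ ((n : ℝ) * (1 / p)) *
          R ^ (((n - 1 : ℕ) : ℝ) * lam) := by
        rw [← Real.rpow_add hR, ← Real.rpow_add hR]
        congr 1
        rw [Nat.cast_sub (by omega), hlam]
        push_cast
        ring
      rw [this]
      ring
    set K := n * (η ^ (1 / p) * C ^ lam) with hK
    have hK0 : 0 ≤ K := by positivity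
    rw [hsplit, lintegral_union measurableSet_Ioi Ioc_disjoint_Ioi_same]
    have hA1 : ∫⁻ R in Ioc 0 ρ, φ R * H R ≤ ENNReal.ofReal (K * ρ) := by
      calc _ ≤ ∫⁻ R in Ioc 0 ρ, ENNReal.ofReal K := by
            refine setLIntegral_mono' measurableSet_Ioc fun R hR => ?_
            rw [hprod R hR.1, min_eq_right hR.2]
            refine ENNReal.ofReal_le_ofReal (le_of_eq ?_)
            have h1 : R * R ^ lam * R ^ (-1 - lam) = 1 := by
              nth_rw 1 [← Real.rpow_one R]
              rw [← Real.rpow_add hR.1, ← Real.rpow_add hR.1,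
                show 1 + lam + (-1 - lam) = 0 by ring, Real.rpow_zero]
            rw [h1, mul_one]
        _ = _ := by
            rw [setLIntegral_const, Real.volume_Ioc, sub_zero, ← ENNReal.ofReal_mul hK0]
    have hA2 : ∫⁻ R in Ioi ρ, φ R * H R = ENNReal.ofReal (K * ρ / lam) := by
      calc _ = ∫⁻ R in Ioi ρ, ENNReal.ofReal (K * (ρ * ρ ^ lam)) *
            ENNReal.ofReal (R ^ (-1 - lam)) := by
            refine setLIntegral_congr_fun measurableSet_Ioi fun R hR => ?_
            have hR : ρ < R := hR
            rw [hprod R (hρ.trans hR), min_eq_left hR.le, ← ENNReal.ofReal_mul (by positivity)]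
            congr 1
            ring
        _ = _ := by
            rw [lintegral_const_mul' _ _ ENNReal.ofReal_ne_top, lintegral_Ioi_rpow_neg hl0 hρ,
              ← ENNReal.ofReal_mul (by positivity), Real.rpow_neg hρ.le]
            congr 1
            field_simp
    rw [hA2]
    refine (add_le_add_left hA1 _).trans (le_of_eq ?_)
    rw [← ENNReal.ofReal_add (by positivity) (by positivity)]
    congr 1
    rw [hK]
    ring
  · rw [hν]
    refine (withDensity_absolutelyContinuous _ _).ae_le ?_
    filter_upwards [ae_restrict_mem hAm] with y hy using hpos y hy
  · fun_prop
  · intro k hk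
    rw [hφ]
    calc ENNReal.ofReal (min ρ k * k ^ (-(n : ℝ)))
        = ∫⁻ R in Ioi k, ENNReal.ofReal (n * min ρ k) * ENNReal.ofReal (R ^ (-1 - (n : ℝ))) := by
          have hm : 0 ≤ min ρ k := le_min hρ.le hk.le
          rw [lintegral_const_mul' _ _ ENNReal.ofReal_ne_top, lintegral_Ioi_rpow_neg hn0 hk,
            ← ENNReal.ofReal_mul (by positivity)]
          congr 1
          field_simp
      _ ≤ _ := by
          refine setLIntegral_mono' measurableSet_Ioi fun R hR => ?_
          have hR : k < R := hR
          have hR0 := hk.trans hR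
          have hm : 0 ≤ min ρ k := le_min hρ.le hk.le
          rw [← ENNReal.ofReal_mul (by positivity)]
          refine ENNReal.ofReal_le_ofReal ?_
          rw [mul_assoc]
          gcongr
  · intro R hR
    have hR' : 0 < min R R₁ := lt_min hR hR₁
    have hset : MeasurableSet {y : ℝ × Sph n | dist y x < R} := hdm measurableSet_Iio
    rw [hν, withDensity_apply _ hset, Measure.restrict_restrict hset]
    refine (setLIntegral_le_rpow_mul _ hp hg _).trans ?_
    rw [hH]
    dsimp only
    have hm : 0 ≤ min ρ R := le_min hρ.le hR.le
    rw [ENNReal.ofReal_mul (by positivity), ← ENNReal.ofReal_rpow_of_nonneg (by positivity)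
      (by positivity), ← ENNReal.ofReal_rpow_of_nonneg (by positivity) hl0.le]
    gcongr
    · calc _ ≤ ∫⁻ y in Metric.closedBall x (min R R₁), g y ^ p ∂(cylMeasure n) := by
            refine lintegral_mono_set fun y hy => ?_
            exact le_min (le_of_lt hy.1) (Metric.mem_ball.1 hy.2.2).le
        _ ≤ ENNReal.ofReal (η * (min R R₁) ^ n) := hLeb _ hR' (min_le_right _ _)
        _ ≤ _ := by
            gcongr
            exact min_le_left _ _
    · calc cylMeasure n ({y | dist y x < R} ∩ A)
          ≤ cylMeasure n ({v : ℝ | e * (v - x.1) ∈ Ioc 0 (min ρ R)} ×ˢ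
            Metric.closedBall x.2 (min R R₁)) := by
            refine measure_mono fun y hy => ⟨⟨hy.2.1.1, le_min hy.2.1.2 ?_⟩, ?_⟩
            · rw [← habs y hy.2]
              exact (hle y hy.2).trans (le_of_lt hy.1)
            · have h1 : dist y.2 x.2 ≤ dist y x := by
                rw [Prod.dist_eq]; exact le_max_right _ _
              exact h1.trans (le_min (le_of_lt hy.1) (Metric.mem_ball.1 hy.2.2).le)
        _ ≤ ENNReal.ofReal (min ρ R) * ENNReal.ofReal (C * (min R R₁) ^ (n - 1)) := by
            rw [Measure.prod_prod]
            gcongr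
            · have hs : MeasurableSet {v : ℝ | e * (v - x.1) ∈ Ioc 0 (min ρ R)} :=
                (measurable_const.mul (measurable_id.sub_const _)) measurableSet_Ioc
              rw [← lintegral_indicator_one hs, ← lintegral_comp_add_mul_sign he _ x.1]
              have h2 : ∀ r, {v : ℝ | e * (v - x.1) ∈ Ioc 0 (min ρ R)}.indicator
                  (1 : ℝ → ℝ≥0∞) (x.1 + e * r) = (Ioc 0 (min ρ R)).indicator 1 r := by
                intro r
                have h3 : e * (x.1 + e * r - x.1) = r := by
                  rcases he with rfl | rfl <;> ring
                refine indicator_eq_indicator (by rw [mem_ofPred_eq, h3]) rfl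
              simp_rw [h2]
              rw [lintegral_indicator_one measurableSet_Ioc, Real.volume_Ioc, sub_zero]
            · exact hcap _ _ hR' ((min_le_right _ _).trans hR₁2)
        _ ≤ _ := by
            rw [← ENNReal.ofReal_mul hm]
            gcongr
            exact min_le_left _ _

theorem measurable_pairKer_right {n : ℕ} (a b : ℝ) (ξ : Sph n) : Measurable (pairKer a b ξ) := by
  unfold pairKer poissonKer
  fun_prop

theorem integrable_pairKer {n : ℕ} (hn : 1 ≤ n) {a b : ℝ} (ha : 0 < a) (hb : 0 < b) (hab : a ≠ b)
    (ξ : Sph n) : Integrable (pairKer a b ξ) (surf n) := by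
  refine ⟨(measurable_pairKer_right a b ξ).aestronglyMeasurable, ?_⟩
  rw [hasFiniteIntegral_iff_ofReal (.of_forall fun ζ => (pairKer_pos ha hb hab ξ ζ).le),
    lintegral_pairKer hn ha hb hab]
  exact ENNReal.ofReal_lt_top

theorem integral_pairKer {n : ℕ} (hn : 1 ≤ n) {a b : ℝ} (ha : 0 < a) (hb : 0 < b) (hab : a ≠ b)
    (ξ : Sph n) : ∫ ζ, pairKer a b ξ ζ ∂(surf n) = sphereArea n := by
  rw [integral_eq_lintegral_of_nonneg_ae
    (.of_forall fun ζ => (pairKer_pos ha hb hab ξ ζ).le)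
    (measurable_pairKer_right a b ξ).aestronglyMeasurable, lintegral_pairKer hn ha hb hab,
    ENNReal.toReal_ofReal (sphereArea_pos hn).le]

/-- The kernel has total mass `sphereArea n`, so the constant c may be moved inside the integral. If
the right-hand side is infinite there is nothing to prove. -/
theorem enorm_poisson_sub_le {n : ℕ} (hn : 1 ≤ n) {a b : ℝ} (ha : 0 < a) (hb : 0 < b)
    (hab : a ≠ b) (ξ : Sph n) {h : Sph n → ℂ} (hh : Measurable h) (c : ℂ) :
    ‖(sphereArea n)⁻¹ • ∫ ζ, pairKer a b ξ ζ • h ζ ∂(surf n) - c‖ₑ ≤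
      ENNReal.ofReal (sphereArea n)⁻¹ *
        ∫⁻ ζ, ENNReal.ofReal (pairKer a b ξ ζ) * ‖h ζ - c‖ₑ ∂(surf n) := by
  have hσ := sphereArea_pos hn
  have hk := (integrable_pairKer hn ha hb hab ξ).smul_const c
  have hen : ∀ ζ, ‖pairKer a b ξ ζ • (h ζ - c)‖ₑ = ENNReal.ofReal (pairKer a b ξ ζ) * ‖h ζ - c‖ₑ :=
    fun ζ => by rw [enorm_smul, Real.enorm_of_nonneg (pairKer_pos ha hb hab ξ ζ).le]
  have hmeas : Measurable fun ζ => pairKer a b ξ ζ • (h ζ - c) :=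
    (measurable_pairKer_right a b ξ).smul (hh.sub_const c)
  by_cases hfin : ∫⁻ ζ, ENNReal.ofReal (pairKer a b ξ ζ) * ‖h ζ - c‖ₑ ∂(surf n) = ⊤
  · rw [hfin, ENNReal.mul_top (ENNReal.ofReal_pos.2 (inv_pos.2 hσ)).ne']
    exact le_top
  have hInt : Integrable (fun ζ => pairKer a b ξ ζ • (h ζ - c)) (surf n) := by
    refine ⟨hmeas.aestronglyMeasurable, ?_⟩
    rw [hasFiniteIntegral_iff_enorm]
    simp_rw [hen]
    exact lt_top_iff_ne_top.2 hfin
  have hc : c = (sphereArea n)⁻¹ • ∫ ζ, pairKer a b ξ ζ • c ∂(surf n) := by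
    rw [integral_smul_const, integral_pairKer hn ha hb hab, smul_smul, inv_mul_cancel₀ hσ.ne',
      one_smul]
  have hsum : ∫ ζ, pairKer a b ξ ζ • h ζ ∂(surf n) =
      ∫ ζ, pairKer a b ξ ζ • (h ζ - c) ∂(surf n) + ∫ ζ, pairKer a b ξ ζ • c ∂(surf n) := by
    rw [← integral_add hInt hk]
    refine integral_congr_ae (.of_forall fun ζ => ?_)
    simp only [smul_sub, sub_add_cancel]
  nth_rw 1 [hc]
  rw [hsum, smul_add, add_sub_cancel_right, enorm_smul, Real.enorm_of_nonneg (inv_pos.2 hσ).le]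
  gcongr
  refine (enorm_integral_le_lintegral_enorm _).trans_eq (lintegral_congr hen)

/-- For `W` locally in `L^p`, the Poisson integrals `P[W(s ± r, ·)](ξ)` converge to `W(s, ξ)` in
the mean as `r → 0`, for almost every `(s, ξ)`. -/
theorem ae_lebesgue_poisson {n : ℕ} (hn : 2 ≤ n) {p : ℝ} (hp : 1 < p) {W : ℝ × Sph n → ℂ}
    (hW : Measurable W)
    (hfin : ∀ a b : ℝ, 0 < a → ∫⁻ y in Icc a b ×ˢ univ, ‖W y‖ₑ ^ p ∂(cylMeasure n) < ⊤) :
    ∀ᵐ x ∂(cylMeasure n), 0 < x.1 → ∀ e : ℝ, e = 1 ∨ e = -1 → ∀ η : ℝ, 0 < η →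
      ∃ r₀ : ℝ, 0 < r₀ ∧ ∀ ρ, 0 < ρ → ρ ≤ r₀ →
      ∫⁻ r in Ioc 0 ρ, ‖(sphereArea n)⁻¹ • ∫ ζ, pairKer x.1 (x.1 + e * r) x.2 ζ •
        W (x.1 + e * r, ζ) ∂(surf n) - W x‖ₑ ≤ ENNReal.ofReal (η * ρ) := by
  have hn1 : 1 ≤ n := by omega
  have hp0 : 0 < p := by linarith
  have hlam : 0 < 1 - 1 / p := by
    have : 1 / p < 1 := by rw [div_lt_one hp0]; exact hp
    linarith
  obtain ⟨D, hD, hnear⟩ := lintegral_slab_near_le hn hp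
  have hσ := sphereArea_pos hn1
  filter_upwards [ae_lebesgue_point_cyl hn1 hp.le hW hfin] with x hx hs e he η hη
  obtain ⟨C, hC, hker⟩ := exists_pairKer_le hn hs
  set g : ℝ × Sph n → ℝ≥0∞ := fun y => ‖W y - W x‖ₑ with hg
  have hgm : Measurable g := (hW.sub_const _).enorm
  have hee : |e| = 1 := by rcases he with rfl | rfl <;> simp
  have he2 : ∀ r, e * (x.1 + e * r - x.1) = r := by rcases he with rfl | rfl <;> intro r <;> ring
  -- Two contributions of at most δρ, multiplied by the kernel constant C and the normalization,
  -- give ηρ.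
  set δ := η * sphereArea n / (2 * C) with hδ
  have hδ0 : 0 < δ := by positivity
  -- The p-th power undoes the exponent 1/p lost in `lintegral_slab_near_le`.
  obtain ⟨R₁, hR₁, hR₁2, hLeb⟩ := hx hs ((δ / D) ^ p) (by positivity)
  have hM : ∫⁻ y in Icc (x.1 / 2) (2 * x.1) ×ˢ univ, g y ^ p ∂(cylMeasure n) < ⊤ := by
    have h2 : (2 : ℝ≥0∞) ^ (p - 1) ≠ ⊤ :=
      ENNReal.rpow_ne_top_of_nonneg (by linarith) ENNReal.ofNat_ne_top
    refine (lintegral_mono fun y => (ENNReal.rpow_le_rpow (enorm_sub_le (a := W y) (b := W x))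
      hp0.le).trans (ENNReal.rpow_add_le_mul_rpow_add_rpow _ _ hp.le)).trans_lt ?_
    rw [lintegral_const_mul' _ _ h2, lintegral_add_right _ measurable_const, setLIntegral_const]
    refine ENNReal.mul_lt_top h2.lt_top (ENNReal.add_lt_top.2 ⟨hfin _ _ (by linarith),
      ENNReal.mul_lt_top (ENNReal.rpow_lt_top_of_nonneg hp0.le enorm_ne_top) ?_⟩)
    rw [Measure.prod_prod]
    exact ENNReal.mul_lt_top measure_Icc_lt_top (measure_lt_top _ _)
  set M := ∫⁻ y in Icc (x.1 / 2) (2 * x.1) ×ˢ univ, g y ^ p ∂(cylMeasure n) with hMdef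
  have hsmall : Tendsto (fun ρ : ℝ => (R₁ ^ n)⁻¹ * (M.toReal ^ (1 / p) *
      (ρ * sphereArea n) ^ (1 - 1 / p))) (𝓝[>] 0) (𝓝 0) := by
    have : Tendsto (fun ρ : ℝ => (R₁ ^ n)⁻¹ * (M.toReal ^ (1 / p) *
        (ρ * sphereArea n) ^ (1 - 1 / p))) (𝓝 0)
        (𝓝 ((R₁ ^ n)⁻¹ * (M.toReal ^ (1 / p) * (0 * sphereArea n) ^ (1 - 1 / p)))) := by
      refine Tendsto.const_mul _ (Tendsto.const_mul _ ?_)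
      exact (tendsto_id.mul_const _).rpow_const (Or.inr hlam.le)
    rw [zero_mul, Real.zero_rpow hlam.ne', mul_zero, mul_zero] at this
    exact this.mono_left nhdsWithin_le_nhds
  obtain ⟨r₁, hr₁, hr₁s⟩ := mem_nhdsGT_iff_exists_Ioc_subset.1 (hsmall.eventually (gt_mem_nhds hδ0))
  refine ⟨min r₁ (x.1 / 2), lt_min hr₁ (by linarith), fun ρ hρ hρr => ?_⟩
  have hρ1 : ρ ≤ r₁ := hρr.trans (min_le_left _ _)
  have hρ2 : ρ ≤ x.1 / 2 := hρr.trans (min_le_right _ _)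
  set S : Set (ℝ × Sph n) := {y | e * (y.1 - x.1) ∈ Ioc 0 ρ} with hS
  have hSm : MeasurableSet S :=
    (measurable_const.mul (measurable_fst.sub_const _)) measurableSet_Ioc
  have habs : ∀ y ∈ S, |y.1 - x.1| = e * (y.1 - x.1) := by
    intro y hy
    rw [← one_mul |y.1 - x.1|, ← hee, ← abs_mul, abs_of_pos hy.1]
  have hrange : ∀ y ∈ S, x.1 / 2 ≤ y.1 ∧ y.1 ≤ 2 * x.1 ∧ y.1 ≠ x.1 := by
    intro y hy
    have h1 := habs y hy
    have h2 : |y.1 - x.1| ≤ ρ := h1.le.trans hy.2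
    rw [abs_le] at h2
    refine ⟨by linarith [h2.1], by linarith [h2.2], fun h => ?_⟩
    have := hy.1
    rw [h, sub_self, mul_zero] at this
    exact lt_irrefl _ this
  have hmk : Measurable fun y : ℝ × Sph n => ENNReal.ofReal (pairKer x.1 y.1 x.2 y.2) * g y := by
    refine Measurable.mul (ENNReal.measurable_ofReal.comp ?_) hgm
    unfold pairKer poissonKer
    fun_prop
  have hstep1 : ∫⁻ r in Ioc 0 ρ, ‖(sphereArea n)⁻¹ • ∫ ζ, pairKer x.1 (x.1 + e * r) x.2 ζ •
        W (x.1 + e * r, ζ) ∂(surf n) - W x‖ₑ ≤ ENNReal.ofReal (sphereArea n)⁻¹ *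
        ∫⁻ y in S, ENNReal.ofReal (pairKer x.1 y.1 x.2 y.2) * g y ∂(cylMeasure n) := by
    calc _ ≤ ∫⁻ r in Ioc 0 ρ, ENNReal.ofReal (sphereArea n)⁻¹ *
          ∫⁻ ζ, ENNReal.ofReal (pairKer x.1 (x.1 + e * r) x.2 ζ) * g (x.1 + e * r, ζ)
            ∂(surf n) := by
          refine setLIntegral_mono' measurableSet_Ioc fun r hr => ?_
          have hmem : ((x.1 + e * r, x.2) : ℝ × Sph n) ∈ S := by
            rw [hS, mem_ofPred_eq, he2]; exact hr
          obtain ⟨h1, -, h3⟩ := hrange _ hmem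
          exact enorm_poisson_sub_le hn1 hs (by linarith) h3.symm x.2
            (hW.comp measurable_prodMk_left) (W x)
      _ = ENNReal.ofReal (sphereArea n)⁻¹ * ∫⁻ v, ∫⁻ ζ, S.indicator (fun y =>
            ENNReal.ofReal (pairKer x.1 y.1 x.2 y.2) * g y) (v, ζ) ∂(surf n) := by
          rw [lintegral_const_mul' _ _ ENNReal.ofReal_ne_top,
            ← lintegral_indicator measurableSet_Ioc, ← lintegral_comp_add_mul_sign he
              (fun v => ∫⁻ ζ, S.indicator (fun y =>
                ENNReal.ofReal (pairKer x.1 y.1 x.2 y.2) * g y) (v, ζ) ∂(surf n)) x.1]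
          congr 1
          refine lintegral_congr fun r => ?_
          by_cases hr : r ∈ Ioc 0 ρ
          · rw [indicator_of_mem hr]
            refine lintegral_congr fun ζ => ?_
            rw [indicator_of_mem]
            rw [hS, mem_ofPred_eq, he2]; exact hr
          · rw [indicator_of_notMem hr]
            symm
            rw [lintegral_eq_zero_of_ae_eq_zero]
            refine .of_forall fun ζ => ?_
            refine indicator_of_notMem ?_ _
            rw [hS, mem_ofPred_eq, he2]; exact hr
      _ = _ := by
          rw [← lintegral_indicator hSm, lintegral_prod _ (hmk.indicator hSm).aemeasurable]
  have hstep2 : ∫⁻ y in S, ENNReal.ofReal (pairKer x.1 y.1 x.2 y.2) * g y ∂(cylMeasure n) ≤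
      ENNReal.ofReal C *
        ∫⁻ y in S, ENNReal.ofReal (|y.1 - x.1| / dist y x ^ n) * g y ∂(cylMeasure n) := by
    rw [← lintegral_const_mul' _ _ ENNReal.ofReal_ne_top]
    refine setLIntegral_mono' hSm fun y hy => ?_
    rw [← mul_assoc, ← ENNReal.ofReal_mul hC.le]
    gcongr
    obtain ⟨h1, h2, h3⟩ := hrange y hy
    exact hker x.2 y h1 h2 h3
  -- Outside the ball the kernel is at most ρ R₁^{-n}, and by Hölder the integral of g over the slab
  -- is O(ρ^{1-1/p}). The product is o(ρ).
  have hfar : ∫⁻ y in S \ Metric.ball x R₁, ENNReal.ofReal (|y.1 - x.1| / dist y x ^ n) * g y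
      ∂(cylMeasure n) ≤ ENNReal.ofReal (δ * ρ) := by
    calc _ ≤ ∫⁻ y in S \ Metric.ball x R₁, ENNReal.ofReal (ρ * (R₁ ^ n)⁻¹) * g y
          ∂(cylMeasure n) := by
          refine setLIntegral_mono' (hSm.diff Metric.isOpen_ball.measurableSet) fun y hy => ?_
          rw [div_eq_mul_inv]
          have h1 : R₁ ≤ dist y x := not_lt.1 fun h => hy.2 h
          have h2 : |y.1 - x.1| ≤ ρ := (habs y hy.1).le.trans hy.1.2
          gcongr
      _ ≤ ∫⁻ y in S, ENNReal.ofReal (ρ * (R₁ ^ n)⁻¹) * g y ∂(cylMeasure n) :=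
          lintegral_mono_set sdiff_subset
      _ = ENNReal.ofReal (ρ * (R₁ ^ n)⁻¹) * ∫⁻ y in S, g y ∂(cylMeasure n) :=
          lintegral_const_mul' _ _ ENNReal.ofReal_ne_top
      _ ≤ ENNReal.ofReal (ρ * (R₁ ^ n)⁻¹) * ENNReal.ofReal (M.toReal ^ (1 / p) *
            (ρ * sphereArea n) ^ (1 - 1 / p)) := by
          gcongr
          refine (setLIntegral_le_rpow_mul _ hp hgm _).trans ?_
          rw [ENNReal.ofReal_mul (by positivity), ← ENNReal.ofReal_rpow_of_nonneg
            ENNReal.toReal_nonneg (by positivity), ENNReal.ofReal_toReal hM.ne,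
            ← ENNReal.ofReal_rpow_of_nonneg (by positivity) hlam.le]
          gcongr
          · exact lintegral_mono_set fun y hy => ⟨⟨(hrange y hy).1, (hrange y hy).2.1⟩, mem_univ _⟩
          · have : S = {v : ℝ | e * (v - x.1) ∈ Ioc 0 ρ} ×ˢ univ := by
              ext y; simp [hS]
            rw [this, Measure.prod_prod, surf_univ hn1, ENNReal.ofReal_mul hρ.le]
            gcongr
            have hs : MeasurableSet {v : ℝ | e * (v - x.1) ∈ Ioc 0 ρ} :=
              (measurable_const.mul (measurable_id.sub_const _)) measurableSet_Ioc
            rw [← lintegral_indicator_one hs, ← lintegral_comp_add_mul_sign he _ x.1]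
            have h2 : ∀ r, {v : ℝ | e * (v - x.1) ∈ Ioc 0 ρ}.indicator
                (1 : ℝ → ℝ≥0∞) (x.1 + e * r) = (Ioc 0 ρ).indicator 1 r := fun r =>
              indicator_eq_indicator (by rw [mem_ofPred_eq, he2]) rfl
            simp_rw [h2]
            rw [lintegral_indicator_one measurableSet_Ioc, Real.volume_Ioc, sub_zero]
      _ ≤ _ := by
          rw [← ENNReal.ofReal_mul (by positivity)]
          refine ENNReal.ofReal_le_ofReal ?_
          have := (mem_ofPred_eq ▸ hr₁s ⟨hρ, hρ1⟩ : _ < δ).le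
          calc _ = (R₁ ^ n)⁻¹ * (M.toReal ^ (1 / p) * (ρ * sphereArea n) ^ (1 - 1 / p)) * ρ := by
                ring
            _ ≤ _ := by gcongr
  have hne : ∫⁻ y in S ∩ Metric.ball x R₁, ENNReal.ofReal (|y.1 - x.1| / dist y x ^ n) * g y
      ∂(cylMeasure n) ≤ ENNReal.ofReal (δ * ρ) := by
    refine (hnear g hgm x _ R₁ (by positivity) hR₁ hR₁2 hLeb e ρ he hρ).trans_eq ?_
    congr 1
    rw [← Real.rpow_mul (by positivity), mul_one_div_cancel hp0.ne', Real.rpow_one]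
    field_simp
  have hsum : ∫⁻ y in S, ENNReal.ofReal (|y.1 - x.1| / dist y x ^ n) * g y ∂(cylMeasure n) ≤
      ENNReal.ofReal (2 * δ * ρ) := by
    rw [← lintegral_inter_add_sdiff _ S Metric.isOpen_ball.measurableSet (B := Metric.ball x R₁)]
    refine (add_le_add hne hfar).trans_eq ?_
    rw [← ENNReal.ofReal_add (by positivity) (by positivity)]
    congr 1
    ring
  refine hstep1.trans ((mul_le_mul_right (hstep2.trans (mul_le_mul_right hsum _)) _).trans_eq ?_)
  rw [← ENNReal.ofReal_mul (by positivity), ← ENNReal.ofReal_mul (by positivity)]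
  congr 1
  rw [hδ]
  field_simp

/-! ### Reduction of the cylinder to a half-line and inversion of one factor -/

theorem pairKer_nonneg {n : ℕ} {a b : ℝ} (ha : 0 < a) (hb : 0 < b) (ξ η : Sph n) :
    0 ≤ pairKer a b ξ η := by
  unfold pairKer poissonKer
  refine div_nonneg ?_ (by positivity)
  have hm : 0 < max a b := lt_max_of_lt_left ha
  rw [Real.sq_sqrt (div_nonneg (le_min ha.le hb.le) hm.le), sub_nonneg, div_le_one hm]
  exact min_le_max

/-- The kernel `pairKer`, extended by zero to nonpositive values of the second variable. -/
noncomputable def cutPairKer {n : ℕ} (x z : ℝ × Sph n) : ℝ :=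
  open Classical in if 0 < z.1 then pairKer x.1 z.1 x.2 z.2 else 0

theorem cutPairKer_nonneg {n : ℕ} {x : ℝ × Sph n} (hx : 0 < x.1) (z : ℝ × Sph n) :
    0 ≤ cutPairKer x z := by
  unfold cutPairKer
  split_ifs with h
  · exact pairKer_nonneg hx h _ _
  · exact le_rfl

theorem measurable_cutPairKer {n : ℕ} (x : ℝ × Sph n) : Measurable (cutPairKer x) := by
  unfold cutPairKer
  refine Measurable.ite (measurableSet_lt measurable_const measurable_fst) ?_ measurable_const
  unfold pairKer poissonKer
  fun_prop

theorem integral_comp_add_mul_sign {e : ℝ} (he : e = 1 ∨ e = -1) (G : ℝ → ℂ) (s : ℝ) :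
    ∫ r, G (s + e * r) = ∫ v, G v := by
  rcases he with rfl | rfl
  · simpa using integral_add_left_eq_self G s
  · simpa [sub_eq_add_neg] using integral_sub_left_eq_self G volume s

theorem quasiMeasurePreserving_add_mul_sign {e : ℝ} (he : e = 1 ∨ e = -1) (s : ℝ) :
    Measure.QuasiMeasurePreserving (fun r : ℝ => s + e * r) volume volume := by
  rcases he with rfl | rfl
  · simpa using (measurePreserving_add_left volume s).quasiMeasurePreserving
  · simpa [sub_eq_add_neg] using (Measure.measurePreserving_sub_left volume s).quasiMeasurePreserving

theorem add_mul_sign {e : ℝ} (he : e = 1 ∨ e = -1) (s r : ℝ) : e * (s + e * r - s) = r := by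
  rcases he with rfl | rfl <;> ring

/-- Fubini in the variable r = e(z.1 - s), the distance from s in the direction e; for a ≥ 0 only r
> 0 contributes. -/
theorem lintegral_shiftKer_cyl {n : ℕ} {β e s a : ℝ} (he : e = 1 ∨ e = -1) (ha : 0 ≤ a)
    {B : ℝ × Sph n → ℝ≥0∞} (hB : Measurable B) :
    ∫⁻ z, ENNReal.ofReal (shiftKer β a (e * (z.1 - s))) * B z ∂(cylMeasure n) =
      ∫⁻ r in Ioi (0 : ℝ), ENNReal.ofReal (shiftKer β a r) * ∫⁻ ζ, B (s + e * r, ζ) ∂(surf n) := by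
  have hm : Measurable (shiftKer β a) := (measurable_shiftKer β).comp measurable_prodMk_left
  have hmB : Measurable fun z : ℝ × Sph n =>
      ENNReal.ofReal (shiftKer β a (e * (z.1 - s))) * B z :=
    (hm.comp (by fun_prop)).ennreal_ofReal.mul hB
  rw [lintegral_prod _ hmB.aemeasurable,
    ← lintegral_comp_add_mul_sign he _ s, ← lintegral_indicator measurableSet_Ioi]
  refine lintegral_congr fun r => ?_
  simp only [add_mul_sign he]
  rw [lintegral_const_mul' _ _ ENNReal.ofReal_ne_top]
  by_cases hr : r ∈ Ioi (0 : ℝ)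
  · rw [indicator_of_mem hr]
  · rw [indicator_of_notMem hr]
    have : r ∉ Ioi a := fun h => hr (lt_of_le_of_lt ha h)
    rw [shiftKer, indicator_of_notMem this, mul_zero, ENNReal.ofReal_zero, zero_mul]

theorem integral_shiftKer_cyl {n : ℕ} {β e s a : ℝ} (hβ : 0 < β) (he : e = 1 ∨ e = -1) (ha : 0 ≤ a)
    {V : ℝ × Sph n → ℂ} (hV : Measurable V)
    (hfin : ∫⁻ z, ENNReal.ofReal (shiftKer β a (e * (z.1 - s))) * ‖V z‖ₑ ∂(cylMeasure n) < ⊤) :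
    ∫ z, shiftKer β a (e * (z.1 - s)) • V z ∂(cylMeasure n) =
      ∫ r in Ioi (0 : ℝ), shiftKer β a r • ∫ ζ, V (s + e * r, ζ) ∂(surf n) := by
  have hm : Measurable (shiftKer β a) := (measurable_shiftKer β).comp measurable_prodMk_left
  have hInt : Integrable (fun z : ℝ × Sph n => shiftKer β a (e * (z.1 - s)) • V z)
      (cylMeasure n) := by
    refine ⟨((hm.comp (by fun_prop)).smul hV).aestronglyMeasurable, ?_⟩
    rw [hasFiniteIntegral_iff_enorm]
    refine lt_of_eq_of_lt (lintegral_congr fun z => ?_) hfin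
    rw [enorm_smul, Real.enorm_of_nonneg (shiftKer_nonneg hβ _ _)]
  rw [integral_prod _ hInt, ← integral_comp_add_mul_sign he _ s,
    ← integral_indicator measurableSet_Ioi]
  refine integral_congr_ae (.of_forall fun r => ?_)
  simp only [add_mul_sign he]
  rw [integral_smul]
  by_cases hr : r ∈ Ioi (0 : ℝ)
  · rw [indicator_of_mem hr]
  · rw [indicator_of_notMem hr]
    have : r ∉ Ioi a := fun h => hr (lt_of_le_of_lt ha h)
    rw [shiftKer, indicator_of_notMem this, mul_zero, zero_smul]

theorem fracKer_eq_shiftKer {n : ℕ} {β e : ℝ} (he : e = 1 ∨ e = -1) {x : ℝ × Sph n} (hx : 0 < x.1)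
    (z : ℝ × Sph n) :
    fracKer β e x z = (sphereArea n)⁻¹ * (shiftKer β 0 (e * (z.1 - x.1)) * cutPairKer x z) := by
  have hee : |e| = 1 := by rcases he with rfl | rfl <;> simp
  unfold fracKer shiftKer cutPairKer
  by_cases hz : 0 < z.1
  · by_cases hz' : 0 < e * (z.1 - x.1)
    · have : |z.1 - x.1| = e * (z.1 - x.1) := by
        rw [← one_mul |z.1 - x.1|, ← hee, ← abs_mul, abs_of_pos hz']
      rw [if_pos ⟨hx, hz, hz'⟩, if_pos hz, indicator_of_mem (mem_Ioi.2 hz'), this, sub_zero,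
          mul_inv]
      ring
    · rw [if_neg (fun h => hz' h.2.2), indicator_of_notMem (by simpa using hz')]
      ring
  · rw [if_neg (fun h => hz h.2.1), if_neg hz]
    ring

/-- After the Poisson integral from x to the level x.1 + ea, the angular kernel is based at x itself
and no longer depends on a. The shift a survives only in the one-dimensional factor, and this
reduces the inversion to a half-line. -/
theorem lintegral_pairKer_mul_fracKer_eq_shiftKer {n : ℕ} (hn : 1 ≤ n) {β e : ℝ} (hβ : 0 < β)
    (he : e = 1 ∨ e = -1) {x : ℝ × Sph n} (hx : 0 < x.1) {a : ℝ} (ha : 0 < a)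
    (hv : 0 < x.1 + e * a) (z : ℝ × Sph n) :
    ∫⁻ ζ, ENNReal.ofReal (pairKer x.1 (x.1 + e * a) x.2 ζ) *
      ENNReal.ofReal (fracKer β e (x.1 + e * a, ζ) z) ∂(surf n) =
      ENNReal.ofReal (shiftKer β a (e * (z.1 - x.1)) * cutPairKer x z) := by
  have hee : |e| = 1 := by rcases he with rfl | rfl <;> simp
  rw [lintegral_pairKer_mul_fracKer hn hβ he hx hv (by rw [add_mul_sign he]; exact ha)]
  congr 1
  have hd : e * (z.1 - (x.1 + e * a)) = e * (z.1 - x.1) - a := by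
    rcases he with rfl | rfl <;> ring
  unfold shiftKer cutPairKer
  by_cases hz : 0 < z.1
  · by_cases hz' : 0 < e * (z.1 - (x.1 + e * a))
    · have : |z.1 - (x.1 + e * a)| = e * (z.1 - x.1) - a := by
        rw [← one_mul |z.1 - _|, ← hee, ← abs_mul, abs_of_pos hz', hd]
      rw [if_pos hz, indicator_of_mem (show z.1 ∈ Ioi (0 : ℝ) ∩ _ from ⟨hz, hz'⟩),
        indicator_of_mem (show e * (z.1 - x.1) ∈ Ioi a by rw [mem_Ioi]; linarith), this]
      ring
    · rw [indicator_of_notMem (fun h => hz' h.2),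
        indicator_of_notMem (show e * (z.1 - x.1) ∉ Ioi a by rw [mem_Ioi]; linarith)]
      ring
  · rw [if_neg hz, indicator_of_notMem (fun h => hz h.1)]
    ring

/-- If `r^{β-1} g` is integrable then the fractional integral of `g` is finite almost
everywhere. -/
theorem ae_lintegral_shiftKer_lt_top {β : ℝ} (hβ : 0 < β) {g : ℝ → ℝ≥0∞} (hg : Measurable g)
    (hfin : ∫⁻ r in Ioi (0 : ℝ), ENNReal.ofReal (shiftKer β 0 r) * g r < ⊤) :
    ∀ᵐ a : ℝ, 0 < a → ∫⁻ r in Ioi (0 : ℝ), ENNReal.ofReal (shiftKer β a r) * g r < ⊤ := by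
  have hΓ := Real.Gamma_pos_of_pos hβ
  have hΓ1 := Real.Gamma_pos_of_pos (show 0 < β + 1 by linarith)
  -- Integrating over a > ε against a^{-1-β} and exchanging the order gives, by the case j = 1 of
  -- `lintegral_rpow_mul_shiftKer`, at most a multiple of the integral of r^{β-1} g.
  have hkey : ∀ N : ℕ, ∀ᵐ a ∂(volume.restrict (Ioi (1 / ((N : ℝ) + 1)))),
      ∫⁻ r in Ioi (0 : ℝ), ENNReal.ofReal (shiftKer β a r) * g r < ⊤ := by
    intro N
    set ε := 1 / ((N : ℝ) + 1) with hε
    have hε0 : 0 < ε := by positivity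
    have hms := measurable_shiftKer β
    have hmP : Measurable fun q : ℝ × ℝ => ENNReal.ofReal (shiftKer β q.1 q.2) * g q.2 :=
      hms.ennreal_ofReal.mul (hg.comp measurable_snd)
    have hΦ : Measurable fun a => ENNReal.ofReal ((|a| ^ (1 + β))⁻¹) *
        ∫⁻ r in Ioi (0 : ℝ), ENNReal.ofReal (shiftKer β a r) * g r :=
      Measurable.mul (by fun_prop) hmP.lintegral_prod_right'
    have hlt : ∫⁻ a in Ioi ε, ENNReal.ofReal ((|a| ^ (1 + β))⁻¹) *
        ∫⁻ r in Ioi (0 : ℝ), ENNReal.ofReal (shiftKer β a r) * g r < ⊤ := by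
      set K := ε⁻¹ * (Real.Gamma (β + 1))⁻¹ * (ε ^ (β - 1))⁻¹ * Real.Gamma β with hK
      have hK0 : 0 ≤ K := by positivity
      calc _ = ∫⁻ a in Ioi ε, ∫⁻ r in Ioi (0 : ℝ), ENNReal.ofReal ((|a| ^ (1 + β))⁻¹) *
            (ENNReal.ofReal (shiftKer β a r) * g r) := by
            refine lintegral_congr fun a => ?_
            rw [lintegral_const_mul' _ _ ENNReal.ofReal_ne_top]
        _ = ∫⁻ r in Ioi (0 : ℝ), ∫⁻ a in Ioi ε, ENNReal.ofReal ((|a| ^ (1 + β))⁻¹) *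
            (ENNReal.ofReal (shiftKer β a r) * g r) := by
            refine lintegral_lintegral_swap (Measurable.aemeasurable ?_)
            have hw : Measurable fun q : ℝ × ℝ => ENNReal.ofReal ((|q.1| ^ (1 + β))⁻¹) := by
                fun_prop
            exact hw.mul hmP
        _ ≤ ∫⁻ r in Ioi (0 : ℝ), ENNReal.ofReal K * (ENNReal.ofReal (shiftKer β 0 r) * g r) := by
            refine setLIntegral_mono' measurableSet_Ioi fun r hr => ?_
            have hr : 0 < r := hr
            have h1 := lintegral_rpow_mul_shiftKer hβ hε0 hr 1
            simp only [Nat.cast_one, one_mul] at h1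
            simp_rw [← mul_assoc]
            have hw : Measurable fun a : ℝ => ENNReal.ofReal ((|a| ^ (1 + β))⁻¹) := by fun_prop
            have hw' : Measurable fun a : ℝ => ENNReal.ofReal (shiftKer β a r) :=
              (hms.comp measurable_prodMk_right).ennreal_ofReal
            have hww : Measurable fun a : ℝ =>
                ENNReal.ofReal ((|a| ^ (1 + β))⁻¹) * ENNReal.ofReal (shiftKer β a r) := hw.mul hw'
            rw [lintegral_mul_const _ hww, h1, ← ENNReal.ofReal_mul hK0]
            gcongr ENNReal.ofReal ?_ * _
            rw [shiftKer, indicator_of_mem (mem_Ioi.2 hr), sub_zero]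
            have h2 : max (r / ε - 1) 0 ≤ r / ε := max_le (by linarith) (by positivity)
            calc _ ≤ ε⁻¹ * ((Real.Gamma (β + 1))⁻¹ * ((r / ε)⁻¹ * (r / ε) ^ β)) := by gcongr
              _ = _ := by
                rw [hK, Real.div_rpow hr.le hε0.le, Real.rpow_sub_one hr.ne',
                  Real.rpow_sub_one hε0.ne']
                field_simp
        _ = ENNReal.ofReal K * ∫⁻ r in Ioi (0 : ℝ), ENNReal.ofReal (shiftKer β 0 r) * g r :=
            lintegral_const_mul' _ _ ENNReal.ofReal_ne_top
        _ < ⊤ := ENNReal.mul_lt_top ENNReal.ofReal_lt_top hfin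
    filter_upwards [ae_lt_top hΦ hlt.ne, ae_restrict_mem measurableSet_Ioi] with a ha ha'
    have ha0 : 0 < a := hε0.trans ha'
    refine (ENNReal.mul_lt_top_iff.1 ha).elim (fun h => h.2) fun h => ?_
    rcases h with h | h
    · rw [ENNReal.ofReal_eq_zero] at h
      have : 0 < (|a| ^ (1 + β))⁻¹ := by
        have := abs_pos.2 ha0.ne'
        positivity
      linarith
    · rw [h]; exact ENNReal.zero_lt_top
  have hall := ae_all_iff.2 fun N => (ae_restrict_iff' measurableSet_Ioi).1 (hkey N)
  filter_upwards [hall] with a ha ha0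
  obtain ⟨N, hN⟩ := exists_nat_one_div_lt ha0
  exact ha N hN

/-- The Poisson integrals of `k` on the side `e` of `x` converge, and the Marchaud derivative of
order `β` of these Poisson integrals converges to `c`. -/
def MarchaudInverts {n : ℕ} (β : ℝ) (ℓ : ℕ) (e : ℝ) (k : ℝ × Sph n → ℂ) (x : ℝ × Sph n) (c : ℂ) :
    Prop :=
  (∀ᵐ r : ℝ, 0 < r → 0 < x.1 + e * r →
    Integrable (fun ζ => pairKer x.1 (x.1 + e * r) x.2 ζ • k (x.1 + e * r, ζ)) (surf n)) ∧
  ∀ F : ℝ → ℂ, F 0 = k x → (∀ r, 0 < r → 0 < x.1 + e * r → F (-r) =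
    (sphereArea n)⁻¹ • ∫ ζ, pairKer x.1 (x.1 + e * r) x.2 ζ • k (x.1 + e * r, ζ) ∂(surf n)) →
    (∀ r, 0 < r → x.1 + e * r ≤ 0 → F (-r) = 0) →
    (∀ ε : ℝ, 0 < ε → IntegrableOn (marchaudIntegrand β ℓ F) (Ioi ε)) ∧
    Tendsto (fun ε : ℝ => ∫ τ in Ioi ε, marchaudIntegrand β ℓ F τ) (𝓝[>] 0) (𝓝 (kap β ℓ • c))

/-- Inversion of the fractional integral `k = M_e W` by a Marchaud derivative of Poisson
integrals of `k`, almost everywhere. -/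
theorem ae_tendsto_marchaud_poisson {n : ℕ} (hn : 2 ≤ n) {β : ℝ} (hβ : 0 < β) {ℓ : ℕ} (hℓ : β < ℓ)
    {e : ℝ} (he : e = 1 ∨ e = -1) {p : ℝ} (hp : 1 < p) {W : ℝ × Sph n → ℂ} (hW : Measurable W)
    (hloc : ∀ a b : ℝ, 0 < a → ∫⁻ y in Icc a b ×ˢ univ, ‖W y‖ₑ ^ p ∂(cylMeasure n) < ⊤)
    {I : Set ℝ} (hI0 : I ⊆ Ioi 0) (hI : ∀ s ∈ I, ∀ v, 0 < v → 0 < e * (v - s) → v ∈ I)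
    {k : ℝ × Sph n → ℂ}
    (hk : ∀ᵐ x ∂(cylMeasure n), x.1 ∈ I → k x = ∫ y, fracKer β e x y • W y ∂(cylMeasure n))
    (hfin : ∀ᵐ x ∂(cylMeasure n), x.1 ∈ I →
      ∫⁻ y, ENNReal.ofReal (fracKer β e x y) * ‖W y‖ₑ ∂(cylMeasure n) < ⊤) :
    ∀ᵐ x ∂(cylMeasure n), x.1 ∈ I → MarchaudInverts β ℓ e k x (W x) := by
  have hn1 : 1 ≤ n := by omega
  have hσ := sphereArea_pos hn1
  have hΓ := Real.Gamma_pos_of_pos hβ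
  -- The formula for k must hold for almost every ζ on almost every level, as the Poisson integrals
  -- are taken on single levels.
  have hkprod := Measure.ae_ae_of_ae_prod hk
  filter_upwards [hk, hfin, ae_lebesgue_poisson hn hp hW hloc] with x hkx hfinx hLeb hxI
  have hx : 0 < x.1 := hI0 hxI
  replace hLeb := hLeb hx e he
  have hcm := measurable_cutPairKer x
  have hc0 := cutPairKer_nonneg hx
  set V : ℝ × Sph n → ℂ := fun z => cutPairKer x z • W z with hV
  have hVm : Measurable V := hcm.smul hW
  have hVe : ∀ z, ‖V z‖ₑ = ENNReal.ofReal (cutPairKer x z) * ‖W z‖ₑ := fun z => by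
    rw [hV, enorm_smul, Real.enorm_of_nonneg (hc0 z)]
  set g : ℝ → ℝ≥0∞ := fun r => ∫⁻ ζ, ‖V (x.1 + e * r, ζ)‖ₑ ∂(surf n) with hg
  have hVsh : Measurable fun q : ℝ × Sph n => V (x.1 + e * q.1, q.2) := hVm.comp (by fun_prop)
  have hgm : Measurable g := hVsh.enorm.lintegral_prod_right'
  -- The function on the half-line: the Poisson integral at x of W on the level at distance r, zero
  -- where that level is not positive.
  set h : ℝ → ℂ := fun r => (sphereArea n)⁻¹ • ∫ ζ, V (x.1 + e * r, ζ) ∂(surf n) with hh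
  have hhm : Measurable h :=
    (hVsh.stronglyMeasurable.integral_prod_right'.measurable).const_smul (sphereArea n)⁻¹
  have hg0 : ∫⁻ r in Ioi (0 : ℝ), ENNReal.ofReal (shiftKer β 0 r) * g r < ⊤ := by
    rw [← lintegral_shiftKer_cyl (s := x.1) he le_rfl hVm.enorm]
    have h1 : ∀ z, ENNReal.ofReal (fracKer β e x z) * ‖W z‖ₑ = ENNReal.ofReal (sphereArea n)⁻¹ *
        (ENNReal.ofReal (shiftKer β 0 (e * (z.1 - x.1))) * ‖V z‖ₑ) := fun z => by
      rw [fracKer_eq_shiftKer he hx, ENNReal.ofReal_mul (by positivity),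
        ENNReal.ofReal_mul (shiftKer_nonneg hβ _ _), hVe]
      ring
    have h2 := hfinx hxI
    simp_rw [h1] at h2
    rw [lintegral_const_mul' _ _ ENNReal.ofReal_ne_top] at h2
    exact (ENNReal.mul_lt_top_iff.1 h2).elim (fun h => h.2) fun h => h.elim
      (fun h => absurd h (ENNReal.ofReal_pos.2 (inv_pos.2 hσ)).ne')
      (fun h => by rw [h]; exact ENNReal.zero_lt_top)
  have hga := ae_lintegral_shiftKer_lt_top hβ hgm hg0
  have hrepr : ∀ a, 0 ≤ a → ∫⁻ r in Ioi (0 : ℝ), ENNReal.ofReal (shiftKer β a r) * g r < ⊤ →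
      (sphereArea n)⁻¹ • ∫ z, (shiftKer β a (e * (z.1 - x.1)) * cutPairKer x z) • W z
        ∂(cylMeasure n) = ∫ r in Ioi (0 : ℝ), shiftKer β a r • h r := by
    intro a ha hlt
    simp_rw [mul_smul]
    rw [integral_shiftKer_cyl (V := V) hβ he ha hVm
      (by rw [lintegral_shiftKer_cyl he ha hVm.enorm]; exact hlt), ← integral_smul]
    refine integral_congr_ae (.of_forall fun r => ?_)
    simp only [hh]
    rw [smul_comm]
  -- The semigroup property in integrated form: the Poisson integral of k on the level at distance a
  -- is the fractional integral of h at a, up to normalization. The levels met stay in I by `hI`.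
  have hcomp : ∀ a, 0 < a → 0 < x.1 + e * a →
      ∫⁻ r in Ioi (0 : ℝ), ENNReal.ofReal (shiftKer β a r) * g r < ⊤ →
      (∀ᵐ ζ ∂(surf n), (x.1 + e * a, ζ).1 ∈ I → k (x.1 + e * a, ζ) =
        ∫ y, fracKer β e (x.1 + e * a, ζ) y • W y ∂(cylMeasure n)) →
      Integrable (fun ζ => pairKer x.1 (x.1 + e * a) x.2 ζ • k (x.1 + e * a, ζ)) (surf n) ∧
      ∫ ζ, pairKer x.1 (x.1 + e * a) x.2 ζ • k (x.1 + e * a, ζ) ∂(surf n) =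
        ∫ z, (shiftKer β a (e * (z.1 - x.1)) * cutPairKer x z) • W z ∂(cylMeasure n) := by
    intro a ha hv hlt hka
    have hvI : x.1 + e * a ∈ I := hI _ hxI _ hv (by rw [add_mul_sign he]; exact ha)
    have h1 := integral_kernel_comp (μ := surf n) (ν := cylMeasure n)
      (k₁ := pairKer x.1 (x.1 + e * a) x.2) (K₂ := fun ζ z => fracKer β e (x.1 + e * a, ζ) z)
      (k₃ := fun z => shiftKer β a (e * (z.1 - x.1)) * cutPairKer x z)
      (measurable_pairKer_right _ _ _) (fun ζ => pairKer_nonneg hx hv _ _)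
      ((measurable_fracKer β e).comp (by fun_prop :
        Measurable fun q : Sph n × ℝ × Sph n => ((x.1 + e * a, q.1), q.2)))
      (fun ζ z => fracKer_nonneg hn1 hβ _ _ _)
      (fun z => mul_nonneg (shiftKer_nonneg hβ _ _) (hc0 z))
      (.of_forall fun z => lintegral_pairKer_mul_fracKer_eq_shiftKer hn1 hβ he hx ha hv z) hW ?_
    · have heq : (fun ζ => pairKer x.1 (x.1 + e * a) x.2 ζ •
          ∫ y, fracKer β e (x.1 + e * a, ζ) y • W y ∂(cylMeasure n)) =ᵐ[surf n]
          fun ζ => pairKer x.1 (x.1 + e * a) x.2 ζ • k (x.1 + e * a, ζ) :=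
        hka.mono fun ζ hζ => by beta_reduce; rw [hζ hvI]
      exact ⟨h1.2.1.congr heq, (integral_congr_ae heq).symm.trans h1.2.2⟩
    · rw [← lintegral_shiftKer_cyl (s := x.1) he ha.le hVm.enorm] at hlt
      refine lt_of_eq_of_lt (lintegral_congr fun z => ?_) hlt
      rw [hVe, ENNReal.ofReal_mul (shiftKer_nonneg hβ _ _), mul_assoc]
  have hkae := (quasiMeasurePreserving_add_mul_sign he x.1).ae hkprod
  refine ⟨?_, fun F hF0 hF hFz => ?_⟩
  · filter_upwards [hga, hkae] with r hr hkr hr0 hv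
    exact (hcomp r hr0 hv (hr hr0) hkr).1
  have hfinh : ∫⁻ r in Ioi (0 : ℝ), ENNReal.ofReal (r ^ (β - 1)) * ‖h r‖ₑ < ⊤ := by
    refine lt_of_le_of_lt ?_ (ENNReal.mul_lt_top (ENNReal.ofReal_lt_top
      (r := Real.Gamma β * (sphereArea n)⁻¹)) hg0)
    rw [← lintegral_const_mul' _ _ ENNReal.ofReal_ne_top]
    refine setLIntegral_mono' measurableSet_Ioi fun r hr => ?_
    have hr : 0 < r := hr
    have h1 : ‖h r‖ₑ ≤ ENNReal.ofReal (sphereArea n)⁻¹ * g r := by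
      rw [hh, enorm_smul, Real.enorm_of_nonneg (inv_pos.2 hσ).le]
      gcongr
      exact enorm_integral_le_lintegral_enorm _
    calc _ ≤ ENNReal.ofReal (r ^ (β - 1)) * (ENNReal.ofReal (sphereArea n)⁻¹ * g r) := by gcongr
      _ = _ := by
        rw [← mul_assoc, ← mul_assoc, ← ENNReal.ofReal_mul (by positivity),
          ← ENNReal.ofReal_mul (by positivity), shiftKer, indicator_of_mem (mem_Ioi.2 hr), sub_zero]
        congr 2
        field_simp
  have hF0' : F 0 = ∫ r in Ioi (0 : ℝ), shiftKer β 0 r • h r := by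
    rw [hF0, hkx hxI, ← hrepr 0 le_rfl hg0, ← integral_smul]
    refine integral_congr_ae (.of_forall fun z => ?_)
    beta_reduce
    rw [fracKer_eq_shiftKer he hx, smul_smul]
  have hF' : ∀ᵐ a : ℝ, 0 < a → F (-a) = ∫ r in Ioi (0 : ℝ), shiftKer β a r • h r := by
    filter_upwards [hga, hkae] with a hla hka ha
    by_cases hv : 0 < x.1 + e * a
    · rw [hF a ha hv, (hcomp a ha hv (hla ha) hka).2, hrepr a ha.le (hla ha)]
    -- This occurs only for e = -1, when the levels have run past 0; then h vanishes beyond a and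
    -- both sides are 0.
    · rw [hFz a ha (not_lt.1 hv)]
      symm
      refine integral_eq_zero_of_ae ((ae_restrict_iff' measurableSet_Ioi).2
        (.of_forall fun r hr => ?_))
      have hr : 0 < r := hr
      beta_reduce
      by_cases hra : r ∈ Ioi a
      · have hra : a < r := hra
        have hvr : ¬ 0 < x.1 + e * r := by
          rcases he with rfl | rfl
          · exact absurd (by linarith) hv
          · linarith
        have : h r = 0 := by
          simp only [hh, hV, cutPairKer, if_neg hvr, zero_smul, integral_zero, smul_zero]
        rw [this, smul_zero]; rfl
      · rw [shiftKer, indicator_of_notMem hra, mul_zero, zero_smul]; rfl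
  refine ⟨fun ε hε => (integral_marchaudIntegrand hβ ℓ hhm hfinh hF0' hF' hε).1,
    tendsto_integral_marchaudIntegrand hβ hℓ hhm hfinh hF0' hF' fun η hη => ?_⟩
  obtain ⟨r₀, hr₀, hle⟩ := hLeb η hη
  -- Within distance x.1/2 all levels are positive, so the cut-off in `cutPairKer` is inactive.
  refine ⟨min r₀ (x.1 / 2), lt_min hr₀ (by linarith), fun ρ hρ hρr => ?_⟩
  refine le_of_eq_of_le ?_ (hle ρ hρ (hρr.trans (min_le_left _ _)))
  refine setLIntegral_congr_fun measurableSet_Ioc fun r hr => ?_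
  have hrx : r ≤ x.1 / 2 := hr.2.trans (hρr.trans (min_le_right _ _))
  have hv : 0 < x.1 + e * r := by
    rcases he with rfl | rfl <;> linarith [hr.1]
  simp only [hh, hV, cutPairKer, if_pos hv]

/-! ### Local L^p bounds and the two-step inversion on the cylinder -/

theorem fracKer_swap {n : ℕ} (β e : ℝ) (x y : ℝ × Sph n) :
    fracKer β e x y = fracKer β (-e) y x := by
  unfold fracKer
  have h : (0 < x.1 ∧ 0 < y.1 ∧ 0 < e * (y.1 - x.1)) ↔
      (0 < y.1 ∧ 0 < x.1 ∧ 0 < -e * (x.1 - y.1)) := by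
    rw [show -e * (x.1 - y.1) = e * (y.1 - x.1) by ring]
    tauto
  simp only [h]
  rw [abs_sub_comm, pairKer_comm, pairKer_symm]

theorem neg_sign {e : ℝ} (he : e = 1 ∨ e = -1) : -e = 1 ∨ -e = -1 := by
  rcases he with rfl | rfl <;> simp

/-- The Schur test. -/
theorem lintegral_schur {X Y : Type*} [MeasurableSpace X] [MeasurableSpace Y] (μ : Measure X)
    (ν : Measure Y) [SFinite μ] [SFinite ν] {K : X → Y → ℝ≥0∞} (hK :
      Measurable (Function.uncurry K))
    {C : ℝ≥0∞} (hC : C ≠ ⊤) (h₁ : ∀ x, ∫⁻ y, K x y ∂ν ≤ C) (h₂ : ∀ y, ∫⁻ x, K x y ∂μ ≤ C) {p : ℝ}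
    (hp : 1 < p) {g : Y → ℝ≥0∞} (hg : Measurable g) (hgp : ∫⁻ y, g y ^ p ∂ν < ⊤) :
    ∫⁻ x, (∫⁻ y, K x y * g y ∂ν) ^ p ∂μ < ⊤ := by
  have hp0 : 0 < p := by linarith
  have hKx : ∀ x, Measurable (K x) := fun x => hK.comp measurable_prodMk_left
  -- Hölder's inequality for the measure with density K(x, ·), whose total mass is at most C.
  have hpt : ∀ x, (∫⁻ y, K x y * g y ∂ν) ^ p ≤ (∫⁻ y, K x y * g y ^ p ∂ν) * C ^ (p - 1) := by
    intro x
    have h := setLIntegral_le_rpow_mul (ν.withDensity (K x)) hp hg univ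
    rw [setLIntegral_univ, setLIntegral_univ, withDensity_apply _ MeasurableSet.univ,
      setLIntegral_univ, lintegral_withDensity_eq_lintegral_mul _ (hKx x) hg,
      lintegral_withDensity_eq_lintegral_mul _ (hKx x) (hg.pow_const p)] at h
    simp only [Pi.mul_apply] at h
    calc _ ≤ ((∫⁻ y, K x y * g y ^ p ∂ν) ^ (1 / p) * (∫⁻ y, K x y ∂ν) ^ (1 - 1 / p)) ^ p := by
          gcongr
      _ = (∫⁻ y, K x y * g y ^ p ∂ν) * (∫⁻ y, K x y ∂ν) ^ (p - 1) := by
          rw [ENNReal.mul_rpow_of_nonneg _ _ hp0.le, ← ENNReal.rpow_mul, ← ENNReal.rpow_mul,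
            one_div_mul_cancel hp0.ne', ENNReal.rpow_one]
          congr 2
          field_simp
      _ ≤ _ := by
          gcongr
          exact h₁ x
  have hCp : C ^ (p - 1) ≠ ⊤ := ENNReal.rpow_ne_top_of_nonneg (by linarith) hC
  calc _ ≤ ∫⁻ x, (∫⁻ y, K x y * g y ^ p ∂ν) * C ^ (p - 1) ∂μ := lintegral_mono hpt
    _ = (∫⁻ x, ∫⁻ y, K x y * g y ^ p ∂ν ∂μ) * C ^ (p - 1) := lintegral_mul_const' _ _ hCp
    _ = (∫⁻ y, ∫⁻ x, K x y * g y ^ p ∂μ ∂ν) * C ^ (p - 1) := by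
        rw [lintegral_lintegral_swap]
        exact (hK.mul ((hg.pow_const p).comp measurable_snd)).aemeasurable
    _ ≤ (∫⁻ y, C * g y ^ p ∂ν) * C ^ (p - 1) := by
        gcongr with y
        have hKy : Measurable fun x => K x y := hK.comp measurable_prodMk_right
        rw [lintegral_mul_const _ hKy]
        gcongr
        exact h₂ y
    _ = (C * ∫⁻ y, g y ^ p ∂ν) * C ^ (p - 1) := by rw [lintegral_const_mul' _ _ hC]
    _ < ⊤ := ENNReal.mul_lt_top (ENNReal.mul_lt_top hC.lt_top hgp) hCp.lt_top

theorem lintegral_cutPairKer_le {n : ℕ} (hn : 1 ≤ n) {x : ℝ × Sph n} (hx : 0 < x.1) (v : ℝ) :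
    ∫⁻ ζ, ENNReal.ofReal (cutPairKer x (v, ζ)) ∂(surf n) ≤ ENNReal.ofReal (sphereArea n) := by
  unfold cutPairKer
  by_cases hv : 0 < v
  · simp only [hv, if_true]
    by_cases hne : x.1 = v
    · have : ∀ ζ, pairKer x.1 v x.2 ζ = 0 := by
        intro ζ
        rw [← hne, pairKer, min_self, max_self, div_self hx.ne', Real.sqrt_one, poissonKer]
        simp
      simp [this]
    · exact (lintegral_pairKer hn hx hv hne x.2).le
  · simp [hv]

/-- Mass of the fractional kernel at bounded distance. -/
theorem lintegral_fracKer_near_le {n : ℕ} (hn : 1 ≤ n) {β : ℝ} (hβ : 0 < β) {e : ℝ}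
    (he : e = 1 ∨ e = -1) {L : ℝ} (hL : 0 ≤ L) (x : ℝ × Sph n) :
    ∫⁻ y, {y : ℝ × Sph n | e * (y.1 - x.1) ≤ L}.indicator
      (fun y => ENNReal.ofReal (fracKer β e x y)) y ∂(cylMeasure n) ≤
      ENNReal.ofReal ((Real.Gamma β)⁻¹ * (L ^ β / β)) := by
  have hσ := sphereArea_pos hn
  have hΓ := Real.Gamma_pos_of_pos hβ
  by_cases hx : 0 < x.1
  · have hSm : MeasurableSet {y : ℝ × Sph n | e * (y.1 - x.1) ≤ L} :=
      measurableSet_le (by fun_prop) measurable_const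
    set B : ℝ × Sph n → ℝ≥0∞ := {y : ℝ × Sph n | e * (y.1 - x.1) ≤ L}.indicator
      (fun y => ENNReal.ofReal (cutPairKer x y)) with hB
    have hBm : Measurable B := (measurable_cutPairKer x).ennreal_ofReal.indicator hSm
    have h1 : ∀ y, {y : ℝ × Sph n | e * (y.1 - x.1) ≤ L}.indicator
        (fun y => ENNReal.ofReal (fracKer β e x y)) y = ENNReal.ofReal (sphereArea n)⁻¹ *
        (ENNReal.ofReal (shiftKer β 0 (e * (y.1 - x.1))) * B y) := by
      intro y
      rw [hB]
      by_cases hy : y ∈ {y : ℝ × Sph n | e * (y.1 - x.1) ≤ L}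
      · rw [indicator_of_mem hy, indicator_of_mem hy, fracKer_eq_shiftKer he hx,
          ENNReal.ofReal_mul (by positivity), ENNReal.ofReal_mul (shiftKer_nonneg hβ _ _)]
      · rw [indicator_of_notMem hy, indicator_of_notMem hy, mul_zero, mul_zero]
    simp_rw [h1]
    rw [lintegral_const_mul' _ _ ENNReal.ofReal_ne_top, lintegral_shiftKer_cyl he le_rfl hBm]
    have h2 : ∫⁻ r in Ioi (0 : ℝ), ENNReal.ofReal (shiftKer β 0 r) *
        ∫⁻ ζ, B (x.1 + e * r, ζ) ∂(surf n) ≤ ∫⁻ r in Ioo 0 L,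
        ENNReal.ofReal ((Real.Gamma β)⁻¹ * sphereArea n) * ENNReal.ofReal (r ^ (β - 1)) := by
      rw [setLIntegral_congr Ioo_ae_eq_Ioc, ← lintegral_indicator measurableSet_Ioi,
        ← lintegral_indicator measurableSet_Ioc]
      refine lintegral_mono fun r => ?_
      by_cases hr : r ∈ Ioi (0 : ℝ)
      · have hr' : 0 < r := hr
        rw [indicator_of_mem hr]
        by_cases hrL : r ≤ L
        · rw [indicator_of_mem (show r ∈ Ioc 0 L from ⟨hr, hrL⟩), shiftKer, indicator_of_mem hr,
            sub_zero, ← ENNReal.ofReal_mul (by positivity),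
            show (Real.Gamma β)⁻¹ * sphereArea n * r ^ (β - 1) =
              (Real.Gamma β)⁻¹ * r ^ (β - 1) * sphereArea n by ring,
            ENNReal.ofReal_mul (p := (Real.Gamma β)⁻¹ * r ^ (β - 1)) (by positivity)]
          gcongr
          refine le_trans (lintegral_mono fun ζ => ?_)
            (lintegral_cutPairKer_le hn hx (x.1 + e * r))
          exact indicator_le_self _ _ _
        · have : ∀ ζ, B (x.1 + e * r, ζ) = 0 := fun ζ => by
            rw [hB]
            refine indicator_of_notMem ?_ _
            rw [mem_ofPred_eq, add_mul_sign he]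
            exact hrL
          simp [this]
      · rw [indicator_of_notMem hr]
        exact zero_le
    refine (mul_le_mul_right h2 _).trans_eq ?_
    rw [lintegral_const_mul' _ _ ENNReal.ofReal_ne_top, lintegral_Ioo_rpow hβ hL,
      ← ENNReal.ofReal_mul (by positivity), ← ENNReal.ofReal_mul (by positivity)]
    congr 1
    field_simp
  · have : ∀ y, fracKer β e x y = 0 := fun y => if_neg fun h => hx h.1
    simp [this, indicator]

/-- Local `L^p` bounds for the fractional integral. -/
theorem lintegral_fracKer_rpow_lt_top {n : ℕ} (hn : 1 ≤ n) {β : ℝ} (hβ : 0 < β) {e : ℝ}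
    (he : e = 1 ∨ e = -1) {p : ℝ} (hp : 1 < p) {I : Set ℝ} {ψ : ℝ × Sph n → ℂ} (hψ : Measurable ψ)
    (hψI : ∀ z, z.1 ∉ I → ψ z = 0)
    (hloc : ∀ a b : ℝ, 0 < a → ∫⁻ y in Icc a b ×ˢ univ, ‖ψ y‖ₑ ^ p ∂(cylMeasure n) < ⊤)
    {a b a' b' : ℝ} (ha' : 0 < a')
    (hI : ∀ s ∈ Icc a b, ∀ t ∈ I, 0 < e * (t - s) → t ∈ Icc a' b') :
    ∫⁻ x in Icc a b ×ˢ univ, (∫⁻ y, ENNReal.ofReal (fracKer β e x y) * ‖ψ y‖ₑ ∂(cylMeasure n)) ^ p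
      ∂(cylMeasure n) < ⊤ := by
  have hp0 : 0 < p := by linarith
  have hee : |e| = 1 := by rcases he with rfl | rfl <;> simp
  -- The one-sided kernel has infinite total mass, so it is cut at a distance that pairs from [a, b]
  -- and [a', b'] never exceed. The Schur test then applies with `lintegral_fracKer_near_le`; the
  -- transposed kernel is the one for -e.
  set L := |b| + |b'| with hL
  set T : Set ((ℝ × Sph n) × ℝ × Sph n) := {q | e * (q.2.1 - q.1.1) ≤ L} with hT
  have hTm : MeasurableSet T := measurableSet_le (by fun_prop) measurable_const
  set K : ℝ × Sph n → ℝ × Sph n → ℝ≥0∞ := fun x y =>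
    T.indicator (fun q => ENNReal.ofReal (fracKer β e q.1 q.2)) (x, y) with hK
  have hKm : Measurable (Function.uncurry K) :=
    (measurable_fracKer β e).ennreal_ofReal.indicator hTm
  set S : Set (ℝ × Sph n) := Icc a' b' ×ˢ univ with hS
  have hSm : MeasurableSet S := measurableSet_Icc.prod MeasurableSet.univ
  set g : ℝ × Sph n → ℝ≥0∞ := S.indicator fun y => ‖ψ y‖ₑ with hg
  have hgm : Measurable g := hψ.enorm.indicator hSm
  have hgp : ∫⁻ y, g y ^ p ∂(cylMeasure n) < ⊤ := by
    refine lt_of_eq_of_lt ?_ (hloc a' b' ha')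
    rw [← lintegral_indicator hSm]
    refine lintegral_congr fun y => ?_
    by_cases hy : y ∈ S
    · rw [hg, indicator_of_mem hy, indicator_of_mem hy]
    · rw [hg, indicator_of_notMem hy, indicator_of_notMem hy, ENNReal.zero_rpow_of_pos hp0]
  have hSch := lintegral_schur (cylMeasure n) (cylMeasure n) hKm
    (C := ENNReal.ofReal ((Real.Gamma β)⁻¹ * (L ^ β / β))) ENNReal.ofReal_ne_top
    (fun x => ?_) (fun y => ?_) hp hgm hgp
  · refine lt_of_le_of_lt ?_ hSch
    refine le_trans ?_ (setLIntegral_le_lintegral (Icc a b ×ˢ univ) _)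
    refine setLIntegral_mono' (measurableSet_Icc.prod MeasurableSet.univ) fun x hx => ?_
    refine ENNReal.rpow_le_rpow (lintegral_mono fun y => ?_) hp0.le
    by_cases h0 : fracKer β e x y = 0
    · rw [h0, ENNReal.ofReal_zero, zero_mul]; exact zero_le
    by_cases hyI : y.1 ∈ I
    · have hc : 0 < x.1 ∧ 0 < y.1 ∧ 0 < e * (y.1 - x.1) := by
        by_contra hc
        exact h0 (if_neg hc)
      have hy := hI x.1 hx.1 y.1 hyI hc.2.2
      have hTq : (x, y) ∈ T := by
        rw [hT, mem_ofPred_eq]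
        calc e * (y.1 - x.1) ≤ |e * (y.1 - x.1)| := le_abs_self _
          _ = |y.1 - x.1| := by rw [abs_mul, hee, one_mul]
          _ ≤ |y.1| + |x.1| := abs_sub _ _
          _ ≤ L := by
            rw [abs_of_pos hc.1, abs_of_pos hc.2.1, hL]
            linarith [hy.2, hx.1.2, le_abs_self b, le_abs_self b']
      rw [hK, hg]
      dsimp only
      rw [indicator_of_mem hTq, indicator_of_mem (show y ∈ S from ⟨hy, mem_univ _⟩)]
    · rw [hψI y hyI, enorm_zero, mul_zero]; exact zero_le
  · exact lintegral_fracKer_near_le hn hβ he (by positivity) x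
  · refine le_of_eq_of_le (lintegral_congr fun x => ?_)
      (lintegral_fracKer_near_le hn hβ (neg_sign he) (L := L) (by positivity) y)
    refine indicator_eq_indicator ?_ ?_
    · rw [hT, mem_ofPred_eq, mem_ofPred_eq]
      dsimp only
      rw [show -e * (x.1 - y.1) = e * (y.1 - x.1) by ring]
    · dsimp only
      rw [fracKer_swap]

/-- Two-step inversion of `k = M_{-e} [v^γ M_e ψ]` on the cylinder. -/
theorem ae_marchaudInverts_comp {n : ℕ} (hn : 2 ≤ n) {β : ℝ} (hβ : 0 < β) {ℓ m : ℕ} (hℓ : β < ℓ)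
    (hm : β < m) {e : ℝ} (he : e = 1 ∨ e = -1) {p : ℝ} (hp : 1 < p) (γ c : ℝ) {I : Set ℝ}
    (hI0 : I ⊆ Ioi 0) (hI : ∀ s ∈ I, ∀ v, 0 < v → 0 < -e * (v - s) → v ∈ I)
    (hIloc : ∀ a b : ℝ, 0 < a → ∃ a' b' : ℝ, 0 < a' ∧ ∀ s ∈ Icc a b, ∀ t ∈ I, 0 < e * (t - s) →
      t ∈ Icc a' b')
    {ψ : ℝ × Sph n → ℂ} (hψ : Measurable ψ) (hψI : ∀ z, z.1 ∉ I → ψ z = 0)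
    (hloc : ∀ a b : ℝ, 0 < a → ∫⁻ y in Icc a b ×ˢ univ, ‖ψ y‖ₑ ^ p ∂(cylMeasure n) < ⊤)
    {K : ℝ × Sph n → ℝ × Sph n → ℝ} (hK0 : ∀ x z, 0 < x.1 → 0 < z.1 → 0 ≤ K x z)
    (hK : ∀ x z : ℝ × Sph n, 0 < x.1 → 0 < z.1 → x.1 ≠ z.1 →
      ∫⁻ y, ENNReal.ofReal (fracKer β (-e) x y * y.1 ^ γ) * ENNReal.ofReal (fracKer β e y z)
        ∂(cylMeasure n) = ENNReal.ofReal (K x z))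
    {k : ℝ × Sph n → ℂ}
    (hk : ∀ᵐ x ∂(cylMeasure n), x.1 ∈ I → k x = ∫ z, K x z • ψ z ∂(cylMeasure n))
    (hfin : ∀ᵐ x ∂(cylMeasure n), x.1 ∈ I →
      ∫⁻ z, ENNReal.ofReal (K x z) * ‖ψ z‖ₑ ∂(cylMeasure n) < ⊤) :
    (∀ᵐ x ∂(cylMeasure n), x.1 ∈ I → MarchaudInverts β ℓ (-e) k x
      (x.1 ^ γ • ∫ y, fracKer β e x y • ψ y ∂(cylMeasure n))) ∧
    ∀ k' : ℝ × Sph n → ℂ, (∀ᵐ x ∂(cylMeasure n),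
      x.1 ∈ I → k' x = c • ∫ y, fracKer β e x y • ψ y ∂(cylMeasure n)) →
      (∀ x, 0 < x.1 → x.1 ∉ I → k' x = 0) →
      ∀ᵐ x ∂(cylMeasure n), 0 < x.1 → MarchaudInverts β m e k' x (c • ψ x) := by
  have hn1 : 1 ≤ n := by omega
  have hp0 : 0 < p := by linarith
  set J : ℝ × Sph n → ℂ := fun x => ∫ y, fracKer β e x y • ψ y ∂(cylMeasure n) with hJ
  set N : ℝ × Sph n → ℝ≥0∞ := fun x =>
    ∫⁻ y, ENNReal.ofReal (fracKer β e x y) * ‖ψ y‖ₑ ∂(cylMeasure n) with hN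
  have hfm := measurable_fracKer (n := n) β e
  have hJm : Measurable J :=
    (hfm.smul (hψ.comp measurable_snd)).stronglyMeasurable.integral_prod_right'.measurable
  have hNm : Measurable N :=
    (hfm.ennreal_ofReal.mul (hψ.enorm.comp measurable_snd)).lintegral_prod_right'
  have hJN : ∀ x, ‖J x‖ₑ ≤ N x := fun x => by
    refine (enorm_integral_le_lintegral_enorm _).trans_eq (lintegral_congr fun y => ?_)
    rw [enorm_smul, Real.enorm_of_nonneg (fracKer_nonneg hn1 hβ _ _ _)]
  -- The intermediate function must be locally in L^p for the first inversion. By `hIloc`, on a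
  -- compact range of levels it depends only on ψ over another compact range.
  have hNloc : ∀ a b : ℝ, 0 < a → ∫⁻ x in Icc a b ×ˢ univ, N x ^ p ∂(cylMeasure n) < ⊤ := by
    intro a b ha
    obtain ⟨a', b', ha', h⟩ := hIloc a b ha
    exact lintegral_fracKer_rpow_lt_top hn1 hβ he hp hψ hψI hloc ha' h
  have hWm : Measurable fun x : ℝ × Sph n => x.1 ^ γ • J x :=
    (measurable_fst.pow_const γ).smul hJm
  refine ⟨?_, fun k' hk' hk'0 => ?_⟩
  · have hmain : ∀ x : ℝ × Sph n, x.1 ∈ I →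
        ∫⁻ z, ENNReal.ofReal (K x z) * ‖ψ z‖ₑ ∂(cylMeasure n) < ⊤ →
        ∫⁻ y, ENNReal.ofReal (fracKer β (-e) x y) * ‖y.1 ^ γ • J y‖ₑ ∂(cylMeasure n) < ⊤ ∧
        ∫ z, K x z • ψ z ∂(cylMeasure n) =
          ∫ y, fracKer β (-e) x y • y.1 ^ γ • J y ∂(cylMeasure n) := by
      intro x hxI hlt
      have hx : 0 < x.1 := hI0 hxI
      classical
      -- K is only known to be nonnegative at positive levels; ψ vanishes elsewhere, so the change
      -- is harmless.
      set K' : ℝ × Sph n → ℝ := fun z => if 0 < z.1 then K x z else 0 with hK'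
      have hK'0 : ∀ z, 0 ≤ K' z := fun z => by
        simp only [hK']
        split_ifs with h
        · exact hK0 x z hx h
        · exact le_rfl
      have hzero : ∀ z, ¬ 0 < z.1 → ψ z = 0 := fun z hz => hψI z fun h => hz (hI0 h)
      have hk₁m : Measurable fun y : ℝ × Sph n => fracKer β (-e) x y * y.1 ^ γ :=
        (measurable_fracKer_right β (-e) x).mul (measurable_fst.pow_const γ)
      have hk₁0 : ∀ y : ℝ × Sph n, 0 ≤ fracKer β (-e) x y * y.1 ^ γ := fun y => by
        by_cases hy : 0 < y.1
        · exact mul_nonneg (fracKer_nonneg hn1 hβ _ _ _) (Real.rpow_nonneg hy.le _)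
        · have : fracKer β (-e) x y = 0 := if_neg fun h => hy h.2.1
          rw [this, zero_mul]
      have hid : ∀ᵐ z ∂(cylMeasure n), ∫⁻ y, ENNReal.ofReal (fracKer β (-e) x y * y.1 ^ γ) *
          ENNReal.ofReal (fracKer β e y z) ∂(cylMeasure n) = ENNReal.ofReal (K' z) := by
        -- The factorization is available off the level of x, which is a null set.
        have hne : ∀ᵐ z ∂(cylMeasure n), z.1 ≠ x.1 := by
          have : ∀ᵐ v : ℝ, v ≠ x.1 := by simp [ae_iff]
          exact Measure.quasiMeasurePreserving_fst.ae this
        filter_upwards [hne] with z hz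
        by_cases hz0 : 0 < z.1
        · simp only [hK', if_pos hz0]
          exact hK x z hx hz0 hz.symm
        · simp only [hK', if_neg hz0, ENNReal.ofReal_zero]
          refine lintegral_eq_zero_of_ae_eq_zero (.of_forall fun y => ?_)
          have : fracKer β e y z = 0 := if_neg fun h => hz0 h.2.1
          simp [this]
      have hK'ψ : ∀ z, K' z • ψ z = K x z • ψ z := fun z => by
        by_cases hz0 : 0 < z.1
        · simp only [hK', if_pos hz0]
        · rw [hzero z hz0, smul_zero, smul_zero]
      have hK'ψ' : ∀ z, ENNReal.ofReal (K' z) * ‖ψ z‖ₑ = ENNReal.ofReal (K x z) * ‖ψ z‖ₑ :=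
        fun z => by
        by_cases hz0 : 0 < z.1
        · simp only [hK', if_pos hz0]
        · rw [hzero z hz0, enorm_zero, mul_zero, mul_zero]
      have hl := lintegral_kernel_comp (μ := cylMeasure n) (ν := cylMeasure n)
        (K₂ := fracKer β e) hk₁m hfm hid hψ.enorm
      simp_rw [hK'ψ'] at hl
      have hi := integral_kernel_comp (μ := cylMeasure n) (ν := cylMeasure n)
        (K₂ := fracKer β e) hk₁m hk₁0 hfm (fun y z => fracKer_nonneg hn1 hβ _ _ _) hK'0 hid hψ
        (by simp_rw [hK'ψ']; exact hlt)
      simp_rw [hK'ψ] at hi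
      refine ⟨?_, ?_⟩
      · refine lt_of_le_of_lt ?_ hlt
        rw [← hl]
        refine lintegral_mono fun y => ?_
        by_cases hy : 0 < y.1
        · rw [enorm_smul, Real.enorm_of_nonneg (Real.rpow_nonneg hy.le _), ← mul_assoc,
            ← ENNReal.ofReal_mul (fracKer_nonneg hn1 hβ _ _ _)]
          gcongr
          exact hJN y
        · have : fracKer β (-e) x y = 0 := if_neg fun h => hy h.2.1
          simp [this]
      · rw [← hi.2.2]
        refine integral_congr_ae (.of_forall fun y => ?_)
        simp only [mul_smul, hJ]
    refine ae_tendsto_marchaud_poisson hn hβ hℓ (neg_sign he) hp hWm ?_ hI0 hI ?_ ?_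
    · intro a b ha
      set C := max (a ^ γ) (b ^ γ) with hC
      refine lt_of_le_of_lt ?_ (ENNReal.mul_lt_top (ENNReal.rpow_lt_top_of_nonneg hp0.le
        (ENNReal.ofReal_ne_top (r := C))) (hNloc a b ha))
      rw [← lintegral_const_mul' _ _ (ENNReal.rpow_ne_top_of_nonneg hp0.le ENNReal.ofReal_ne_top)]
      refine setLIntegral_mono' (measurableSet_Icc.prod MeasurableSet.univ) fun x hx => ?_
      have hxa : a ≤ x.1 := hx.1.1
      have hxb : x.1 ≤ b := hx.1.2
      have hx0 : 0 < x.1 := ha.trans_le hxa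
      rw [← ENNReal.mul_rpow_of_nonneg _ _ hp0.le]
      gcongr
      rw [enorm_smul, Real.enorm_of_nonneg (Real.rpow_nonneg hx0.le _)]
      gcongr
      · rcases le_total 0 γ with h | h
        · exact (Real.rpow_le_rpow hx0.le hxb h).trans (le_max_right _ _)
        · exact (Real.rpow_le_rpow_of_nonpos ha hxa h).trans (le_max_left _ _)
      · exact hJN x
    · filter_upwards [hk, hfin] with x h1 h2 hx
      rw [h1 hx, (hmain x hx (h2 hx)).2]
    · filter_upwards [hfin] with x h2 hx
      exact (hmain x hx (h2 hx)).1
  · have hNfin : ∀ᵐ x ∂(cylMeasure n), 0 < x.1 → N x < ⊤ := by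
      have h1 : ∀ q : ℕ, ∀ᵐ x ∂(cylMeasure n),
          x ∈ Icc (1 / ((q : ℝ) + 1)) (q + 1) ×ˢ (univ : Set (Sph n)) → N x < ⊤ := by
        intro q
        refine (ae_restrict_iff' (measurableSet_Icc.prod MeasurableSet.univ)).1 ?_
        filter_upwards [ae_lt_top (hNm.pow_const p)
          (hNloc (1 / ((q : ℝ) + 1)) (q + 1) (by positivity)).ne] with x hx
        exact (ENNReal.rpow_lt_top_iff_of_pos hp0).1 hx
      filter_upwards [ae_all_iff.2 h1] with x hx hx0
      obtain ⟨q₁, h₁⟩ := exists_nat_one_div_lt hx0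
      obtain ⟨q₂, h₂⟩ := exists_nat_gt x.1
      refine hx (max q₁ q₂) ⟨⟨le_trans ?_ h₁.le, ?_⟩, mem_univ _⟩
      · gcongr
        exact le_max_left _ _
      · push_cast
        have := le_max_right (q₁ : ℝ) q₂
        linarith
    -- From a level outside I no point of I lies in the direction e, for otherwise `hI` would bring
    -- that level into I. So the extension by zero agrees with the fractional integral.
    have hout : ∀ x : ℝ × Sph n, 0 < x.1 → x.1 ∉ I → J x = 0 := by
      intro x hx hxI
      rw [hJ]
      refine integral_eq_zero_of_ae (.of_forall fun y => ?_)
      by_cases hyI : y.1 ∈ I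
      · have : fracKer β e x y = 0 := if_neg fun h => hxI
          (hI y.1 hyI x.1 hx (by have := h.2.2; linarith))
        simp [this]
      · simp [hψI y hyI]
    -- The second inversion runs on the whole half-line, since its Poisson integrals leave I.
    refine (ae_tendsto_marchaud_poisson hn hβ hm he hp (W := fun x => c • ψ x) (I := Ioi 0) (k :=
        k')
      (hψ.const_smul c) ?_ subset_rfl (fun s _ v hv _ => hv) ?_ ?_).mono fun x hx hx0 => hx hx0
    · intro a b ha
      simp_rw [enorm_smul, ENNReal.mul_rpow_of_nonneg _ _ hp0.le]
      rw [lintegral_const_mul' _ _ (ENNReal.rpow_ne_top_of_nonneg hp0.le enorm_ne_top)]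
      exact ENNReal.mul_lt_top (ENNReal.rpow_lt_top_of_nonneg hp0.le enorm_ne_top) (hloc a b ha)
    · filter_upwards [hk'] with x h1 hx
      simp_rw [smul_comm _ c]
      rw [integral_smul]
      by_cases hxI : x.1 ∈ I
      · exact h1 hxI
      · rw [hk'0 x hx hxI]
        have := hout x hx hxI
        simp only [hJ] at this
        rw [this, smul_zero]
    · filter_upwards [hNfin] with x h1 hx
      have h2 : ∀ y, ENNReal.ofReal (fracKer β e x y) * ‖c • ψ y‖ₑ =
          ‖c‖ₑ * (ENNReal.ofReal (fracKer β e x y) * ‖ψ y‖ₑ) := fun y => by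
        rw [enorm_smul]; ring
      simp_rw [h2]
      rw [lintegral_const_mul' _ _ enorm_ne_top]
      exact ENNReal.mul_lt_top enorm_lt_top (h1 hx)

/-! ### Coordinates on the sphere -/

/-- The point `(u, h)` of `ℝ^{n+1} = ℝ^n × ℝ`. -/
noncomputable def joinPt {n : ℕ} (u : EuclideanSpace ℝ (Fin n)) (h : ℝ) :
    EuclideanSpace ℝ (Fin (n + 1)) :=
  WithLp.toLp 2 (Fin.snoc (α := fun _ => ℝ) (fun i => u i) h)

theorem measurable_joinPt {n : ℕ} :
    Measurable fun q : EuclideanSpace ℝ (Fin n) × ℝ => joinPt q.1 q.2 := by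
  refine (WithLp.measurable_toLp 2 (Fin (n + 1) → ℝ)).comp (measurable_pi_iff.2 fun i => ?_)
  refine Fin.lastCases ?_ (fun j => ?_) i
  · simp only [Fin.snoc_last]
    exact measurable_snd
  · simp only [Fin.snoc_castSucc]
    fun_prop

theorem measurable_joinPt_right {n : ℕ} (u : EuclideanSpace ℝ (Fin n)) : Measurable (joinPt u) :=
  measurable_joinPt.comp (measurable_const.prodMk measurable_id)

theorem norm_joinPt_sq {n : ℕ} (u : EuclideanSpace ℝ (Fin n)) (h : ℝ) :
    ‖joinPt u h‖ ^ 2 = ‖u‖ ^ 2 + h ^ 2 := by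
  rw [EuclideanSpace.real_norm_sq_eq, EuclideanSpace.real_norm_sq_eq, Fin.sum_univ_castSucc]
  simp [joinPt]

theorem smul_joinPt {n : ℕ} (r : ℝ) (u : EuclideanSpace ℝ (Fin n)) (h : ℝ) :
    r • joinPt u h = joinPt (r • u) (r * h) := by
  ext i
  refine Fin.lastCases ?_ (fun j => ?_) i <;> simp [joinPt]

theorem lintegral_joinPt {n : ℕ} {F : EuclideanSpace ℝ (Fin (n + 1)) → ℝ≥0∞} (hF : Measurable F) :
    ∫⁻ y, F y = ∫⁻ u : EuclideanSpace ℝ (Fin n), ∫⁻ h : ℝ, F (joinPt u h) := by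
  have h1 := (PiLp.volume_preserving_toLp (Fin (n + 1))).lintegral_comp hF
  have h2 := ((volume_preserving_piFinSuccAbove (fun _ : Fin (n + 1) => ℝ) (Fin.last n)).symm
    _).lintegral_comp (hF.comp (WithLp.measurable_toLp 2 (Fin (n + 1) → ℝ)))
  have hm : Measurable fun q : ℝ × EuclideanSpace ℝ (Fin n) => F (joinPt q.2 q.1) :=
    hF.comp (measurable_joinPt.comp measurable_swap)
  rw [← h1]
  refine h2.symm.trans ?_
  have hu : Measurable (Function.uncurry fun (u : EuclideanSpace ℝ (Fin n)) (h : ℝ) =>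
      F (joinPt u h)) := hF.comp measurable_joinPt
  rw [lintegral_lintegral_swap hu.aemeasurable, Measure.volume_eq_prod, lintegral_prod]
  · refine lintegral_congr fun h => ?_
    have hmh : Measurable fun u : EuclideanSpace ℝ (Fin n) => F (joinPt u h) :=
      hm.comp measurable_prodMk_left
    refine Eq.trans ?_ ((PiLp.volume_preserving_toLp (Fin n)).lintegral_comp hmh)
    refine lintegral_congr fun u => ?_
    simp only [Function.comp, joinPt, MeasurableEquiv.piFinSuccAbove_symm_apply]
    congr 2
    exact Fin.insertNth_last' h u
  · exact ((hF.comp (WithLp.measurable_toLp 2 (Fin (n + 1) → ℝ))).comp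
      (MeasurableEquiv.measurable _)).aemeasurable

/-- The coordinates `(t, ω) ↦ (sin θ · ω, - cos θ)`, `t = tan² (θ / 2)`, on the sphere. -/
noncomputable def cylPt {n : ℕ} (z : ℝ × Sph n) : Sph (n + 1) := spherePt √z.1 z.2

theorem coe_cylPt {n : ℕ} {z : ℝ × Sph n} (hz : 0 ≤ z.1) :
    (cylPt z : EuclideanSpace ℝ (Fin (n + 1))) =
      joinPt ((2 * √z.1 / (1 + z.1)) • (z.2 : EuclideanSpace ℝ (Fin n))) ((z.1 - 1) / (1 + z.1)) :=
        by
  simp only [cylPt, spherePt, joinPt, Real.sq_sqrt hz]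
  rfl

theorem measurable_cylPt {n : ℕ} : Measurable (cylPt : ℝ × Sph n → Sph (n + 1)) := by
  refine Measurable.subtype_mk ?_
  have : Measurable fun z : ℝ × Sph n => joinPt ((2 * √z.1 / (1 + √z.1 ^ 2)) •
      (z.2 : EuclideanSpace ℝ (Fin n))) ((√z.1 ^ 2 - 1) / (1 + √z.1 ^ 2)) :=
    measurable_joinPt.comp (Measurable.prodMk (by fun_prop) (by fun_prop))
  exact this

theorem height_cylPt {n : ℕ} {z : ℝ × Sph n} (hz : 0 ≤ z.1) :
    height (cylPt z) = (z.1 - 1) / (1 + z.1) := by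
  rw [height, coe_cylPt hz]
  simp [joinPt]

theorem tanSq_cylPt {n : ℕ} {z : ℝ × Sph n} (hz : 0 ≤ z.1) : tanSq (cylPt z) = z.1 := by
  rw [tanSq, height_cylPt hz]
  have : 1 + z.1 ≠ 0 := by positivity
  have h2 : 1 - (z.1 - 1) / (1 + z.1) = 2 / (1 + z.1) := by field_simp; ring
  rw [h2]
  field_simp
  ring

theorem dir_cylPt {n : ℕ} {z : ℝ × Sph n} (hz : 0 < z.1) :
    dir (cylPt z) = (z.2 : EuclideanSpace ℝ (Fin n)) := by
  have h1 : horiz (cylPt z) = (2 * √z.1 / (1 + z.1)) • (z.2 : EuclideanSpace ℝ (Fin n)) := by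
    ext i
    rw [horiz, coe_cylPt hz.le]
    simp [joinPt]
  have hpos : 0 < 2 * √z.1 / (1 + z.1) := by
    have := Real.sqrt_pos.2 hz
    positivity
  rw [dir, h1, norm_smul, norm_eq_of_mem_sphere, mul_one, Real.norm_of_nonneg hpos.le, smul_smul,
    inv_mul_cancel₀ hpos.ne', one_smul]

theorem injOn_cylPt {n : ℕ} : InjOn (cylPt : ℝ × Sph n → Sph (n + 1)) (Ioi 0 ×ˢ univ) := by
  intro z hz w hw h
  have hz : 0 < z.1 := hz.1
  have hw : 0 < w.1 := hw.1
  refine Prod.ext ?_ (Subtype.ext ?_)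
  · rw [← tanSq_cylPt hz.le, h, tanSq_cylPt hw.le]
  · rw [← dir_cylPt hz, h, dir_cylPt hw]

/-- The density of the surface measure in the coordinates `(t, ω)`. -/
noncomputable def cylDens (n : ℕ) (t : ℝ) : ℝ :=
  2 ^ ((n : ℝ) - 1) * (t ^ ((n : ℝ) / 2 - 1) * (1 + t) ^ (-(n : ℝ)))

theorem cylDens_pos {n : ℕ} {t : ℝ} (ht : 0 < t) : 0 < cylDens n t := by
  unfold cylDens
  positivity

theorem measurable_cylDens {n : ℕ} : Measurable (cylDens n) := by
  unfold cylDens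
  fun_prop

theorem sqrt_sub_inv_bijOn : BijOn (fun t : ℝ => (t - 1) / (2 * √t)) (Ioi 0) univ := by
  have hform : ∀ t : ℝ, 0 < t → (t - 1) / (2 * √t) = (√t - (√t)⁻¹) / 2 := by
    intro t ht
    have := Real.sqrt_pos.2 ht
    nth_rw 1 [← Real.sq_sqrt ht.le]
    field_simp
  refine ⟨mapsTo_univ _ _, ?_, ?_⟩
  · intro t ht s hs h
    have ht : 0 < t := ht
    have hs : 0 < s := hs
    simp only [hform t ht, hform s hs] at h
    have h1 := Real.sqrt_pos.2 ht
    have h2 := Real.sqrt_pos.2 hs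
    have h3 : (√t - √s) * (1 + (√t)⁻¹ * (√s)⁻¹) = 0 := by
      field_simp at h ⊢
      linear_combination h
    have h4 : (1 + (√t)⁻¹ * (√s)⁻¹) ≠ 0 := by positivity
    have h5 : √t = √s := by
      rcases mul_eq_zero.1 h3 with h | h
      · linarith
      · exact absurd h h4
    rw [← Real.sq_sqrt ht.le, h5, Real.sq_sqrt hs.le]
  · intro k _
    have hpos : 0 < k + √(k ^ 2 + 1) := by
      have : |k| < √(k ^ 2 + 1) := by
        rw [← Real.sqrt_sq_eq_abs]
        exact Real.sqrt_lt_sqrt (sq_nonneg _) (by linarith)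
      linarith [neg_abs_le k]
    refine ⟨(k + √(k ^ 2 + 1)) ^ 2, mem_Ioi.2 (by positivity), ?_⟩
    dsimp only
    rw [hform _ (by positivity), Real.sqrt_sq hpos.le]
    have h2 := Real.sq_sqrt (show 0 ≤ k ^ 2 + 1 by positivity)
    field_simp
    linear_combination h2

theorem hasDerivAt_sqrt_sub_inv {t : ℝ} (ht : 0 < t) :
    HasDerivAt (fun t : ℝ => (t - 1) / (2 * √t)) ((1 + t) / (4 * (t * √t))) t := by
  have h1 := Real.sqrt_pos.2 ht
  have h := ((hasDerivAt_id t).sub_const 1).div ((Real.hasDerivAt_sqrt ht.ne').const_mul 2)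
    (by positivity)
  refine h.congr_deriv ?_
  simp only [id]
  have h2 := Real.sq_sqrt ht.le
  field_simp
  rw [h2]
  ring

theorem cylDens_algebra {n : ℕ} {t : ℝ} (ht : 0 < t) (c : ℝ) :
    (1 + t) / (4 * (t * √t)) * (((1 + t) / (2 * √t))⁻¹ ^ (n + 1) / c) = 1 / c * cylDens n t := by
  have hst := Real.sqrt_pos.2 ht
  have h2 := Real.sq_sqrt ht.le
  have h3 : t ^ ((n : ℝ) / 2 - 1) = √t ^ n / t := by
    rw [Real.rpow_sub_one ht.ne', Real.rpow_div_two_eq_sqrt _ ht.le, Real.rpow_natCast]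
  rw [cylDens, h3, Real.rpow_sub_one two_ne_zero, Real.rpow_natCast, Real.rpow_neg (by positivity),
    Real.rpow_natCast, inv_div, div_pow, mul_pow, pow_succ √t, pow_succ (1 + t), pow_succ (2 : ℝ)]
  field_simp
  norm_num

theorem lintegral_comp_mul_left {ρ : ℝ} (hρ : 0 < ρ) {g : ℝ → ℝ≥0∞} (hg : Measurable g) :
    ∫⁻ k, g (ρ * k) = ENNReal.ofReal ρ⁻¹ * ∫⁻ h, g h := by
  rw [← lintegral_map hg (measurable_const_mul ρ), Real.map_volume_mul_left hρ.ne',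
    lintegral_smul_measure, abs_of_pos (inv_pos.2 hρ), smul_eq_mul]

/-- The degree-zero extension of G, cut to the unit ball, is integrated over ℝ^{n+1} in two ways: in
polar coordinates, and on ℝ^n × ℝ with polar coordinates in ℝ^n. In the second, the points (ρω, ρk)
fill the ray through (ω, k), and k = -cot θ = (t - 1)/(2√t). -/
theorem lintegral_surf_succ {n : ℕ} (hn : 1 ≤ n) {G : Sph (n + 1) → ℝ≥0∞} (hG : Measurable G) :
    ∫⁻ x, G x ∂(surf (n + 1)) = ∫⁻ z in Ioi 0 ×ˢ univ, ENNReal.ofReal (cylDens n z.1) * G (cylPt z)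
      ∂(cylMeasure n) := by
  set G' : EuclideanSpace ℝ (Fin (n + 1)) → ℝ≥0∞ := Function.extend Subtype.val G 0 with hG'
  have hG'm : Measurable G' :=
    (MeasurableEmbedding.subtype_coe Metric.isClosed_sphere.measurableSet).measurable_extend hG
      measurable_const
  have hG'v : ∀ x : Sph (n + 1), G' x = G x := fun x => Subtype.val_injective.extend_apply _ _ _
  set F : EuclideanSpace ℝ (Fin (n + 1)) → ℝ≥0∞ :=
    (Metric.ball 0 1).indicator fun y => G' (‖y‖⁻¹ • y) with hF
  have hFm : Measurable F := by
    refine Measurable.indicator (hG'm.comp ?_) Metric.isOpen_ball.measurableSet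
    exact measurable_norm.inv.smul measurable_id
  have hFr : ∀ (y : EuclideanSpace ℝ (Fin (n + 1))), y ≠ 0 → ∀ ρ : ℝ, 0 < ρ →
      F (ρ • y) = (Iio ‖y‖⁻¹).indicator (fun _ => G' (‖y‖⁻¹ • y)) ρ := by
    intro y hy ρ hρ
    have hy0 := norm_pos_iff.2 hy
    have hiff : ρ • y ∈ Metric.ball (0 : EuclideanSpace ℝ (Fin (n + 1))) 1 ↔ ρ ∈ Iio ‖y‖⁻¹ := by
      rw [mem_ball_zero_iff, norm_smul, Real.norm_of_nonneg hρ.le, mem_Iio, ← one_div,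
        lt_div_iff₀ hy0]
    by_cases h : ρ ∈ Iio ‖y‖⁻¹
    · rw [hF, indicator_of_mem (hiff.2 h), indicator_of_mem h, norm_smul,
        Real.norm_of_nonneg hρ.le, smul_smul]
      congr 2
      field_simp
    · rw [hF, indicator_of_notMem (fun h' => h (hiff.1 h')), indicator_of_notMem h]
  -- On a ray the extension is constant up to the unit sphere, so the radial integral is explicit
  -- for a representative y of any length.
  have hrad : ∀ (y : EuclideanSpace ℝ (Fin (n + 1))), y ≠ 0 →
      ∫⁻ ρ in Ioi (0 : ℝ), ENNReal.ofReal (ρ ^ n) * F (ρ • y) =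
      ENNReal.ofReal (‖y‖⁻¹ ^ (n + 1) / ((n + 1 : ℕ) : ℝ)) * G' (‖y‖⁻¹ • y) := by
    intro y hy
    have hy0 := norm_pos_iff.2 hy
    rw [← lintegral_Ioo_pow (d := n + 1) (by omega) (inv_pos.2 hy0), ← lintegral_mul_const _
      (by fun_prop), ← lintegral_indicator measurableSet_Ioi,
        ← lintegral_indicator measurableSet_Ioo]
    refine lintegral_congr fun ρ => ?_
    by_cases h0 : ρ ∈ Ioi (0 : ℝ)
    · rw [indicator_of_mem h0, hFr y hy ρ h0]
      by_cases h1 : ρ ∈ Iio ‖y‖⁻¹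
      · rw [indicator_of_mem h1, indicator_of_mem (show ρ ∈ Ioo 0 ‖y‖⁻¹ from ⟨h0, h1⟩)]
        rfl
      · rw [indicator_of_notMem h1, indicator_of_notMem (fun h => h1 h.2), mul_zero]
    · rw [indicator_of_notMem h0, indicator_of_notMem (fun h => h0 h.1)]
  have hL : ∫⁻ y, F y = ENNReal.ofReal (1 / ((n + 1 : ℕ) : ℝ)) * ∫⁻ x, G x ∂(surf (n + 1)) := by
    rw [lintegral_polar (by omega) hFm, ← lintegral_const_mul _ hG]
    refine lintegral_congr fun ω => ?_
    have hω : (ω : EuclideanSpace ℝ (Fin (n + 1))) ≠ 0 := by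
      rw [← norm_pos_iff, norm_eq_of_mem_sphere]; exact one_pos
    rw [Nat.add_sub_cancel, hrad _ hω, norm_eq_of_mem_sphere, inv_one, one_pow, one_smul, hG'v]
  have hFj : Measurable fun q : EuclideanSpace ℝ (Fin n) × ℝ => F (joinPt q.1 q.2) :=
    hFm.comp measurable_joinPt
  have hR : ∫⁻ y, F y = ENNReal.ofReal (1 / ((n + 1 : ℕ) : ℝ)) *
      ∫⁻ ω, (∫⁻ t in Ioi (0 : ℝ), ENNReal.ofReal (cylDens n t) * G (cylPt (t, ω))) ∂(surf n) := by
    rw [lintegral_joinPt hFm, lintegral_polar hn hFj.lintegral_prod_right',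
      ← lintegral_const_mul' _ _ ENNReal.ofReal_ne_top]
    refine lintegral_congr fun ω => ?_
    have hj0 : ∀ k : ℝ, joinPt (ω : EuclideanSpace ℝ (Fin n)) k ≠ 0 := by
      intro k h
      have := norm_joinPt_sq (ω : EuclideanSpace ℝ (Fin n)) k
      rw [h, norm_zero, norm_eq_of_mem_sphere] at this
      nlinarith [sq_nonneg k]
    calc ∫⁻ ρ in Ioi (0 : ℝ), ENNReal.ofReal (ρ ^ (n - 1)) *
          ∫⁻ h : ℝ, F (joinPt (ρ • (ω : EuclideanSpace ℝ (Fin n))) h)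
        -- With h = ρk the Jacobian ρ raises the weight from ρ^{n-1} to ρ^n.
        = ∫⁻ ρ in Ioi (0 : ℝ), ∫⁻ k : ℝ, ENNReal.ofReal (ρ ^ n) *
            F (ρ • joinPt (ω : EuclideanSpace ℝ (Fin n)) k) := by
          refine setLIntegral_congr_fun measurableSet_Ioi fun ρ hρ => ?_
          have hρ : 0 < ρ := hρ
          beta_reduce
          rw [lintegral_const_mul' _ _ ENNReal.ofReal_ne_top]
          simp_rw [smul_joinPt]
          have hmk : Measurable fun h => F (joinPt (ρ • (ω : EuclideanSpace ℝ (Fin n))) h) :=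
            hFm.comp (measurable_joinPt_right _)
          rw [lintegral_comp_mul_left hρ hmk, ← mul_assoc, ← ENNReal.ofReal_mul (by positivity)]
          congr 2
          obtain ⟨d, rfl⟩ : ∃ d, n = d + 1 := ⟨n - 1, by omega⟩
          rw [Nat.add_sub_cancel, pow_succ, mul_assoc, mul_inv_cancel₀ hρ.ne', mul_one]
      _ = ∫⁻ k : ℝ, ∫⁻ ρ in Ioi (0 : ℝ), ENNReal.ofReal (ρ ^ n) *
            F (ρ • joinPt (ω : EuclideanSpace ℝ (Fin n)) k) := by
          refine lintegral_lintegral_swap (Measurable.aemeasurable ?_)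
          refine Measurable.mul (by fun_prop) (hFm.comp ?_)
          exact measurable_fst.smul ((measurable_joinPt_right _).comp measurable_snd)
      _ = ∫⁻ k in (fun t : ℝ => (t - 1) / (2 * √t)) '' Ioi 0,
            ENNReal.ofReal (‖joinPt (ω : EuclideanSpace ℝ (Fin n)) k‖⁻¹ ^ (n + 1) /
              ((n + 1 : ℕ) : ℝ)) * G' (‖joinPt (ω : EuclideanSpace ℝ (Fin n)) k‖⁻¹ •
              joinPt (ω : EuclideanSpace ℝ (Fin n)) k) := by
          rw [sqrt_sub_inv_bijOn.image_eq, setLIntegral_univ]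
          exact lintegral_congr fun k => hrad _ (hj0 k)
      _ = ∫⁻ t in Ioi (0 : ℝ), ENNReal.ofReal (1 / ((n + 1 : ℕ) : ℝ)) *
            (ENNReal.ofReal (cylDens n t) * G (cylPt (t, ω))) := by
          rw [lintegral_image_eq_lintegral_abs_deriv_mul measurableSet_Ioi
            (fun t ht => (hasDerivAt_sqrt_sub_inv ht).hasDerivWithinAt) sqrt_sub_inv_bijOn.injOn]
          refine setLIntegral_congr_fun measurableSet_Ioi fun t ht => ?_
          have ht : 0 < t := ht
          have hst := Real.sqrt_pos.2 ht
          have h2 := Real.sq_sqrt ht.le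
          have hN : ‖joinPt (ω : EuclideanSpace ℝ (Fin n)) ((t - 1) / (2 * √t))‖ =
              (1 + t) / (2 * √t) := by
            rw [← sq_eq_sq₀ (norm_nonneg _) (by positivity), norm_joinPt_sq, norm_eq_of_mem_sphere,
              div_pow, div_pow, mul_pow, h2]
            field_simp
            ring
          beta_reduce
          rw [hN, ← hG'v, coe_cylPt ht.le, smul_joinPt, ← mul_assoc (ENNReal.ofReal _),
            ← mul_assoc (ENNReal.ofReal _), ← ENNReal.ofReal_mul (abs_nonneg _),
              ← ENNReal.ofReal_mul (by positivity)]
          congr 2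
          · rw [abs_of_pos (by positivity)]
            exact cylDens_algebra ht _
          · rw [inv_div]
            congr 1
            field_simp
      _ = _ := lintegral_const_mul' _ _ ENNReal.ofReal_ne_top
  have hc0 : ENNReal.ofReal (1 / ((n + 1 : ℕ) : ℝ)) ≠ 0 :=
    (ENNReal.ofReal_pos.2 (by positivity)).ne'
  have := (ENNReal.mul_right_inj hc0 ENNReal.ofReal_ne_top).1 (hL.symm.trans hR)
  rw [this, ← Measure.prod_restrict, Measure.restrict_univ, lintegral_prod_symm]
  exact (((measurable_cylDens.comp measurable_fst).ennreal_ofReal).mul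
    (hG.comp measurable_cylPt)).aemeasurable

theorem surf_succ_eq_map {n : ℕ} (hn : 1 ≤ n) :
    surf (n + 1) = Measure.map cylPt (((cylMeasure n).restrict (Ioi 0 ×ˢ univ)).withDensity
      fun z => ENNReal.ofReal (cylDens n z.1)) := by
  have hd : Measurable fun z : ℝ × Sph n => ENNReal.ofReal (cylDens n z.1) :=
    (measurable_cylDens.comp measurable_fst).ennreal_ofReal
  refine Measure.ext_of_lintegral _ fun G hG => ?_
  have hGc : Measurable fun z : ℝ × Sph n => G (cylPt z) := hG.comp measurable_cylPt
  rw [lintegral_map hG measurable_cylPt, lintegral_withDensity_eq_lintegral_mul _ hd hGc,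
      lintegral_surf_succ hn hG]
  rfl

theorem integral_surf_succ {n : ℕ} (hn : 1 ≤ n) {G : Sph (n + 1) → ℂ} (hG : Measurable G) :
    ∫ x, G x ∂(surf (n + 1)) = ∫ z in Ioi 0 ×ˢ univ, cylDens n z.1 • G (cylPt z)
      ∂(cylMeasure n) := by
  have hd : Measurable fun z : ℝ × Sph n => ENNReal.ofReal (cylDens n z.1) :=
    (measurable_cylDens.comp measurable_fst).ennreal_ofReal
  rw [surf_succ_eq_map hn, integral_map measurable_cylPt.aemeasurable hG.aestronglyMeasurable,
    integral_withDensity_eq_integral_toReal_smul hd (.of_forall fun _ => ENNReal.ofReal_lt_top)]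
  refine setIntegral_congr_fun (measurableSet_Ioi.prod MeasurableSet.univ) fun z hz => ?_
  have hz : 0 < z.1 := hz.1
  simp only [ENNReal.toReal_ofReal (cylDens_pos hz).le]

/-- The set where P holds need not be measurable. The image of a Borel set under the injective Borel
map `cylPt` is Borel, which gives a measurable set of full measure on which P holds. -/
theorem ae_surf_of_ae_cyl {n : ℕ} (hn : 1 ≤ n) {P : Sph (n + 1) → Prop}
    (h : ∀ᵐ z ∂(cylMeasure n), 0 < z.1 → P (cylPt z)) : ∀ᵐ x ∂(surf (n + 1)), P x := by
  obtain ⟨N, hN, hNm, hN0⟩ := exists_measurable_superset_of_null (ae_iff.1 h)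
  set A : Set (Sph (n + 1)) := cylPt '' ((Ioi 0 ×ˢ univ) \ N) with hA
  have hAm : MeasurableSet A :=
    ((measurableSet_Ioi.prod MeasurableSet.univ).diff hNm).image_of_measurable_injOn
      measurable_cylPt (injOn_cylPt.mono sdiff_subset)
  have hAc : surf (n + 1) Aᶜ = 0 := by
    rw [← lintegral_indicator_one hAm.compl, lintegral_surf_succ hn
      (measurable_one.indicator hAm.compl)]
    refine lintegral_eq_zero_of_ae_eq_zero ?_
    filter_upwards [ae_restrict_mem (measurableSet_Ioi.prod MeasurableSet.univ),
      ae_restrict_of_ae (measure_eq_zero_iff_ae_notMem.1 hN0)] with z hz hzN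
    rw [indicator_of_notMem, mul_zero]
    · rfl
    · exact not_not.2 ⟨z, ⟨hz, hzN⟩, rfl⟩
  filter_upwards [measure_eq_zero_iff_ae_notMem.1 hAc] with x hx
  obtain ⟨z, ⟨hz, hzN⟩, rfl⟩ := not_not.1 hx
  by_contra hP
  exact hzN (hN fun h => hP (h hz.1))

theorem ae_cyl_of_ae_surf {n : ℕ} (hn : 1 ≤ n) {P : Sph (n + 1) → Prop}
    (h : ∀ᵐ x ∂(surf (n + 1)), P x) : ∀ᵐ z ∂(cylMeasure n), 0 < z.1 → P (cylPt z) := by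
  rw [surf_succ_eq_map hn] at h
  have h1 := ae_of_ae_map measurable_cylPt.aemeasurable h
  have hd : Measurable fun z : ℝ × Sph n => ENNReal.ofReal (cylDens n z.1) :=
    (measurable_cylDens.comp measurable_fst).ennreal_ofReal
  rw [ae_withDensity_iff hd, ae_restrict_iff' (measurableSet_Ioi.prod MeasurableSet.univ)] at h1
  filter_upwards [h1] with z hz hz0
  exact hz ⟨hz0, mem_univ _⟩ (ENNReal.ofReal_pos.2 (cylDens_pos hz0)).ne'

/-! ### The Riesz kernel in stereographic coordinates -/

/-- The distance formula for stereographic projection, the images being √s ξ and √t η. The factors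
of x and z separate, so the spherical kernel is the Euclidean one up to weights. -/
theorem norm_cylPt_sub_sq {n : ℕ} {x z : ℝ × Sph n} (hx : 0 < x.1) (hz : 0 < z.1) :
    ‖(cylPt x : EuclideanSpace ℝ (Fin (n + 1))) - cylPt z‖ ^ 2 =
      4 * ‖√x.1 • (x.2 : EuclideanSpace ℝ (Fin n)) - √z.1 • (z.2 : EuclideanSpace ℝ (Fin n))‖ ^ 2 /
        ((1 + x.1) * (1 + z.1)) := by
  have hsub : ∀ (u u' : EuclideanSpace ℝ (Fin n)) (h h' : ℝ),
      joinPt u h - joinPt u' h' = joinPt (u - u') (h - h') := by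
    intro u u' h h'
    ext i
    refine Fin.lastCases ?_ (fun j => ?_) i <;> simp [joinPt]
  rw [coe_cylPt hx.le, coe_cylPt hz.le, hsub, norm_joinPt_sq, norm_sqrt_smul_sub_sq hx.le hz.le,
    norm_sub_sq_real, norm_smul, norm_smul, inner_smul_left, inner_smul_right,
    norm_eq_of_mem_sphere, norm_eq_of_mem_sphere, Real.sqrt_mul hx.le, mul_one, mul_one,
    Real.norm_eq_abs, Real.norm_eq_abs, sq_abs, sq_abs, div_pow, div_pow, mul_pow, mul_pow,
    Real.sq_sqrt hx.le, Real.sq_sqrt hz.le]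
  simp only [conj_trivial]
  field_simp
  ring

theorem norm_cylPt_sub_rpow {n : ℕ} {x z : ℝ × Sph n} (hx : 0 < x.1) (hz : 0 < z.1) (β : ℝ) :
    ‖(cylPt x : EuclideanSpace ℝ (Fin (n + 1))) - cylPt z‖ ^ (2 * β - n) =
      2 ^ (2 * β - n) * ((1 + x.1) ^ ((n : ℝ) / 2 - β) * (1 + z.1) ^ ((n : ℝ) / 2 - β)) *
      ‖√x.1 • (x.2 : EuclideanSpace ℝ (Fin n)) - √z.1 • (z.2 : EuclideanSpace ℝ (Fin n))‖ ^
        (2 * β - n) := by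
  have h2 : ∀ a : ℝ, 0 ≤ a → a ^ (2 * β - n) = (a ^ 2) ^ (β - (n : ℝ) / 2) := by
    intro a ha
    rw [← Real.rpow_natCast, ← Real.rpow_mul ha]
    congr 1
    push_cast
    ring
  rw [h2 _ (norm_nonneg _), norm_cylPt_sub_sq hx hz, h2 _ (norm_nonneg _), h2 2 (by norm_num),
    Real.div_rpow (by positivity) (by positivity), Real.mul_rpow (by positivity) (by positivity),
    Real.mul_rpow (by positivity) (by positivity), ← neg_sub (β) ((n : ℝ) / 2),
    Real.rpow_neg (by positivity), Real.rpow_neg (by positivity)]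
  norm_num
  field_simp

/-- The Riesz kernel on the sphere is uniformly integrable. -/
theorem exists_lintegral_riesz_le {n : ℕ} (hn : 1 ≤ n) {α : ℝ} (hα : 0 < α) (hαn : α < n) :
    ∃ C : ℝ≥0∞, C ≠ ⊤ ∧ ∀ y : Sph (n + 1), ∫⁻ x, ENNReal.ofReal
      (‖(x : EuclideanSpace ℝ (Fin (n + 1))) - y‖ ^ (α - n)) ∂(surf (n + 1)) ≤ C := by
  obtain ⟨c, hc, hcap⟩ := exists_surf_closedBall_le (d := n + 1) (by omega)
  simp only [Nat.add_sub_cancel] at hcap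
  have hna : 0 < (n : ℝ) - α := by linarith
  -- φ is minus the derivative of R^{α-n}. Against the cap measure O(R^n) it leaves R^{α-1} near 0,
  -- where α > 0 is needed; beyond 1/2 the total area suffices, and α < n gives convergence.
  set φ : ℝ → ℝ≥0∞ := fun R => ENNReal.ofReal (((n : ℝ) - α) * R ^ (-1 - ((n : ℝ) - α))) with hφ
  set H : ℝ → ℝ≥0∞ := fun R => if R ≤ 1 / 2 then ENNReal.ofReal (c * R ^ n) else
    surf (n + 1) univ with hH
  refine ⟨∫⁻ R in Ioi (0 : ℝ), φ R * H R, ?_, fun y => ?_⟩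
  · rw [← Ioc_union_Ioi_eq_Ioi (show (0 : ℝ) ≤ 1 / 2 by norm_num),
      lintegral_union measurableSet_Ioi Ioc_disjoint_Ioi_same]
    refine ENNReal.add_ne_top.2 ⟨ne_of_lt ?_, ne_of_lt ?_⟩
    · calc ∫⁻ R in Ioc (0 : ℝ) (1 / 2), φ R * H R
          = ∫⁻ R in Ioc (0 : ℝ) (1 / 2), ENNReal.ofReal (((n : ℝ) - α) * c) *
            ENNReal.ofReal (R ^ (α - 1)) := by
            refine setLIntegral_congr_fun measurableSet_Ioc fun R hR => ?_
            have hR0 : 0 < R := hR.1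
            simp only [hφ, hH, if_pos hR.2]
            rw [← ENNReal.ofReal_mul (by positivity), ← ENNReal.ofReal_mul (by positivity)]
            congr 1
            have : R ^ (α - 1) = R ^ (-1 - ((n : ℝ) - α)) * R ^ n := by
              rw [← Real.rpow_natCast, ← Real.rpow_add hR0]
              congr 1
              ring
            rw [this]
            ring
        _ < ⊤ := by
            rw [lintegral_const_mul' _ _ ENNReal.ofReal_ne_top, ← setLIntegral_congr Ioo_ae_eq_Ioc,
              lintegral_Ioo_rpow hα (by norm_num)]
            exact ENNReal.mul_lt_top ENNReal.ofReal_lt_top ENNReal.ofReal_lt_top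
    · calc ∫⁻ R in Ioi (1 / 2 : ℝ), φ R * H R
          = ∫⁻ R in Ioi (1 / 2 : ℝ), (surf (n + 1) univ * ENNReal.ofReal ((n : ℝ) - α)) *
            ENNReal.ofReal (R ^ (-1 - ((n : ℝ) - α))) := by
            refine setLIntegral_congr_fun measurableSet_Ioi fun R hR => ?_
            have hR : 1 / 2 < R := hR
            simp only [hφ, hH, if_neg (not_le.2 hR)]
            rw [ENNReal.ofReal_mul hna.le]
            ring
        _ < ⊤ := by
            have hne : surf (n + 1) univ * ENNReal.ofReal ((n : ℝ) - α) ≠ ⊤ :=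
              ENNReal.mul_ne_top (measure_ne_top _ _) ENNReal.ofReal_ne_top
            rw [lintegral_const_mul' _ _ hne, lintegral_Ioi_rpow_neg hna (by norm_num)]
            exact ENNReal.mul_lt_top hne.lt_top ENNReal.ofReal_lt_top
  · have hy0 : surf (n + 1) {y} = 0 := by
      refine le_antisymm (ge_of_tendsto (x := 𝓝[>] (0 : ℝ))
        (f := fun R : ℝ => ENNReal.ofReal (c * R ^ n)) ?_ ?_) zero_le
      · have h1 : Tendsto (fun R : ℝ => ENNReal.ofReal (c * R ^ n)) (𝓝 0)
            (𝓝 (ENNReal.ofReal (c * 0 ^ n))) :=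
          ENNReal.tendsto_ofReal ((tendsto_id.pow n).const_mul c)
        rw [zero_pow (by omega), mul_zero, ENNReal.ofReal_zero] at h1
        exact h1.mono_left nhdsWithin_le_nhds
      · filter_upwards [Ioc_mem_nhdsGT (show (0 : ℝ) < 1 / 2 by norm_num)] with R hR
        refine (measure_mono ?_).trans (hcap y R hR.1 hR.2)
        exact singleton_subset_iff.2 (Metric.mem_closedBall_self hR.1.le)
    refine le_of_eq_of_le (lintegral_congr fun x => ?_) (lintegral_comp_le_of_distribution
      (surf (n + 1)) (κ := fun x => dist x y) (Θ := fun R => ENNReal.ofReal (R ^ (α - n)))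
      (φ := φ) (H := H) (measurable_id.dist measurable_const) ?_ ?_ ?_ ?_)
    · rw [Subtype.dist_eq, dist_eq_norm]
    · filter_upwards [measure_eq_zero_iff_ae_notMem.1 hy0] with x hx
      exact dist_pos.2 hx
    · rw [hφ]
      fun_prop
    · intro R hR
      simp only [hφ]
      simp_rw [ENNReal.ofReal_mul hna.le]
      rw [lintegral_const_mul' _ _ ENNReal.ofReal_ne_top, lintegral_Ioi_rpow_neg hna hR,
        ← ENNReal.ofReal_mul hna.le, neg_sub, mul_div_cancel₀ _ hna.ne']
    · intro R hR
      simp only [hH]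
      split_ifs with h
      · exact (measure_mono fun x hx => Metric.mem_closedBall.2 (le_of_lt hx)).trans (hcap y R hR h)
      · exact measure_mono (subset_univ _)

/-- Tonelli and the uniform bound on the integrals of the kernel: the potential of an L¹ function is
again in L¹. -/
theorem ae_lintegral_riesz_lt_top {n : ℕ} (hn : 1 ≤ n) {α : ℝ} (hα : 0 < α) (hαn : α < n)
    {φ : Sph (n + 1) → ℝ≥0∞} (hφ : Measurable φ) (hfin : ∫⁻ y, φ y ∂(surf (n + 1)) < ⊤) :
    ∀ᵐ x : Sph (n + 1) ∂(surf (n + 1)), ∫⁻ y, ENNReal.ofReal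
      (‖(x : EuclideanSpace ℝ (Fin (n + 1))) - y‖ ^ (α - n)) * φ y ∂(surf (n + 1)) < ⊤ := by
  obtain ⟨C, hC, hle⟩ := exists_lintegral_riesz_le hn hα hαn
  have hk : Measurable fun q : Sph (n + 1) × Sph (n + 1) => ENNReal.ofReal
      (‖(q.1 : EuclideanSpace ℝ (Fin (n + 1))) - q.2‖ ^ (α - n)) := by fun_prop
  have hkm : Measurable fun q : Sph (n + 1) × Sph (n + 1) => ENNReal.ofReal
      (‖(q.1 : EuclideanSpace ℝ (Fin (n + 1))) - q.2‖ ^ (α - n)) * φ q.2 :=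
    hk.mul (hφ.comp measurable_snd)
  refine ae_lt_top hkm.lintegral_prod_right' (ne_of_lt ?_)
  calc _ = ∫⁻ y : Sph (n + 1), ∫⁻ x : Sph (n + 1), ENNReal.ofReal
        (‖(x : EuclideanSpace ℝ (Fin (n + 1))) - y‖ ^ (α - n)) * φ y ∂(surf (n + 1))
          ∂(surf (n + 1)) := lintegral_lintegral_swap hkm.aemeasurable
    _ ≤ ∫⁻ y, C * φ y ∂(surf (n + 1)) := by
        refine lintegral_mono fun y => ?_
        have hky : Measurable fun x : Sph (n + 1) => ENNReal.ofReal
          (‖(x : EuclideanSpace ℝ (Fin (n + 1))) - y‖ ^ (α - n)) := by fun_prop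
        rw [lintegral_mul_const _ hky]
        exact mul_le_mul_left (hle y) _
    _ = C * ∫⁻ y, φ y ∂(surf (n + 1)) := lintegral_const_mul' _ _ hC
    _ < ⊤ := ENNReal.mul_lt_top hC.lt_top hfin

/-! ### Hypersingular integrals in the coordinates `(s, ξ)` -/

theorem marchaudIntegrand_smul (β : ℝ) (ℓ : ℕ) (a : ℝ) (F : ℝ → ℂ) :
    marchaudIntegrand β ℓ (fun u => a • F u) = fun τ => a • marchaudIntegrand β ℓ F τ := by
  ext τ
  simp only [marchaudIntegrand, finDiff]
  rw [smul_comm a, Finset.smul_sum (r := a)]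
  congr 1
  exact Finset.sum_congr rfl fun j _ => mul_smul_comm _ _ _

theorem ae_neg {P : ℝ → Prop} (h : ∀ᵐ r : ℝ, P (-r)) : ∀ᵐ u : ℝ, P u := by
  have := (Measure.measurePreserving_neg (volume : Measure ℝ)).quasiMeasurePreserving.ae h
  simpa using this

theorem aPlusIntegrand_cylPt {n : ℕ} (f : Sph (n + 1) → ℂ) {z : ℝ × Sph n} (hz : 0 < z.1) {r : ℝ}
    (hr : 0 < r) :
    aPlusIntegrand f (cylPt z) (-r) =
      fun η => pairKer z.1 (z.1 + -1 * r) z.2 η • f (cylPt (z.1 + -1 * r, η)) := by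
  ext η
  have h1 : min z.1 (z.1 + -1 * r) = z.1 + -1 * r := min_eq_right (by linarith)
  have h2 : max z.1 (z.1 + -1 * r) = z.1 := max_eq_left (by linarith)
  have h3 : (z.1 + -1 * r) / z.1 = 1 + -r / z.1 := by field_simp
  rw [aPlusIntegrand, poissonIntegrand, pairKer, poissonKer, h1, h2, h3, tanSq_cylPt hz.le,
    dir_cylPt hz, cylPt, neg_one_mul]

theorem aMinusIntegrand_cylPt {n : ℕ} (f : Sph (n + 1) → ℂ) {z : ℝ × Sph n} (hz : 0 < z.1) {r : ℝ}
    (hr : 0 < r) :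
    aMinusIntegrand f (cylPt z) (-r) =
      fun η => pairKer z.1 (z.1 + 1 * r) z.2 η • f (cylPt (z.1 + 1 * r, η)) := by
  ext η
  have h1 : min z.1 (z.1 + 1 * r) = z.1 := min_eq_left (by linarith)
  have h2 : max z.1 (z.1 + 1 * r) = z.1 + 1 * r := max_eq_right (by linarith)
  have h3 : √(z.1 / (z.1 + 1 * r)) = (√(1 - -r / z.1))⁻¹ := by
    have h4 : 1 - -r / z.1 = (z.1 + 1 * r) / z.1 := by field_simp; ring
    rw [← Real.sqrt_inv, h4, inv_div]
  rw [aMinusIntegrand, poissonIntegrand, pairKer, poissonKer, h1, h2, h3, tanSq_cylPt hz.le,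
    dir_cylPt hz, cylPt, sub_neg_eq_add, one_mul]

/-- Since 1 + u/s = (s + u)/s, the function A_x^+ f is s^{1-n/2} times the Poisson integrals of the
weighted function in the hypothesis. Hence T_+ is the Marchaud derivative on the side e = -1, up to
a factor depending on s. -/
theorem tPlus_of_marchaudInverts {n : ℕ} {β : ℝ} (hβ : 0 < β) {ℓ : ℕ} (hℓ : β < ℓ)
    {f : Sph (n + 1) → ℂ} {z : ℝ × Sph n} (hz : 0 < z.1) {c : ℂ}
    (h : MarchaudInverts β ℓ (-1) (fun y => (y.1 ^ ((n : ℝ) / 2 - 1) *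
      (1 + y.1) ^ (β - (n : ℝ) / 2)) • f (cylPt y)) z c) :
    TPlusConverges β ℓ f (cylPt z) ∧ tPlus β ℓ f (cylPt z) =
      (2 ^ (-β) * ((1 + z.1) ^ (β + (n : ℝ) / 2) * z.1 ^ (1 - (n : ℝ) / 2))) • c := by
  have hkap := kap_pos hβ hℓ
  have hs : tanSq (cylPt z) = z.1 := tanSq_cylPt hz.le
  have hzz : z.1 ^ (1 - (n : ℝ) / 2) * z.1 ^ ((n : ℝ) / 2 - 1) = 1 := by
    rw [← Real.rpow_add hz, sub_add_sub_cancel, sub_self, Real.rpow_zero]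
  -- Multiplying by s^{n/2-1} moves the weight to the level s + u, where the Poisson integral is
  -- taken.
  set F : ℝ → ℂ := fun u => z.1 ^ ((n : ℝ) / 2 - 1) • aPlus β f (cylPt z) u with hF
  have hFa : aPlus β f (cylPt z) = fun u => z.1 ^ (1 - (n : ℝ) / 2) • F u := by
    ext u
    rw [hF, smul_smul, hzz, one_smul]
  obtain ⟨hInt, hlim⟩ := h
  have key := hlim F ?_ ?_ ?_
  · obtain ⟨hI, hT⟩ := key
    have hT' : Tendsto (fun ε => tPlusTrunc β ℓ ε f (cylPt z)) (𝓝[>] 0)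
        (𝓝 ((2 ^ (-β) * ((1 + z.1) ^ (β + (n : ℝ) / 2) * z.1 ^ (1 - (n : ℝ) / 2))) • c)) := by
      have h1 := hT.const_smul (2 ^ (-β) / kap β ℓ * (1 + z.1) ^ (β + (n : ℝ) / 2) *
        z.1 ^ (1 - (n : ℝ) / 2))
      rw [smul_smul] at h1
      convert h1 using 2 with ε
      · rw [tPlusTrunc, hFa, marchaudIntegrand_smul, integral_smul, smul_smul, hs]
      · congr 1
        field_simp
    refine ⟨⟨?_, fun ε hε => ?_, _, hT'⟩, hT'.limUnder_eq⟩
    · refine ae_neg (hInt.mono fun r hr hr0 hr1 => ?_)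
      rw [hs] at hr1
      have hr0 : 0 < r := by linarith
      have hv : 0 < z.1 + -1 * r := by linarith
      rw [aPlusIntegrand_cylPt f hz hr0]
      have hcoef : (z.1 + -1 * r) ^ ((n : ℝ) / 2 - 1) * (1 + (z.1 + -1 * r)) ^ (β - (n : ℝ) / 2) ≠
          0 := by positivity
      have := hr hr0 hv
      simp_rw [smul_comm _ ((z.1 + -1 * r) ^ ((n : ℝ) / 2 - 1) * _)] at this
      exact (integrable_smul_iff hcoef _).1 this
    · rw [hFa, marchaudIntegrand_smul]
      exact Integrable.smul (z.1 ^ (1 - (n : ℝ) / 2)) (hI ε hε)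
  · simp only [hF, aPlus, if_true, hs, smul_smul]
  · intro r hr hv
    have hv' : 0 < tanSq (cylPt z) + -r := by rw [hs]; linarith
    have hr' : -r ≠ 0 := by linarith
    simp only [hF]
    rw [aPlus, if_neg hr', if_pos ⟨by linarith, hv'⟩, hs, smul_smul, poisson]
    have hP := aPlusIntegrand_cylPt f hz hr
    rw [aPlusIntegrand, hs] at hP
    rw [hP]
    simp_rw [smul_comm _ ((z.1 + -1 * r) ^ ((n : ℝ) / 2 - 1) * _)]
    rw [integral_smul, smul_comm _ (sphereArea n)⁻¹]
    congr 2
    rw [← mul_assoc, show 1 + -r / z.1 = (z.1 + -1 * r) / z.1 by field_simp,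
      Real.div_rpow hv.le hz.le, neg_one_mul, add_assoc]
    field_simp
  · intro r hr hv
    have hv' : ¬ 0 < tanSq (cylPt z) + -r := by rw [hs]; linarith
    have hr' : -r ≠ 0 := by linarith
    simp only [hF]
    rw [aPlus, if_neg hr', if_neg (fun h => hv' h.2), smul_zero]

/-- The counterpart on the side e = 1, where A_x^- carries its weight at the level s - u already. -/
theorem tMinus_of_marchaudInverts {n : ℕ} {β : ℝ} (hβ : 0 < β) {ℓ : ℕ} (hℓ : β < ℓ)
    {f : Sph (n + 1) → ℂ} {z : ℝ × Sph n} (hz : 0 < z.1) {c : ℂ}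
    (h : MarchaudInverts β ℓ 1 (fun y => (1 + y.1) ^ (β - (n : ℝ) / 2) • f (cylPt y)) z c) :
    TMinusConverges β ℓ f (cylPt z) ∧ tMinus β ℓ f (cylPt z) =
      (2 ^ (-β) * (1 + z.1) ^ (β + (n : ℝ) / 2)) • c := by
  have hkap := kap_pos hβ hℓ
  have hs : tanSq (cylPt z) = z.1 := tanSq_cylPt hz.le
  obtain ⟨hInt, hlim⟩ := h
  have key := hlim (aMinus β f (cylPt z)) ?_ ?_ ?_
  · obtain ⟨hI, hT⟩ := key
    have hT' : Tendsto (fun ε => tMinusTrunc β ℓ ε f (cylPt z)) (𝓝[>] 0)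
        (𝓝 ((2 ^ (-β) * (1 + z.1) ^ (β + (n : ℝ) / 2)) • c)) := by
      have h1 := hT.const_smul (2 ^ (-β) / kap β ℓ * (1 + z.1) ^ (β + (n : ℝ) / 2))
      rw [smul_smul] at h1
      convert h1 using 2 with ε
      · rw [tMinusTrunc, hs]
      · congr 1
        field_simp
    refine ⟨⟨?_, hI, _, hT'⟩, hT'.limUnder_eq⟩
    refine ae_neg (hInt.mono fun r hr hr0 => ?_)
    have hr0 : 0 < r := by linarith
    have hv : 0 < z.1 + 1 * r := by linarith
    rw [aMinusIntegrand_cylPt f hz hr0]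
    have hcoef : (1 + (z.1 + 1 * r)) ^ (β - (n : ℝ) / 2) ≠ 0 := by positivity
    have := hr hr0 hv
    simp_rw [smul_comm _ ((1 + (z.1 + 1 * r)) ^ (β - (n : ℝ) / 2))] at this
    exact (integrable_smul_iff hcoef _).1 this
  · simp only [aMinus, if_true, hs]
  · intro r hr hv
    have hr' : -r ≠ 0 := by linarith
    rw [aMinus, if_neg hr', if_pos (by linarith), hs, poisson]
    have hP := aMinusIntegrand_cylPt f hz hr
    rw [aMinusIntegrand, hs] at hP
    rw [hP]
    simp_rw [smul_comm _ ((1 + (z.1 + 1 * r)) ^ (β - (n : ℝ) / 2))]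
    rw [integral_smul, smul_comm _ (sphereArea n)⁻¹]
    congr 3
    ring
  · intro r hr hv
    linarith

/-! ### Weighted Lebesgue classes and the Riesz potential in the coordinates `(s, ξ)` -/

theorem measurable_height {n : ℕ} : Measurable (height : Sph (n + 1) → ℝ) := by
  unfold height
  fun_prop

theorem measurableSet_seg {n : ℕ} (a b : ℝ) : MeasurableSet (seg n a b) :=
  (measurableSet_lt measurable_const measurable_height).inter
    (measurableSet_lt measurable_height measurable_const)

/-- φ is only almost everywhere measurable, and arbitrary off Ω; the Borel representative g
vanishing off Ω replaces it from here on. -/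
theorem MemWeightedLp.exists_measurable {n : ℕ} {p : ℝ} (hp : 1 < p) {Ω : Set (Sph (n + 1))}
    (hΩ : MeasurableSet Ω) {w : Sph (n + 1) → ℝ} (hw : Measurable w) (hw0 : ∀ x ∈ Ω, 0 < w x)
    {φ : Sph (n + 1) → ℂ} (h : MemWeightedLp p Ω w φ) :
    ∃ g : Sph (n + 1) → ℂ, Measurable g ∧ (∀ x, x ∉ Ω → g x = 0) ∧
      φ =ᵐ[(surf (n + 1)).restrict Ω] g ∧
      ∫⁻ x, (ENNReal.ofReal (w x) * ‖g x‖ₑ) ^ p ∂(surf (n + 1)) < ⊤ := by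
  have hp0 : 0 < p := by linarith
  obtain ⟨hm, hfin⟩ := h
  have hfin' := (eLpNorm_lt_top_iff_lintegral_rpow_enorm_lt_top
    (by simpa using hp0) ENNReal.ofReal_ne_top).1 hfin
  rw [ENNReal.toReal_ofReal hp0.le] at hfin'
  set G := hm.mk _ with hG
  have hGm : Measurable G := hm.stronglyMeasurable_mk.measurable
  have hGe := hm.ae_eq_mk
  refine ⟨Ω.indicator fun x => (w x)⁻¹ • G x, (hw.inv.smul hGm).indicator hΩ,
    fun x hx => indicator_of_notMem hx _, ?_, ?_⟩
  · filter_upwards [hGe, ae_restrict_mem hΩ] with x hx hxΩ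
    rw [indicator_of_mem hxΩ, hG, ← hx, smul_smul, inv_mul_cancel₀ (hw0 x hxΩ).ne', one_smul]
  · refine lt_of_le_of_lt (le_of_eq ?_) hfin'
    rw [← lintegral_indicator hΩ]
    have hGe' := (ae_restrict_iff' hΩ).1 hGe
    refine lintegral_congr_ae ?_
    filter_upwards [hGe'] with x hx
    by_cases hxΩ : x ∈ Ω
    · rw [indicator_of_mem hxΩ, indicator_of_mem hxΩ, hG, ← hx hxΩ, smul_smul,
        inv_mul_cancel₀ (hw0 x hxΩ).ne', one_smul, enorm_smul,
        Real.enorm_of_nonneg (hw0 x hxΩ).le]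
    · rw [indicator_of_notMem hxΩ, indicator_of_notMem hxΩ, enorm_zero, mul_zero,
        ENNReal.zero_rpow_of_pos hp0]

/-- Hölder's inequality for the product of w g and w^{-1} on Ω. -/
theorem lintegral_enorm_lt_top_of_weighted {X : Type*} [MeasurableSpace X] {μ : Measure X}
    {p p' : ℝ} (hpp' : p.HolderConjugate p') {Ω : Set X} (hΩ : MeasurableSet Ω) {w : X → ℝ}
    (hw : Measurable w) (hw0 : ∀ x ∈ Ω, 0 < w x) {g : X → ℂ} (hg : Measurable g)
    (hg0 : ∀ x, x ∉ Ω → g x = 0)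
    (hfin : ∫⁻ x, (ENNReal.ofReal (w x) * ‖g x‖ₑ) ^ p ∂μ < ⊤)
    (hwfin : ∫⁻ x in Ω, ENNReal.ofReal (w x ^ (-p')) ∂μ < ⊤) :
    ∫⁻ x, ‖g x‖ₑ ∂μ < ⊤ := by
  have hp0 := hpp'.pos
  have hp0' := hpp'.symm.pos
  have h1 : ∫⁻ x, ‖g x‖ₑ ∂μ = ∫⁻ x in Ω, ((fun x => ENNReal.ofReal (w x) * ‖g x‖ₑ) *
      fun x => ENNReal.ofReal (w x)⁻¹) x ∂μ := by
    rw [← lintegral_indicator hΩ]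
    refine lintegral_congr fun x => ?_
    by_cases hx : x ∈ Ω
    · rw [indicator_of_mem hx, Pi.mul_apply, mul_comm, ← mul_assoc,
        ← ENNReal.ofReal_mul (inv_nonneg.2 (hw0 x hx).le), inv_mul_cancel₀ (hw0 x hx).ne',
        ENNReal.ofReal_one, one_mul]
    · rw [indicator_of_notMem hx, hg0 x hx, enorm_zero]
  rw [h1]
  refine (ENNReal.lintegral_mul_le_Lp_mul_Lq _ hpp' (by fun_prop) (by fun_prop)).trans_lt
    (ENNReal.mul_lt_top (ENNReal.rpow_lt_top_of_nonneg (by positivity) (ne_of_lt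
      ((setLIntegral_le_lintegral _ _).trans_lt hfin)))
      (ENNReal.rpow_lt_top_of_nonneg (by positivity) (ne_of_lt ?_)))
  refine lt_of_le_of_lt (le_of_eq (setLIntegral_congr_fun hΩ fun x hx => ?_)) hwfin
  rw [ENNReal.ofReal_rpow_of_pos (inv_pos.2 (hw0 x hx)), Real.inv_rpow (hw0 x hx).le,
    Real.rpow_neg (hw0 x hx).le]

theorem one_add_height_cylPt {n : ℕ} {z : ℝ × Sph n} (hz : 0 < z.1) :
    1 + height (cylPt z) = 2 * z.1 / (1 + z.1) := by
  rw [height_cylPt hz.le]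
  field_simp
  ring

theorem one_sub_height_cylPt {n : ℕ} {z : ℝ × Sph n} (hz : 0 < z.1) :
    1 - height (cylPt z) = 2 / (1 + z.1) := by
  rw [height_cylPt hz.le]
  field_simp
  ring

theorem cylPt_mem_seg_below {n : ℕ} {b : ℝ} (hb : b < 1) {z : ℝ × Sph n} (hz : 0 < z.1) :
    cylPt z ∈ seg n (-1) b ↔ z.1 ∈ Ioo 0 ((1 + b) / (1 - b)) := by
  have h1 : 0 < 1 + z.1 := by linarith
  have h2 : 0 < 1 - b := by linarith
  have h3 := one_add_height_cylPt hz
  have h4 : 0 < 2 * z.1 / (1 + z.1) := by positivity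
  have h5 : height (cylPt z) < b ↔ z.1 < (1 + b) / (1 - b) := by
    rw [height_cylPt hz.le, div_lt_iff₀ h1, lt_div_iff₀ h2]
    constructor <;> intro h <;> linarith
  simp only [seg, mem_ofPred_eq, mem_Ioo, h5, hz, true_and]
  exact ⟨fun h => h.2, fun h => ⟨by linarith, h⟩⟩

theorem cylPt_mem_seg_above {n : ℕ} {a : ℝ} (ha : a < 1) {z : ℝ × Sph n} (hz : 0 < z.1) :
    cylPt z ∈ seg n a 1 ↔ z.1 ∈ Ioi ((1 + a) / (1 - a)) := by
  have h1 : 0 < 1 + z.1 := by linarith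
  have h2 : 0 < 1 - a := by linarith
  have h3 := one_sub_height_cylPt hz
  have h4 : 0 < 2 / (1 + z.1) := by positivity
  have h5 : a < height (cylPt z) ↔ (1 + a) / (1 - a) < z.1 := by
    rw [height_cylPt hz.le, lt_div_iff₀ h1, div_lt_iff₀ h2]
    constructor <;> intro h <;> linarith
  simp only [seg, mem_ofPred_eq, mem_Ioi, h5]
  exact ⟨fun h => h.1, fun h => ⟨h, by linarith⟩⟩

theorem setLIntegral_surf_le {n : ℕ} (hn : 1 ≤ n) {Ω : Set (Sph (n + 1))} (hΩ : MeasurableSet Ω)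
    {I : Set ℝ} (hIm : MeasurableSet I) (hI : ∀ z : ℝ × Sph n, 0 < z.1 → (cylPt z ∈ Ω ↔ z.1 ∈ I))
    {G : Sph (n + 1) → ℝ≥0∞} (hG : Measurable G) {H : ℝ → ℝ≥0∞} (hH : Measurable H)
    (hle : ∀ z : ℝ × Sph n, 0 < z.1 → z.1 ∈ I → ENNReal.ofReal (cylDens n z.1) * G (cylPt z) ≤
      H z.1) :
    ∫⁻ x in Ω, G x ∂(surf (n + 1)) ≤ surf n univ * ∫⁻ t in I, H t := by
  rw [← lintegral_indicator hΩ, lintegral_surf_succ hn (hG.indicator hΩ)]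
  calc _ ≤ ∫⁻ z in Ioi 0 ×ˢ univ, I.indicator H z.1 ∂(cylMeasure n) := by
        refine setLIntegral_mono (((hH.indicator hIm)).comp measurable_fst) fun z hz => ?_
        have hz0 : 0 < z.1 := hz.1
        by_cases h : z.1 ∈ I
        · rw [indicator_of_mem h, indicator_of_mem ((hI z hz0).2 h)]
          exact hle z hz0 h
        · rw [indicator_of_notMem (fun h' => h ((hI z hz0).1 h')), mul_zero]
          exact zero_le
    _ ≤ ∫⁻ z : ℝ × Sph n, I.indicator H z.1 * 1 ∂(cylMeasure n) := by
        simp_rw [mul_one]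
        exact setLIntegral_le_lintegral _ _
    _ = surf n univ * ∫⁻ t in I, H t := by
        rw [cylMeasure, lintegral_prod_mul (f := I.indicator H) (g := fun _ : Sph n => (1 : ℝ≥0∞))
          (hH.indicator hIm).aemeasurable aemeasurable_const, lintegral_indicator hIm,
          lintegral_const, one_mul, mul_comm]

/-- Near the South Pole 1 + x_{n+1} is comparable with t and the density with t^{n/2-1}, so
integrability there is exactly κ < n/2. It is used with κ = μp'. -/
theorem setLIntegral_one_add_height_lt_top {n : ℕ} (hn : 1 ≤ n) {b : ℝ} (hb : -1 < b) (hb1 : b < 1)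
    {κ : ℝ} (hκ : κ < n / 2) :
    ∫⁻ x in seg n (-1) b, ENNReal.ofReal ((1 + height x) ^ (-κ)) ∂(surf (n + 1)) < ⊤ := by
  have hB : 0 < (1 + b) / (1 - b) := div_pos (by linarith) (by linarith)
  have hn0 : (0 : ℝ) ≤ n := n.cast_nonneg
  have hhm := measurable_height (n := n)
  refine (setLIntegral_surf_le hn (measurableSet_seg _ _) measurableSet_Ioo
    (fun z hz => cylPt_mem_seg_below hb1 hz) (by fun_prop)
    (H := fun t => ENNReal.ofReal (2 ^ ((n : ℝ) - 1) * 2 ^ (-κ)) *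
      ENNReal.ofReal (t ^ (((n : ℝ) / 2 - κ) - 1))) (by fun_prop) ?_).trans_lt ?_
  · intro z hz _
    rw [one_add_height_cylPt hz, ← ENNReal.ofReal_mul (cylDens_pos hz).le,
      ← ENNReal.ofReal_mul (by positivity)]
    refine ENNReal.ofReal_le_ofReal ?_
    have h1 : (1 + z.1) ^ (κ - n) ≤ 1 :=
      Real.rpow_le_one_of_one_le_of_nonpos (by linarith) (by linarith)
    have h2 : z.1 ^ (((n : ℝ) / 2 - κ) - 1) = z.1 ^ ((n : ℝ) / 2 - 1) * z.1 ^ (-κ) := by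
      rw [← Real.rpow_add hz]
      congr 1
      ring
    have h3 : (1 + z.1) ^ (κ - n) = (1 + z.1) ^ (-(n : ℝ)) * (1 + z.1) ^ κ := by
      rw [← Real.rpow_add (by linarith)]
      congr 1
      ring
    have h4 : (2 * z.1 / (1 + z.1)) ^ (-κ) = 2 ^ (-κ) * z.1 ^ (-κ) * (1 + z.1) ^ κ := by
      rw [Real.div_rpow (by positivity) (by positivity), Real.mul_rpow (by positivity) hz.le,
        Real.rpow_neg (by linarith : 0 ≤ 1 + z.1), div_inv_eq_mul]
    rw [cylDens, h4, h2]
    calc _ = 2 ^ ((n : ℝ) - 1) * 2 ^ (-κ) * (z.1 ^ ((n : ℝ) / 2 - 1) * z.1 ^ (-κ)) *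
          (1 + z.1) ^ (κ - n) := by rw [h3]; ring
      _ ≤ _ := mul_le_of_le_one_right (by positivity) h1
  · rw [lintegral_const_mul' _ _ ENNReal.ofReal_ne_top, lintegral_Ioo_rpow (by linarith) hB.le]
    exact ENNReal.mul_lt_top (measure_lt_top _ _)
      (ENNReal.mul_lt_top ENNReal.ofReal_lt_top ENNReal.ofReal_lt_top)

/-- At the North Pole t → ∞, 1 - x_{n+1} is comparable with 1/t and the density with t^{-n/2-1}; the
same threshold results. -/
theorem setLIntegral_one_sub_height_lt_top {n : ℕ} (hn : 1 ≤ n) {a : ℝ} (ha : -1 < a) (ha1 : a < 1)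
    {κ : ℝ} (hκ : κ < n / 2) :
    ∫⁻ x in seg n a 1, ENNReal.ofReal ((1 - height x) ^ (-κ)) ∂(surf (n + 1)) < ⊤ := by
  have hA : 0 < (1 + a) / (1 - a) := div_pos (by linarith) (by linarith)
  have hn0 : (0 : ℝ) ≤ n := n.cast_nonneg
  have hhm := measurable_height (n := n)
  refine (setLIntegral_surf_le hn (measurableSet_seg _ _) measurableSet_Ioi
    (fun z hz => cylPt_mem_seg_above ha1 hz) (by fun_prop)
    (H := fun t => ENNReal.ofReal (2 ^ ((n : ℝ) - 1) * 2 ^ (-κ)) *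
      ENNReal.ofReal (t ^ (-1 - ((n : ℝ) / 2 - κ)))) (by fun_prop) ?_).trans_lt ?_
  · intro z hz _
    rw [one_sub_height_cylPt hz, ← ENNReal.ofReal_mul (cylDens_pos hz).le,
      ← ENNReal.ofReal_mul (by positivity)]
    refine ENNReal.ofReal_le_ofReal ?_
    have h1 : (1 + z.1) ^ (κ - n) ≤ z.1 ^ (κ - n) :=
      Real.rpow_le_rpow_of_nonpos hz (by linarith) (by linarith)
    have h2 : z.1 ^ (-1 - ((n : ℝ) / 2 - κ)) = z.1 ^ ((n : ℝ) / 2 - 1) * z.1 ^ (κ - n) := by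
      rw [← Real.rpow_add hz]
      congr 1
      ring
    have h3 : (1 + z.1) ^ (κ - n) = (1 + z.1) ^ (-(n : ℝ)) * (1 + z.1) ^ κ := by
      rw [← Real.rpow_add (by linarith)]
      congr 1
      ring
    have h4 : (2 / (1 + z.1)) ^ (-κ) = 2 ^ (-κ) * (1 + z.1) ^ κ := by
      rw [Real.div_rpow (by positivity) (by positivity),
        Real.rpow_neg (by linarith : 0 ≤ 1 + z.1), div_inv_eq_mul]
    rw [cylDens, h4, h2]
    calc _ = 2 ^ ((n : ℝ) - 1) * 2 ^ (-κ) * (z.1 ^ ((n : ℝ) / 2 - 1) * (1 + z.1) ^ (κ - n)) := by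
            rw [h3]; ring
      _ ≤ _ := by gcongr
  · rw [lintegral_const_mul' _ _ ENNReal.ofReal_ne_top, lintegral_Ioi_rpow_neg (by linarith) hA]
    exact ENNReal.mul_lt_top (measure_lt_top _ _)
      (ENNReal.mul_lt_top ENNReal.ofReal_lt_top ENNReal.ofReal_lt_top)

/-- Weighted integrability on the sphere controls local integrability on the cylinder. -/
theorem setLIntegral_cyl_rpow_lt_top {n : ℕ} (hn : 1 ≤ n) {p : ℝ} (hp : 1 < p)
    {w : Sph (n + 1) → ℝ} (hw : Measurable w) {v : ℝ → ℝ} (hv : ContinuousOn v (Ioi 0))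
    (hv0 : ∀ t, 0 < t → 0 < v t) (hwv : ∀ z : ℝ × Sph n, 0 < z.1 → w (cylPt z) = v z.1)
    {g : Sph (n + 1) → ℂ} (hg : Measurable g)
    (hfin : ∫⁻ x, (ENNReal.ofReal (w x) * ‖g x‖ₑ) ^ p ∂(surf (n + 1)) < ⊤)
    {q : ℝ → ℝ} (hq : ContinuousOn q (Ioi 0)) {ψ : ℝ × Sph n → ℂ}
    (hψ : ∀ z, 0 < z.1 → ψ z = q z.1 • g (cylPt z)) {a : ℝ} (ha : 0 < a) (b : ℝ) :
    ∫⁻ y in Icc a b ×ˢ univ, ‖ψ y‖ₑ ^ p ∂(cylMeasure n) < ⊤ := by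
  have hp0 : 0 < p := by linarith
  have hsub : Icc a b ⊆ Ioi 0 := fun t ht => lt_of_lt_of_le ha ht.1
  have hdc : ContinuousOn (cylDens n) (Icc a b) := by
    intro t ht
    have ht0 : 0 < t := hsub ht
    unfold cylDens
    refine ContinuousAt.continuousWithinAt ?_
    have h1 : 1 + t ≠ 0 := by linarith
    have h2 := ht0.ne'
    fun_prop (disch := simp_all)
  -- On a compact range of levels all weights are bounded above and below, so no condition on their
  -- exponents is needed.
  have hc : ContinuousOn (fun t => |q t| ^ p * (cylDens n t * v t ^ p)⁻¹) (Icc a b) := by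
    refine ((hq.mono hsub).abs.rpow_const fun t _ => Or.inr hp0.le).mul
      ((hdc.mul ((hv.mono hsub).rpow_const fun t _ => Or.inr hp0.le)).inv₀ fun t ht => ?_)
    have := hv0 t (hsub ht)
    have := cylDens_pos (n := n) (hsub ht)
    exact (mul_pos this (Real.rpow_pos_of_pos (hv0 t (hsub ht)) _)).ne'
  obtain ⟨C, hC⟩ := isCompact_Icc.bddAbove_image hc
  have hm : MeasurableSet (Icc a b ×ˢ (univ : Set (Sph n))) := measurableSet_Icc.prod .univ
  have hGm : Measurable fun x : Sph (n + 1) => (ENNReal.ofReal (w x) * ‖g x‖ₑ) ^ p := by fun_prop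
  have hdm : Measurable fun z : ℝ × Sph n => ENNReal.ofReal (cylDens n z.1) :=
    (measurable_cylDens.comp measurable_fst).ennreal_ofReal
  rw [lintegral_surf_succ hn hGm] at hfin
  calc _ ≤ ∫⁻ z in Icc a b ×ˢ univ, ENNReal.ofReal C * (ENNReal.ofReal (cylDens n z.1) *
        (ENNReal.ofReal (w (cylPt z)) * ‖g (cylPt z)‖ₑ) ^ p) ∂(cylMeasure n) := by
        refine setLIntegral_mono ((hdm.mul (hGm.comp measurable_cylPt)).const_mul _) fun z hz => ?_
        have hz0 : 0 < z.1 := hsub hz.1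
        have hvz := hv0 _ hz0
        have hdz := cylDens_pos (n := n) hz0
        have hCz : |q z.1| ^ p * (cylDens n z.1 * v z.1 ^ p)⁻¹ ≤ C := hC ⟨z.1, hz.1, rfl⟩
        have hCz' : |q z.1| ^ p ≤ C * (cylDens n z.1 * v z.1 ^ p) := by
          rwa [← div_eq_mul_inv, div_le_iff₀ (by positivity)] at hCz
        have hC0 : 0 ≤ C := le_trans (by positivity) hCz
        rw [hψ z hz0, hwv z hz0, enorm_smul, ENNReal.mul_rpow_of_nonneg _ _ hp0.le,
          ENNReal.mul_rpow_of_nonneg _ _ hp0.le, ← mul_assoc, ← mul_assoc, Real.enorm_eq_ofReal_abs,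
          ENNReal.ofReal_rpow_of_nonneg (abs_nonneg _) hp0.le,
          ENNReal.ofReal_rpow_of_nonneg hvz.le hp0.le, mul_assoc (ENNReal.ofReal C),
          ← ENNReal.ofReal_mul hdz.le, ← ENNReal.ofReal_mul hC0]
        exact mul_le_mul_left (ENNReal.ofReal_le_ofReal hCz') _
    _ ≤ ∫⁻ z in Ioi 0 ×ˢ univ, ENNReal.ofReal C * (ENNReal.ofReal (cylDens n z.1) *
        (ENNReal.ofReal (w (cylPt z)) * ‖g (cylPt z)‖ₑ) ^ p) ∂(cylMeasure n) :=
        lintegral_mono_set (prod_mono_left hsub)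
    _ < ⊤ := by
        rw [lintegral_const_mul' _ _ ENNReal.ofReal_ne_top]
        exact ENNReal.mul_lt_top ENNReal.ofReal_lt_top hfin

/-- Multiplication by (1 + s)^{β-n/2} removes the dependence on 1 + s, and the density combines with
the other weight into (1 + t)^{-(n/2+β)}. -/
theorem riesz_kernel_cylPt {n : ℕ} {x z : ℝ × Sph n} (hx : 0 < x.1) (hz : 0 < z.1) (β : ℝ) :
    (1 + x.1) ^ (β - (n : ℝ) / 2) * (Real.Gamma ((n - 2 * β) / 2) / (2 ^ (2 * β) *
      Real.pi ^ ((n : ℝ) / 2) * Real.Gamma (2 * β / 2)) * (cylDens n z.1 *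
        ‖(cylPt x : EuclideanSpace ℝ (Fin (n + 1))) - cylPt z‖ ^ (2 * β - n))) =
      z.1 ^ ((n : ℝ) / 2 - 1) * (1 + z.1) ^ (-((n : ℝ) / 2 + β)) * (rieszConst n β *
        ‖√x.1 • (x.2 : EuclideanSpace ℝ (Fin n)) - √z.1 • (z.2 : EuclideanSpace ℝ (Fin n))‖ ^
          (2 * β - n)) := by
  have h1 : (1 + x.1) ^ (β - (n : ℝ) / 2) * (1 + x.1) ^ ((n : ℝ) / 2 - β) = 1 := by
    rw [← Real.rpow_add (by linarith), sub_add_sub_cancel, sub_self, Real.rpow_zero]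
  have h2 : (1 + z.1) ^ (-(n : ℝ)) * (1 + z.1) ^ ((n : ℝ) / 2 - β) =
      (1 + z.1) ^ (-((n : ℝ) / 2 + β)) := by
    rw [← Real.rpow_add (by linarith)]
    congr 1
    ring
  have h3 : (2 : ℝ) ^ ((n : ℝ) - 1) * 2 ^ (2 * β - n) * 2 = 2 ^ (2 * β) := by
    rw [← Real.rpow_add two_pos, ← Real.rpow_add_one two_ne_zero]
    congr 1
    ring
  have h4 : ((n : ℝ) - 2 * β) / 2 = n / 2 - β := by ring
  have h5 : (2 : ℝ) * β / 2 = β := by ring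
  rw [norm_cylPt_sub_rpow hx hz, rieszConst, h4, h5, cylDens, ← h2, ← h3]
  have h6 : (2 : ℝ) ^ ((n : ℝ) - 1) ≠ 0 := by positivity
  have h7 : (2 : ℝ) ^ (2 * β - n) ≠ 0 := by positivity
  set N := ‖√x.1 • (x.2 : EuclideanSpace ℝ (Fin n)) - √z.1 • (z.2 : EuclideanSpace ℝ (Fin n))‖ ^
          (2 * β - n)
  calc _ = ((1 + x.1) ^ (β - (n : ℝ) / 2) * (1 + x.1) ^ ((n : ℝ) / 2 - β)) *
        (z.1 ^ ((n : ℝ) / 2 - 1) * ((1 + z.1) ^ (-(n : ℝ)) * (1 + z.1) ^ ((n : ℝ) / 2 - β)) *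
        (Real.Gamma (n / 2 - β) / (2 * Real.pi ^ ((n : ℝ) / 2) * Real.Gamma β) * N)) := by
        field_simp
    _ = _ := by rw [h1, one_mul]

/-- The function q records how the remaining weight at t is divided between the kernel K and the
density ψ, and κ the extra weight at s; the two caps use different divisions. -/
theorem rieszPotential_cylPt {n : ℕ} (hn : 1 ≤ n) {β : ℝ} {Ω : Set (Sph (n + 1))}
    {φ g : Sph (n + 1) → ℂ} (hg : Measurable g)
    (hg0 : ∀ x, x ∉ Ω → g x = 0) (hφ : φ =ᵐ[(surf (n + 1)).restrict Ω] g)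
    {q : ℝ → ℝ} {ψ : ℝ × Sph n → ℂ} (hψ : ∀ z, 0 < z.1 → ψ z = q z.1 • g (cylPt z))
    (hψ0 : ∀ z, ¬ 0 < z.1 → ψ z = 0) {κ : ℝ} {x : ℝ × Sph n} (hx : 0 < x.1) {K : ℝ × Sph n → ℝ}
    (hK : ∀ z : ℝ × Sph n, 0 < z.1 → K z * q z.1 = κ * (z.1 ^ ((n : ℝ) / 2 - 1) *
      (1 + z.1) ^ (-((n : ℝ) / 2 + β)) * (rieszConst n β * ‖√x.1 • (x.2 : EuclideanSpace ℝ (Fin n))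
        -
        √z.1 • (z.2 : EuclideanSpace ℝ (Fin n))‖ ^ (2 * β - n)))) :
    (κ * (1 + x.1) ^ (β - (n : ℝ) / 2)) • rieszPotential (2 * β) Ω φ (cylPt x) =
      ∫ z, K z • ψ z ∂(cylMeasure n) := by
  have hm : MeasurableSet (Ioi (0 : ℝ) ×ˢ (univ : Set (Sph n))) := measurableSet_Ioi.prod .univ
  have h1 : ∫ y in Ω, rieszIntegrand (2 * β) φ (cylPt x) y ∂(surf (n + 1)) =
      ∫ y, rieszIntegrand (2 * β) g (cylPt x) y ∂(surf (n + 1)) := by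
    rw [← setIntegral_eq_integral_of_forall_compl_eq_zero (s := Ω)
      (f := rieszIntegrand (2 * β) g (cylPt x))]
    · refine integral_congr_ae ?_
      filter_upwards [hφ] with y hy
      rw [rieszIntegrand, rieszIntegrand, hy]
    · intro y hy
      rw [rieszIntegrand, hg0 y hy, smul_zero]
  have h2 : Measurable (rieszIntegrand (2 * β) g (cylPt x)) := by
    unfold rieszIntegrand
    fun_prop
  rw [rieszPotential, h1, integral_surf_succ hn h2, smul_smul, ← integral_smul,
    ← setIntegral_eq_integral_of_forall_compl_eq_zero (s := Ioi 0 ×ˢ univ)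
      (f := fun z => K z • ψ z)]
  · refine setIntegral_congr_fun hm fun z hz => ?_
    have hz0 : 0 < z.1 := hz.1
    rw [hψ z hz0, smul_smul, smul_smul (K z), hK z hz0, ← riesz_kernel_cylPt hx hz0, rieszIntegrand,
      smul_smul]
    congr 1
    ring
  · intro z hz
    rw [hψ0 z fun h => hz ⟨h, mem_univ _⟩, smul_zero]

theorem ae_lintegral_cyl_riesz_lt_top {n : ℕ} (hn : 1 ≤ n) {β : ℝ} (hβ : 0 < β)
    (hβn : β < n / 2) {g : Sph (n + 1) → ℂ} (hg : Measurable g)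
    (hfin : ∫⁻ y, ‖g y‖ₑ ∂(surf (n + 1)) < ⊤)
    {q : ℝ → ℝ} (hq : ∀ t, 0 < t → 0 ≤ q t) {ψ : ℝ × Sph n → ℂ}
    (hψ : ∀ z, 0 < z.1 → ψ z = q z.1 • g (cylPt z)) (hψ0 : ∀ z, ¬ 0 < z.1 → ψ z = 0)
    {κ : ℝ → ℝ} (hκ : ∀ t, 0 < t → 0 ≤ κ t) {K : ℝ × Sph n → ℝ × Sph n → ℝ}
    (hK0 : ∀ x z : ℝ × Sph n, 0 < x.1 → 0 < z.1 → 0 ≤ K x z)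
    (hK : ∀ x z : ℝ × Sph n, 0 < x.1 → 0 < z.1 → K x z * q z.1 = κ x.1 * (z.1 ^ ((n : ℝ) / 2 - 1) *
      (1 + z.1) ^ (-((n : ℝ) / 2 + β)) * (rieszConst n β * ‖√x.1 • (x.2 : EuclideanSpace ℝ (Fin n))
        -
        √z.1 • (z.2 : EuclideanSpace ℝ (Fin n))‖ ^ (2 * β - n)))) :
    ∀ᵐ x ∂(cylMeasure n), 0 < x.1 →
      ∫⁻ z, ENNReal.ofReal (K x z) * ‖ψ z‖ₑ ∂(cylMeasure n) < ⊤ := by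
  have hm : MeasurableSet (Ioi (0 : ℝ) ×ˢ (univ : Set (Sph n))) := measurableSet_Ioi.prod .univ
  have hgm : Measurable fun y => ‖g y‖ₑ := by fun_prop
  filter_upwards [ae_cyl_of_ae_surf hn (ae_lintegral_riesz_lt_top hn (α := 2 * β) (by linarith)
    (by linarith) hgm hfin)] with x hx hx0
  have hx1 := hx hx0
  have hGm : Measurable fun y : Sph (n + 1) => ENNReal.ofReal
      (‖(cylPt x : EuclideanSpace ℝ (Fin (n + 1))) - y‖ ^ (2 * β - n)) * ‖g y‖ₑ := by fun_prop
  rw [lintegral_surf_succ hn hGm] at hx1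
  set C := κ x.1 * (1 + x.1) ^ (β - (n : ℝ) / 2) * (Real.Gamma ((n - 2 * β) / 2) / (2 ^ (2 * β) *
      Real.pi ^ ((n : ℝ) / 2) * Real.Gamma (2 * β / 2))) with hC
  have hC0 : 0 ≤ C := by
    have h1 := hκ x.1 hx0
    have h2 : 0 < Real.Gamma (((n : ℝ) - 2 * β) / 2) := Real.Gamma_pos_of_pos (by linarith)
    have h3 : 0 < Real.Gamma (2 * β / 2) := Real.Gamma_pos_of_pos (by linarith)
    positivity
  calc _ = ∫⁻ z in Ioi 0 ×ˢ univ, ENNReal.ofReal (K x z) * ‖ψ z‖ₑ ∂(cylMeasure n) := by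
        rw [← lintegral_indicator hm]
        refine lintegral_congr fun z => ?_
        by_cases hz : z ∈ Ioi (0 : ℝ) ×ˢ (univ : Set (Sph n))
        · rw [indicator_of_mem hz]
        · rw [indicator_of_notMem hz, hψ0 z fun h => hz ⟨h, mem_univ _⟩, enorm_zero, mul_zero]
    _ = ∫⁻ z in Ioi 0 ×ˢ univ, ENNReal.ofReal C * (ENNReal.ofReal (cylDens n z.1) *
        (ENNReal.ofReal (‖(cylPt x : EuclideanSpace ℝ (Fin (n + 1))) - cylPt z‖ ^ (2 * β - n)) *
          ‖g (cylPt z)‖ₑ)) ∂(cylMeasure n) := by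
        refine setLIntegral_congr_fun hm fun z hz => ?_
        have hz0 : 0 < z.1 := hz.1
        rw [hψ z hz0, enorm_smul, Real.enorm_of_nonneg (hq _ hz0), ← mul_assoc, ← mul_assoc,
          ← mul_assoc, ← ENNReal.ofReal_mul (hK0 x z hx0 hz0), hK x z hx0 hz0,
          ← riesz_kernel_cylPt hx0 hz0, ← ENNReal.ofReal_mul hC0,
          ← ENNReal.ofReal_mul (mul_nonneg hC0 (cylDens_pos hz0).le)]
        congr 2
        rw [hC]
        ring
    _ < ⊤ := by
        rw [lintegral_const_mul' _ _ ENNReal.ofReal_ne_top]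
        exact ENNReal.mul_lt_top ENNReal.ofReal_lt_top hx1

theorem ae_integrableOn_rieszIntegrand {n : ℕ} (hn : 1 ≤ n) {α : ℝ} (hα : 0 < α)
    (hαn : α < n) {Ω : Set (Sph (n + 1))} {φ g : Sph (n + 1) → ℂ} (hg : Measurable g)
    (hφ : φ =ᵐ[(surf (n + 1)).restrict Ω] g) (hfin : ∫⁻ y, ‖g y‖ₑ ∂(surf (n + 1)) < ⊤) :
    ∀ᵐ x ∂(surf (n + 1)), IntegrableOn (rieszIntegrand α φ x) Ω (surf (n + 1)) := by
  filter_upwards [ae_lintegral_riesz_lt_top hn hα hαn hg.enorm hfin] with x hx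
  have h1 : Integrable (rieszIntegrand α g x) (surf (n + 1)) := by
    refine ⟨?_, ?_⟩
    · unfold rieszIntegrand
      fun_prop
    · refine lt_of_le_of_lt (le_of_eq (lintegral_congr fun y => ?_)) hx
      rw [rieszIntegrand, enorm_smul, Real.enorm_of_nonneg (by positivity)]
  refine h1.integrableOn.congr ?_
  filter_upwards [hφ] with y hy
  rw [rieszIntegrand, rieszIntegrand, hy]

theorem one_sub_height_sq_cylPt_rpow {n : ℕ} {z : ℝ × Sph n} (hz : 0 < z.1) (β : ℝ) :
    (1 - height (cylPt z) ^ 2) ^ (2 * β / 2) =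
      2 ^ β * 2 ^ β * (z.1 ^ β * ((1 + z.1) ^ (-β) * (1 + z.1) ^ (-β))) := by
  have h1 : 0 < 1 + z.1 := by linarith
  have h : 1 - height (cylPt z) ^ 2 = 2 * 2 * (z.1 * ((1 + z.1)⁻¹ * (1 + z.1)⁻¹)) := by
    calc _ = (1 + height (cylPt z)) * (1 - height (cylPt z)) := by ring
      _ = _ := by
        rw [one_add_height_cylPt hz, one_sub_height_cylPt hz]
        field_simp
  have h2 : 2 * β / 2 = β := by ring
  rw [h, h2, Real.mul_rpow (by positivity) (by positivity), Real.mul_rpow (by positivity)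
    (by positivity), Real.mul_rpow hz.le (by positivity), Real.mul_rpow (by positivity)
    (by positivity), Real.inv_rpow h1.le, Real.rpow_neg h1.le]

/-- The multiplier q_α together with the prefactor of the first hypersingular integral and the
weight of the second: every power of 1 + s cancels, and s^β is left to meet v^γ. -/
theorem weight_cancel {n : ℕ} {s : ℝ} (hs : 0 < s) (β : ℝ) :
    (1 + s) ^ (β - (n : ℝ) / 2) * (2 ^ β * 2 ^ β * (s ^ β * ((1 + s) ^ (-β) * (1 + s) ^ (-β))) *
      (2 ^ (-β) * (1 + s) ^ (β + (n : ℝ) / 2))) = 2 ^ β * s ^ β := by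
  have h1 : 0 < 1 + s := by linarith
  have e1 : (1 + s) ^ (β - (n : ℝ) / 2) * (1 + s) ^ (β + (n : ℝ) / 2) *
      ((1 + s) ^ (-β) * (1 + s) ^ (-β)) = 1 := by
    rw [← Real.rpow_add h1, ← Real.rpow_add h1, ← Real.rpow_add h1,
      show β - (n : ℝ) / 2 + (β + (n : ℝ) / 2) + (-β + -β) = 0 by ring, Real.rpow_zero]
  have e2 : (2 : ℝ) ^ β * 2 ^ (-β) = 1 := by
    rw [← Real.rpow_add two_pos, add_neg_cancel, Real.rpow_zero]
  linear_combination (2 ^ β * s ^ β * (2 ^ β * 2 ^ (-β))) * e1 + (2 ^ β * s ^ β) * e2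

/-! ### Inversion of the Riesz potential on spherical caps -/

/-- Here the factorization through levels v < min(s, t) is used: the outer factor, inverted by T_+,
looks towards the South Pole and stays in the cap. -/
theorem riesz_inversion_below {n : ℕ} (hn : 2 ≤ n) {β : ℝ} (hβ : 0 < β) (hβn : β < n / 2)
    {p p' : ℝ} (hp : 1 < p) (hpp' : p.HolderConjugate p') {ℓ m : ℕ} (hℓ : β < ℓ) (hm : β < m)
    {b : ℝ} (hb : -1 < b) (hb1 : b < 1) {μ : ℝ} (hμ : μ * p' < n / 2) {φ f : Sph (n + 1) → ℂ}
    (hφ : MemWeightedLp p (seg n (-1) b) (fun x => (1 + height x) ^ μ) φ)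
    (hf : f =ᵐ[(surf (n + 1)).restrict (seg n (-1) b)]
      rieszPotential (2 * β) (seg n (-1) b) φ) :
    ∀ᵐ x ∂(surf (n + 1)).restrict (seg n (-1) b),
      IntegrableOn (rieszIntegrand (2 * β) φ x) (seg n (-1) b) (surf (n + 1)) ∧
      TPlusConverges β ℓ f x ∧
      TMinusConverges β m (extZero (seg n (-1) b) (qMul (2 * β) (tPlus β ℓ f))) x ∧
      φ x = tRight β m b (qMul (2 * β) (tPlus β ℓ f)) x := by
  have hn1 : 1 ≤ n := by omega
  set Ω := seg n (-1) b with hΩ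
  have hΩm : MeasurableSet Ω := measurableSet_seg _ _
  set B := (1 + b) / (1 - b) with hB
  have hmem : ∀ z : ℝ × Sph n, 0 < z.1 → (cylPt z ∈ Ω ↔ z.1 ∈ Ioo 0 B) :=
    fun z hz => cylPt_mem_seg_below hb1 hz
  have hhm := measurable_height (n := n)
  have hw : Measurable fun x : Sph (n + 1) => (1 + height x) ^ μ := by fun_prop
  have hw1 : ∀ x ∈ Ω, 0 < 1 + height x := fun x hx => by linarith [hx.1]
  have hw0 : ∀ x ∈ Ω, 0 < (1 + height x) ^ μ := fun x hx => Real.rpow_pos_of_pos (hw1 x hx) _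
  obtain ⟨g, hg, hg0, hφg, hgp⟩ := hφ.exists_measurable hp hΩm hw hw0
  have hL1 : ∫⁻ x, ‖g x‖ₑ ∂(surf (n + 1)) < ⊤ := by
    refine lintegral_enorm_lt_top_of_weighted hpp' hΩm hw hw0 hg hg0 hgp ?_
    refine lt_of_le_of_lt (le_of_eq (setLIntegral_congr_fun hΩm fun x hx => ?_))
      (setLIntegral_one_add_height_lt_top hn1 hb hb1 hμ)
    rw [← Real.rpow_mul (hw1 x hx).le, mul_neg]
  -- The factor t^{n/2-1} is left in the kernel, because the factorization below produces
  -- (st)^{n/2-1}.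
  set q : ℝ → ℝ := fun t => (1 + t) ^ (-((n : ℝ) / 2 + β)) with hq
  set ψ : ℝ × Sph n → ℂ := (Ioo 0 B ×ˢ univ).indicator fun z => q z.1 • g (cylPt z) with hψ
  have hqm : Measurable q := by fun_prop
  have hψm : Measurable ψ := ((hqm.comp measurable_fst).smul (hg.comp measurable_cylPt)).indicator
    (measurableSet_Ioo.prod .univ)
  have hψI : ∀ z : ℝ × Sph n, z.1 ∉ Ioo 0 B → ψ z = 0 :=
    fun z hz => indicator_of_notMem (fun h => hz h.1) _
  have hψ0 : ∀ z : ℝ × Sph n, ¬ 0 < z.1 → ψ z = 0 := fun z hz => hψI z fun h => hz h.1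
  have hψq : ∀ z : ℝ × Sph n, 0 < z.1 → ψ z = q z.1 • g (cylPt z) := by
    intro z hz
    by_cases h : z.1 ∈ Ioo 0 B
    · rw [hψ, indicator_of_mem (show z ∈ Ioo 0 B ×ˢ univ from ⟨h, mem_univ _⟩)]
    · rw [hψI z h, hg0 _ fun h' => h ((hmem z hz).1 h'), smul_zero]
  have hqc : ContinuousOn q (Ioi 0) := by
    intro t ht
    have h1 : 1 + t ≠ 0 := by linarith [mem_Ioi.1 ht]
    refine ContinuousAt.continuousWithinAt ?_
    fun_prop (disch := simp_all)
  have hloc : ∀ a' b' : ℝ, 0 < a' →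
      ∫⁻ y in Icc a' b' ×ˢ univ, ‖ψ y‖ₑ ^ p ∂(cylMeasure n) < ⊤ := by
    intro a' b' ha'
    refine setLIntegral_cyl_rpow_lt_top hn1 hp hw (v := fun t => (2 * t / (1 + t)) ^ μ) ?_ ?_
      (fun z hz => by rw [one_add_height_cylPt hz]) hg hgp hqc hψq ha' b'
    · intro t ht
      have ht : 0 < t := ht
      have h1 : 1 + t ≠ 0 := by linarith
      have h2 : 2 * t / (1 + t) ≠ 0 := by positivity
      refine ContinuousAt.continuousWithinAt ?_
      refine ContinuousAt.rpow_const ?_ (Or.inl h2)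
      fun_prop (disch := assumption)
    · intro t ht
      positivity
  set N : ℝ × Sph n → ℝ × Sph n → ℝ := fun x z =>
    ‖√x.1 • (x.2 : EuclideanSpace ℝ (Fin n)) - √z.1 • (z.2 : EuclideanSpace ℝ (Fin n))‖ ^
      (2 * β - n) with hN
  set K : ℝ × Sph n → ℝ × Sph n → ℝ := fun x z =>
    rieszConst n β * ((x.1 * z.1) ^ ((n : ℝ) / 2 - 1) * N x z) with hK
  have hc0 : 0 ≤ rieszConst n β := by
    have h2 : 0 < Real.Gamma ((n : ℝ) / 2 - β) := Real.Gamma_pos_of_pos (by linarith)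
    have h3 := Real.Gamma_pos_of_pos hβ
    rw [rieszConst]
    positivity
  have hK0 : ∀ x z : ℝ × Sph n, 0 < x.1 → 0 < z.1 → 0 ≤ K x z := fun x z hx hz => by
    simp only [hK, hN]
    positivity
  have hKq : ∀ x z : ℝ × Sph n, 0 < x.1 → 0 < z.1 → K x z * q z.1 = x.1 ^ ((n : ℝ) / 2 - 1) *
      (z.1 ^ ((n : ℝ) / 2 - 1) * (1 + z.1) ^ (-((n : ℝ) / 2 + β)) *
        (rieszConst n β * N x z)) := fun x z hx hz => by
    simp only [hK, hq]
    rw [Real.mul_rpow hx.le hz.le]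
    ring
  set k : ℝ × Sph n → ℂ := fun y => (y.1 ^ ((n : ℝ) / 2 - 1) *
      (1 + y.1) ^ (β - (n : ℝ) / 2)) • f (cylPt y) with hk
  have hfc := ae_cyl_of_ae_surf hn1 ((ae_restrict_iff' hΩm).1 hf)
  have hkK : ∀ᵐ x ∂(cylMeasure n), x.1 ∈ Ioo 0 B → k x = ∫ z, K x z • ψ z ∂(cylMeasure n) := by
    filter_upwards [hfc] with x hx hxI
    simp only [hk]
    rw [hx hxI.1 ((hmem x hxI.1).2 hxI)]
    exact rieszPotential_cylPt hn1 hg hg0 hφg hψq hψ0 hxI.1 fun z hz => hKq x z hxI.1 hz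
  have hfin := ae_lintegral_cyl_riesz_lt_top hn1 hβ hβn hg hL1 (fun t ht => by positivity) hψq hψ0
    (κ := fun t => t ^ ((n : ℝ) / 2 - 1)) (fun t ht => by positivity) hK0 hKq
  -- The exponent n/2 - 1 - β is that of v in `lintegral_riesz_below`. The constant 2^β is what the
  -- multiplier leaves after the first step; the prefactor 2^{-β} of the second removes it.
  have key := ae_marchaudInverts_comp hn hβ hℓ hm (Or.inl rfl) hp ((n : ℝ) / 2 - 1 - β) (2 ^ β)
    (I := Ioo 0 B) (fun t ht => ht.1)
    (fun s hs v hv h => ⟨hv, by linarith [hs.2]⟩)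
    (fun a' b' ha' => ⟨a', B, ha', fun s hs t ht h => ⟨by linarith [hs.1], ht.2.le⟩⟩)
    hψm hψI hloc hK0
    (fun x z hx hz hxz => lintegral_fracKer_comp_below hn1 hβ hβn hx hz hxz) hkK
    (hfin.mono fun x hx hxI => hx hxI.1)
  obtain ⟨h1, h2⟩ := key
  set F := extZero Ω (qMul (2 * β) (tPlus β ℓ f)) with hF
  have h3 := h2 (fun y => (1 + y.1) ^ (β - (n : ℝ) / 2) • F (cylPt y)) ?_ ?_
  · have h4 := ae_surf_of_ae_cyl hn1 (P := fun x => x ∈ Ω →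
        TPlusConverges β ℓ f x ∧ TMinusConverges β m F x ∧ g x = tMinus β m F x) ?_
    · refine (ae_restrict_iff' hΩm).2 ?_
      filter_upwards [ae_integrableOn_rieszIntegrand hn1 (α := 2 * β) (by linarith) (by linarith) hg
        hφg hL1, (ae_restrict_iff' hΩm).1 hφg, h4] with x hx1 hx2 hx3 hxΩ
      obtain ⟨hx4, hx5, hx6⟩ := hx3 hxΩ
      exact ⟨hx1, hx4, hx5, (hx2 hxΩ).trans hx6⟩
    filter_upwards [h1, h3] with z hz1 hz3 hz hzΩ
    have hT := tMinus_of_marchaudInverts hβ hm hz (hz3 hz)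
    refine ⟨(tPlus_of_marchaudInverts hβ hℓ hz (hz1 ((hmem z hz).1 hzΩ))).1, hT.1, ?_⟩
    rw [hT.2, hψq z hz, smul_smul, smul_smul]
    have e1 : (2 : ℝ) ^ (-β) * 2 ^ β = 1 := by
      rw [← Real.rpow_add two_pos, neg_add_cancel, Real.rpow_zero]
    have e2 : (1 + z.1) ^ (β + (n : ℝ) / 2) * q z.1 = 1 := by
      simp only [hq]
      rw [← Real.rpow_add (by linarith), add_comm β, add_neg_cancel, Real.rpow_zero]
    have e3 : 2 ^ (-β) * (1 + z.1) ^ (β + (n : ℝ) / 2) * 2 ^ β * q z.1 = 1 := by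
      linear_combination ((1 + z.1) ^ (β + (n : ℝ) / 2) * q z.1) * e1 + e2
    rw [e3, one_smul]
  · filter_upwards [h1] with x hx hxI
    have hx0 := hxI.1
    simp only [hF]
    rw [extZero, indicator_of_mem ((hmem x hx0).2 hxI), qMul,
      (tPlus_of_marchaudInverts hβ hℓ hx0 (hx hxI)).2, one_sub_height_sq_cylPt_rpow hx0, smul_smul,
      smul_smul, smul_smul]
    -- The identity of weights behind the choice of q_α: after it, the function entering the second
    -- step is 2^β times the inner fractional integral.
    congr 1
    have e1 : x.1 ^ β * x.1 ^ (1 - (n : ℝ) / 2) * x.1 ^ ((n : ℝ) / 2 - 1 - β) = 1 := by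
      rw [← Real.rpow_add hx0, ← Real.rpow_add hx0,
        show β + (1 - (n : ℝ) / 2) + ((n : ℝ) / 2 - 1 - β) = 0 by ring, Real.rpow_zero]
    linear_combination (x.1 ^ (1 - (n : ℝ) / 2) * x.1 ^ ((n : ℝ) / 2 - 1 - β)) *
      weight_cancel (n := n) hx0 β + 2 ^ β * e1
  · intro x hx hxI
    simp only [hF]
    rw [extZero, indicator_of_notMem fun h => hxI ((hmem x hx).1 h), smul_zero]

/-- The mirror image, with the factorization through levels v > max(s, t): the outer factor,
inverted by T_-, looks towards the North Pole. -/
theorem riesz_inversion_above {n : ℕ} (hn : 2 ≤ n) {β : ℝ} (hβ : 0 < β) (hβn : β < n / 2)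
    {p p' : ℝ} (hp : 1 < p) (hpp' : p.HolderConjugate p') {ℓ m : ℕ} (hℓ : β < ℓ) (hm : β < m)
    {a : ℝ} (ha : -1 < a) (ha1 : a < 1) {ν : ℝ} (hν : ν * p' < n / 2) {φ f : Sph (n + 1) → ℂ}
    (hφ : MemWeightedLp p (seg n a 1) (fun x => (1 - height x) ^ ν) φ)
    (hf : f =ᵐ[(surf (n + 1)).restrict (seg n a 1)]
      rieszPotential (2 * β) (seg n a 1) φ) :
    ∀ᵐ x ∂(surf (n + 1)).restrict (seg n a 1),
      IntegrableOn (rieszIntegrand (2 * β) φ x) (seg n a 1) (surf (n + 1)) ∧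
      TMinusConverges β ℓ f x ∧
      TPlusConverges β m (extZero (seg n a 1) (qMul (2 * β) (tMinus β ℓ f))) x ∧
      φ x = tLeft β m a (qMul (2 * β) (tMinus β ℓ f)) x := by
  have hn1 : 1 ≤ n := by omega
  set Ω := seg n a 1 with hΩ
  have hΩm : MeasurableSet Ω := measurableSet_seg _ _
  set A := (1 + a) / (1 - a) with hA
  have hA0 : 0 < A := div_pos (by linarith) (by linarith)
  have hmem : ∀ z : ℝ × Sph n, 0 < z.1 → (cylPt z ∈ Ω ↔ z.1 ∈ Ioi A) :=
    fun z hz => cylPt_mem_seg_above ha1 hz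
  have hhm := measurable_height (n := n)
  have hw : Measurable fun x : Sph (n + 1) => (1 - height x) ^ ν := by fun_prop
  have hw1 : ∀ x ∈ Ω, 0 < 1 - height x := fun x hx => by linarith [hx.2]
  have hw0 : ∀ x ∈ Ω, 0 < (1 - height x) ^ ν := fun x hx => Real.rpow_pos_of_pos (hw1 x hx) _
  obtain ⟨g, hg, hg0, hφg, hgp⟩ := hφ.exists_measurable hp hΩm hw hw0
  have hL1 : ∫⁻ x, ‖g x‖ₑ ∂(surf (n + 1)) < ⊤ := by
    refine lintegral_enorm_lt_top_of_weighted hpp' hΩm hw hw0 hg hg0 hgp ?_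
    refine lt_of_le_of_lt (le_of_eq (setLIntegral_congr_fun hΩm fun x hx => ?_))
      (setLIntegral_one_sub_height_lt_top hn1 ha ha1 hν)
    rw [← Real.rpow_mul (hw1 x hx).le, mul_neg]
  -- The factorization above produces no power of st, so t^{n/2-1} goes into ψ; it is compensated by
  -- the weight that T_+ carries in the second step.
  set q : ℝ → ℝ := fun t => t ^ ((n : ℝ) / 2 - 1) * (1 + t) ^ (-((n : ℝ) / 2 + β)) with hq
  set ψ : ℝ × Sph n → ℂ := (Ioi A ×ˢ univ).indicator fun z => q z.1 • g (cylPt z) with hψ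
  have hqm : Measurable q := by fun_prop
  have hψm : Measurable ψ := ((hqm.comp measurable_fst).smul (hg.comp measurable_cylPt)).indicator
    (measurableSet_Ioi.prod .univ)
  have hψI : ∀ z : ℝ × Sph n, z.1 ∉ Ioi A → ψ z = 0 :=
    fun z hz => indicator_of_notMem (fun h => hz h.1) _
  have hψ0 : ∀ z : ℝ × Sph n, ¬ 0 < z.1 → ψ z = 0 := fun z hz => hψI z fun h => hz (hA0.trans h)
  have hψq : ∀ z : ℝ × Sph n, 0 < z.1 → ψ z = q z.1 • g (cylPt z) := by
    intro z hz
    by_cases h : z.1 ∈ Ioi A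
    · rw [hψ, indicator_of_mem (show z ∈ Ioi A ×ˢ univ from ⟨h, mem_univ _⟩)]
    · rw [hψI z h, hg0 _ fun h' => h ((hmem z hz).1 h'), smul_zero]
  have hqc : ContinuousOn q (Ioi 0) := by
    intro t ht
    have h1 : 1 + t ≠ 0 := by linarith [mem_Ioi.1 ht]
    have h2 : t ≠ 0 := (mem_Ioi.1 ht).ne'
    refine ContinuousAt.continuousWithinAt ?_
    fun_prop (disch := simp_all)
  have hloc : ∀ a' b' : ℝ, 0 < a' →
      ∫⁻ y in Icc a' b' ×ˢ univ, ‖ψ y‖ₑ ^ p ∂(cylMeasure n) < ⊤ := by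
    intro a' b' ha'
    refine setLIntegral_cyl_rpow_lt_top hn1 hp hw (v := fun t => (2 / (1 + t)) ^ ν) ?_ ?_
      (fun z hz => by rw [one_sub_height_cylPt hz]) hg hgp hqc hψq ha' b'
    · intro t ht
      have ht : 0 < t := ht
      have h1 : 1 + t ≠ 0 := by linarith
      have h2 : 2 / (1 + t) ≠ 0 := by positivity
      refine ContinuousAt.continuousWithinAt ?_
      refine ContinuousAt.rpow_const ?_ (Or.inl h2)
      fun_prop (disch := assumption)
    · intro t ht
      positivity
  set N : ℝ × Sph n → ℝ × Sph n → ℝ := fun x z =>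
    ‖√x.1 • (x.2 : EuclideanSpace ℝ (Fin n)) - √z.1 • (z.2 : EuclideanSpace ℝ (Fin n))‖ ^
      (2 * β - n) with hN
  set K : ℝ × Sph n → ℝ × Sph n → ℝ := fun x z =>
    rieszConst n β * N x z with hK
  have hc0 : 0 ≤ rieszConst n β := by
    have h2 : 0 < Real.Gamma ((n : ℝ) / 2 - β) := Real.Gamma_pos_of_pos (by linarith)
    have h3 := Real.Gamma_pos_of_pos hβ
    rw [rieszConst]
    positivity
  have hK0 : ∀ x z : ℝ × Sph n, 0 < x.1 → 0 < z.1 → 0 ≤ K x z := fun x z hx hz => by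
    simp only [hK, hN]
    positivity
  have hKq : ∀ x z : ℝ × Sph n, 0 < x.1 → 0 < z.1 → K x z * q z.1 = 1 *
      (z.1 ^ ((n : ℝ) / 2 - 1) * (1 + z.1) ^ (-((n : ℝ) / 2 + β)) *
        (rieszConst n β * N x z)) := fun x z hx hz => by
    simp only [hK, hq]
    ring
  set k : ℝ × Sph n → ℂ := fun y => (1 + y.1) ^ (β - (n : ℝ) / 2) • f (cylPt y) with hk
  have hfc := ae_cyl_of_ae_surf hn1 ((ae_restrict_iff' hΩm).1 hf)
  have hkK : ∀ᵐ x ∂(cylMeasure n), x.1 ∈ Ioi A → k x = ∫ z, K x z • ψ z ∂(cylMeasure n) := by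
    filter_upwards [hfc] with x hx hxI
    simp only [hk]
    have hx0 : 0 < x.1 := hA0.trans hxI
    rw [hx hx0 ((hmem x hx0).2 hxI), ← one_mul ((1 + x.1) ^ (β - (n : ℝ) / 2))]
    exact rieszPotential_cylPt hn1 hg hg0 hφg hψq hψ0 hx0 fun z hz => hKq x z hx0 hz
  have hfin := ae_lintegral_cyl_riesz_lt_top hn1 hβ hβn hg hL1 (fun t ht => by positivity) hψq hψ0
    (κ := fun _ => 1) (fun _ _ => zero_le_one) hK0 hKq
  have key := ae_marchaudInverts_comp hn hβ hℓ hm (Or.inr rfl) hp (1 - β - (n : ℝ) / 2) (2 ^ β)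
    (I := Ioi A) (fun t ht => hA0.trans ht)
    (fun s hs v hv h => by rw [mem_Ioi] at hs ⊢; linarith)
    (fun a' b' ha' => ⟨A, b', hA0, fun s hs t ht h => ⟨(mem_Ioi.1 ht).le, by linarith [hs.2]⟩⟩)
    hψm hψI hloc hK0
    (fun x z hx hz hxz => by
      rw [neg_neg]
      exact lintegral_fracKer_comp_above hn1 hβ hβn hx hz hxz) hkK
    (hfin.mono fun x hx hxI => hx (hA0.trans hxI))
  rw [neg_neg] at key
  obtain ⟨h1, h2⟩ := key
  set F := extZero Ω (qMul (2 * β) (tMinus β ℓ f)) with hF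
  have h3 := h2 (fun y => (y.1 ^ ((n : ℝ) / 2 - 1) * (1 + y.1) ^ (β - (n : ℝ) / 2)) • F (cylPt y))
      ?_ ?_
  · have h4 := ae_surf_of_ae_cyl hn1 (P := fun x => x ∈ Ω →
        TMinusConverges β ℓ f x ∧ TPlusConverges β m F x ∧ g x = tPlus β m F x) ?_
    · refine (ae_restrict_iff' hΩm).2 ?_
      filter_upwards [ae_integrableOn_rieszIntegrand hn1 (α := 2 * β) (by linarith) (by linarith) hg
        hφg hL1, (ae_restrict_iff' hΩm).1 hφg, h4] with x hx1 hx2 hx3 hxΩ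
      obtain ⟨hx4, hx5, hx6⟩ := hx3 hxΩ
      exact ⟨hx1, hx4, hx5, (hx2 hxΩ).trans hx6⟩
    filter_upwards [h1, h3] with z hz1 hz3 hz hzΩ
    have hT := tPlus_of_marchaudInverts hβ hm hz (hz3 hz)
    refine ⟨(tMinus_of_marchaudInverts hβ hℓ hz (hz1 ((hmem z hz).1 hzΩ))).1, hT.1, ?_⟩
    rw [hT.2, hψq z hz, smul_smul, smul_smul]
    have e1 : (2 : ℝ) ^ (-β) * 2 ^ β = 1 := by
      rw [← Real.rpow_add two_pos, neg_add_cancel, Real.rpow_zero]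
    have e2 : (1 + z.1) ^ (β + (n : ℝ) / 2) * (1 + z.1) ^ (-((n : ℝ) / 2 + β)) = 1 := by
      rw [← Real.rpow_add (by linarith), add_comm β, add_neg_cancel, Real.rpow_zero]
    have e3 : z.1 ^ (1 - (n : ℝ) / 2) * z.1 ^ ((n : ℝ) / 2 - 1) = 1 := by
      rw [← Real.rpow_add hz, sub_add_sub_cancel, sub_self, Real.rpow_zero]
    have e4 : 2 ^ (-β) * ((1 + z.1) ^ (β + (n : ℝ) / 2) * z.1 ^ (1 - (n : ℝ) / 2)) * 2 ^ β *
        q z.1 = 1 := by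
      simp only [hq]
      linear_combination ((1 + z.1) ^ (β + (n : ℝ) / 2) * (1 + z.1) ^ (-((n : ℝ) / 2 + β)) *
        (z.1 ^ (1 - (n : ℝ) / 2) * z.1 ^ ((n : ℝ) / 2 - 1))) * e1 +
        (z.1 ^ (1 - (n : ℝ) / 2) * z.1 ^ ((n : ℝ) / 2 - 1)) * e2 + e3
    rw [e4, one_smul]
  · filter_upwards [h1] with x hx hxI
    have hx0 : 0 < x.1 := hA0.trans hxI
    simp only [hF]
    rw [extZero, indicator_of_mem ((hmem x hx0).2 hxI), qMul,
      (tMinus_of_marchaudInverts hβ hℓ hx0 (hx hxI)).2, one_sub_height_sq_cylPt_rpow hx0, smul_smul,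
      smul_smul, smul_smul]
    congr 1
    have e1 : x.1 ^ β * x.1 ^ ((n : ℝ) / 2 - 1) * x.1 ^ (1 - β - (n : ℝ) / 2) = 1 := by
      rw [← Real.rpow_add hx0, ← Real.rpow_add hx0,
        show β + ((n : ℝ) / 2 - 1) + (1 - β - (n : ℝ) / 2) = 0 by ring, Real.rpow_zero]
    linear_combination (x.1 ^ ((n : ℝ) / 2 - 1) * x.1 ^ (1 - β - (n : ℝ) / 2)) *
      weight_cancel (n := n) hx0 β + 2 ^ β * e1
  · intro x hx hxI
    simp only [hF]
    rw [extZero, indicator_of_notMem fun h => hxI ((hmem x hx).1 h), smul_zero]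

theorem theorem5p2 (n : ℕ) (hn : 2 ≤ n) (α : ℝ) (hα : 0 < α) (hαn : α < n)
    (p p' : ℝ) (hp : 1 < p) (hpp' : 1 / p + 1 / p' = 1)
    (ℓ m : ℕ) (hℓ : α / 2 < ℓ) (hm : α / 2 < m) :
    (∀ b : ℝ, -1 < b → b < 1 → ∀ μ : ℝ, μ < n / (2 * p') → ∀ φ f : Sph (n + 1) → ℂ,
      MemWeightedLp p (seg n (-1) b) (fun x => (1 + height x) ^ μ) φ →
      f =ᵐ[(surf (n + 1)).restrict (seg n (-1) b)] rieszPotential α (seg n (-1) b) φ →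
      ∀ᵐ x ∂(surf (n + 1)).restrict (seg n (-1) b),
        IntegrableOn (rieszIntegrand α φ x) (seg n (-1) b) (surf (n + 1)) ∧
        TPlusConverges (α / 2) ℓ f x ∧
        TMinusConverges (α / 2) m
          (extZero (seg n (-1) b) (qMul α (tPlus (α / 2) ℓ f))) x ∧
        φ x = tRight (α / 2) m b (qMul α (tPlus (α / 2) ℓ f)) x) ∧
    (∀ a : ℝ, -1 < a → a < 1 → ∀ ν : ℝ, ν < n / (2 * p') → ∀ φ f : Sph (n + 1) → ℂ,
      MemWeightedLp p (seg n a 1) (fun x => (1 - height x) ^ ν) φ →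
      f =ᵐ[(surf (n + 1)).restrict (seg n a 1)] rieszPotential α (seg n a 1) φ →
      ∀ᵐ x ∂(surf (n + 1)).restrict (seg n a 1),
        IntegrableOn (rieszIntegrand α φ x) (seg n a 1) (surf (n + 1)) ∧
        TMinusConverges (α / 2) ℓ f x ∧
        TPlusConverges (α / 2) m
          (extZero (seg n a 1) (qMul α (tMinus (α / 2) ℓ f))) x ∧
        φ x = tLeft (α / 2) m a (qMul α (tMinus (α / 2) ℓ f)) x) := by
  obtain ⟨β, rfl⟩ : ∃ β, α = 2 * β := ⟨α / 2, by ring⟩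
  have hβ2 : 2 * β / 2 = β := by ring
  have hβ : 0 < β := by linarith
  have hβn : β < n / 2 := by linarith
  rw [hβ2] at hℓ hm ⊢
  have hpp : p.HolderConjugate p' :=
    Real.holderConjugate_iff.2 ⟨hp, by rwa [one_div, one_div] at hpp'⟩
  have hp0 := hpp.symm.pos
  have hexp : ∀ κ : ℝ, κ < n / (2 * p') → κ * p' < n / 2 := by
    intro κ hκ
    rw [lt_div_iff₀ (by positivity)] at hκ
    linarith
  exact ⟨fun b hb hb1 μ hμ φ f hφ hf =>
      riesz_inversion_below hn hβ hβn hp hpp hℓ hm hb hb1 (hexp μ hμ) hφ hf,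
    fun a ha ha1 ν hν φ f hφ hf =>
      riesz_inversion_above hn hβ hβn hp hpp hℓ hm ha ha1 (hexp ν hν) hφ hf⟩
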